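/- Conventions. For $u:\mathbb R^2\to\mathbb R$ write $\tilde u(l;y)=(2\pi)^{-1/2}\int e^{-ilx}u(x,y)\,dx$. Let $\mathbf E_{1,w}$ be the space of $u\in L^2(\mathbb R^2)$ for which $$(1+x^2)^2(1+y^2)^{5/2}u,\quad (1+y^2)^2(1-\partial_x^2)^2u,\quad (1-\partial_y^2)^2u,\quad \partial_x^{-1}u,\quad (1+y^2)^{1/2}\,\partial_x^{-1}\partial_yu$$ all lie in $L^2(\mathbb R^2)$ (distributional derivatives; $\partial_x^{-1}g$ denotes the $w$ with $\partial_xw=g$). Put $c=(2\pi)^{-1/2}\|\tilde u\|_{L^1(\mathbb R^2)}$. Assume that $u\in\mathbf E_{1,w}$ and that $$c<1,\qquad \Big(\iint|\tilde u(l;y)|^2|l|^{-1}\,dl\,dy\Big)^{1/2}<\frac{1-c}{4},\qquad (2\pi)^{-1/2}\iint(1+l^2)^{1/2}|\tilde u(l;y)|\,dy\,dl<1 .$$ Scattering data. With $*$ denoting convolution in $l$, the integral equations $$\tilde\mu^\pm_\sharp(k,l;y)=\frac{i}{\sqrt{2\pi}}\int_{\pm l\cdot\infty}^{y}e^{-il(l+2k)(y-\eta)}\,\big(\tilde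 u*(\sqrt{2\pi}\,\delta+\tilde\mu^\pm_\sharp)\big)(k,l;\eta)\,d\eta ,$$ where the lower limit $\pm l\cdot\infty$ is $+\infty$ if $\pm l>0$ and $-\infty$ if $\pm l<0$, have solutions $\tilde\mu_\sharp^\pm\in L^\infty_y(L^2(dk\,dl))\cap L^\infty_{y,k}(L^2(dl))$. For any such solutions let, with $H$ the Heaviside function, $$T^\pm(k,l)=-\frac{i}{2\pi}H(\pm(l-k))\int e^{i(l^2-k^2)y}\,\big(\tilde u*(\sqrt{2\pi}\,\delta+\tilde\mu^\pm_\sharp)\big)(k,l-k;y)\,dy .$$ The nonlocal Riemann–Hilbert problem. For $t>0$ and $x,y\in\mathbb R$ put $\xi=x/t$, $\eta=y/t$, $a=\frac1{12}\big(\xi-\frac{\eta^2}{12}\big)$, $S_0(k,l;\xi,\eta)=(l-k)\xi-(l^2-k^2)\eta+4(l^3-k^3)$ and $$(\mathcal T^\pm f)(k)=\int e^{itS_0(k,l;\xi,\eta)}\,T^\pm(k,l)f(l)\,dl,\qquad \mathcal C_T=C_+\mathcal T^-+C_-\mathcal T^+,$$ where $C_\pm$ are the Cauchy projectors on $L^2(\mathbb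 R)$ ($C_+$ is the Fourier projection onto positive frequencies, and $C_+-C_-=I$). Proposition. For all $t>0$, $x,y\in\mathbb R$ the problem $\mu^l=1+\mathcal C_T\mu^l$ has a unique solution $\mu^l=\mu^l(\cdot,x;y,t)$ with $\mu^l-1\in L^2(\mathbb R)$, and $x\mapsto\mu^l(\cdot,x;y,t)-1\in L^2(\mathbb R)$ is differentiable. Moreover, for every $\delta>0$ there is a constant $C$, depending only on $\delta$ and $u$, such that for all $t>0$, $x,y\in\mathbb R$ $$\|\mu^l-1\|_{L^2}\le C\begin{cases}t^{-1},&a>\delta,\\ t^{-1/3},&|a|<\delta,\\ t^{-1/2},&a<-\delta,\end{cases}\qquad\text{and}\qquad \Big\|\frac{\partial\mu^l}{\partial x}\Big\|_{L^2}\le C\begin{cases}t^{-1},&a>\delta,\\ t^{-1/3},&|a|<\delta,\\ t^{-1/2},&a<-\delta.\end{cases}$$ -/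

import Mathlib

open MeasureTheory Real
open scoped ENNReal NNReal FourierTransform ContDiff

noncomputable section

namespace KPI

/-! ### The space of initial data -/

/-- Real test functions on the plane. -/
def IsTest (φ : ℝ × ℝ → ℝ) : Prop := ContDiff ℝ ∞ φ ∧ HasCompactSupport φ

/-- The `n`-th partial derivative in the first variable. -/
def dx (n : ℕ) (φ : ℝ × ℝ → ℝ) : ℝ × ℝ → ℝ :=
  fun p => iteratedDeriv n (fun s => φ (s, p.2)) p.1

/-- The `n`-th partial derivative in the second variable. -/
def dy (n : ℕ) (φ : ℝ × ℝ → ℝ) : ℝ × ℝ → ℝ :=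
  fun p => iteratedDeriv n (fun s => φ (p.1, s)) p.2

/-- The space `E_{1,w}`: all of the norms
`‖u‖_{L^{2,4}_x L^{2,5}_y}`, `‖(1+y²)²(1-∂ₓ²)²u‖_{L²}`, `‖(1-∂_y²)²u‖_{L²}`, `‖∂ₓ⁻¹u‖_{L²}` and
`‖∂ₓ⁻¹∂_y u‖_{L²_x L^{2,1}_y}` are finite. Derivatives are distributional, `∂ₓ⁻¹u` is the
`L²` function with `∂ₓ(∂ₓ⁻¹u) = u`, and `∂ₓ⁻¹∂_y u` the one with `∂ₓ(∂ₓ⁻¹∂_y u) = ∂_y u`. -/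
structure MemE1w (u : ℝ × ℝ → ℝ) : Prop where
  memLp : MemLp u 2 volume
  weighted : MemLp (fun p : ℝ × ℝ => (1 + p.1 ^ 2) ^ 2 * (1 + p.2 ^ 2) ^ (5 / 2 : ℝ) * u p) 2 volume
  smooth_x : ∃ v : ℝ × ℝ → ℝ, MemLp (fun p : ℝ × ℝ => (1 + p.2 ^ 2) ^ 2 * v p) 2 volume ∧
    ∀ φ, IsTest φ → ∫ p, v p * φ p = ∫ p, u p * (φ p - 2 * dx 2 φ p + dx 4 φ p)
  smooth_y : ∃ v : ℝ × ℝ → ℝ, MemLp v 2 volume ∧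
    ∀ φ, IsTest φ → ∫ p, v p * φ p = ∫ p, u p * (φ p - 2 * dy 2 φ p + dy 4 φ p)
  inv_x : ∃ w : ℝ × ℝ → ℝ, MemLp w 2 volume ∧
    ∀ φ, IsTest φ → ∫ p, w p * dx 1 φ p = -∫ p, u p * φ p
  inv_x_y : ∃ w : ℝ × ℝ → ℝ, MemLp (fun p : ℝ × ℝ => (1 + p.2 ^ 2) ^ (1 / 2 : ℝ) * w p) 2 volume ∧
    ∀ φ, IsTest φ → ∫ p, w p * dx 1 φ p = ∫ p, u p * dy 1 φ p

/-- The partial Fourier transform `ũ(l;y) = (2π)^{-1/2} ∫ e^{-ilx} u(x,y) dx`. -/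
def pft (u : ℝ × ℝ → ℝ) (l y : ℝ) : ℂ :=
  (√(2 * π) : ℂ)⁻¹ * ∫ x : ℝ, Complex.exp (-(Complex.I * l * x)) * (u (x, y) : ℂ)

/-- The constant `c = ‖ũ‖_{L¹(ℝ²)} / √(2π)`. -/
def smallC (u : ℝ × ℝ → ℝ) : ℝ≥0∞ :=
  (∫⁻ l : ℝ, ∫⁻ y : ℝ, ‖pft u l y‖ₑ) / ENNReal.ofReal √(2 * π)

/-- The constant `c̃ = ‖ũ‖_{L^{1,1}_l L¹_y} / √(2π)`. -/
def smallCt (u : ℝ × ℝ → ℝ) : ℝ≥0∞ :=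
  (∫⁻ l : ℝ, ENNReal.ofReal √(1 + l ^ 2) * ∫⁻ y : ℝ, ‖pft u l y‖ₑ) / ENNReal.ofReal √(2 * π)

/-- The norm `‖ũ‖_{L²_y L^{2,-1}_l} = (∫∫ |ũ(l;y)|² |l|⁻¹ dl dy)^{1/2}`. -/
def normInvHalf (u : ℝ × ℝ → ℝ) : ℝ≥0∞ :=
  (∫⁻ l : ℝ, ∫⁻ y : ℝ, ‖pft u l y‖ₑ ^ 2 / ‖l‖ₑ) ^ (1 / 2 : ℝ)

/-! ### Scattering solutions and scattering data

A sign `±` is encoded by `σ = 1` or `σ = -1`. The function `m` stands for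
`μ̃_♯^±(k,l;y) = μ̃^±(k,l;y) - √(2π) δ(l)`. -/

/-- `(ũ * μ̃)(k,l;y)`, the convolution in `l`, for `μ̃ = √(2π) δ + m`. -/
def conv (u : ℝ × ℝ → ℝ) (m : ℝ → ℝ → ℝ → ℂ) (k l y : ℝ) : ℂ :=
  (√(2 * π) : ℂ) * pft u l y + ∫ l' : ℝ, pft u (l - l') y * m k l' y

/-- The integral `∫_{± l·∞}^y g(η) dη`, where `± l·∞` is `+∞` if `± l > 0` and `-∞` if
`± l < 0`. -/
def intFrom (σ l y : ℝ) (g : ℝ → ℂ) : ℂ :=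
  if 0 < σ * l then -∫ η in Set.Ioi y, g η
  else if σ * l < 0 then ∫ η in Set.Iic y, g η
  else 0

/-- `m = μ̃_♯^±` solves the integral equation
`μ̃_♯ = (i/√(2π)) ∫_{± l·∞}^y e^{-il(l+2k)(y-η)} (ũ * (√(2π) δ + μ̃_♯))(k,l;η) dη`
in the space `X ∩ Y`, with `X = L^∞_y(L²(dk dl))` and `Y = L^∞_{y,k}(L²(dl))`. -/
structure IsScatteringSolution (σ : ℝ) (u : ℝ × ℝ → ℝ) (m : ℝ → ℝ → ℝ → ℂ) : Prop where
  measurable : AEStronglyMeasurable (fun p : ℝ × ℝ × ℝ => m p.1 p.2.1 p.2.2) volume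
  mem_X : ∃ C : ℝ≥0, ∀ᵐ y : ℝ, eLpNorm (fun p : ℝ × ℝ => m p.1 p.2 y) 2 volume ≤ C
  mem_Y : ∃ C : ℝ≥0, ∀ᵐ q : ℝ × ℝ, eLpNorm (fun l : ℝ => m q.1 l q.2) 2 volume ≤ C
  eqn : ∀ᵐ p : ℝ × ℝ × ℝ, m p.1 p.2.1 p.2.2 =
    Complex.I / (√(2 * π) : ℂ) * intFrom σ p.2.1 p.2.2 (fun η =>
      Complex.exp (-(Complex.I * p.2.1 * (p.2.1 + 2 * p.1) * (p.2.2 - η))) *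
        conv u m p.1 p.2.1 η)

/-- The scattering data
`T^±(k,l) = -(i/2π) H(±(l-k)) ∫ e^{i(l²-k²)y} (ũ * μ̃^±)(k,l-k;y) dy`. -/
def scatData (σ : ℝ) (u : ℝ × ℝ → ℝ) (m : ℝ → ℝ → ℝ → ℂ) (k l : ℝ) : ℂ :=
  if 0 < σ * (l - k) then
    -(Complex.I / (2 * π)) *
      ∫ y : ℝ, Complex.exp (Complex.I * (l ^ 2 - k ^ 2) * y) * conv u m k (l - k) y
  else 0

/-! ### The nonlocal Riemann-Hilbert problem -/

/-- The Hilbert space `L²(ℝ)`. -/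
abbrev L2 : Type := Lp ℂ 2 (volume : Measure ℝ)

/-- Restriction of an `L²` function to a half-line or any other measurable set
(extended by zero). -/
def restrictL2 (s : Set ℝ) (hs : MeasurableSet s) (f : L2) : L2 :=
  ((Lp.memLp f).indicator hs).toLp

/-- The Cauchy projector `C₊`: the boundary value from the upper half-plane of the Cauchy
integral `(2πi)⁻¹ ∫ f(s)/(s-z) ds`, that is, the Fourier projection onto positive
frequencies. -/
def cauchyPlus (f : L2) : L2 := 𝓕⁻ (restrictL2 (Set.Ioi 0) measurableSet_Ioi (𝓕 f))

/-- The Cauchy projector `C₋`: the boundary value from the lower half-plane of the Cauchy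
integral `(2πi)⁻¹ ∫ f(s)/(s-z) ds`, that is, minus the Fourier projection onto negative
frequencies, so that `C₊ - C₋ = I`. -/
def cauchyMinus (f : L2) : L2 := -𝓕⁻ (restrictL2 (Set.Iio 0) measurableSet_Iio (𝓕 f))

/-- The phase `S₀(k,l;ξ,η) = (l-k)ξ - (l²-k²)η + 4(l³-k³)`. -/
def S0 (k l ξ η : ℝ) : ℝ := (l - k) * ξ - (l ^ 2 - k ^ 2) * η + 4 * (l ^ 3 - k ^ 3)

/-- The integrand of `𝒯^±` at `(k,l)`, with `ξ = x/t`, `η = y/t`. -/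
def kernelT (T : ℝ → ℝ → ℂ) (t x y : ℝ) (f : ℝ → ℂ) (k l : ℝ) : ℂ :=
  Complex.exp (Complex.I * t * S0 k l (x / t) (y / t)) * T k l * f l

/-- `(𝒯^± f)(k) = ∫ e^{itS₀(k,l;ξ,η)} T^±(k,l) f(l) dl`. -/
def opT (T : ℝ → ℝ → ℂ) (t x y : ℝ) (f : ℝ → ℂ) (k : ℝ) : ℂ :=
  ∫ l : ℝ, kernelT T t x y f k l

/-- `μ = 1 + w`, with `w ∈ L²(ℝ)`, solves `μ = 1 + C₊ 𝒯⁻ μ + C₋ 𝒯⁺ μ` at `(t,x,y)`, where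
`Tp = T⁺` and `Tm = T⁻`. The integrals `𝒯^± μ` converge absolutely at almost every point and
define elements of `L²(ℝ)`. -/
structure IsRHPSolution (Tp Tm : ℝ → ℝ → ℂ) (t x y : ℝ) (w : L2) : Prop where
  integrable_plus : ∀ᵐ k : ℝ, Integrable (kernelT Tp t x y (fun l => 1 + w l) k)
  integrable_minus : ∀ᵐ k : ℝ, Integrable (kernelT Tm t x y (fun l => 1 + w l) k)
  eqn : ∃ (hp : MemLp (opT Tp t x y (fun l => 1 + w l)) 2 volume)
      (hm : MemLp (opT Tm t x y (fun l => 1 + w l)) 2 volume),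
    w = cauchyPlus hm.toLp + cauchyMinus hp.toLp

/-- The parameter `a = (ξ - η²/12)/12`, with `ξ = x/t`, `η = y/t`. -/
def aParam (t x y : ℝ) : ℝ := 1 / 12 * (x / t - (y / t) ^ 2 / 12)

end KPI

end

noncomputable section

namespace KPI

open Complex (I)
open ENNReal (ofReal mul_lt_top add_lt_top ofReal_mul ofReal_le_ofReal ofReal_one ofReal_pow ofReal_lt_top ofReal_toReal)
open Function (uncurry)
open Set (Ioo Icc Ioi Iic Iio indicator_of_mem)
open Filter (Tendsto atTop)

/-! For `w = μ^l - 1` the problem reads `w = b + S w`, where `S = C₊𝒯⁻ + C₋𝒯⁺` acts on `L²` and `b`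
is the formal image of the constant `1`. If each kernel `T^±` has norm at most `1/4` in `L²(dk dl)`,
then `‖S‖ ≤ 1/2`: the oscillating factor is unimodular, Hilbert-Schmidt norms dominate operator
norms, and `C_±` are contractions. Hence `w = (1 - S)⁻¹ b` and `‖w‖ ≤ 2 ‖b‖`. Differentiation in `x`
multiplies the kernels by `i(l - k)`, so `∂ₓw` is controlled by `b`, `∂ₓb` and `‖∂ₓS‖`
(`affine_family`). All decay in `t` therefore comes from `k ↦ ∫ e^{itS₀} T^±(k,l) dl` and its
variant with the factor `i(l - k)`.

Decay. After the shift `l = s + y/(12t)` the phase is `t(4s³ + 12as)` plus a function of `k`. Van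
der Corput estimates bound its integrals over arbitrary intervals by multiples of `t⁻¹`, `t^{-1/2}`
or `t^{-1/3}`, according to `a` (`norm_integral_cub_le_of_pos`, `norm_integral_cub_le_of_neg`,
`norm_integral_cub_le_third`). On the half-line `±(l - k) > 0`, integration by parts against the
primitive of the exponential that vanishes at `l = k` costs only the `L¹(dl)` norm of the
`l`-derivative of the amplitude. So three facts about the scattering data suffice (`ScatKernel`):
smallness in `L²`, moments in `l - k`, and a weighted bound of `∂_l T^±` in `L²(dk; L¹(dl))`.

Smallness and moments. In the interaction picture `n = e^{il(l+2k)y} μ̃_♯` the variable `y` enters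
the integral equation only as an endpoint of integration, and up to constants `T^±(k,l)` is `tau(k,
l-k)`, the integral of the same integrand over the whole line. For fixed `l`, Plancherel in `k`
bounds `∫ e^{il(l+2k)η} g(η) dη` by `√(π/|l|) ‖g‖`; this is where the norm with `|l|⁻¹` comes from.
The convolution term obeys Young's inequality with mass `c < 1`, so `n` and `tau` are bounded by
source/(1 - c). Replacing the weight `1` by `(1 + ε|l|)³`, which is submultiplicative and keeps the
mass below one for small `ε`, gives the moments (`InteractionSol.exists_bound`).

The derivative in `l`. Differentiating the phase produces the factor `2i(l+k)η`, unbounded in `k`.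
In the linear term it is removed by integrating by parts in `η`, because `il(l+2k)` times the phase
factor is the `η`-derivative of that factor (`KPot.dlin_by_parts`); in the convolution it is removed
by integrating by parts in `l'`, which moves the derivative to `n` and picks up the jump of `n` at
`l' = 0` (`GoodParam.deriv_nonlin_eq`). What is left is a linear equation for `∂_l n`, after
subtraction of an explicit boundary term, with the same convolution kernel. It is solved in `L¹(dl;
L²(dk))` by the same contraction, first for `k ∈ [-R, R]`, where the norm is known to be finite, and
then uniformly in `R` (`InteractionSol.dtau_bound`).

The potential. The source of that equation is singular like `|l|^{-3/2}` at `l = 0`. Finiteness of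
the norm with `|l|⁻¹` forces `ũ(0;y) = 0`, hence `|ũ(l;y)| ≤ |l| U(y)`, and a weighted interpolation
inequality gives a gain `|l|^{3/4}` for `∂_y ũ`, which is enough for integrability (`RegPot.kpot`).
Existence of scattering solutions follows from the Neumann series (`KPot.exists_interactionSol`). -/

theorem enorm_real (x : ℝ) : ‖(x : ℂ)‖ₑ = ‖x‖ₑ := by rw [← ofReal_norm, Complex.norm_real, ofReal_norm]

theorem enorm_I : ‖I‖ₑ = 1 := by rw [← ofReal_norm, Complex.norm_I, ofReal_one]

theorem enorm_I_mul (s : ℝ) (z : ℂ) : ‖I * s * z‖ₑ = ‖s‖ₑ * ‖z‖ₑ := by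
  rw [enorm_mul, enorm_mul, enorm_I, one_mul, enorm_real]

/-! ### The `L²` norm of a nonnegative function -/

/-- The `L²` norm of an extended nonnegative function. -/
def l2n {α : Type*} [MeasurableSpace α] (μ : Measure α) (g : α → ℝ≥0∞) : ℝ≥0∞ :=
  (∫⁻ a, g a ^ 2 ∂μ) ^ (1 / 2 : ℝ)

section L2n

variable {α β : Type*} [MeasurableSpace α] [MeasurableSpace β] {μ : Measure α} {ν : Measure β}

theorem ENNReal_sq_rpow_half (x : ℝ≥0∞) : (x ^ 2) ^ (1 / 2 : ℝ) = x := by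
  rw [← ENNReal.rpow_natCast, ← ENNReal.rpow_mul]; norm_num

theorem ENNReal_rpow_half_sq (x : ℝ≥0∞) : (x ^ (1 / 2 : ℝ)) ^ 2 = x := by
  rw [← ENNReal.rpow_natCast, ← ENNReal.rpow_mul]; norm_num

theorem ENNReal_sq_le_sq {x y : ℝ≥0∞} : x ^ 2 ≤ y ^ 2 ↔ x ≤ y :=
  ENNReal.pow_le_pow_left_iff two_ne_zero

theorem l2n_sq (g : α → ℝ≥0∞) : l2n μ g ^ 2 = ∫⁻ a, g a ^ 2 ∂μ := ENNReal_rpow_half_sq _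

theorem l2n_le_iff {g : α → ℝ≥0∞} {c : ℝ≥0∞} : l2n μ g ≤ c ↔ ∫⁻ a, g a ^ 2 ∂μ ≤ c ^ 2 := by
  rw [← l2n_sq, ENNReal_sq_le_sq]

theorem l2n_lt_top_iff {g : α → ℝ≥0∞} : l2n μ g < ⊤ ↔ ∫⁻ a, g a ^ 2 ∂μ < ⊤ := by
  rw [← l2n_sq, ENNReal.pow_lt_top_iff]; simp

theorem l2n_mono_ae {f g : α → ℝ≥0∞} (h : ∀ᵐ a ∂μ, f a ≤ g a) : l2n μ f ≤ l2n μ g := by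
  unfold l2n
  gcongr 1
  exact lintegral_mono_ae (h.mono fun a ha => by gcongr)

theorem l2n_mono {f g : α → ℝ≥0∞} (h : ∀ a, f a ≤ g a) : l2n μ f ≤ l2n μ g :=
  l2n_mono_ae (ae_of_all _ h)

@[simp] theorem l2n_zero : l2n μ (fun _ => 0) = 0 := by simp [l2n]

theorem l2n_add_le {f g : α → ℝ≥0∞} (hf : AEMeasurable f μ) (hg : AEMeasurable g μ) :
    l2n μ (fun a => f a + g a) ≤ l2n μ f + l2n μ g := by
  have := ENNReal.lintegral_Lp_add_le hf hg (p := 2) (by norm_num)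
  simpa [l2n] using this

theorem l2n_const_mul (c : ℝ≥0∞) {f : α → ℝ≥0∞} (hf : AEMeasurable f μ) :
    l2n μ (fun a => c * f a) = c * l2n μ f := by
  simp only [l2n, mul_pow]
  rw [lintegral_const_mul'' _ (hf.pow_const 2), ENNReal.mul_rpow_of_nonneg _ _ (by norm_num),
    ENNReal_sq_rpow_half]

theorem lintegral_mul_le_l2n {f g : α → ℝ≥0∞} (hf : AEMeasurable f μ) (hg : AEMeasurable g μ) :
    ∫⁻ a, f a * g a ∂μ ≤ l2n μ f * l2n μ g := by
  have := ENNReal.lintegral_mul_le_Lp_mul_Lq μ (p := 2) (q := 2) ⟨by norm_num, by norm_num,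
    by norm_num⟩ hf hg
  simpa [l2n] using this

theorem measurable_l2n_left [SFinite μ] {F : α → β → ℝ≥0∞} (hF : Measurable (uncurry F)) :
    Measurable fun b => l2n μ (fun a => F a b) := by
  unfold l2n
  refine Measurable.pow_const (Measurable.lintegral_prod_left' (f := fun p : α × β => F p.1 p.2 ^ 2)
    ?_) _
  exact hF.pow_const 2

/-- Minkowski's integral inequality. -/
theorem l2n_lintegral_le [SFinite μ] [SFinite ν] {F : α → β → ℝ≥0∞}
    (hF : Measurable (uncurry F)) :
    l2n μ (fun a => ∫⁻ b, F a b ∂ν) ≤ ∫⁻ b, l2n μ (fun a => F a b) ∂ν := by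
  have hF1 : ∀ a, Measurable (F a) := fun a => hF.of_uncurry_left
  have hF2 : ∀ b, Measurable (fun a => F a b) := fun b => hF.of_uncurry_right
  rw [l2n_le_iff]
  -- The square is a double integral over `b, b'`; after Tonelli, Cauchy-Schwarz in `a` factorizes
  -- it again.
  calc ∫⁻ a, (∫⁻ b, F a b ∂ν) ^ 2 ∂μ
      = ∫⁻ a, ∫⁻ b, ∫⁻ b', F a b * F a b' ∂ν ∂ν ∂μ := by
        refine lintegral_congr fun a => ?_
        simp_rw [lintegral_const_mul _ (hF1 a)]
        rw [lintegral_mul_const _ (hF1 a), sq]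
    _ = ∫⁻ b, ∫⁻ a, ∫⁻ b', F a b * F a b' ∂ν ∂μ ∂ν := by
        rw [lintegral_lintegral_swap]
        refine Measurable.aemeasurable ?_
        refine Measurable.lintegral_prod_right' (f := fun p : (α × β) × β =>
          F p.1.1 p.1.2 * F p.1.1 p.2) ?_
        exact (hF.comp measurable_fst).mul
          (hF.comp ((measurable_fst.comp measurable_fst).prodMk measurable_snd))
    _ = ∫⁻ b, ∫⁻ b', ∫⁻ a, F a b * F a b' ∂μ ∂ν ∂ν := by
        refine lintegral_congr fun b => ?_
        rw [lintegral_lintegral_swap]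
        exact (((hF2 b).comp measurable_fst).mul hF).aemeasurable
    _ ≤ ∫⁻ b, ∫⁻ b', l2n μ (fun a => F a b) * l2n μ (fun a => F a b') ∂ν ∂ν := by
        gcongr with b b'
        exact lintegral_mul_le_l2n (hF2 b).aemeasurable (hF2 b').aemeasurable
    _ = (∫⁻ b, l2n μ (fun a => F a b) ∂ν) ^ 2 := by
        have := measurable_l2n_left (μ := μ) hF
        simp_rw [lintegral_const_mul _ this]
        rw [lintegral_mul_const _ this, sq]

theorem ae_lt_top_of_l2n {g : α → ℝ≥0∞} (hg : Measurable g) (h : l2n μ g < ⊤) :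
    ∀ᵐ a ∂μ, g a < ⊤ := by
  have := ae_lt_top (hg.pow_const 2) (l2n_lt_top_iff.1 h).ne
  filter_upwards [this] with a ha
  rw [ENNReal.pow_lt_top_iff] at ha
  simpa using ha

theorem l2n_prod [SFinite ν] {F : α → β → ℝ≥0∞} (hF : Measurable (uncurry F)) :
    l2n (μ.prod ν) (uncurry F) = l2n μ (fun a => l2n ν (F a)) := by
  unfold l2n
  congr 1
  rw [lintegral_prod _ (hF.pow_const 2).aemeasurable]
  refine lintegral_congr fun a => ?_
  rw [ENNReal_rpow_half_sq]; rfl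

theorem l2n_swap [SFinite μ] [SFinite ν] {F : α → β → ℝ≥0∞}
    (hF : Measurable (uncurry F)) :
    l2n μ (fun a => l2n ν (F a)) = l2n ν (fun b => l2n μ (fun a => F a b)) := by
  unfold l2n
  congr 1
  simp_rw [ENNReal_rpow_half_sq]
  exact lintegral_lintegral_swap (hF.pow_const 2).aemeasurable

/-- The linear Gronwall inequality for a kernel of mass less than one. -/
theorem contraction_bound {D κ : ℝ → ℝ≥0∞} (hκ : AEMeasurable κ) {S : ℝ≥0∞} {c : ℝ≥0∞}
    (hc : c < 1) (hκc : ∫⁻ y, κ y ≤ c) (hfin : ∫⁻ y, κ y * D y < ⊤)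
    (hD : ∀ᵐ y, D y ≤ S + ∫⁻ η, κ η * D η) :
    S + ∫⁻ η, κ η * D η ≤ S / (1 - c) := by
  generalize hI : ∫⁻ η, κ η * D η = I at hfin hD ⊢
  -- Integrating the hypothesis against `κ` closes the inequality on the single number `I`. Its
  -- finiteness is what permits absorbing `c * I` on the left.
  have h1 : I ≤ c * (S + I) := by
    calc I ≤ ∫⁻ y, κ y * (S + I) := hI.symm.trans_le <| lintegral_mono_ae (hD.mono fun y hy => by gcongr)
      _ = (∫⁻ y, κ y) * (S + I) := lintegral_mul_const'' _ hκ
      _ ≤ _ := by gcongr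
  rw [ENNReal.le_div_iff_mul_le (Or.inl (tsub_pos_of_lt hc).ne') (Or.inl (by simp))]
  rcases eq_or_ne S ⊤ with hS | hS
  · simp [hS]
  lift S to ℝ≥0 using hS
  clear hI hD
  lift I to ℝ≥0 using hfin.ne
  lift c to ℝ≥0 using (hc.trans ENNReal.one_lt_top).ne
  norm_cast at *
  rw [← NNReal.coe_le_coe] at *
  rw [← NNReal.coe_lt_coe] at hc
  push_cast [NNReal.coe_sub hc.le] at *
  nlinarith

end L2n

/-! ### Plancherel's theorem for Fourier integrals and in the spectral parameter `k` -/

/-- On `L¹ ∩ L²` the Fourier transform of `L²` functions is given by the Fourier integral. -/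
theorem fourier_toLp_ae_eq {f : ℝ → ℂ} (h1 : Integrable f) (h2 : MemLp f 2) :
    (𝓕 (h2.toLp f) : Lp ℂ 2 (volume : Measure ℝ)) =ᵐ[volume] 𝓕 f := by
  refine ae_eq_of_integral_contDiff_smul_eq
    -- Both sides are tested against smooth compactly supported functions: the `L²` transform agrees
    -- with the transform of tempered distributions, and the integral is self-adjoint by Fubini.
    ((Lp.memLp _).locallyIntegrable (by norm_num)) ?_ fun g hg hgc => ?_
  · exact (VectorFourier.fourierIntegral_continuous Real.continuous_fourierChar
      (by exact continuous_inner) h1).locallyIntegrable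
  · have hc : HasCompactSupport (fun x => (g x : ℂ)) := hgc.comp_left (g := fun r : ℝ => (r : ℂ)) rfl
    have hd : ContDiff ℝ ∞ (fun x => (g x : ℂ)) := Complex.ofRealCLM.contDiff.comp hg
    set G : SchwartzMap ℝ ℂ := hc.toSchwartzMap hd with hG
    have h3 := congrArg (fun T => T G) (Lp.fourier_toTemperedDistribution_eq (h2.toLp f))
    simp only [TemperedDistribution.fourier_apply, Lp.toTemperedDistribution_apply] at h3
    have h4 : ∀ x, (G x : ℂ) = g x := fun x => rfl
    have h5 : ∫ x, g x • (𝓕 (h2.toLp f) : Lp ℂ 2 (volume : Measure ℝ)) x =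
        ∫ x, G x • (𝓕 (h2.toLp f) : Lp ℂ 2 (volume : Measure ℝ)) x := by
      simp [h4]
    rw [h5, ← h3]
    have h6 : ∫ x, (𝓕 G : SchwartzMap ℝ ℂ) x • (h2.toLp f) x = ∫ x, f x • (𝓕 (G : ℝ → ℂ)) x := by
      refine integral_congr_ae ?_
      filter_upwards [h2.coeFn_toLp] with x hx
      rw [hx, SchwartzMap.fourier_coe, smul_eq_mul, smul_eq_mul, mul_comm]
    rw [h6]
    have h7 := VectorFourier.integral_fourierIntegral_smul_eq_flip (L := innerₗ ℝ) (μ := volume)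
      (ν := volume) (f := f) (g := (G : ℝ → ℂ))
      Real.continuous_fourierChar (by exact continuous_inner) h1 G.integrable
    rw [flip_innerₗ] at h7
    refine h7.symm.trans ?_
    refine integral_congr_ae (ae_of_all _ fun x => ?_)
    simp only [h4, smul_eq_mul, Complex.real_smul]
    rw [mul_comm]; rfl

theorem lintegral_fourier_sq {f : ℝ → ℂ} (h1 : Integrable f) (h2 : MemLp f 2) :
    ∫⁻ ξ, ‖𝓕 f ξ‖ₑ ^ 2 = ∫⁻ x, ‖f x‖ₑ ^ 2 := by
  have h := Lp.norm_fourier_eq (h2.toLp f)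
  have h3 : eLpNorm (𝓕 f) 2 volume = eLpNorm f 2 volume := by
    rw [← eLpNorm_congr_ae (fourier_toLp_ae_eq h1 h2), ← eLpNorm_congr_ae h2.coeFn_toLp,
      ← Lp.enorm_def, ← Lp.enorm_def, ← ofReal_norm, h, ofReal_norm]
  have h4 := fun g : ℝ → ℂ => eLpNorm_nnreal_pow_eq_lintegral (f := g) (μ := volume) (p := 2)
    (by norm_num)
  have h5 := h4 (𝓕 f)
  have h6 := h4 f
  norm_num at h5 h6
  rw [← h5, ← h6, h3]

theorem lintegral_comp_mul_left {a : ℝ} (ha : a ≠ 0) (f : ℝ → ℝ≥0∞) :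
    ∫⁻ x, f (a * x) = ofReal |a⁻¹| * ∫⁻ x, f x := by
  have := lintegral_map_equiv f (Homeomorph.mulLeft₀ a ha).toMeasurableEquiv (μ := volume)
  simp only [Homeomorph.toMeasurableEquiv_coe, Homeomorph.coe_mulLeft₀] at this
  rw [← this, Real.map_volume_mul_left ha, lintegral_smul_measure, smul_eq_mul]


theorem lintegral_cexp_sq {f : ℝ → ℂ} (h1 : Integrable f) (h2 : MemLp f 2) :
    ∫⁻ ξ : ℝ, ‖∫ x : ℝ, Complex.exp (-(I * ξ * x)) * f x‖ₑ ^ 2 =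
      ofReal (2 * π) * ∫⁻ x, ‖f x‖ₑ ^ 2 := by
  have hπ := Real.pi_pos
  have h3 : ∀ ξ : ℝ, ∫ x : ℝ, Complex.exp (-(I * ξ * x)) * f x = 𝓕 f ((2 * π)⁻¹ * ξ) := by
    intro ξ
    rw [Real.fourier_real_eq_integral_exp_smul]
    congr 1; ext x
    rw [smul_eq_mul]
    congr 2
    push_cast
    field_simp
  simp_rw [h3]
  rw [lintegral_comp_mul_left (by positivity) (fun ξ => ‖𝓕 f ξ‖ₑ ^ 2), lintegral_fourier_sq h1 h2,
    inv_inv, abs_of_pos (by positivity)]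

/-- The unimodular factor `e^{i l (l + 2k) y}`. -/
def ph (k l y : ℝ) : ℂ := Complex.exp (((l * (l + 2 * k) * y : ℝ) : ℂ) * I)

@[simp] theorem norm_ph (k l y : ℝ) : ‖ph k l y‖ = 1 := Complex.norm_exp_ofReal_mul_I _

@[simp] theorem enorm_ph (k l y : ℝ) : ‖ph k l y‖ₑ = 1 := by
  rw [← ofReal_norm, norm_ph, ofReal_one]

theorem continuous_ph : Continuous fun p : ℝ × ℝ × ℝ => ph p.1 p.2.1 p.2.2 := by
  unfold ph; fun_prop

@[fun_prop] theorem measurable_ph_comp {α : Type*} [MeasurableSpace α] {f g h : α → ℝ} (hf : Measurable f)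
    (hg : Measurable g) (hh : Measurable h) : Measurable fun a => ph (f a) (g a) (h a) :=
  continuous_ph.measurable.comp (hf.prodMk (hg.prodMk hh))

/-- Plancherel's theorem in the variable `k`. -/
theorem lintegral_ph_sq_le {l : ℝ} (hl : l ≠ 0) {g : ℝ → ℂ} (hg : Integrable g) :
    ∫⁻ k : ℝ, ‖∫ η : ℝ, ph k l η * g η‖ₑ ^ 2 ≤ ofReal (π / |l|) * ∫⁻ η, ‖g η‖ₑ ^ 2 := by
  have hπ := Real.pi_pos
  have hl' : 0 < |l| := abs_pos.2 hl
  by_cases htop : ∫⁻ η, ‖g η‖ₑ ^ 2 = ⊤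
  · rw [htop, ENNReal.mul_top]; · exact le_top
    simpa using by positivity
  -- Since `l(l+2k)η = l²η + 2lkη`, the chirp `l²η` goes into `f` and what remains is a Fourier
  -- integral at frequency `-2lk`. The substitution contributes `1/(2|l|)` and Plancherel `2π`,
  -- whence `π/|l|`.
  set f : ℝ → ℂ := fun η => Complex.exp (((l * l * η : ℝ) : ℂ) * I) * g η with hf
  have hfn : ∀ η, ‖f η‖ₑ = ‖g η‖ₑ := fun η => by
    rw [hf, enorm_mul, ← ofReal_norm (Complex.exp _), Complex.norm_exp_ofReal_mul_I]; simp
  have hfm : AEStronglyMeasurable f volume :=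
    (Continuous.aestronglyMeasurable (by fun_prop)).mul hg.1
  have hf1 : Integrable f := ⟨hfm, by
    have := hg.2; simp only [HasFiniteIntegral, hfn] at this ⊢; exact this⟩
  have hf2 : MemLp f 2 := by
    refine ⟨hfm, ?_⟩
    rw [eLpNorm_lt_top_iff_lintegral_rpow_enorm_lt_top (by norm_num) (by norm_num)]
    simp only [hfn]
    simpa [lt_top_iff_ne_top] using htop
  have h3 : ∀ k : ℝ, ∫ η : ℝ, ph k l η * g η =
      ∫ x : ℝ, Complex.exp (-(I * ((-2 * l) * k : ℝ) * x)) * f x := by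
    intro k
    congr 1; ext η
    rw [hf, ← mul_assoc, ← Complex.exp_add, ph]
    congr 2
    push_cast; ring
  simp_rw [h3]
  rw [lintegral_comp_mul_left (by simpa using hl)
    (fun k => ‖∫ x : ℝ, Complex.exp (-(I * (k : ℝ) * x)) * f x‖ₑ ^ 2),
    lintegral_cexp_sq hf1 hf2, ← mul_assoc, ← ofReal_mul (by positivity)]
  simp only [hfn]
  gcongr
  rw [abs_inv, abs_mul]
  norm_num
  field_simp
  rfl

theorem l2n_ph_le {l : ℝ} (hl : l ≠ 0) {g : ℝ → ℂ} (hg : Integrable g) :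
    l2n volume (fun k : ℝ => ‖∫ η : ℝ, ph k l η * g η‖ₑ) ≤
      ofReal √(π / |l|) * l2n volume (fun η => ‖g η‖ₑ) := by
  rw [l2n_le_iff, mul_pow, l2n_sq, ← ofReal_pow (by positivity), Real.sq_sqrt (by positivity)]
  exact lintegral_ph_sq_le hl hg

/-! ### Oscillatory integrals with cubic phase -/

/-- The oscillating exponential with phase `t (4 s³ + 12 a s)`. -/
def cub (t a s : ℝ) : ℂ := Complex.exp (((t * (4 * s ^ 3 + 12 * a * s) : ℝ) : ℂ) * I)

theorem norm_cub (t a s : ℝ) : ‖cub t a s‖ = 1 := Complex.norm_exp_ofReal_mul_I _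

theorem continuous_cub (t a : ℝ) : Continuous (cub t a) := by unfold cub; fun_prop

theorem hasDerivAt_cub (t a s : ℝ) :
    HasDerivAt (cub t a) (12 * t * (s ^ 2 + a) * I * cub t a s) s := by
  have h1 : HasDerivAt (fun s : ℝ => t * (4 * s ^ 3 + 12 * a * s))
      (t * (4 * (3 * s ^ 2) + 12 * a)) s := by
    have := (((hasDerivAt_id s).pow 3).const_mul 4).add ((hasDerivAt_id s).const_mul (12 * a))
    convert! this.const_mul t using 1
    simp
  have h2 := (h1.ofReal_comp.mul_const I).cexp
  refine HasDerivAt.congr_deriv (f := cub t a) h2 ?_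
  unfold cub
  push_cast
  ring

/-- The first derivative test on an interval of the half-line where the derivative of the phase
is of one sign. -/
theorem norm_integral_cub_le_of_sign {t a κ α β : ℝ} (ht : 0 < t) (hκ : 0 < κ) (hα : 0 ≤ α)
    (hαβ : α ≤ β) (h : (∀ s ∈ Icc α β, κ ≤ s ^ 2 + a) ∨ ∀ s ∈ Icc α β, s ^ 2 + a ≤ -κ) :
    ‖∫ s in α..β, cub t a s‖ ≤ 1 / (t * κ) := by
  have hne : ∀ s ∈ Icc α β, s ^ 2 + a ≠ 0 := fun s hs => by
    rcases h with h | h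
    · have := h s hs; intro h0; linarith
    · have := h s hs; intro h0; linarith
  have hge : ∀ s ∈ Icc α β, κ ≤ |s ^ 2 + a| := fun s hs => by
    rcases h with h | h
    · exact (h s hs).trans (le_abs_self _)
    · have := h s hs; rw [abs_of_nonpos (by linarith)]; linarith
  -- The reciprocal of the derivative of the phase, against which the exponential is integrated by
  -- parts.
  set g : ℝ → ℝ := fun s => (12 * t * (s ^ 2 + a))⁻¹ with hg
  set g' : ℝ → ℝ := fun s => -(24 * t * s) / (12 * t * (s ^ 2 + a)) ^ 2 with hg'
  have hgd : ∀ s ∈ Icc α β, HasDerivAt g (g' s) s := fun s hs => by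
    have h1 : HasDerivAt (fun s : ℝ => 12 * t * (s ^ 2 + a)) (24 * t * s) s := by
      have := (((hasDerivAt_id s).pow 2).add_const a).const_mul (12 * t)
      convert! this using 1
      simp; ring
    exact h1.inv (mul_ne_zero (by positivity) (hne s hs))
  have hg'c : ContinuousOn g' (Icc α β) := by
    refine ContinuousOn.div (by fun_prop) (by fun_prop) fun s hs => ?_
    exact pow_ne_zero _ (mul_ne_zero (by positivity) (hne s hs))
  have hu : Set.uIcc α β = Icc α β := Set.uIcc_of_le hαβ
  have hgle : ∀ s ∈ Icc α β, |g s| ≤ 1 / (12 * t * κ) := fun s hs => by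
    have := hge s hs
    rw [hg, abs_inv, abs_mul, abs_of_pos (by positivity : 0 < 12 * t), ← one_div]
    gcongr
  have hg'i : IntervalIntegrable g' volume α β :=
    ContinuousOn.intervalIntegrable (by rwa [hu])
  have hparts := intervalIntegral.integral_mul_deriv_eq_deriv_mul (a := α) (b := β)
    (u := fun s => (g s : ℂ) * (-I)) (v := cub t a) (u' := fun s => (g' s : ℂ) * (-I))
    (v' := fun s => 12 * t * (s ^ 2 + a) * I * cub t a s)
    (fun s hs => ((hgd s (hu ▸ hs)).ofReal_comp.mul_const _))
    (fun s _ => hasDerivAt_cub t a s)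
    (ContinuousOn.intervalIntegrable (by
      rw [hu]; exact (Complex.continuous_ofReal.comp_continuousOn hg'c).mul_const _))
    (Continuous.intervalIntegrable (by have := continuous_cub t a; fun_prop) _ _)
  have heq : ∫ s in α..β, cub t a s =
      ∫ s in α..β, (g s : ℂ) * (-I) * (12 * t * (s ^ 2 + a) * I * cub t a s) := by
    refine intervalIntegral.integral_congr fun s hs => ?_
    have h1 : (12 * t * (s ^ 2 + a) : ℂ) ≠ 0 := by
      have := mul_ne_zero (by positivity : 12 * t ≠ 0) (hne s (hu ▸ hs))
      exact_mod_cast this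
    have h2 : (g s : ℂ) * (12 * t * (s ^ 2 + a)) = 1 := by
      simp only [hg]; push_cast
      exact inv_mul_cancel₀ h1
    have h3 : (g s : ℂ) * (-I) * (12 * t * (s ^ 2 + a) * I * cub t a s) =
        ((g s : ℂ) * (12 * t * (s ^ 2 + a))) * (-(I * I)) * cub t a s := by ring
    simp only [h3, h2, Complex.I_mul_I]; ring
  have hα' : α ∈ Icc α β := ⟨le_rfl, hαβ⟩
  have hβ' : β ∈ Icc α β := ⟨hαβ, le_rfl⟩
  -- On the half-line `s ≥ 0` the function `g` is decreasing on `[α, β]`, so its total variation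
  -- telescopes to `g α - g β`; no second derivative estimate is needed.
  have hint : ‖∫ s in α..β, (g' s : ℂ) * (-I) * cub t a s‖ ≤ g α - g β := by
    refine (intervalIntegral.norm_integral_le_integral_norm hαβ).trans ?_
    have : ∫ s in α..β, ‖(g' s : ℂ) * (-I) * cub t a s‖ = ∫ s in α..β, -g' s := by
      refine intervalIntegral.integral_congr fun s hs => ?_
      rw [hu] at hs
      simp only [norm_mul, norm_neg, Complex.norm_I, norm_cub, Complex.norm_real, mul_one,
        norm_eq_abs]
      refine abs_of_nonpos ?_
      have : 0 ≤ s := hα.trans hs.1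
      simp only [hg', neg_div]
      have : 0 ≤ 24 * t * s / (12 * t * (s ^ 2 + a)) ^ 2 := by positivity
      linarith
    rw [this, intervalIntegral.integral_neg,
      intervalIntegral.integral_eq_sub_of_hasDerivAt (fun s hs => hgd s (hu ▸ hs)) hg'i]
    linarith
  rw [heq, hparts]
  have e1 : ‖(g β : ℂ) * (-I) * cub t a β‖ = |g β| := by simp [norm_cub]
  have e2 : ‖(g α : ℂ) * (-I) * cub t a α‖ = |g α| := by simp [norm_cub]
  have b1 := hgle α hα'
  have b2 := hgle β hβ'
  have b3 : g α - g β ≤ |g α| + |g β| := by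
    have := le_abs_self (g α); have := neg_abs_le (g β); linarith
  calc _ ≤ |g β| + |g α| + (g α - g β) := by
        refine (norm_sub_le _ _).trans (add_le_add ((norm_sub_le _ _).trans ?_) hint)
        rw [e1, e2]
    _ ≤ 4 * (1 / (12 * t * κ)) := by linarith
    _ ≤ 1 / (t * κ) := by
        rw [show 4 * (1 / (12 * t * κ)) = (1 / 3) * (1 / (t * κ)) by field_simp; norm_num]
        have : 0 ≤ 1 / (t * κ) := by positivity
        linarith

theorem intervalIntegrable_cub (t a α β : ℝ) : IntervalIntegrable (cub t a) volume α β :=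
  (continuous_cub t a).intervalIntegrable _ _

/-- Splitting off an interval of length `r` on which the phase may be stationary. -/
theorem norm_integral_cub_le_half {t a κ r c₀ c₁ α β : ℝ} (ht : 0 < t) (hκ : 0 < κ)
    (h01 : c₀ ≤ c₁) (hr : c₁ - c₀ ≤ r)
    (h0 : ∀ s, 0 ≤ s → s ≤ c₀ → s ^ 2 + a ≤ -κ) (h1 : ∀ s, 0 ≤ s → c₁ ≤ s → κ ≤ s ^ 2 + a)
    (hα : 0 ≤ α) (hαβ : α ≤ β) :
    ‖∫ s in α..β, cub t a s‖ ≤ r + 2 / (t * κ) := by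
  have hp : 0 ≤ 1 / (t * κ) := by positivity
  -- `p` and `q` are `c₀` and `c₁` clamped to `[α, β]`. The first derivative test applies on `[α,
  -- p]` and `[q, β]`, and the middle piece is bounded by its length.
  set p := max α (min β c₀) with hpdef
  set q := max α (min β c₁) with hqdef
  have hαp : α ≤ p := le_max_left _ _
  have hpq : p ≤ q := max_le_max le_rfl (min_le_min le_rfl h01)
  have hqβ : q ≤ β := max_le hαβ (min_le_left _ _)
  have i1 : ‖∫ s in α..p, cub t a s‖ ≤ 1 / (t * κ) := by
    rcases hαp.eq_or_lt with h | h
    · rw [← h]; simpa using hp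
    · have hpc : p ≤ c₀ := by
        rw [hpdef, max_def] at h ⊢
        split_ifs at h ⊢ with h'
        · exact min_le_right _ _
        · exact absurd h (lt_irrefl _)
      exact norm_integral_cub_le_of_sign ht hκ hα hαp
        (Or.inr fun s hs => h0 s (hα.trans hs.1) (hs.2.trans hpc))
  have i3 : ‖∫ s in q..β, cub t a s‖ ≤ 1 / (t * κ) := by
    rcases hqβ.eq_or_lt with h | h
    · rw [← h]; simpa using hp
    · have hqc : c₁ ≤ q := by
        have : min β c₁ ≤ q := le_max_right _ _
        rcases min_choice β c₁ with h' | h'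
        · rw [h'] at this; exact absurd (this.trans_lt h) (lt_irrefl _)
        · rwa [h'] at this
      exact norm_integral_cub_le_of_sign ht hκ (hα.trans (hαp.trans hpq)) hqβ
        (Or.inl fun s hs => h1 s (hα.trans (hαp.trans (hpq.trans hs.1))) (hqc.trans hs.1))
  have i2 : ‖∫ s in p..q, cub t a s‖ ≤ r := by
    have := intervalIntegral.norm_integral_le_of_norm_le_const (a := p) (b := q) (f := cub t a)
      (C := 1) (fun s _ => (norm_cub t a s).le)
    rw [one_mul, abs_of_nonneg (by linarith)] at this
    refine this.trans (le_trans ?_ hr)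
    rw [hpdef, hqdef]
    rcases le_total β c₀ with h | h <;> rcases le_total β c₁ with h' | h' <;>
      simp only [min_eq_left, min_eq_right, h, h', max_def] <;> split_ifs <;> linarith
  rw [← intervalIntegral.integral_add_adjacent_intervals (intervalIntegrable_cub t a α p)
      (intervalIntegrable_cub t a p β),
    ← intervalIntegral.integral_add_adjacent_intervals (intervalIntegrable_cub t a p q)
      (intervalIntegrable_cub t a q β)]
  refine (norm_add_le _ _).trans ((add_le_add i1 ((norm_add_le _ _).trans
    (add_le_add i2 i3))).trans (le_of_eq ?_))
  ring

theorem cub_neg (t a s : ℝ) : cub t a (-s) = starRingEnd ℂ (cub t a s) := by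
  unfold cub
  rw [← Complex.exp_conj]
  congr 1
  simp only [map_mul, Complex.conj_ofReal, Complex.conj_I]
  push_cast; ring

theorem norm_integral_cub_neg (t a α β : ℝ) :
    ‖∫ s in α..β, cub t a s‖ = ‖∫ s in (-β)..(-α), cub t a s‖ := by
  rw [← intervalIntegral.integral_comp_neg]
  simp_rw [cub_neg]
  have : ∫ s in α..β, starRingEnd ℂ (cub t a s) = starRingEnd ℂ (∫ s in α..β, cub t a s) := by
    simp only [intervalIntegral, integral_conj, map_sub]
  rw [this, RCLike.norm_conj]

/-- The phase is odd, so integrals over the negative half-line are conjugates of integrals over the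
positive one. Cutting at zero costs the factor two. -/
theorem norm_integral_cub_le {t a κ r c₀ c₁ : ℝ} (ht : 0 < t) (hκ : 0 < κ)
    (h01 : c₀ ≤ c₁) (hr : c₁ - c₀ ≤ r)
    (h0 : ∀ s, 0 ≤ s → s ≤ c₀ → s ^ 2 + a ≤ -κ) (h1 : ∀ s, 0 ≤ s → c₁ ≤ s → κ ≤ s ^ 2 + a)
    (α β : ℝ) :
    ‖∫ s in α..β, cub t a s‖ ≤ 2 * (r + 2 / (t * κ)) := by
  have hr0 : 0 ≤ r := by linarith
  have hp : 0 ≤ r + 2 / (t * κ) := by positivity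
  have key := fun α β : ℝ => norm_integral_cub_le_half (α := α) (β := β) ht hκ h01 hr h0 h1
  wlog hαβ : α ≤ β generalizing α β
  · rw [intervalIntegral.integral_symm, norm_neg]
    exact this β α (le_of_not_ge hαβ)
  rcases le_total 0 α with hα | hα
  · linarith [key α β hα hαβ]
  rcases le_total β 0 with hβ | hβ
  · rw [norm_integral_cub_neg]
    linarith [key (-β) (-α) (by linarith) (by linarith)]
  · rw [← intervalIntegral.integral_add_adjacent_intervals (intervalIntegrable_cub t a α 0)
      (intervalIntegrable_cub t a 0 β)]
    have i1 := key 0 β le_rfl hβ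
    have i2 := key 0 (-α) le_rfl (by linarith)
    have i3 := norm_integral_cub_neg t a α 0
    rw [neg_zero] at i3
    linarith [norm_add_le (∫ s in α..0, cub t a s) (∫ s in (0 : ℝ)..β, cub t a s)]

theorem norm_integral_cub_le_of_pos {t a δ : ℝ} (ht : 0 < t) (hδ : 0 < δ) (ha : δ < a) (α β : ℝ) :
    ‖∫ s in α..β, cub t a s‖ ≤ 4 / δ * t ^ (-1 : ℝ) := by
  -- With `a > δ` there is no stationary point: the negative value of `c₀ = c₁` makes the first
  -- condition void and the window empty.
  refine (norm_integral_cub_le (r := 0) (c₀ := -1) (c₁ := -1) ht hδ le_rfl (by norm_num)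
    (fun s h h' => by linarith) (fun s _ _ => by nlinarith) α β).trans (le_of_eq ?_)
  rw [Real.rpow_neg_one]
  field_simp
  ring

/-- Uniformly in `a`, the set of `s ≥ 0` with `|s² + a| < ρ²` lies in a window of length `3ρ`. The
choice `ρ = t^{-1/3}` balances this length with the contribution `2/(tρ²) = 2ρ` from outside, giving
`2(3ρ + 2ρ)`. This covers the degenerate stationary point at `a = 0`. -/
theorem norm_integral_cub_le_third {t : ℝ} (ht : 0 < t) (a α β : ℝ) :
    ‖∫ s in α..β, cub t a s‖ ≤ 10 * t ^ (-(1 / 3) : ℝ) := by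
  set ρ := t ^ (-(1 / 3) : ℝ) with hρ
  have hρ0 : 0 < ρ := Real.rpow_pos_of_pos ht _
  have hρ3 : t * ρ ^ 3 = 1 := by
    rw [hρ, ← Real.rpow_natCast, ← Real.rpow_mul ht.le]
    norm_num
    rw [Real.rpow_neg_one]
    exact mul_inv_cancel₀ ht.ne'
  have h2 : 2 / (t * ρ ^ 2) = 2 * ρ := by
    rw [div_eq_iff (by positivity)]
    linear_combination -2 * hρ3
  set c₁ := √(max (ρ ^ 2 - a) 0) with hc1
  -- In the second case the phase derivative is never below the threshold, and a negative `c₀` makes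
  -- the corresponding condition void. The value `-ρ` keeps the window shorter than `3ρ`, as then
  -- `c₁ ≤ 2ρ`.
  set c₀ := if a + ρ ^ 2 ≤ 0 then √(-a - ρ ^ 2) else -ρ with hc0
  have hc1s : c₁ ^ 2 = max (ρ ^ 2 - a) 0 := Real.sq_sqrt (le_max_right _ _)
  have hc10 : 0 ≤ c₁ := Real.sqrt_nonneg _
  have main : c₀ ≤ c₁ ∧ c₁ - c₀ ≤ 3 * ρ ∧ ∀ s, 0 ≤ s → s ≤ c₀ → s ^ 2 + a ≤ -ρ ^ 2 := by
    rw [hc0]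
    split_ifs with h
    · have h3 : √(-a - ρ ^ 2) ^ 2 = -a - ρ ^ 2 := Real.sq_sqrt (by linarith)
      have h4 := Real.sqrt_nonneg (-a - ρ ^ 2)
      rw [max_eq_left (by nlinarith)] at hc1s
      refine ⟨?_, ?_, fun s hs hs' => by nlinarith⟩
      · rw [hc1]
        refine Real.sqrt_le_sqrt ((?_ : _ ≤ ρ ^ 2 - a).trans (le_max_left _ _))
        nlinarith
      · have h5 : c₁ ≤ √(-a - ρ ^ 2) + 3 * ρ := by
          refine abs_le_of_sq_le_sq' ?_ (by positivity) |>.2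
          nlinarith [mul_nonneg h4 hρ0.le]
        linarith
    · refine ⟨by linarith, ?_, fun s hs hs' => by linarith⟩
      have h5 : c₁ ≤ 2 * ρ := by
        refine abs_le_of_sq_le_sq' ?_ (by positivity) |>.2
        rw [hc1s]
        refine max_le ?_ (by positivity)
        nlinarith
      linarith
  have := norm_integral_cub_le (a := a) (κ := ρ ^ 2) (r := 3 * ρ) (c₀ := c₀) (c₁ := c₁) ht
    (by positivity) main.1 main.2.1 main.2.2 (fun s hs hs' => ?_) α β
  · rw [h2] at this
    linarith
  · have h6 : c₁ ^ 2 ≤ s ^ 2 := by gcongr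
    have := le_max_left (ρ ^ 2 - a) 0
    linarith

/-- The stationary points `±√(-a)` stay at distance at least `√δ` from the origin and are
nondegenerate: outside a window of radius `ρ = t^{-1/2}` around `√(-a)` one has `|s² + a| ≥ ρ√δ` for
`s ≥ 0`, and `tρ² = 1` balances both contributions. -/
theorem norm_integral_cub_le_of_neg {t a δ : ℝ} (ht : 0 < t) (hδ : 0 < δ) (ha : a < -δ) (α β : ℝ) :
    ‖∫ s in α..β, cub t a s‖ ≤ (4 + 4 / √δ) * t ^ (-(1 / 2) : ℝ) := by
  set ρ := t ^ (-(1 / 2) : ℝ) with hρ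
  have hρ0 : 0 < ρ := Real.rpow_pos_of_pos ht _
  have hρ2 : t * ρ ^ 2 = 1 := by
    rw [hρ, ← Real.rpow_natCast, ← Real.rpow_mul ht.le]
    norm_num
    rw [Real.rpow_neg_one]
    exact mul_inv_cancel₀ ht.ne'
  have hb : √(-a) ^ 2 = -a := Real.sq_sqrt (by linarith)
  have hb0 : √δ ≤ √(-a) := Real.sqrt_le_sqrt (by linarith)
  have hδ0 : 0 < √δ := Real.sqrt_pos.2 hδ
  have h2 : 2 / (t * (ρ * √δ)) = 2 * ρ / √δ := by
    rw [div_eq_div_iff (by positivity) (by positivity)]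
    linear_combination -2 * √δ * hρ2
  have := norm_integral_cub_le (a := a) (κ := ρ * √δ) (r := 2 * ρ) (c₀ := √(-a) - ρ)
    (c₁ := √(-a) + ρ) ht (by positivity) (by linarith) (by linarith) (fun s hs hs' => ?_)
    (fun s hs hs' => ?_) α β
  · rw [h2] at this
    refine this.trans (le_of_eq ?_)
    field_simp
    ring
  · nlinarith [mul_nonneg hs (by linarith : 0 ≤ √(-a) - ρ - s), mul_nonneg hρ0.le (by linarith : 0 ≤ √(-a) - √δ)]
  · nlinarith [mul_nonneg hρ0.le (by linarith : 0 ≤ √(-a) - √δ)]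

/-! ### Amplitudes of bounded variation -/

/-- The primitive of `e` is taken to vanish at the endpoint `k`, so the boundary term there is zero
even if `f k ≠ 0`, and at infinity `f` tends to zero. This is why the cutoff `H(±(l-k))` in the
scattering data does no harm. -/
theorem norm_integral_Ioi_mul_le {e f f' : ℝ → ℂ} {M : ℝ} (he : Continuous e)
    (hM : ∀ α β, ‖∫ s in α..β, e s‖ ≤ M) (hen : ∀ s, ‖e s‖ ≤ 1) (hf : ∀ s, HasDerivAt f (f' s) s)
    (hfi : Integrable f) (hf'i : Integrable f') (k : ℝ) :
    ‖∫ s in Ioi k, e s * f s‖ ≤ M * ∫ s, ‖f' s‖ := by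
  set F : ℝ → ℂ := fun l => ∫ s in k..l, e s with hF
  have hFd : ∀ s, HasDerivAt F (e s) s := fun s => he.integral_hasStrictDerivAt k s |>.hasDerivAt
  have hFM : ∀ s, ‖F s‖ ≤ M := fun s => hM k s
  have hFc : Continuous F := continuous_iff_continuousAt.2 fun s => (hFd s).continuousAt
  have hM0 : 0 ≤ M := (norm_nonneg _).trans (hM 0 0)
  have hfc : Continuous f := continuous_iff_continuousAt.2 fun s => (hf s).continuousAt
  have hlim : Tendsto f atTop (nhds 0) :=
    tendsto_zero_of_hasDerivAt_of_integrableOn_Ioi (a := k) (fun s _ => hf s)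
      hf'i.integrableOn hfi.integrableOn
  have hi1 : Integrable (fun s => F s * f' s) :=
    hf'i.bdd_mul hFc.aestronglyMeasurable (ae_of_all _ hFM)
  have hi2 : Integrable (fun s => e s * f s) :=
    hfi.bdd_mul he.aestronglyMeasurable (ae_of_all _ hen)
  have h := integral_Ioi_mul_deriv_eq_deriv_mul (a := k) (u := f) (u' := f') (v := F) (v' := e)
    (a' := 0) (b' := 0) (fun s _ => hf s) (fun s _ => hFd s)
    (by rw [mul_comm]; exact hi2.integrableOn) (by rw [mul_comm]; exact hi1.integrableOn)
    ?_ ?_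
  · have h' : ∫ s in Ioi k, e s * f s = -∫ s in Ioi k, f' s * F s := by
      simp_rw [mul_comm (e _)]
      rw [h]; simp
    rw [h', norm_neg]
    calc ‖∫ s in Ioi k, f' s * F s‖ ≤ ∫ s in Ioi k, ‖f' s * F s‖ :=
          norm_integral_le_integral_norm _
      _ ≤ ∫ s in Ioi k, M * ‖f' s‖ := by
          refine integral_mono_of_nonneg (ae_of_all _ fun _ => norm_nonneg _)
            (hf'i.norm.const_mul M).integrableOn (ae_of_all _ fun s => ?_)
          simp only [norm_mul]
          rw [mul_comm]
          gcongr
          exact hFM s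
      _ ≤ ∫ s, M * ‖f' s‖ := setIntegral_le_integral (hf'i.norm.const_mul M)
          (ae_of_all _ fun _ => by positivity)
      _ = _ := integral_const_mul _ _
  · have : Tendsto (f * F) (nhds k) (nhds (f k * F k)) :=
      (hfc.mul hFc).continuousAt
    have hz : f k * F k = 0 := by simp [hF]
    rw [hz] at this
    exact this.mono_left nhdsWithin_le_nhds
  · have := hlim.zero_mul_isBoundedUnder_le (g := F)
      (Filter.isBoundedUnder_of ⟨M, fun s => hFM s⟩)
    exact this

theorem norm_integral_Iio_mul_le {e f f' : ℝ → ℂ} {M : ℝ} (he : Continuous e)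
    (hM : ∀ α β, ‖∫ s in α..β, e s‖ ≤ M) (hen : ∀ s, ‖e s‖ ≤ 1) (hf : ∀ s, HasDerivAt f (f' s) s)
    (hfi : Integrable f) (hf'i : Integrable f') (k : ℝ) :
    ‖∫ s in Iio k, e s * f s‖ ≤ M * ∫ s, ‖f' s‖ := by
  have h := norm_integral_Ioi_mul_le (e := fun s => e (-s)) (f := fun s => f (-s))
    (f' := fun s => -f' (-s)) (M := M) (he.comp continuous_neg)
    (fun α β => by rw [intervalIntegral.integral_comp_neg]; exact hM _ _) (fun s => hen _)
    (fun s => by simpa [Function.comp_def] using (hf (-s)).scomp s (hasDerivAt_neg s)) hfi.comp_neg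
    hf'i.comp_neg.neg (-k)
  rw [integral_comp_neg_Ioi (-k) (fun s => e s * f s), neg_neg] at h
  simp only [norm_neg] at h
  rw [integral_neg_eq_self (fun s => ‖f' s‖)] at h
  rwa [integral_Iic_eq_integral_Iio] at h

/-! ### The phase of the Riemann-Hilbert problem -/

/-- The oscillating factor of the Riemann-Hilbert problem. -/
def osc (t x y k l : ℝ) : ℂ := Complex.exp (I * t * S0 k l (x / t) (y / t))

theorem osc_eq (t x y k l : ℝ) :
    osc t x y k l = Complex.exp (((t * S0 k l (x / t) (y / t) : ℝ) : ℂ) * I) := by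
  unfold osc; congr 1; push_cast; ring

@[simp] theorem norm_osc (t x y k l : ℝ) : ‖osc t x y k l‖ = 1 := by
  rw [osc_eq]; exact Complex.norm_exp_ofReal_mul_I _

theorem continuous_osc (t x y : ℝ) : Continuous fun p : ℝ × ℝ => osc t x y p.1 p.2 := by
  unfold osc S0; fun_prop

/-- The shift by `η/12 = y/(12t)` removes the quadratic term of the cubic `4l³ - ηl² + ξl` and
leaves the linear coefficient `ξ - η²/12 = 12a`. Being a difference of the same function at `l` and
at `k`, the phase factorizes, and the factor in `k` is irrelevant for norms. -/
theorem osc_eq_cub {t : ℝ} (ht : 0 < t) (x y k l : ℝ) :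
    osc t x y k l = starRingEnd ℂ (cub t (aParam t x y) (k - y / (12 * t))) *
      cub t (aParam t x y) (l - y / (12 * t)) := by
  rw [← cub_neg, osc_eq, cub, cub, ← Complex.exp_add, ← add_mul, ← Complex.ofReal_add]
  congr 3
  unfold S0 aParam
  field_simp
  ring

theorem norm_integral_osc_le {t : ℝ} (ht : 0 < t) (x y k : ℝ) {M : ℝ}
    (hM : ∀ α β, ‖∫ s in α..β, cub t (aParam t x y) s‖ ≤ M) (α β : ℝ) :
    ‖∫ l in α..β, osc t x y k l‖ ≤ M := by
  simp_rw [osc_eq_cub ht]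
  rw [intervalIntegral.integral_const_mul, norm_mul, RCLike.norm_conj, norm_cub, one_mul,
    intervalIntegral.integral_comp_sub_right]
  exact hM _ _

/-! ### Integrals from `± l·∞` -/

theorem measurable_intFrom {α : Type*} [MeasurableSpace α] (σ : ℝ) {l y : α → ℝ} {G : α → ℝ → ℂ}
    (hl : Measurable l) (hy : Measurable y) (hG : Measurable (uncurry G)) :
    Measurable fun a => intFrom σ (l a) (y a) (G a) := by
  unfold intFrom
  have h1 : Measurable fun a => ∫ η in Ioi (y a), G a η := by
    simp_rw [← integral_indicator measurableSet_Ioi]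
    refine StronglyMeasurable.measurable ?_
    refine StronglyMeasurable.integral_prod_right (f := fun a η => (Ioi (y a)).indicator (G a) η) ?_
    refine Measurable.stronglyMeasurable ?_
    exact hG.indicator (measurableSet_lt (hy.comp measurable_fst) measurable_snd)
  have h2 : Measurable fun a => ∫ η in Iic (y a), G a η := by
    simp_rw [← integral_indicator measurableSet_Iic]
    refine StronglyMeasurable.measurable ?_
    refine StronglyMeasurable.integral_prod_right (f := fun a η => (Iic (y a)).indicator (G a) η) ?_
    refine Measurable.stronglyMeasurable ?_
    exact hG.indicator (measurableSet_le measurable_snd (hy.comp measurable_fst))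
  refine Measurable.ite (measurableSet_lt measurable_const (by fun_prop)) h1.neg ?_
  exact Measurable.ite (measurableSet_lt (by fun_prop) measurable_const) h2 measurable_const

/-- The range of integration of `intFrom`. -/
def ray (σ l y : ℝ) : Set ℝ := if 0 < σ * l then Ioi y else if σ * l < 0 then Iic y else ∅

/-- The sign of `intFrom`. -/
def raySign (σ l : ℝ) : ℂ := if 0 < σ * l then -1 else 1

theorem measurableSet_ray (σ l y : ℝ) : MeasurableSet (ray σ l y) := by
  unfold ray; split_ifs <;> measurability

theorem enorm_raySign (σ l : ℝ) : ‖raySign σ l‖ₑ = 1 := by unfold raySign; split_ifs <;> simp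

theorem intFrom_eq (σ l y : ℝ) (g : ℝ → ℂ) :
    intFrom σ l y g = raySign σ l * ∫ η in ray σ l y, g η := by
  unfold intFrom ray raySign
  split_ifs <;> simp

theorem enorm_intFrom_le (σ l y : ℝ) (g : ℝ → ℂ) : ‖intFrom σ l y g‖ₑ ≤ ∫⁻ η, ‖g η‖ₑ := by
  rw [intFrom_eq, enorm_mul, enorm_raySign, one_mul]
  exact (enorm_integral_le_lintegral_enorm _).trans (setLIntegral_le_lintegral _ _)

/-- Integrability of `g` is not required, because otherwise the right-hand side is infinite. This
saves proving that the convolution term is integrable before it has been estimated. -/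
theorem enorm_integral_add_le {μ : Measure ℝ} {f g : ℝ → ℂ} (hf : Integrable f μ)
    (hg : AEStronglyMeasurable g μ) :
    ‖∫ η, (f η + g η) ∂μ‖ₑ ≤ ‖∫ η, f η ∂μ‖ₑ + ∫⁻ η, ‖g η‖ₑ ∂μ := by
  by_cases hgi : Integrable g μ
  · rw [integral_add hf hgi]
    exact (enorm_add_le _ _).trans (by gcongr; exact enorm_integral_le_lintegral_enorm _)
  · have : ∫⁻ η, ‖g η‖ₑ ∂μ = ⊤ := by
      by_contra h
      exact hgi ⟨hg, lt_top_iff_ne_top.2 h⟩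
    simp [this]

theorem enorm_intFrom_add_le (σ l y : ℝ) {f g : ℝ → ℂ} (hf : Integrable f) (hg : Measurable g) :
    ‖intFrom σ l y (fun η => f η + g η)‖ₑ ≤ ‖intFrom σ l y f‖ₑ + ∫⁻ η, ‖g η‖ₑ := by
  simp only [intFrom_eq, enorm_mul, enorm_raySign, one_mul]
  refine (enorm_integral_add_le hf.integrableOn hg.aestronglyMeasurable).trans ?_
  gcongr
  exact Measure.restrict_le_self

theorem intFrom_add (σ l y : ℝ) {f g : ℝ → ℂ} (hf : Integrable f) (hg : Integrable g) :
    intFrom σ l y (fun η => f η + g η) = intFrom σ l y f + intFrom σ l y g := by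
  simp only [intFrom_eq]
  rw [integral_add hf.integrableOn hg.integrableOn, mul_add]

theorem intFrom_const_mul (σ l y : ℝ) (c : ℂ) (f : ℝ → ℂ) :
    intFrom σ l y (fun η => c * f η) = c * intFrom σ l y f := by
  simp only [intFrom_eq]
  rw [integral_const_mul]; ring

theorem intFrom_congr_ae (σ l y : ℝ) {f g : ℝ → ℂ} (h : f =ᵐ[volume] g) :
    intFrom σ l y f = intFrom σ l y g := by
  simp only [intFrom_eq]
  rw [integral_congr_ae (ae_restrict_of_ae h)]

/-- The ray of integration does not depend on `k`, so it can be put into `g` as an indicator before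
Plancherel in `k` is applied. -/
theorem l2n_intFrom_ph_le (σ y : ℝ) {l : ℝ} (hl : l ≠ 0) {g : ℝ → ℂ} (hg : Integrable g) :
    l2n volume (fun k : ℝ => ‖intFrom σ l y (fun η => ph k l η * g η)‖ₑ) ≤
      ofReal √(π / |l|) * l2n volume (fun η => ‖g η‖ₑ) := by
  have h := l2n_ph_le hl (hg.indicator (measurableSet_ray σ l y))
  have h1 : ∀ k, ‖intFrom σ l y (fun η => ph k l η * g η)‖ₑ =
      ‖∫ η, ph k l η * (ray σ l y).indicator g η‖ₑ := fun k => by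
    rw [intFrom_eq, enorm_mul, enorm_raySign, one_mul, ← integral_indicator (measurableSet_ray σ l y)]
    simp only [Set.indicator_mul_right]
  simp_rw [h1]
  refine h.trans ?_
  gcongr
  refine l2n_mono fun η => ?_
  by_cases hη : η ∈ ray σ l y <;> simp [hη]

/-! ### Convolution bounds -/

/-- The majorant of `∫ (q * m)(k,l;η) dη`. -/
def majConv (q : ℝ → ℝ → ℂ) (a : ℝ → ℝ → ℝ → ℝ≥0∞) (k l : ℝ) : ℝ≥0∞ :=
  ∫⁻ η : ℝ, ∫⁻ l' : ℝ, ‖q (l - l') η‖ₑ * a k l' η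

theorem measurable_majConv {q : ℝ → ℝ → ℂ} {a : ℝ → ℝ → ℝ → ℝ≥0∞}
    (hq : Measurable (uncurry q)) (ha : Measurable fun p : ℝ × ℝ × ℝ => a p.1 p.2.1 p.2.2) :
    Measurable fun p : ℝ × ℝ => majConv q a p.1 p.2 := by
  unfold majConv
  refine Measurable.lintegral_prod_right' (f := fun p : (ℝ × ℝ) × ℝ => ∫⁻ l' : ℝ,
    ‖q (p.1.2 - l') p.2‖ₑ * a p.1.1 l' p.2) ?_
  refine Measurable.lintegral_prod_right' (f := fun p : ((ℝ × ℝ) × ℝ) × ℝ =>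
    ‖q (p.1.1.2 - p.2) p.1.2‖ₑ * a p.1.1.1 p.2 p.1.2) ?_
  have h1 : Measurable fun p : ((ℝ × ℝ) × ℝ) × ℝ => q (p.1.1.2 - p.2) p.1.2 :=
    hq.comp (f := fun p : ((ℝ × ℝ) × ℝ) × ℝ => (p.1.1.2 - p.2, p.1.2)) (by fun_prop)
  have h2 : Measurable fun p : ((ℝ × ℝ) × ℝ) × ℝ => a p.1.1.1 p.2 p.1.2 :=
    ha.comp (f := fun p : ((ℝ × ℝ) × ℝ) × ℝ => (p.1.1.1, p.2, p.1.2)) (by fun_prop)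
  exact h1.enorm.mul h2

theorem majConv_eq (q : ℝ → ℝ → ℂ) (a : ℝ → ℝ → ℝ → ℝ≥0∞) (k l : ℝ) :
    majConv q a k l = ∫⁻ η : ℝ, ∫⁻ s : ℝ, ‖q s η‖ₑ * a k (l - s) η := by
  unfold majConv
  refine lintegral_congr fun η => ?_
  rw [← lintegral_sub_left_eq_self (fun s => ‖q s η‖ₑ * a k (l - s) η) l]
  simp

variable {q : ℝ → ℝ → ℂ} {a : ℝ → ℝ → ℝ → ℝ≥0∞} {w : ℝ → ℝ≥0∞}

/-- The `L²(dk dl)` norm with a weight in `l`. -/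
def normX (w : ℝ → ℝ≥0∞) (a : ℝ → ℝ → ℝ → ℝ≥0∞) (y : ℝ) : ℝ≥0∞ :=
  l2n volume fun p : ℝ × ℝ => w p.2 * a p.1 p.2 y

/-- The `L¹(dl; L²(dk))` norm with a weight in `l`. -/
def normZ (w : ℝ → ℝ≥0∞) (a : ℝ → ℝ → ℝ → ℝ≥0∞) (y : ℝ) : ℝ≥0∞ :=
  ∫⁻ l : ℝ, w l * l2n volume fun k : ℝ => a k l y

theorem l2n_comp_sub_right (f : ℝ × ℝ → ℝ≥0∞) (s : ℝ) :
    l2n volume (fun p : ℝ × ℝ => f (p.1, p.2 - s)) = l2n volume f := by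
  have h1 : ∀ p : ℝ × ℝ, f (p.1, p.2 - s) = f (p - ((0 : ℝ), s)) := fun p => by
    congr 1; ext <;> simp
  unfold l2n
  simp_rw [h1]
  rw [lintegral_sub_right_eq_self (fun p : ℝ × ℝ => f p ^ 2)]

/-- Young's inequality `L¹ * L² ⊂ L²` via Minkowski's inequality. Submultiplicativity distributes
the weight over the two factors `s` and `l - s`, and translation in `l` preserves the norm. -/
theorem l2n_majConv_le (hq : Measurable (uncurry q))
    (ha : Measurable fun p : ℝ × ℝ × ℝ => a p.1 p.2.1 p.2.2) (hw : Measurable w)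
    (hsub : ∀ l s, w l ≤ w s * w (l - s)) :
    l2n volume (fun p : ℝ × ℝ => w p.2 * majConv q a p.1 p.2) ≤
      ∫⁻ η : ℝ, (∫⁻ s : ℝ, w s * ‖q s η‖ₑ) * normX w a η := by
  have hqm : ∀ η, Measurable fun s => q s η := fun η => hq.of_uncurry_right
  have hm : Measurable fun p : (ℝ × ℝ) × ℝ × ℝ =>
      w p.2.2 * ‖q p.2.2 p.2.1‖ₑ * (w (p.1.2 - p.2.2) * a p.1.1 (p.1.2 - p.2.2) p.2.1) := by
    have h1 : Measurable fun p : (ℝ × ℝ) × ℝ × ℝ => q p.2.2 p.2.1 :=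
      hq.comp (f := fun p : (ℝ × ℝ) × ℝ × ℝ => (p.2.2, p.2.1)) (by fun_prop)
    have h2 : Measurable fun p : (ℝ × ℝ) × ℝ × ℝ => a p.1.1 (p.1.2 - p.2.2) p.2.1 :=
      ha.comp (f := fun p : (ℝ × ℝ) × ℝ × ℝ => (p.1.1, p.1.2 - p.2.2, p.2.1)) (by fun_prop)
    exact ((hw.comp (by fun_prop)).mul h1.enorm).mul ((hw.comp (by fun_prop)).mul h2)
  calc l2n volume (fun p : ℝ × ℝ => w p.2 * majConv q a p.1 p.2)
      ≤ l2n volume (fun p : ℝ × ℝ => ∫⁻ η : ℝ, ∫⁻ s : ℝ,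
          w s * ‖q s η‖ₑ * (w (p.2 - s) * a p.1 (p.2 - s) η)) := by
        refine l2n_mono fun p => ?_
        rw [majConv_eq]
        refine (lintegral_const_mul_le _ _).trans (lintegral_mono fun η => ?_)
        refine (lintegral_const_mul_le _ _).trans (lintegral_mono fun s => ?_)
        calc w p.2 * (‖q s η‖ₑ * a p.1 (p.2 - s) η)
            ≤ (w s * w (p.2 - s)) * (‖q s η‖ₑ * a p.1 (p.2 - s) η) := by gcongr; exact hsub _ _
          _ = _ := by ring
    _ ≤ ∫⁻ η : ℝ, l2n volume (fun p : ℝ × ℝ => ∫⁻ s : ℝ,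
          w s * ‖q s η‖ₑ * (w (p.2 - s) * a p.1 (p.2 - s) η)) := by
        refine l2n_lintegral_le ?_
        refine Measurable.lintegral_prod_right' (f := fun p : ((ℝ × ℝ) × ℝ) × ℝ =>
          w p.2 * ‖q p.2 p.1.2‖ₑ * (w (p.1.1.2 - p.2) * a p.1.1.1 (p.1.1.2 - p.2) p.1.2)) ?_
        exact hm.comp (g := fun p : (ℝ × ℝ) × ℝ × ℝ =>
          w p.2.2 * ‖q p.2.2 p.2.1‖ₑ * (w (p.1.2 - p.2.2) * a p.1.1 (p.1.2 - p.2.2) p.2.1))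
          (f := fun p : ((ℝ × ℝ) × ℝ) × ℝ => (p.1.1, p.1.2, p.2)) (by fun_prop)
    _ ≤ ∫⁻ η : ℝ, ∫⁻ s : ℝ, l2n volume (fun p : ℝ × ℝ =>
          w s * ‖q s η‖ₑ * (w (p.2 - s) * a p.1 (p.2 - s) η)) := by
        refine lintegral_mono fun η => l2n_lintegral_le ?_
        exact hm.comp (f := fun p : (ℝ × ℝ) × ℝ => (p.1, η, p.2)) (by fun_prop)
    _ = ∫⁻ η : ℝ, ∫⁻ s : ℝ, w s * ‖q s η‖ₑ * normX w a η := by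
        refine lintegral_congr fun η => lintegral_congr fun s => ?_
        have h3 : Measurable fun p : ℝ × ℝ => w (p.2 - s) * a p.1 (p.2 - s) η := by
          have : Measurable fun p : ℝ × ℝ => a p.1 (p.2 - s) η :=
            ha.comp (f := fun p : ℝ × ℝ => (p.1, p.2 - s, η)) (by fun_prop)
          exact (hw.comp (by fun_prop)).mul this
        rw [l2n_const_mul _ h3.aemeasurable]
        congr 1
        exact l2n_comp_sub_right (fun p : ℝ × ℝ => w p.2 * a p.1 p.2 η) s
    _ = _ := by
        refine lintegral_congr fun η => ?_
        exact lintegral_mul_const _ (hw.mul (hqm η).enorm)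

/-- The companion `L¹ * L¹ ⊂ L¹` in the variable `l`, with values in `L²(dk)`. The mass of the
kernel is the same as in `l2n_majConv_le`, so the same contraction constant serves for the
derivative. -/
theorem lintegral_l2n_majConv_le (hq : Measurable (uncurry q))
    (ha : Measurable fun p : ℝ × ℝ × ℝ => a p.1 p.2.1 p.2.2) (hw : Measurable w)
    (hsub : ∀ l s, w l ≤ w s * w (l - s)) :
    ∫⁻ l, w l * l2n volume (fun k => majConv q a k l) ≤
      ∫⁻ η : ℝ, (∫⁻ s : ℝ, w s * ‖q s η‖ₑ) * normZ w a η := by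
  have hqm : ∀ η, Measurable fun s => q s η := fun η => hq.of_uncurry_right
  have ham : Measurable fun p : ℝ × ℝ => l2n volume (fun k => a k p.1 p.2) :=
    measurable_l2n_left (F := fun k (p : ℝ × ℝ) => a k p.1 p.2) ha
  have hm : Measurable fun p : ℝ × ℝ × ℝ × ℝ =>
      ‖q p.2.2.2 p.2.2.1‖ₑ * a p.1 (p.2.1 - p.2.2.2) p.2.2.1 := by
    have h1 : Measurable fun p : ℝ × ℝ × ℝ × ℝ => q p.2.2.2 p.2.2.1 :=
      hq.comp (f := fun p : ℝ × ℝ × ℝ × ℝ => (p.2.2.2, p.2.2.1)) (by fun_prop)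
    have h2 : Measurable fun p : ℝ × ℝ × ℝ × ℝ => a p.1 (p.2.1 - p.2.2.2) p.2.2.1 :=
      ha.comp (f := fun p : ℝ × ℝ × ℝ × ℝ => (p.1, p.2.1 - p.2.2.2, p.2.2.1)) (by fun_prop)
    exact h1.enorm.mul h2
  have hm2 : Measurable fun p : ℝ × ℝ × ℝ => w p.1 * (‖q p.2.2 p.2.1‖ₑ *
      l2n volume (fun k => a k (p.1 - p.2.2) p.2.1)) := by
    have h1 : Measurable fun p : ℝ × ℝ × ℝ => q p.2.2 p.2.1 :=
      hq.comp (f := fun p : ℝ × ℝ × ℝ => (p.2.2, p.2.1)) (by fun_prop)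
    exact (hw.comp measurable_fst).mul (h1.enorm.mul
      (ham.comp (f := fun p : ℝ × ℝ × ℝ => (p.1 - p.2.2, p.2.1)) (by fun_prop)))
  calc ∫⁻ l, w l * l2n volume (fun k => majConv q a k l)
      ≤ ∫⁻ l, ∫⁻ η, ∫⁻ s, w l * (‖q s η‖ₑ * l2n volume (fun k => a k (l - s) η)) := by
        refine lintegral_mono fun l => ?_
        simp_rw [majConv_eq]
        have e1 : l2n volume (fun k => ∫⁻ η : ℝ, ∫⁻ s : ℝ, ‖q s η‖ₑ * a k (l - s) η) ≤
            ∫⁻ η, ∫⁻ s, ‖q s η‖ₑ * l2n volume (fun k => a k (l - s) η) := by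
          refine (l2n_lintegral_le ?_).trans (lintegral_mono fun η => (l2n_lintegral_le ?_).trans
            (lintegral_mono fun s => (l2n_const_mul _ ?_).le))
          · refine Measurable.lintegral_prod_right' (f := fun p : (ℝ × ℝ) × ℝ =>
              ‖q p.2 p.1.2‖ₑ * a p.1.1 (l - p.2) p.1.2) ?_
            exact hm.comp (g := fun p : ℝ × ℝ × ℝ × ℝ =>
              ‖q p.2.2.2 p.2.2.1‖ₑ * a p.1 (p.2.1 - p.2.2.2) p.2.2.1)
              (f := fun p : (ℝ × ℝ) × ℝ => (p.1.1, l, p.1.2, p.2)) (by fun_prop)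
          · exact hm.comp (f := fun p : ℝ × ℝ => (p.1, l, η, p.2)) (by fun_prop)
          · exact (ha.comp (f := fun k : ℝ => (k, l - s, η)) (by fun_prop)).aemeasurable
        refine (mul_le_mul_right e1 _).trans ?_
        refine (lintegral_const_mul_le _ _).trans (lintegral_mono fun η => ?_)
        exact lintegral_const_mul_le _ _
    _ = ∫⁻ η, ∫⁻ s, ∫⁻ l, w l * (‖q s η‖ₑ * l2n volume (fun k => a k (l - s) η)) := by
        rw [lintegral_lintegral_swap]
        · refine lintegral_congr fun η => ?_
          rw [lintegral_lintegral_swap]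
          exact (hm2.comp (f := fun p : ℝ × ℝ => (p.1, η, p.2)) (by fun_prop)).aemeasurable
        · refine Measurable.aemeasurable ?_
          refine Measurable.lintegral_prod_right' (f := fun p : (ℝ × ℝ) × ℝ =>
            w p.1.1 * (‖q p.2 p.1.2‖ₑ * l2n volume (fun k => a k (p.1.1 - p.2) p.1.2))) ?_
          exact hm2.comp (f := fun p : (ℝ × ℝ) × ℝ => (p.1.1, p.1.2, p.2)) (by fun_prop)
    _ ≤ ∫⁻ η, ∫⁻ s, w s * ‖q s η‖ₑ * normZ w a η := by
        refine lintegral_mono fun η => lintegral_mono fun s => ?_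
        calc ∫⁻ l, w l * (‖q s η‖ₑ * l2n volume (fun k => a k (l - s) η))
            ≤ ∫⁻ l, w s * ‖q s η‖ₑ * (w (l - s) * l2n volume (fun k => a k (l - s) η)) := by
              refine lintegral_mono fun l => ?_
              refine (mul_le_mul_left (hsub l s) _).trans (le_of_eq ?_)
              ring
          _ = w s * ‖q s η‖ₑ * ∫⁻ l, (w (l - s) * l2n volume (fun k => a k (l - s) η)) := by
              refine lintegral_const_mul _ ?_
              exact (hw.comp (by fun_prop)).mul
                (ham.comp (f := fun l : ℝ => (l - s, η)) (by fun_prop))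
          _ = _ := by
              congr 1
              exact lintegral_sub_right_eq_self (fun l => w l * l2n volume (fun k => a k l η)) s
    _ = _ := by
        refine lintegral_congr fun η => ?_
        exact lintegral_mul_const _ (hw.mul (hqm η).enorm)

/-! ### Solutions of the integral equation in the interaction picture -/

/-- Joint measurability of a function of three variables. -/
abbrev Measurable₃ (f : ℝ → ℝ → ℝ → ℂ) : Prop := Measurable fun p : ℝ × ℝ × ℝ => f p.1 p.2.1 p.2.2

/-- The constant `(2π)^{-1/2}`. -/
def i2π : ℝ≥0∞ := ofReal (√(2 * π))⁻¹

theorem sqrt_two_pi_pos : 0 < √(2 * π) := Real.sqrt_pos.2 (by positivity)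

theorem i2π_ne_zero : i2π ≠ 0 := by rw [i2π]; simpa using sqrt_two_pi_pos

theorem i2π_mul_enorm_sqrt : i2π * ‖((√(2 * π) : ℝ) : ℂ)‖ₑ = 1 := by
  rw [enorm_real, enorm_of_nonneg (sqrt_nonneg _), i2π, ← ofReal_mul (by positivity),
    inv_mul_cancel₀ sqrt_two_pi_pos.ne', ofReal_one]

theorem i2π_ne_top : i2π ≠ ⊤ := ENNReal.ofReal_ne_top

theorem i2π_lt_top : i2π < ⊤ := ofReal_lt_top

theorem enorm_I_div : ‖(I / (√(2 * π) : ℂ))‖ₑ = i2π := by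
  rw [← ofReal_norm, i2π]
  congr 1
  rw [norm_div, Complex.norm_I, Complex.norm_real, norm_eq_abs, abs_of_pos sqrt_two_pi_pos,
    one_div]

theorem sqrt_two_pi_ne_zero : (√(2 * π) : ℂ) ≠ 0 := by
  exact_mod_cast sqrt_two_pi_pos.ne'

theorem ph_mul_ph_neg (k l y : ℝ) : ph k l y * ph k l (-y) = 1 := by
  unfold ph
  rw [← Complex.exp_add, ← add_mul, ← Complex.ofReal_add]
  simp

/-- The nonlinear part of the integrand of the integral equation. -/
def nonlin (q : ℝ → ℝ → ℂ) (n : ℝ → ℝ → ℝ → ℂ) (k l η : ℝ) : ℂ :=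
  ∫ l' : ℝ, q (l - l') η * (ph k l' (-η) * n k l' η)

/-- The integrand of the integral equation, with the phase of the interaction picture. -/
def integrand (q : ℝ → ℝ → ℂ) (n : ℝ → ℝ → ℝ → ℂ) (k l η : ℝ) : ℂ :=
  (√(2 * π) : ℂ) * (ph k l η * q l η) + ph k l η * nonlin q n k l η

/-- Solutions of the integral equation in the interaction picture `n = e^{i l (l + 2k) y} μ̃_♯`. -/
structure InteractionSol (σ : ℝ) (q : ℝ → ℝ → ℂ) (n : ℝ → ℝ → ℝ → ℂ) : Prop where
  meas : Measurable fun p : ℝ × ℝ × ℝ => n p.1 p.2.1 p.2.2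
  bdd : ∃ C : ℝ≥0, ∀ᵐ y : ℝ, l2n volume (fun p : ℝ × ℝ => ‖n p.1 p.2 y‖ₑ) ≤ C
  eqn : ∀ᵐ k : ℝ, ∀ l y : ℝ,
    n k l y = I / (√(2 * π) : ℂ) * intFrom σ l y (integrand q n k l)

/-- The weight `1 + |l|`. -/
def wt (l : ℝ) : ℝ≥0∞ := ofReal (1 + |l|)

@[fun_prop] theorem measurable_wt : Measurable wt := by unfold wt; fun_prop

theorem wt_lt_top (l : ℝ) : wt l < ⊤ := ofReal_lt_top

theorem one_le_wt (l : ℝ) : 1 ≤ wt l := by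
  rw [wt, ENNReal.one_le_ofReal]; linarith [abs_nonneg l]

/-- The source term of the equation for the derivative of the scattering solution. -/
def src (q q' r : ℝ → ℝ → ℂ) (l η : ℝ) : ℂ :=
  I * l * η * q l η + q' l η - (q l η + η * r l η) / l

/-- The product of the potential with the boundary term of the derivative. -/
def srcB (q : ℝ → ℝ → ℂ) (l η : ℝ) : ℂ := ∫ l' : ℝ, q (l - l') η * (I * (η / l') * q l' η)

/-- The properties of the partial Fourier transform `q` of the potential which are used in the
analysis of the scattering problem; `q'` and `r` are its partial derivatives. -/
structure KPot (q q' r : ℝ → ℝ → ℂ) (U : ℝ → ℝ) : Prop where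
  mq : Measurable (uncurry q)
  mq' : Measurable (uncurry q')
  mr : Measurable (uncurry r)
  mU : Measurable U
  hd : ∀ y l, HasDerivAt (fun l => q l y) (q' l y) l
  bq : ∀ l y, ‖q l y‖ ≤ U y
  bq' : ∀ l y, ‖q' l y‖ ≤ U y
  iU : Integrable fun y => (1 + |y|) * U y
  q0 : ∀ y, q 0 y = 0
  w3 : ∫⁻ y, ∫⁻ l, wt l ^ 3 * (wt y * ‖q l y‖ₑ) < ⊤
  w1' : ∫⁻ y, ∫⁻ l, wt l * ‖q' l y‖ₑ < ⊤
  x3 : l2n volume (fun l => wt l ^ 3 * (ofReal √(π / |l|) *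
    l2n volume fun y => ‖q l y‖ₑ)) < ⊤
  bfin : ∀ᵐ y : ℝ, ∫⁻ l, wt l * (‖y / l‖ₑ * ‖q l y‖ₑ) < ⊤
  kb : ∫⁻ y : ℝ, (∫⁻ l, wt l * ‖q l y‖ₑ) * ∫⁻ l, wt l * (‖y / l‖ₑ * ‖q l y‖ₑ) < ⊤
  yderiv : ∀ᵐ l : ℝ, ∃ f : ℝ → ℂ, (∀ y, HasDerivAt f (r l y) y) ∧ f =ᵐ[volume] q l
  yint : ∀ᵐ l : ℝ, Integrable fun y => ((1 + |y| : ℝ) : ℂ) * r l y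
  gint : ∀ᵐ l : ℝ, Integrable (srcB q l)
  g1 : ∫⁻ l, wt l * (ofReal √(π / |l|) * l2n volume fun y => ‖src q q' r l y‖ₑ) < ⊤
  gB : ∫⁻ l, wt l * (ofReal √(π / |l|) * l2n volume fun y => ‖srcB q l y‖ₑ) < ⊤

section Measurability

variable {q : ℝ → ℝ → ℂ} {n : ℝ → ℝ → ℝ → ℂ}

theorem measurable_nonlin (hq : Measurable (uncurry q))
    (hn : Measurable₃ n) :
    Measurable fun p : ℝ × ℝ × ℝ => nonlin q n p.1 p.2.1 p.2.2 := by
  unfold nonlin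
  refine StronglyMeasurable.measurable ?_
  refine StronglyMeasurable.integral_prod_right (f := fun (p : ℝ × ℝ × ℝ) l' =>
    q (p.2.1 - l') p.2.2 * (ph p.1 l' (-p.2.2) * n p.1 l' p.2.2)) ?_
  refine Measurable.stronglyMeasurable ?_
  have h1 : Measurable fun p : (ℝ × ℝ × ℝ) × ℝ => q (p.1.2.1 - p.2) p.1.2.2 :=
    hq.comp (f := fun p : (ℝ × ℝ × ℝ) × ℝ => (p.1.2.1 - p.2, p.1.2.2)) (by fun_prop)
  have h2 : Measurable fun p : (ℝ × ℝ × ℝ) × ℝ => n p.1.1 p.2 p.1.2.2 :=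
    hn.comp (f := fun p : (ℝ × ℝ × ℝ) × ℝ => (p.1.1, p.2, p.1.2.2)) (by fun_prop)
  exact h1.mul ((measurable_ph_comp (by fun_prop) (by fun_prop) (by fun_prop)).mul h2)

theorem measurable_integrand (hq : Measurable (uncurry q))
    (hn : Measurable₃ n) :
    Measurable fun p : ℝ × ℝ × ℝ => integrand q n p.1 p.2.1 p.2.2 := by
  have h1 : Measurable fun p : ℝ × ℝ × ℝ => q p.2.1 p.2.2 := hq.comp measurable_snd
  have h2 : Measurable fun p : ℝ × ℝ × ℝ => ph p.1 p.2.1 p.2.2 := by fun_prop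
  exact ((h2.mul h1).const_mul _).add (h2.mul (measurable_nonlin hq hn))

theorem enorm_nonlin_le (q : ℝ → ℝ → ℂ) (n : ℝ → ℝ → ℝ → ℂ) (k l η : ℝ) :
    ‖nonlin q n k l η‖ₑ ≤ ∫⁻ l', ‖q (l - l') η‖ₑ * ‖n k l' η‖ₑ := by
  refine (enorm_integral_le_lintegral_enorm _).trans (le_of_eq ?_)
  simp [enorm_mul]

end Measurability

theorem KPot.integrable_q {q q' r : ℝ → ℝ → ℂ} {U : ℝ → ℝ} (h : KPot q q' r U) (l : ℝ) :
    Integrable (q l) := by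
  refine h.iU.mono' h.mq.of_uncurry_left.aestronglyMeasurable (ae_of_all _ fun y => ?_)
  have h1 := h.bq l y
  have h2 : 0 ≤ U y := (norm_nonneg _).trans h1
  nlinarith [abs_nonneg y]

theorem integrable_ph_mul (k l : ℝ) {g : ℝ → ℂ} (hg : Integrable g) :
    Integrable fun η => ph k l η * g η := by
  refine hg.bdd_mul (c := 1) (Measurable.aestronglyMeasurable (by fun_prop)) ?_
  exact ae_of_all _ fun η => by simp

/-! ### Bounds in `L²(dk dl)` -/

section BoundX

variable {σ : ℝ} {q : ℝ → ℝ → ℂ} {n : ℝ → ℝ → ℝ → ℂ} {w : ℝ → ℝ≥0∞}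

theorem enorm_intFrom_integrand_le (hq : Measurable (uncurry q))
    (hqi : ∀ l, Integrable (q l)) (hn : Measurable₃ n)
    (k l y : ℝ) :
    i2π * ‖intFrom σ l y (integrand q n k l)‖ₑ ≤ ‖intFrom σ l y (fun η => ph k l η * q l η)‖ₑ +
      i2π * majConv q (fun k l y => ‖n k l y‖ₑ) k l := by
  have h2 : Measurable fun η => ph k l η * nonlin q n k l η :=
    (measurable_ph_comp (by fun_prop) (by fun_prop) (by fun_prop)).mul
      ((measurable_nonlin hq hn).comp (f := fun η : ℝ => (k, l, η)) (by fun_prop))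
  have h1 := enorm_intFrom_add_le σ l y (f := fun η => (√(2 * π) : ℂ) * (ph k l η * q l η))
    ((integrable_ph_mul k l (hqi l)).const_mul _) h2
  rw [intFrom_const_mul, enorm_mul] at h1
  have h3 := i2π_mul_enorm_sqrt
  calc i2π * ‖intFrom σ l y (integrand q n k l)‖ₑ
      ≤ i2π * (‖((√(2 * π) : ℝ) : ℂ)‖ₑ * ‖intFrom σ l y (fun η => ph k l η * q l η)‖ₑ +
        ∫⁻ η, ‖ph k l η * nonlin q n k l η‖ₑ) := by gcongr; exact h1
    _ = ‖intFrom σ l y (fun η => ph k l η * q l η)‖ₑ +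
        i2π * ∫⁻ η, ‖ph k l η * nonlin q n k l η‖ₑ := by rw [mul_add, ← mul_assoc, h3, one_mul]
    _ ≤ _ := by
        unfold majConv
        gcongr with η
        rw [enorm_mul, enorm_ph, one_mul]
        exact enorm_nonlin_le _ _ _ _ _

theorem InteractionSol.enorm_le (h : InteractionSol σ q n) (hq : Measurable (uncurry q))
    (hqi : ∀ l, Integrable (q l)) :
    ∀ᵐ k : ℝ, ∀ l y, ‖n k l y‖ₑ ≤ ‖intFrom σ l y (fun η => ph k l η * q l η)‖ₑ +
      i2π * majConv q (fun k l y => ‖n k l y‖ₑ) k l := by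
  filter_upwards [h.eqn] with k hk l y
  conv_lhs => rw [hk l y, enorm_mul, enorm_I_div]
  exact enorm_intFrom_integrand_le hq hqi h.meas k l y

theorem measurable_intFrom_ph (σ y : ℝ) (hq : Measurable (uncurry q)) :
    Measurable fun p : ℝ × ℝ => intFrom σ p.2 y (fun η => ph p.1 p.2 η * q p.2 η) := by
  refine measurable_intFrom (G := fun (p : ℝ × ℝ) η => ph p.1 p.2 η * q p.2 η) σ (by fun_prop)
    (by fun_prop) ?_
  have h1 : Measurable fun p : (ℝ × ℝ) × ℝ => q p.1.2 p.2 :=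
    hq.comp (f := fun p : (ℝ × ℝ) × ℝ => (p.1.2, p.2)) (by fun_prop)
  exact Measurable.mul (f := fun p : (ℝ × ℝ) × ℝ => ph p.1.1 p.1.2 p.2) (by fun_prop) h1

/-- The size in `L²(dk dl)` of the inhomogeneous term of the integral equation. -/
def srcX (w : ℝ → ℝ≥0∞) (q : ℝ → ℝ → ℂ) : ℝ≥0∞ :=
  l2n volume (fun l => w l * (ofReal √(π / |l|) * l2n volume fun y => ‖q l y‖ₑ))

/-- For each `l` the norm in `k` is evaluated first, where Plancherel yields the factor `√(π/|l|)`;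
the exceptional value `l = 0` is a null set. -/
theorem l2n_lin_le (hq : Measurable (uncurry q)) (hqi : ∀ l, Integrable (q l))
    (hw : Measurable w) (σ y : ℝ) :
    l2n volume (fun p : ℝ × ℝ => w p.2 * ‖intFrom σ p.2 y (fun η => ph p.1 p.2 η * q p.2 η)‖ₑ) ≤
      srcX w q := by
  have hm : Measurable (uncurry fun k l : ℝ =>
      w l * ‖intFrom σ l y (fun η => ph k l η * q l η)‖ₑ) :=
    (hw.comp measurable_snd).mul (measurable_intFrom_ph σ y hq).enorm
  rw [Measure.volume_eq_prod]
  refine (l2n_prod hm).trans_le ?_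
  rw [l2n_swap hm]
  refine l2n_mono_ae ?_
  have h0 := Measure.ae_ne volume (0 : ℝ)
  filter_upwards [h0] with l hl
  rw [l2n_const_mul]
  · gcongr
    exact l2n_intFrom_ph_le σ y hl (hqi l)
  · exact ((measurable_intFrom_ph σ y hq).enorm.comp
      (f := fun k : ℝ => (k, l)) (by fun_prop)).aemeasurable

/-- The linear term is bounded by Plancherel, the convolution by absolute values over the whole
line. The right-hand side no longer depends on `y`, which is what `contraction_bound` needs. -/
theorem normX_le (h : InteractionSol σ q n) (hq : Measurable (uncurry q))
    (hqi : ∀ l, Integrable (q l)) (hw : Measurable w) (hsub : ∀ l s, w l ≤ w s * w (l - s)) (y : ℝ) :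
    normX w (fun k l y => ‖n k l y‖ₑ) y ≤ srcX w q + ∫⁻ η : ℝ, (i2π * ∫⁻ s, w s * ‖q s η‖ₑ) *
      normX w (fun k l y => ‖n k l y‖ₑ) η := by
  have hae : ∀ᵐ p : ℝ × ℝ, w p.2 * ‖n p.1 p.2 y‖ₑ ≤
      w p.2 * ‖intFrom σ p.2 y (fun η => ph p.1 p.2 η * q p.2 η)‖ₑ +
      i2π * (w p.2 * majConv q (fun k l y => ‖n k l y‖ₑ) p.1 p.2) := by
    have h1 : ∀ᵐ p : ℝ × ℝ, _ := Measure.quasiMeasurePreserving_fst.ae (h.enorm_le hq hqi)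
    filter_upwards [h1] with p hp
    calc _ ≤ w p.2 * (‖intFrom σ p.2 y (fun η => ph p.1 p.2 η * q p.2 η)‖ₑ +
      i2π * majConv q (fun k l y => ‖n k l y‖ₑ) p.1 p.2) := by gcongr; exact hp _ _
      _ = _ := by ring
  have hm1 := (hw.comp measurable_snd).mul (measurable_intFrom_ph σ y hq).enorm
  have hm2 := (hw.comp measurable_snd).mul
    (measurable_majConv (a := fun k l y => ‖n k l y‖ₑ) hq h.meas.enorm)
  refine (l2n_mono_ae hae).trans ?_
  refine (l2n_add_le hm1.aemeasurable (hm2.const_mul _).aemeasurable).trans ?_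
  gcongr ?_ + ?_
  · exact l2n_lin_le hq hqi hw σ y
  · refine (l2n_const_mul _ hm2.aemeasurable).trans_le ?_
    simp_rw [mul_assoc]
    rw [lintegral_const_mul']
    · gcongr
      exact l2n_majConv_le hq h.meas.enorm hw hsub
    · exact i2π_ne_top

theorem measurable_mass (hq : Measurable (uncurry q)) (hw : Measurable w) :
    Measurable fun η : ℝ => ∫⁻ s, w s * ‖q s η‖ₑ := by
  refine Measurable.lintegral_prod_right' (f := fun p : ℝ × ℝ => w p.2 * ‖q p.2 p.1‖ₑ) ?_
  exact (hw.comp measurable_snd).mul (hq.comp measurable_swap).enorm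

/-- Boundedness of the weight makes the weighted norm of `n` finite a priori, so that the
contraction may be absorbed. The bound obtained does not involve `R`. -/
theorem srcX_add_le (h : InteractionSol σ q n) (hq : Measurable (uncurry q))
    (hqi : ∀ l, Integrable (q l)) (hw : Measurable w) (hsub : ∀ l s, w l ≤ w s * w (l - s))
    {R : ℝ≥0} (hR : ∀ l, w l ≤ R) {c : ℝ≥0∞} (hc : c < 1)
    (hwc : i2π * ∫⁻ η, ∫⁻ s, w s * ‖q s η‖ₑ ≤ c) :
    srcX w q + ∫⁻ η : ℝ, (i2π * ∫⁻ s, w s * ‖q s η‖ₑ) *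
      normX w (fun k l y => ‖n k l y‖ₑ) η ≤ srcX w q / (1 - c) := by
  have hκ := measurable_mass hq hw
  have hκc : ∫⁻ η, i2π * ∫⁻ s, w s * ‖q s η‖ₑ ≤ c := by rwa [lintegral_const_mul _ hκ]
  refine contraction_bound (hκ.const_mul _).aemeasurable hc hκc ?_
    (ae_of_all _ fun y => normX_le h hq hqi hw hsub y)
  obtain ⟨C, hC⟩ := h.bdd
  have h1 : ∀ᵐ η : ℝ, normX w (fun k l y => ‖n k l y‖ₑ) η ≤ R * C := by
    filter_upwards [hC] with η hη
    calc normX w (fun k l y => ‖n k l y‖ₑ) η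
        ≤ l2n volume (fun p : ℝ × ℝ => R * ‖n p.1 p.2 η‖ₑ) :=
          l2n_mono fun p => by gcongr; exact hR _
      _ = R * l2n volume (fun p : ℝ × ℝ => ‖n p.1 p.2 η‖ₑ) :=
          l2n_const_mul _ (h.meas.enorm.comp (f := fun p : ℝ × ℝ => (p.1, p.2, η))
            (by fun_prop)).aemeasurable
      _ ≤ R * C := by gcongr
  calc _ ≤ ∫⁻ η, (i2π * ∫⁻ s, w s * ‖q s η‖ₑ) * (R * C) :=
        lintegral_mono_ae (h1.mono fun η hη => by gcongr)
    _ = (∫⁻ η, i2π * ∫⁻ s, w s * ‖q s η‖ₑ) * (R * C) :=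
        lintegral_mul_const _ (hκ.const_mul _)
    _ < ⊤ := mul_lt_top (hκc.trans_lt (hc.trans ENNReal.one_lt_top))
        (mul_lt_top (by simp) (by simp))

/-- The analogue of the scattering data before restriction to a half-plane. -/
def tau (q : ℝ → ℝ → ℂ) (n : ℝ → ℝ → ℝ → ℂ) (k l : ℝ) : ℂ := ∫ η, integrand q n k l η

theorem measurable_tau (hq : Measurable (uncurry q))
    (hn : Measurable₃ n) :
    Measurable fun p : ℝ × ℝ => tau q n p.1 p.2 := by
  refine StronglyMeasurable.measurable ?_
  refine StronglyMeasurable.integral_prod_right (f := fun (p : ℝ × ℝ) η => integrand q n p.1 p.2 η) ?_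
  exact ((measurable_integrand hq hn).comp (f := fun p : (ℝ × ℝ) × ℝ => (p.1.1, p.1.2, p.2))
    (by fun_prop)).stronglyMeasurable

/-- The function `tau` is the same integral as in the equation for `n`, over the whole line instead
of a ray, so it obeys the same bound as `n` at any `y`. -/
theorem l2n_tau_le (h : InteractionSol σ q n) (hq : Measurable (uncurry q))
    (hqi : ∀ l, Integrable (q l)) (hw : Measurable w) (hsub : ∀ l s, w l ≤ w s * w (l - s)) :
    i2π * l2n volume (fun p : ℝ × ℝ => w p.2 * ‖tau q n p.1 p.2‖ₑ) ≤ srcX w q +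
      ∫⁻ η : ℝ, (i2π * ∫⁻ s, w s * ‖q s η‖ₑ) * normX w (fun k l y => ‖n k l y‖ₑ) η := by
  have hph : Measurable fun p : ℝ × ℝ => ∫ η, ph p.1 p.2 η * q p.2 η := by
    refine StronglyMeasurable.measurable ?_
    refine StronglyMeasurable.integral_prod_right (f := fun (p : ℝ × ℝ) η => ph p.1 p.2 η * q p.2 η) ?_
    refine Measurable.stronglyMeasurable ?_
    have h1 : Measurable fun p : (ℝ × ℝ) × ℝ => q p.1.2 p.2 :=
      hq.comp (f := fun p : (ℝ × ℝ) × ℝ => (p.1.2, p.2)) (by fun_prop)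
    exact Measurable.mul (f := fun p : (ℝ × ℝ) × ℝ => ph p.1.1 p.1.2 p.2) (by fun_prop) h1
  have hpt : ∀ k l, i2π * ‖tau q n k l‖ₑ ≤ ‖∫ η, ph k l η * q l η‖ₑ +
      i2π * majConv q (fun k l y => ‖n k l y‖ₑ) k l := by
    intro k l
    have h2 : Measurable fun η => ph k l η * nonlin q n k l η :=
      (measurable_ph_comp (by fun_prop) (by fun_prop) (by fun_prop)).mul
        ((measurable_nonlin hq h.meas).comp (f := fun η : ℝ => (k, l, η)) (by fun_prop))
    have h1 := enorm_integral_add_le (f := fun η => (√(2 * π) : ℂ) * (ph k l η * q l η))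
      ((integrable_ph_mul k l (hqi l)).const_mul _) h2.aestronglyMeasurable (μ := volume)
    rw [integral_const_mul, enorm_mul] at h1
    have h3 := i2π_mul_enorm_sqrt
    calc i2π * ‖tau q n k l‖ₑ
        ≤ i2π * (‖((√(2 * π) : ℝ) : ℂ)‖ₑ * ‖∫ η, ph k l η * q l η‖ₑ +
          ∫⁻ η, ‖ph k l η * nonlin q n k l η‖ₑ) := by gcongr; exact h1
      _ = ‖∫ η, ph k l η * q l η‖ₑ +
          i2π * ∫⁻ η, ‖ph k l η * nonlin q n k l η‖ₑ := by rw [mul_add, ← mul_assoc, h3, one_mul]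
      _ ≤ _ := by
          unfold majConv
          gcongr with η
          rw [enorm_mul, enorm_ph, one_mul]
          exact enorm_nonlin_le _ _ _ _ _
  have hm0 := (hw.comp measurable_snd).mul (measurable_tau hq h.meas).enorm
  have hm1 := (hw.comp measurable_snd).mul hph.enorm
  have hm2 := (hw.comp measurable_snd).mul
    (measurable_majConv (a := fun k l y => ‖n k l y‖ₑ) hq h.meas.enorm)
  refine (l2n_const_mul _ hm0.aemeasurable).symm.trans_le ?_
  have hpt' : ∀ p : ℝ × ℝ, i2π * (w p.2 * ‖tau q n p.1 p.2‖ₑ) ≤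
      w p.2 * ‖∫ η, ph p.1 p.2 η * q p.2 η‖ₑ +
      i2π * (w p.2 * majConv q (fun k l y => ‖n k l y‖ₑ) p.1 p.2) := fun p => by
    calc _ = w p.2 * (i2π * ‖tau q n p.1 p.2‖ₑ) := by ring
      _ ≤ w p.2 * (‖∫ η, ph p.1 p.2 η * q p.2 η‖ₑ +
        i2π * majConv q (fun k l y => ‖n k l y‖ₑ) p.1 p.2) := by gcongr; exact hpt _ _
      _ = _ := by ring
  refine (l2n_mono hpt').trans ?_
  refine (l2n_add_le hm1.aemeasurable (hm2.const_mul _).aemeasurable).trans ?_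
  gcongr ?_ + ?_
  · have hm : Measurable (uncurry fun k l : ℝ =>
        w l * ‖∫ η, ph k l η * q l η‖ₑ) := hm1
    rw [Measure.volume_eq_prod]
    refine (l2n_prod hm).trans_le ?_
    rw [l2n_swap hm]
    refine l2n_mono_ae ?_
    have h0 := Measure.ae_ne volume (0 : ℝ)
    filter_upwards [h0] with l hl
    rw [l2n_const_mul]
    · gcongr
      exact l2n_ph_le hl (hqi l)
    · exact (hph.enorm.comp (f := fun k : ℝ => (k, l)) (by fun_prop)).aemeasurable
  · refine (l2n_const_mul _ hm2.aemeasurable).trans_le ?_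
    simp_rw [mul_assoc]
    rw [lintegral_const_mul']
    · gcongr
      exact l2n_majConv_le hq h.meas.enorm hw hsub
    · exact i2π_ne_top

/-- Fatou's lemma: since `v` is finite, each truncated weight is eventually equal to it at every
point. -/
theorem l2n_le_of_forall_min {α : Type*} [MeasurableSpace α] {μ : Measure α} {v f : α → ℝ≥0∞}
    (hv : Measurable v) (hf : Measurable f) (hvt : ∀ a, v a < ⊤) {C : ℝ≥0∞}
    (h : ∀ R : ℕ, l2n μ (fun a => min (v a) R * f a) ≤ C) : l2n μ (fun a => v a * f a) ≤ C := by
  rw [l2n_le_iff]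
  have h1 : ∀ a, Filter.liminf (fun R : ℕ => (min (v a) R * f a) ^ 2) atTop =
      (v a * f a) ^ 2 := by
    intro a
    refine Filter.Tendsto.liminf_eq (tendsto_const_nhds.congr' ?_)
    obtain ⟨N, hN⟩ := ENNReal.exists_nat_gt (hvt a).ne
    filter_upwards [Filter.eventually_ge_atTop N] with R hR
    rw [min_eq_left (hN.le.trans (by exact_mod_cast hR))]
  simp_rw [← h1]
  refine (lintegral_liminf_le fun R => ((hv.min measurable_const).mul hf).pow_const 2).trans ?_
  refine Filter.liminf_le_of_le (by isBoundedDefault) fun b hb => ?_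
  obtain ⟨R, hR⟩ := hb.exists
  exact hR.trans (l2n_le_iff.1 (h R))

theorem srcX_mono {w v : ℝ → ℝ≥0∞} (h : ∀ l, w l ≤ v l) (q : ℝ → ℝ → ℂ) : srcX w q ≤ srcX v q :=
  l2n_mono fun l => by gcongr; exact h l

/-- Weighted bounds for the scattering solution and the scattering data. -/
theorem InteractionSol.weighted_bounds (h : InteractionSol σ q n) (hq : Measurable (uncurry q))
    (hqi : ∀ l, Integrable (q l)) (hw : Measurable w) (hsub : ∀ l s, w l ≤ w s * w (l - s))
    (hw1 : ∀ l, 1 ≤ w l) (hwt : ∀ l, w l < ⊤) {c : ℝ≥0∞} (hc : c < 1)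
    (hwc : i2π * ∫⁻ η, ∫⁻ s, w s * ‖q s η‖ₑ ≤ c) :
    (∀ y, normX w (fun k l y => ‖n k l y‖ₑ) y ≤ srcX w q / (1 - c)) ∧
    i2π * l2n volume (fun p : ℝ × ℝ => w p.2 * ‖tau q n p.1 p.2‖ₑ) ≤ srcX w q / (1 - c) := by
  -- Truncation at a level at least `1` keeps a weight `w ≥ 1` submultiplicative: if one factor is
  -- truncated, the product is already at least the level. The shift `R + 1` guarantees this for `R
  -- = 0`.
  set wR : ℕ → ℝ → ℝ≥0∞ := fun R l => min (w l) (R + 1 : ℕ) with hwR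
  have hm : ∀ R, Measurable (wR R) := fun R => hw.min measurable_const
  have hle : ∀ R l, wR R l ≤ w l := fun R l => min_le_left _ _
  have h1 : ∀ R l, 1 ≤ wR R l := fun R l => le_min (hw1 l) (by simp)
  have hsubR : ∀ R l s, wR R l ≤ wR R s * wR R (l - s) := by
    intro R l s
    rcases le_total (w s) ((R + 1 : ℕ) : ℝ≥0∞) with h2 | h2
    · rcases le_total (w (l - s)) ((R + 1 : ℕ) : ℝ≥0∞) with h3 | h3
      · have : wR R s * wR R (l - s) = w s * w (l - s) := by
          simp only [hwR]; rw [min_eq_left h2, min_eq_left h3]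
        rw [this]
        exact (hle R l).trans (hsub l s)
      · have : wR R (l - s) = ((R + 1 : ℕ) : ℝ≥0∞) := min_eq_right h3
        rw [this]
        exact (min_le_right _ _).trans (le_mul_of_one_le_left (zero_le) (h1 R s))
    · have : wR R s = ((R + 1 : ℕ) : ℝ≥0∞) := min_eq_right h2
      rw [this]
      exact (min_le_right _ _).trans (le_mul_of_one_le_right (zero_le) (h1 R _))
  have hcR : ∀ R, i2π * ∫⁻ η, ∫⁻ s, wR R s * ‖q s η‖ₑ ≤ c := fun R => by
    refine le_trans ?_ hwc
    gcongr with η s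
    exact hle R s
  have key : ∀ R, srcX (wR R) q + ∫⁻ η : ℝ, (i2π * ∫⁻ s, wR R s * ‖q s η‖ₑ) *
      normX (wR R) (fun k l y => ‖n k l y‖ₑ) η ≤ srcX w q / (1 - c) := fun R => by
    refine (srcX_add_le h hq hqi (hm R) (hsubR R) (R := (R + 1 : ℕ)) (fun l => ?_) hc (hcR R)).trans ?_
    · exact (min_le_right _ _).trans (by simp)
    · gcongr
      exact srcX_mono (hle R) q
  have hnm : ∀ y, Measurable fun p : ℝ × ℝ => ‖n p.1 p.2 y‖ₑ := fun y =>
    h.meas.enorm.comp (f := fun p : ℝ × ℝ => (p.1, p.2, y)) (by fun_prop)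
  have mono : ∀ (R : ℕ) (f : ℝ × ℝ → ℝ≥0∞), l2n volume (fun p : ℝ × ℝ => min (w p.2) R * f p) ≤
      l2n volume (fun p : ℝ × ℝ => wR R p.2 * f p) := fun R f => l2n_mono fun p => by
    gcongr
    exact min_le_min le_rfl (by simp)
  refine ⟨fun y => ?_, ?_⟩
  · refine l2n_le_of_forall_min (v := fun p : ℝ × ℝ => w p.2) (by fun_prop) (hnm y)
      (fun p => hwt _) fun R => ?_
    exact (mono R _).trans ((normX_le h hq hqi (hm R) (hsubR R) y).trans (key R))
  · rw [mul_comm, ← ENNReal.le_div_iff_mul_le (.inl i2π_ne_zero) (.inl i2π_ne_top)]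
    refine l2n_le_of_forall_min (v := fun p : ℝ × ℝ => w p.2) (by fun_prop)
      (measurable_tau hq h.meas).enorm (fun p => hwt _) fun R => ?_
    rw [ENNReal.le_div_iff_mul_le (.inl i2π_ne_zero) (.inl i2π_ne_top), mul_comm]
    refine le_trans ?_ ((l2n_tau_le h hq hqi (hm R) (hsubR R)).trans (key R))
    gcongr
    exact mono R _

end BoundX

/-! ### Differentiation of the integral equation in `l` -/

/-- The derivative in `l` of `integrand q n k l η`. -/
def dintegrand (q q' : ℝ → ℝ → ℂ) (n : ℝ → ℝ → ℝ → ℂ) (k l η : ℝ) : ℂ :=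
  (√(2 * π) : ℂ) * (ph k l η * (2 * I * (l + k) * η * q l η + q' l η)) +
    ph k l η * (2 * I * (l + k) * η * nonlin q n k l η + nonlin q' n k l η)

/-- The derivative in `l ≠ 0` of the scattering solution `n`. -/
def dsol (σ : ℝ) (q q' : ℝ → ℝ → ℂ) (n : ℝ → ℝ → ℝ → ℂ) (k l y : ℝ) : ℂ :=
  I / (√(2 * π) : ℂ) * intFrom σ l y (dintegrand q q' n k l)

/-- The jump of the scattering solution at `l = 0`. -/
def jump (σ : ℝ) (q : ℝ → ℝ → ℂ) (n : ℝ → ℝ → ℝ → ℂ) (k : ℝ) : ℂ :=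
  -(σ * (I / (√(2 * π) : ℂ) * tau q n k 0))

/-- The parameters `k` for which the equation holds and all integrals converge. -/
structure GoodParam (σ : ℝ) (q q' : ℝ → ℝ → ℂ) (n : ℝ → ℝ → ℝ → ℂ) (U : ℝ → ℝ) (k : ℝ) : Prop where
  eqn : ∀ l y : ℝ, n k l y = I / (√(2 * π) : ℂ) * intFrom σ l y (integrand q n k l)
  nint : ∫⁻ η : ℝ, ofReal ((1 + |η|) * U η) * ∫⁻ l', wt l' * ‖n k l' η‖ₑ < ⊤
  nfin : ∀ᵐ η : ℝ, ∫⁻ l', wt l' * ‖n k l' η‖ₑ < ⊤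
  dfin : ∫⁻ l : ℝ, wt l * ∫⁻ η : ℝ, ‖dintegrand q q' n k l η‖ₑ < ⊤

variable {σ : ℝ} {q q' r : ℝ → ℝ → ℂ} {U : ℝ → ℝ} {n : ℝ → ℝ → ℝ → ℂ}

theorem hasDerivAt_ph (k l η : ℝ) :
    HasDerivAt (fun l => ph k l η) (2 * I * (l + k) * η * ph k l η) l := by
  have h1 : HasDerivAt (fun l : ℝ => l * (l + 2 * k) * η) ((2 * (l + k)) * η) l := by
    have := ((hasDerivAt_id l).mul ((hasDerivAt_id l).add_const (2 * k))).mul_const η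
    convert! this using 1
    simp only [id]; ring
  refine HasDerivAt.congr_deriv (f := fun l => ph k l η) ((h1.ofReal_comp.mul_const I).cexp) ?_
  unfold ph
  push_cast; ring

theorem hasDerivAt_ph_right (k l η : ℝ) :
    HasDerivAt (fun η => ph k l η) (I * l * (l + 2 * k) * ph k l η) η := by
  have h1 : HasDerivAt (fun η : ℝ => l * (l + 2 * k) * η) (l * (l + 2 * k)) η := by
    simpa using (hasDerivAt_id η).const_mul (l * (l + 2 * k))
  refine HasDerivAt.congr_deriv (f := fun η => ph k l η) ((h1.ofReal_comp.mul_const I).cexp) ?_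
  unfold ph
  push_cast; ring

theorem measurable_dintegrand (hq : Measurable (uncurry q))
    (hq' : Measurable (uncurry q'))
    (hn : Measurable₃ n) :
    Measurable fun p : ℝ × ℝ × ℝ => dintegrand q q' n p.1 p.2.1 p.2.2 := by
  have h1 : Measurable fun p : ℝ × ℝ × ℝ => q p.2.1 p.2.2 := hq.comp measurable_snd
  have h1' : Measurable fun p : ℝ × ℝ × ℝ => q' p.2.1 p.2.2 := hq'.comp measurable_snd
  have h2 : Measurable fun p : ℝ × ℝ × ℝ => ph p.1 p.2.1 p.2.2 := by fun_prop
  have h3 : Measurable fun p : ℝ × ℝ × ℝ => (2 * I * (p.2.1 + p.1) * p.2.2 : ℂ) := by fun_prop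
  exact ((h2.mul ((h3.mul h1).add h1')).const_mul _).add
    (h2.mul ((h3.mul (measurable_nonlin hq hn)).add (measurable_nonlin hq' hn)))

theorem measurable_dsol (σ : ℝ) (hq : Measurable (uncurry q))
    (hq' : Measurable (uncurry q'))
    (hn : Measurable₃ n) :
    Measurable fun p : ℝ × ℝ × ℝ => dsol σ q q' n p.1 p.2.1 p.2.2 := by
  refine (measurable_intFrom (G := fun (p : ℝ × ℝ × ℝ) η => dintegrand q q' n p.1 p.2.1 η) σ
    (by fun_prop) (by fun_prop) ?_).const_mul _
  exact (measurable_dintegrand hq hq' hn).comp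
    (f := fun p : (ℝ × ℝ × ℝ) × ℝ => (p.1.1, p.1.2.1, p.2)) (by fun_prop)

/-- The mass `∫ |n(k,l',η)| dl'`. -/
def massN (n : ℝ → ℝ → ℝ → ℂ) (k η : ℝ) : ℝ≥0∞ := ∫⁻ l', wt l' * ‖n k l' η‖ₑ

theorem lintegral_enorm_le_massN (n : ℝ → ℝ → ℝ → ℂ) (k η : ℝ) :
    ∫⁻ l', ‖n k l' η‖ₑ ≤ massN n k η :=
  lintegral_mono fun l' => le_mul_of_one_le_left (zero_le) (one_le_wt l')

theorem measurable_n_apply (hn : Measurable₃ n) (k η : ℝ) :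
    Measurable fun l' => n k l' η := hn.comp (f := fun l' : ℝ => (k, l', η)) (by fun_prop)

theorem integrable_n (hn : Measurable₃ n) {k η : ℝ}
    (h : massN n k η < ⊤) : Integrable fun l' => n k l' η :=
  ⟨(measurable_n_apply hn k η).aestronglyMeasurable, (lintegral_enorm_le_massN n k η).trans_lt h⟩

theorem integrable_mul_n (hn : Measurable₃ n) {k η : ℝ}
    (h : massN n k η < ⊤) : Integrable fun l' : ℝ => (l' : ℂ) * n k l' η := by
  refine ⟨?_, ?_⟩
  · exact ((Complex.measurable_ofReal).mul (measurable_n_apply hn k η)).aestronglyMeasurable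
  · refine lt_of_le_of_lt (lintegral_mono fun l' => ?_) h
    rw [enorm_mul]
    gcongr
    rw [wt, ← ofReal_norm, Complex.norm_real, norm_eq_abs]
    exact ofReal_le_ofReal (by linarith)

theorem integrable_ph_neg_mul (hn : Measurable₃ n) {k η : ℝ}
    (h : massN n k η < ⊤) : Integrable fun l' => ph k l' (-η) * n k l' η := by
  refine (integrable_n hn h).bdd_mul (c := 1) (Measurable.aestronglyMeasurable (by fun_prop)) ?_
  exact ae_of_all _ fun η => by simp

theorem integrable_conv (hn : Measurable₃ n) {k η : ℝ}
    (h : massN n k η < ⊤) (hq : Measurable (uncurry q)) (hb : ∀ l, ‖q l η‖ ≤ U η) (l : ℝ) :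
    Integrable fun l' => q (l - l') η * (ph k l' (-η) * n k l' η) := by
  refine (integrable_ph_neg_mul hn h).bdd_mul (c := U η) ?_ (ae_of_all _ fun l' => hb _)
  exact (hq.comp (f := fun l' => (l - l', η)) (by fun_prop)).aestronglyMeasurable

theorem norm_nonlin_le (hn : Measurable₃ n) {k η : ℝ}
    (h : massN n k η < ⊤) (hb : ∀ l, ‖q l η‖ ≤ U η) (l : ℝ) :
    ‖nonlin q n k l η‖ ≤ U η * (massN n k η).toReal := by
  have hU : 0 ≤ U η := (norm_nonneg _).trans (hb 0)
  have h1 : ∫ l', ‖n k l' η‖ ≤ (massN n k η).toReal := by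
    rw [integral_norm_eq_lintegral_enorm (measurable_n_apply hn k η).aestronglyMeasurable]
    exact ENNReal.toReal_mono h.ne (lintegral_enorm_le_massN n k η)
  calc ‖nonlin q n k l η‖ ≤ ∫ l', U η * ‖n k l' η‖ := by
        refine norm_integral_le_of_norm_le ((integrable_n hn h).norm.const_mul _)
          (ae_of_all _ fun l' => ?_)
        rw [norm_mul, norm_mul, norm_ph, one_mul]
        gcongr
        exact hb _
    _ ≤ _ := by rw [integral_const_mul]; gcongr

theorem KPot.hasDerivAt_nonlin (K : KPot q q' r U)
    (hn : Measurable₃ n) {k η : ℝ}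
    (h : massN n k η < ⊤) (l : ℝ) :
    HasDerivAt (fun l => nonlin q n k l η) (nonlin q' n k l η) l := by
  refine (hasDerivAt_integral_of_dominated_loc_of_deriv_le (μ := volume)
    (F := fun l l' => q (l - l') η * (ph k l' (-η) * n k l' η))
    (F' := fun l l' => q' (l - l') η * (ph k l' (-η) * n k l' η))
    (bound := fun l' => U η * ‖n k l' η‖) (x₀ := l) (s := Set.univ) Filter.univ_mem ?_ ?_ ?_ ?_ ?_ ?_).2
  · exact .of_forall fun l => (integrable_conv hn h K.mq (fun l => K.bq l η) l).1
  · exact integrable_conv hn h K.mq (fun l => K.bq l η) l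
  · exact (integrable_conv hn h K.mq' (fun l => K.bq' l η) l).1
  · refine ae_of_all _ fun l' x _ => ?_
    rw [norm_mul, norm_mul, norm_ph, one_mul]
    gcongr
    exact K.bq' _ _
  · exact (integrable_n hn h).norm.const_mul _
  · refine ae_of_all _ fun l' x _ => ?_
    have := (K.hd η (x - l')).scomp x ((hasDerivAt_id x).sub_const l')
    simpa [Function.comp_def] using this.mul_const (ph k l' (-η) * n k l' η)

theorem KPot.hasDerivAt_integrand (K : KPot q q' r U)
    (hn : Measurable₃ n) {k η : ℝ}
    (h : massN n k η < ⊤) (l : ℝ) :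
    HasDerivAt (fun l => integrand q n k l η) (dintegrand q q' n k l η) l := by
  have h1 := hasDerivAt_ph k l η
  have h2 := (((h1.mul (K.hd η l)).const_mul (√(2 * π) : ℂ))).add
    (h1.mul (K.hasDerivAt_nonlin hn h l))
  refine HasDerivAt.congr_deriv (f := fun l => integrand q n k l η) h2 ?_
  unfold dintegrand
  ring

/-- The majorant used for differentiation under the integral sign. -/
def domin (U : ℝ → ℝ) (n : ℝ → ℝ → ℝ → ℂ) (k η : ℝ) : ℝ :=
  ((1 + |η|) * U η) * (√(2 * π) + (massN n k η).toReal)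

theorem KPot.norm_dintegrand_le (K : KPot q q' r U)
    (hn : Measurable₃ n) {k η : ℝ}
    (h : massN n k η < ⊤) (l : ℝ) :
    ‖dintegrand q q' n k l η‖ ≤ (2 * |l + k| + 1) * domin U n k η := by
  have hU : 0 ≤ U η := (norm_nonneg _).trans (K.bq 0 η)
  have hM : 0 ≤ (massN n k η).toReal := ENNReal.toReal_nonneg
  have hs := sqrt_two_pi_pos
  have hc : ‖(2 * I * (l + k) * η : ℂ)‖ = 2 * |l + k| * |η| := by
    rw [← Complex.ofReal_add, norm_mul, norm_mul, norm_mul, Complex.norm_real, Complex.norm_real]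
    simp
  have e1 : ‖(2 * I * (l + k) * η * q l η + q' l η : ℂ)‖ ≤
      2 * |l + k| * |η| * U η + U η := by
    refine (norm_add_le _ _).trans (add_le_add ?_ (K.bq' _ _))
    rw [norm_mul, hc]; gcongr; exact K.bq _ _
  have e2 : ‖(2 * I * (l + k) * η * nonlin q n k l η + nonlin q' n k l η : ℂ)‖ ≤
      2 * |l + k| * |η| * (U η * (massN n k η).toReal) + U η * (massN n k η).toReal := by
    refine (norm_add_le _ _).trans (add_le_add ?_ (norm_nonlin_le hn h (fun l => K.bq' l η) l))
    rw [norm_mul, hc]; gcongr; exact norm_nonlin_le hn h (fun l => K.bq l η) l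
  have e3 : 2 * |l + k| * |η| + 1 ≤ (2 * |l + k| + 1) * (1 + |η|) := by
    nlinarith [abs_nonneg (l + k), abs_nonneg η]
  calc ‖dintegrand q q' n k l η‖ ≤ √(2 * π) * (2 * |l + k| * |η| * U η + U η) +
      (2 * |l + k| * |η| * (U η * (massN n k η).toReal) + U η * (massN n k η).toReal) := by
        refine (norm_add_le _ _).trans (add_le_add ?_ ?_)
        · rw [norm_mul, norm_mul, norm_ph, one_mul, Complex.norm_real, norm_eq_abs,
            abs_of_pos hs]
          gcongr
        · rw [norm_mul, norm_ph, one_mul]; exact e2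
    _ = (2 * |l + k| * |η| + 1) * (U η * (√(2 * π) + (massN n k η).toReal)) := by ring
    _ ≤ ((2 * |l + k| + 1) * (1 + |η|)) * (U η * (√(2 * π) + (massN n k η).toReal)) := by gcongr
    _ = _ := by unfold domin; ring

theorem KPot.norm_integrand_le (K : KPot q q' r U)
    (hn : Measurable₃ n) {k η : ℝ}
    (h : massN n k η < ⊤) (l : ℝ) : ‖integrand q n k l η‖ ≤ domin U n k η := by
  have hU : 0 ≤ U η := (norm_nonneg _).trans (K.bq 0 η)
  have hM : 0 ≤ (massN n k η).toReal := ENNReal.toReal_nonneg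
  have hs := sqrt_two_pi_pos
  calc ‖integrand q n k l η‖ ≤ √(2 * π) * U η + U η * (massN n k η).toReal := by
        refine (norm_add_le _ _).trans (add_le_add ?_ ?_)
        · rw [norm_mul, norm_mul, norm_ph, one_mul, Complex.norm_real, norm_eq_abs,
            abs_of_pos hs]
          gcongr; exact K.bq _ _
        · rw [norm_mul, norm_ph, one_mul]; exact norm_nonlin_le hn h (fun l => K.bq l η) l
    _ = U η * (√(2 * π) + (massN n k η).toReal) := by ring
    _ ≤ ((1 + |η|) * U η) * (√(2 * π) + (massN n k η).toReal) := by
        gcongr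
        nlinarith [abs_nonneg η]

theorem measurable_massN (hn : Measurable₃ n) :
    Measurable fun p : ℝ × ℝ => massN n p.1 p.2 := by
  refine Measurable.lintegral_prod_right' (f := fun p : (ℝ × ℝ) × ℝ => wt p.2 * ‖n p.1.1 p.2 p.1.2‖ₑ) ?_
  exact (measurable_wt.comp measurable_snd).mul
    (hn.comp (f := fun p : (ℝ × ℝ) × ℝ => (p.1.1, p.2, p.1.2)) (by fun_prop)).enorm

theorem KPot.integrable_domin (K : KPot q q' r U)
    (hn : Measurable₃ n) {k : ℝ} (g : GoodParam σ q q' n U k) :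
    Integrable (domin U n k) := by
  have hm : Measurable (massN n k) := (measurable_massN hn).of_uncurry_left
  have h1 : Integrable fun η => (1 + |η|) * U η * (massN n k η).toReal := by
    refine ⟨?_, ?_⟩
    · have := K.mU
      exact Measurable.aestronglyMeasurable (by fun_prop)
    · refine lt_of_le_of_lt (lintegral_mono fun η => ?_) g.nint
      have hU : 0 ≤ U η := (norm_nonneg _).trans (K.bq 0 η)
      rw [enorm_mul, enorm_of_nonneg (by positivity), enorm_of_nonneg ENNReal.toReal_nonneg]
      gcongr
      exact ENNReal.ofReal_toReal_le
  have h2 := (K.iU.mul_const √(2 * π)).add h1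
  refine h2.congr (ae_of_all _ fun η => ?_)
  simp only [domin, Pi.add_apply]; ring

/-- In the interaction picture the integrand does not contain the endpoint `y`, so for a fixed set
the integral is differentiable at every `l`, including `l = 0`. The solution itself fails to be
smooth there only because the ray changes direction. -/
theorem KPot.hasDerivAt_setIntegral (K : KPot q q' r U)
    (hn : Measurable₃ n) {k : ℝ} (g : GoodParam σ q q' n U k)
    (s : Set ℝ) (l : ℝ) :
    HasDerivAt (fun l => ∫ η in s, integrand q n k l η) (∫ η in s, dintegrand q q' n k l η) l := by
  have hmi : ∀ l, Measurable (integrand q n k l) := fun l =>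
    (measurable_integrand K.mq hn).comp (f := fun η : ℝ => (k, l, η)) (by fun_prop)
  have hmd : ∀ l, Measurable (dintegrand q q' n k l) := fun l =>
    (measurable_dintegrand K.mq K.mq' hn).comp (f := fun η : ℝ => (k, l, η)) (by fun_prop)
  have hfin : ∀ᵐ η ∂volume.restrict s, massN n k η < ⊤ := ae_restrict_of_ae g.nfin
  have hd := (K.integrable_domin hn g).integrableOn (s := s)
  refine (hasDerivAt_integral_of_dominated_loc_of_deriv_le (μ := volume.restrict s)
    (F := fun l η => integrand q n k l η) (F' := fun l η => dintegrand q q' n k l η)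
    (bound := fun η => (2 * (|l| + 1 + |k|) + 1) * domin U n k η) (x₀ := l) (s := Metric.ball l 1)
    (Metric.ball_mem_nhds l one_pos) ?_ ?_ ?_ ?_ ?_ ?_).2
  · exact .of_forall fun l => (hmi l).aestronglyMeasurable
  · refine hd.mono' (hmi l).aestronglyMeasurable ?_
    filter_upwards [hfin] with η hη using K.norm_integrand_le hn hη l
  · exact (hmd l).aestronglyMeasurable
  · filter_upwards [hfin] with η hη x hx
    have hU : 0 ≤ U η := (norm_nonneg _).trans (K.bq 0 η)
    refine (K.norm_dintegrand_le hn hη x).trans ?_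
    have : 0 ≤ domin U n k η := by
      unfold domin
      have : 0 ≤ (massN n k η).toReal := ENNReal.toReal_nonneg
      positivity
    gcongr
    rw [Metric.mem_ball, Real.dist_eq] at hx
    have h1 := abs_add_le x k
    have h2 := abs_add_le (x - l) l
    rw [sub_add_cancel] at h2
    linarith
  · exact hd.const_mul _
  · filter_upwards [hfin] with η hη x _ using K.hasDerivAt_integrand hn hη x

theorem KPot.hasDerivAt_tau (K : KPot q q' r U)
    (hn : Measurable₃ n) {k : ℝ} (g : GoodParam σ q q' n U k)
    (l : ℝ) : HasDerivAt (tau q n k) (∫ η, dintegrand q q' n k l η) l := by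
  have := K.hasDerivAt_setIntegral hn g Set.univ l
  simp only [Measure.restrict_univ] at this
  exact this

theorem KPot.integrable_integrand (K : KPot q q' r U)
    (hn : Measurable₃ n) {k : ℝ} (g : GoodParam σ q q' n U k)
    (l : ℝ) : Integrable (integrand q n k l) := by
  refine (K.integrable_domin hn g).mono' ((measurable_integrand K.mq hn).comp
    (f := fun η : ℝ => (k, l, η)) (by fun_prop)).aestronglyMeasurable ?_
  filter_upwards [g.nfin] with η hη using K.norm_integrand_le hn hη l

theorem KPot.integrable_dintegrand (K : KPot q q' r U)
    (hn : Measurable₃ n) {k : ℝ} (g : GoodParam σ q q' n U k)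
    (l : ℝ) : Integrable (dintegrand q q' n k l) := by
  refine ((K.integrable_domin hn g).const_mul (2 * |l + k| + 1)).mono'
    ((measurable_dintegrand K.mq K.mq' hn).comp
    (f := fun η : ℝ => (k, l, η)) (by fun_prop)).aestronglyMeasurable ?_
  filter_upwards [g.nfin] with η hη using K.norm_dintegrand_le hn hη l

/-- One of the two branches (`l > 0` and `l < 0`) of the scattering solution, extended to all `l`. -/
def branch (σ e : ℝ) (q : ℝ → ℝ → ℂ) (n : ℝ → ℝ → ℝ → ℂ) (k y l : ℝ) : ℂ :=
  I / (√(2 * π) : ℂ) * (raySign σ e * ∫ η in ray σ e y, integrand q n k l η)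

/-- The derivative of `branch`. -/
def dbranch (σ e : ℝ) (q q' : ℝ → ℝ → ℂ) (n : ℝ → ℝ → ℝ → ℂ) (k y l : ℝ) : ℂ :=
  I / (√(2 * π) : ℂ) * (raySign σ e * ∫ η in ray σ e y, dintegrand q q' n k l η)

theorem KPot.hasDerivAt_branch (K : KPot q q' r U)
    (hn : Measurable₃ n) {k : ℝ} (g : GoodParam σ q q' n U k)
    (e y l : ℝ) : HasDerivAt (branch σ e q n k y) (dbranch σ e q q' n k y l) l :=
  ((K.hasDerivAt_setIntegral hn g (ray σ e y) l).const_mul _).const_mul _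

theorem ray_eq_of_pos {e l : ℝ} (h : 0 < e * l) (σ y : ℝ) :
    ray σ l y = ray σ e y ∧ raySign σ l = raySign σ e := by
  have h1 : (0 < σ * l ↔ 0 < σ * e) ∧ (σ * l < 0 ↔ σ * e < 0) := by
    rcases pos_and_pos_or_neg_and_neg_of_mul_pos h with ⟨he, hl⟩ | ⟨he, hl⟩
    · simp [mul_pos_iff_of_pos_right, mul_neg_iff, hl, he, not_lt.2 hl.le, not_lt.2 he.le]
    · simp [mul_pos_iff, mul_neg_iff, hl, he, not_lt.2 hl.le, not_lt.2 he.le]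
  simp [ray, raySign, h1]

theorem GoodParam.eq_branch {k : ℝ} (g : GoodParam σ q q' n U k) {e l : ℝ} (h : 0 < e * l) (y : ℝ) :
    n k l y = branch σ e q n k y l := by
  rw [g.eqn, intFrom_eq, (ray_eq_of_pos h σ y).1, (ray_eq_of_pos h σ y).2, branch]

theorem dsol_eq_dbranch (k : ℝ) {e l : ℝ} (h : 0 < e * l) (y : ℝ) :
    dsol σ q q' n k l y = dbranch σ e q q' n k y l := by
  rw [dsol, intFrom_eq, (ray_eq_of_pos h σ y).1, (ray_eq_of_pos h σ y).2, dbranch]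

/-- The rays for `l > 0` and `l < 0` are complementary half-lines and carry opposite signs, so the
two boundary values at `l = 0` differ by an integral over the whole line. In particular the jump
does not depend on `y`. -/
theorem KPot.branch_sub_branch (K : KPot q q' r U)
    (hn : Measurable₃ n) {k : ℝ} (g : GoodParam σ q q' n U k)
    (hσ : σ = 1 ∨ σ = -1) (y : ℝ) :
    branch σ 1 q n k y 0 - branch σ (-1) q n k y 0 = jump σ q n k := by
  have hi := K.integrable_integrand hn g 0
  have h := intervalIntegral.integral_Iic_add_Ioi (b := y) hi.integrableOn hi.integrableOn
  unfold jump branch tau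
  rw [← h]
  rcases hσ with rfl | rfl <;> norm_num [ray, raySign] <;> ring

theorem GoodParam.integrable_dsol {k : ℝ} (g : GoodParam σ q q' n U k) (K : KPot q q' r U)
    (hn : Measurable₃ n) (y : ℝ) :
    Integrable fun l => dsol σ q q' n k l y := by
  refine ⟨((measurable_dsol σ K.mq K.mq' hn).comp (f := fun l : ℝ => (k, l, y))
    (by fun_prop)).aestronglyMeasurable, ?_⟩
  calc ∫⁻ l, ‖dsol σ q q' n k l y‖ₑ
      ≤ ∫⁻ l, i2π * (wt l * ∫⁻ η, ‖dintegrand q q' n k l η‖ₑ) := by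
        refine lintegral_mono fun l => ?_
        rw [dsol, enorm_mul, enorm_I_div]
        gcongr
        exact (enorm_intFrom_le _ _ _ _).trans (le_mul_of_one_le_left (zero_le) (one_le_wt l))
    _ = i2π * ∫⁻ l, (wt l * ∫⁻ η, ‖dintegrand q q' n k l η‖ₑ) := lintegral_const_mul' _ _ i2π_ne_top
    _ < ⊤ := mul_lt_top i2π_lt_top g.dfin

/-- The derivative of the nonlinear term is expressed by the derivative of the solution. -/
theorem GoodParam.deriv_nonlin_eq {k : ℝ} (g : GoodParam σ q q' n U k) (K : KPot q q' r U)
    (hn : Measurable₃ n) (hσ : σ = 1 ∨ σ = -1)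
    {η : ℝ} (hη : massN n k η < ⊤) (l : ℝ) :
    2 * I * (l + k) * η * nonlin q n k l η + nonlin q' n k l η =
      2 * I * nonlin (fun s η => s * η * q s η) n k l η + q l η * jump σ q n k +
        nonlin q (dsol σ q q' n) k l η := by
  have hphm : ∀ η, Measurable fun l' => ph k l' η := fun η => by fun_prop
  have hqm : ∀ {p : ℝ → ℝ → ℂ}, Measurable (uncurry p) →
      Measurable fun l' => p (l - l') η := fun hp =>
    hp.comp (f := fun l' => (l - l', η)) (by fun_prop)
  -- The part of the convolution that multiplies `n k l' η`. Differentiating its phase in `l'`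
  -- produces `-2i(l'+k)η`, so integration by parts removes both `q'` and the factor `l' + k`.
  set G : ℝ → ℂ := fun l' => q (l - l') η * ph k l' (-η) with hG
  set G' : ℝ → ℂ := fun l' => -(q' (l - l') η + 2 * I * (l' + k) * η * q (l - l') η) *
    ph k l' (-η) with hG'
  have hGd : ∀ l', HasDerivAt G (G' l') l' := fun l' => by
    have h1 := (K.hd η (l - l')).scomp l' ((hasDerivAt_id l').const_sub l)
    have h2 := h1.mul (hasDerivAt_ph k l' (-η))
    refine HasDerivAt.congr_deriv (f := G) (by simpa [Function.comp_def] using! h2) ?_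
    simp only [hG']
    ring
  have hGm : Measurable G := (hqm K.mq).mul (hphm _)
  have hGb : ∀ l', ‖G l'‖ ≤ U η := fun l' => by
    simp only [hG, norm_mul, norm_ph, mul_one]; exact K.bq _ _
  have hI1 : Integrable fun l' => G l' * dsol σ q q' n k l' η :=
    (g.integrable_dsol K hn η).bdd_mul hGm.aestronglyMeasurable (ae_of_all _ hGb)
  have hIq : Integrable fun l' => q (l - l') η * (ph k l' (-η) * n k l' η) :=
    integrable_conv hn hη K.mq (fun l => K.bq l η) l
  have hIq' : Integrable fun l' => q' (l - l') η * (ph k l' (-η) * n k l' η) :=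
    integrable_conv hn hη K.mq' (fun l => K.bq' l η) l
  have hIlq : Integrable fun l' : ℝ => (l' : ℂ) * (q (l - l') η * (ph k l' (-η) * n k l' η)) := by
    have h1 : Integrable fun l' => G l' * ((l' : ℂ) * n k l' η) :=
      (integrable_mul_n hn hη).bdd_mul hGm.aestronglyMeasurable (ae_of_all _ hGb)
    refine h1.congr (ae_of_all _ fun l' => ?_)
    simp only [hG]; ring
  have hI2 : Integrable fun l' => G' l' * n k l' η := by
    have h1 := (hIq'.add ((hIlq.add (hIq.const_mul (k : ℂ))).const_mul (2 * I * η))).neg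
    refine h1.congr (ae_of_all _ fun l' => ?_)
    simp only [hG', Pi.add_apply, Pi.neg_apply]; ring
  -- The integrand is the derivative of `G n` away from zero. On each half-line `n` equals a branch
  -- that is differentiable up to and beyond `0`; the two boundary values combine to the jump.
  have hsum : ∫ l', (G' l' * n k l' η + G l' * dsol σ q q' n k l' η) = -(G 0 * jump σ q n k) := by
    have hcont : ∀ e, Continuous (branch σ e q n k η) := fun e =>
      continuous_iff_continuousAt.2 fun x => (K.hasDerivAt_branch hn g e η x).continuousAt
    have hGc : Continuous G := continuous_iff_continuousAt.2 fun x => (hGd x).continuousAt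
    have hpos : ∀ l' ∈ Ioi (0 : ℝ), (0 : ℝ) < 1 * l' := fun l' hl' => by simpa using hl'
    have hneg : ∀ l' ∈ Iio (0 : ℝ), (0 : ℝ) < (-1) * l' := fun l' hl' => by simpa using hl'
    have hP : ∫ l' in Ioi 0, (G' l' * n k l' η + G l' * dsol σ q q' n k l' η) =
        0 - G 0 * branch σ 1 q n k η 0 := by
      have e0 : ∀ l' ∈ Ioi (0 : ℝ), G' l' * n k l' η + G l' * dsol σ q q' n k l' η =
          G' l' * branch σ 1 q n k η l' + G l' * dbranch σ 1 q q' n k η l' := fun l' hl' => by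
        rw [g.eq_branch (hpos l' hl'), dsol_eq_dbranch k (hpos l' hl')]
      have e1 : IntegrableOn (fun l' => G' l' * branch σ 1 q n k η l' +
          G l' * dbranch σ 1 q q' n k η l') (Ioi 0) :=
        (hI2.add hI1).integrableOn.congr_fun e0 measurableSet_Ioi
      have e2 : IntegrableOn (fun l' => G l' * branch σ 1 q n k η l') (Ioi 0) :=
        hIq.integrableOn.congr_fun (fun l' hl' => by
          simp only [hG]
          rw [← g.eq_branch (hpos l' hl')]; ring) measurableSet_Ioi
      rw [setIntegral_congr_fun measurableSet_Ioi e0]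
      refine integral_Ioi_deriv_mul_eq_sub (fun x _ => hGd x)
        (fun x _ => K.hasDerivAt_branch hn g 1 η x) e1 ?_ ?_
      · exact ((hGc.mul (hcont 1)).continuousAt (x := 0)).tendsto.mono_left nhdsWithin_le_nhds
      · exact tendsto_zero_of_hasDerivAt_of_integrableOn_Ioi (a := 0)
          (fun x _ => (hGd x).mul (K.hasDerivAt_branch hn g 1 η x)) e1 e2
    have hN : ∫ l' in Iic 0, (G' l' * n k l' η + G l' * dsol σ q q' n k l' η) =
        G 0 * branch σ (-1) q n k η 0 - 0 := by
      have e0 : ∀ l' ∈ Iio (0 : ℝ), G' l' * n k l' η + G l' * dsol σ q q' n k l' η =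
          G' l' * branch σ (-1) q n k η l' + G l' * dbranch σ (-1) q q' n k η l' := fun l' hl' => by
        rw [g.eq_branch (hneg l' hl'), dsol_eq_dbranch k (hneg l' hl')]
      have e1 : IntegrableOn (fun l' => G' l' * branch σ (-1) q n k η l' +
          G l' * dbranch σ (-1) q q' n k η l') (Iic 0) :=
        (integrableOn_Iic_iff_integrableOn_Iio enorm_ne_top).2
          ((hI2.add hI1).integrableOn.congr_fun e0 measurableSet_Iio)
      have e2 : IntegrableOn (fun l' => G l' * branch σ (-1) q n k η l') (Iic 0) :=
        (integrableOn_Iic_iff_integrableOn_Iio enorm_ne_top).2 (hIq.integrableOn.congr_fun (fun l' hl' => by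
          simp only [hG]
          rw [← g.eq_branch (hneg l' hl')]; ring) measurableSet_Iio)
      rw [integral_Iic_eq_integral_Iio, setIntegral_congr_fun measurableSet_Iio e0,
        ← integral_Iic_eq_integral_Iio]
      refine integral_Iic_deriv_mul_eq_sub (fun x _ => hGd x)
        (fun x _ => K.hasDerivAt_branch hn g (-1) η x) e1 ?_ ?_
      · exact ((hGc.mul (hcont (-1))).continuousAt (x := 0)).tendsto.mono_left nhdsWithin_le_nhds
      · exact tendsto_zero_of_hasDerivAt_of_integrableOn_Iic (a := 0)
          (fun x _ => (hGd x).mul (K.hasDerivAt_branch hn g (-1) η x)) e1 e2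
    rw [← intervalIntegral.integral_Iic_add_Ioi (b := (0 : ℝ))
      (f := fun l' => G' l' * n k l' η + G l' * dsol σ q q' n k l' η) (hI2.add hI1).integrableOn
      (hI2.add hI1).integrableOn, hP, hN, ← K.branch_sub_branch hn g hσ η]
    ring
  rw [integral_add hI2 hI1] at hsum
  have hG0 : G 0 = q l η := by simp [hG, ph]
  rw [hG0] at hsum
  have hd : nonlin q (dsol σ q q' n) k l η = ∫ l', G l' * dsol σ q q' n k l' η := by
    unfold nonlin
    refine integral_congr_ae (ae_of_all _ fun l' => ?_)
    simp only [hG]; ring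
  rw [hd, eq_sub_of_add_eq' hsum]
  -- The decomposition `l + k = (l - l') + (l' + k)`: the first summand is harmless, since it falls
  -- on the decaying factor `q (l - l') η`, and the second was removed by the integration by parts.
  have h1 : nonlin (fun s η => s * η * q s η) n k l η =
      ∫ l', (((l * η : ℝ) : ℂ) * (q (l - l') η * (ph k l' (-η) * n k l' η)) -
        η * ((l' : ℂ) * (q (l - l') η * (ph k l' (-η) * n k l' η)))) := by
    unfold nonlin
    refine integral_congr_ae (ae_of_all _ fun l' => ?_)
    push_cast; ring
  have h2 : ∫ l', G' l' * n k l' η = ∫ l', (-(q' (l - l') η * (ph k l' (-η) * n k l' η)) -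
      (2 * I * η) * ((l' : ℂ) * (q (l - l') η * (ph k l' (-η) * n k l' η)) +
        k * (q (l - l') η * (ph k l' (-η) * n k l' η)))) := by
    refine integral_congr_ae (ae_of_all _ fun l' => ?_)
    simp only [hG']; ring
  have hA : Integrable fun l' : ℝ => (l' : ℂ) * (q (l - l') η * (ph k l' (-η) * n k l' η)) +
      k * (q (l - l') η * (ph k l' (-η) * n k l' η)) := hIlq.add (hIq.const_mul _)
  have hB : Integrable fun l' : ℝ => -(q' (l - l') η * (ph k l' (-η) * n k l' η)) := hIq'.neg
  rw [h1, integral_sub (hIq.const_mul _) (hIlq.const_mul _), integral_const_mul, integral_const_mul,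
    h2, integral_sub hB (hA.const_mul _), integral_neg,
    integral_const_mul, integral_add hIlq (hIq.const_mul _), integral_const_mul]
  unfold nonlin
  push_cast
  ring

variable {σ : ℝ} {q q' r : ℝ → ℝ → ℂ} {U : ℝ → ℝ} {n : ℝ → ℝ → ℝ → ℂ}

/-! ### Integration by parts in `y` for the linear term -/

/-- The linear part of `dintegrand`, up to a factor `√(2π)`. -/
def dlin (q q' : ℝ → ℝ → ℂ) (k l η : ℝ) : ℂ :=
  ph k l η * (2 * I * (l + k) * η * q l η + q' l η)

/-- The nonlinear part of `dintegrand`. -/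
def dnonlin (q q' : ℝ → ℝ → ℂ) (n : ℝ → ℝ → ℝ → ℂ) (k l η : ℝ) : ℂ :=
  ph k l η * (2 * I * (l + k) * η * nonlin q n k l η + nonlin q' n k l η)

theorem dintegrand_eq (k l η : ℝ) :
    dintegrand q q' n k l η = (√(2 * π) : ℂ) * dlin q q' k l η + dnonlin q q' n k l η := rfl

theorem KPot.integrable_mul_q (K : KPot q q' r U) (l : ℝ) :
    Integrable fun η : ℝ => (η : ℂ) * q l η := by
  have hm := K.mq.of_uncurry_left (x := l)
  refine K.iU.mono' (Measurable.aestronglyMeasurable (by fun_prop))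
    (ae_of_all _ fun y => ?_)
  have h1 := K.bq l y
  rw [norm_mul, Complex.norm_real, norm_eq_abs]
  have h2 : 0 ≤ U y := (norm_nonneg _).trans h1
  calc |y| * ‖q l y‖ ≤ |y| * U y := by gcongr
    _ ≤ (1 + |y|) * U y := by gcongr; linarith

theorem KPot.integrable_q' (K : KPot q q' r U) (l : ℝ) : Integrable (q' l) := by
  refine K.iU.mono' K.mq'.of_uncurry_left.aestronglyMeasurable (ae_of_all _ fun y => ?_)
  have h1 := K.bq' l y
  have h2 : 0 ≤ U y := (norm_nonneg _).trans h1
  nlinarith [abs_nonneg y]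

theorem KPot.integrable_dlin (K : KPot q q' r U) (k l : ℝ) : Integrable (dlin q q' k l) := by
  refine integrable_ph_mul k l (g := fun η => 2 * I * (l + k) * η * q l η + q' l η) ?_
  refine Integrable.add ?_ (K.integrable_q' l)
  simp_rw [mul_assoc]
  exact (((K.integrable_mul_q l).const_mul _).const_mul _).const_mul _

/-- The unbounded factor `k` disappears through `2(l+k) = (l+2k) + l`: the product of `il(l+2k)`
with the phase factor is its `η`-derivative, so the first summand is integrated by parts after
division by `l`. The price is the singularity `1/l` in `src` and, on a ray, the boundary term at
`y`. -/
theorem KPot.dlin_by_parts (K : KPot q q' r U) :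
    ∀ᵐ l : ℝ, Integrable (src q q' r l) ∧ ∀ k : ℝ,
      ∫ η, dlin q q' k l η = ∫ η, ph k l η * src q q' r l η ∧
      ∀ σ : ℝ, σ ≠ 0 → ∀ᵐ y : ℝ, intFrom σ l y (dlin q q' k l) =
        y / l * (ph k l y * q l y) + intFrom σ l y (fun η => ph k l η * src q q' r l η) := by
  have h0 := Measure.ae_ne volume (0 : ℝ)
  filter_upwards [h0, K.yderiv, K.yint] with l hl ⟨f, hf, hfq⟩ hr
  have hl' : (l : ℂ) ≠ 0 := by exact_mod_cast hl
  have hrm : Measurable (r l) := K.mr.of_uncurry_left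
  have hinv : ∀ y : ℝ, ((1 + |y| : ℝ) : ℂ) ≠ 0 := fun y => by
    have : 0 < 1 + |y| := by positivity
    exact_mod_cast this.ne'
  have hr1 : Integrable fun y : ℝ => (y : ℂ) * r l y := by
    refine hr.mono (Measurable.aestronglyMeasurable (by fun_prop))
      (ae_of_all _ fun y => ?_)
    rw [norm_mul, norm_mul, Complex.norm_real, Complex.norm_real]
    gcongr
    rw [norm_eq_abs, norm_eq_abs]
    exact (by linarith : |y| ≤ 1 + |y|).trans (le_abs_self _)
  have hq1 := K.integrable_mul_q l
  have hq0 := K.integrable_q l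
  have hf1 : Integrable fun y : ℝ => (y : ℂ) * f y :=
    hq1.congr (hfq.mono fun y hy => by simp only [hy])
  have hf0 : Integrable f := hq0.congr hfq.symm
  have hsrc : Integrable (src q q' r l) := by
    have h1 := (((hq1.const_mul (I * l)).add (K.integrable_q' l)).sub
      ((hq0.add hr1).div_const (l : ℂ)))
    refine h1.congr (ae_of_all _ fun y => ?_)
    simp only [src, Pi.add_apply, Pi.sub_apply]; ring
  refine ⟨hsrc, fun k => ?_⟩
  have hlin := K.integrable_dlin k l
  have hps := integrable_ph_mul k l hsrc
  -- The representative `f` of `q l` is differentiable, while `q l` itself need not be; this is why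
  -- the boundary identity is asserted for almost every `y` only.
  set H : ℝ → ℂ := fun η => η / l * (ph k l η * f η) with hH
  set H' : ℝ → ℂ := fun η => 1 / l * (ph k l η * f η) +
    η / l * (I * l * (l + 2 * k) * ph k l η * f η + ph k l η * r l η) with hH'
  have hHd : ∀ η, HasDerivAt H (H' η) η := fun η => by
    have h1 : HasDerivAt (fun η : ℝ => (η : ℂ) / l) (1 / l) η := by
      simpa using (hasDerivAt_id η).ofReal_comp.div_const (l : ℂ)
    exact h1.mul ((hasDerivAt_ph_right k l η).mul (hf η))
  have hHi : Integrable H := by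
    have h1 := (integrable_ph_mul k l hf1).const_mul (1 / (l : ℂ))
    refine h1.congr (ae_of_all _ fun y => ?_)
    simp only [hH]; ring
  have hH'ae : H' =ᵐ[volume] fun η => dlin q q' k l η - ph k l η * src q q' r l η := by
    filter_upwards [hfq] with η hη
    simp only [hH', dlin, src, hη]
    field_simp
    ring
  have hH'i : Integrable H' := (hlin.sub hps).congr hH'ae.symm
  have hsub : ∀ s : Set ℝ, ∫ η in s, H' η =
      (∫ η in s, dlin q q' k l η) - ∫ η in s, ph k l η * src q q' r l η := fun s => by
    rw [integral_congr_ae (ae_restrict_of_ae hH'ae), integral_sub hlin.integrableOn hps.integrableOn]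
  have htop : Tendsto H atTop (nhds 0) :=
    tendsto_zero_of_hasDerivAt_of_integrableOn_Ioi (a := 0) (fun x _ => hHd x)
      hH'i.integrableOn hHi.integrableOn
  have hbot : Tendsto H Filter.atBot (nhds 0) :=
    tendsto_zero_of_hasDerivAt_of_integrableOn_Iic (a := 0) (fun x _ => hHd x)
      hH'i.integrableOn hHi.integrableOn
  refine ⟨?_, fun σ hσ => ?_⟩
  · have h1 := integral_of_hasDerivAt_of_tendsto hHd hH'i hbot htop
    have h2 := hsub Set.univ
    simp only [Measure.restrict_univ] at h2
    rw [h1, sub_zero] at h2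
    exact (sub_eq_zero.1 h2.symm)
  · filter_upwards [hfq] with y hy
    have hI : ∫ η in Ioi y, H' η = 0 - H y :=
      integral_Ioi_of_hasDerivAt_of_tendsto' (fun x _ => hHd x) hH'i.integrableOn htop
    have hN : ∫ η in Iic y, H' η = H y - 0 :=
      integral_Iic_of_hasDerivAt_of_tendsto' (fun x _ => hHd x) hH'i.integrableOn hbot
    have hHy : H y = y / l * (ph k l y * q l y) := by simp only [hH, hy]
    rw [← hHy]
    rw [hsub] at hI hN
    unfold intFrom
    rcases lt_trichotomy (σ * l) 0 with h | h | h
    · rw [if_neg (not_lt.2 h.le), if_pos h, if_neg (not_lt.2 h.le), if_pos h]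
      linear_combination hN
    · exact absurd h (mul_ne_zero hσ hl)
    · rw [if_pos h, if_pos h]
      linear_combination -hI

/-! ### The equation for the derivative -/

/-- The boundary term in the derivative of the scattering solution. -/
def bdry (q : ℝ → ℝ → ℂ) (k l y : ℝ) : ℂ := I * (y / l * (ph k l y * q l y))

/-- The derivative of the scattering solution without the boundary term. -/
def dreg (σ : ℝ) (q q' : ℝ → ℝ → ℂ) (n : ℝ → ℝ → ℝ → ℂ) (k l y : ℝ) : ℂ :=
  dsol σ q q' n k l y - bdry q k l y

/-- The majorant of the nonlinear terms in the equation for the derivative. -/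
def majD (σ : ℝ) (q q' : ℝ → ℝ → ℂ) (n : ℝ → ℝ → ℝ → ℂ) (k l : ℝ) : ℝ≥0∞ :=
  2 * majConv (fun s η => s * η * q s η) (fun k l y => ‖n k l y‖ₑ) k l +
    ‖jump σ q n k‖ₑ * (∫⁻ η, ‖q l η‖ₑ) + majConv q (fun k l y => ‖dreg σ q q' n k l y‖ₑ) k l

theorem measurable_bdry (hq : Measurable (uncurry q)) :
    Measurable fun p : ℝ × ℝ × ℝ => bdry q p.1 p.2.1 p.2.2 := by
  have h1 : Measurable fun p : ℝ × ℝ × ℝ => q p.2.1 p.2.2 := hq.comp measurable_snd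
  have h2 : Measurable fun p : ℝ × ℝ × ℝ => ph p.1 p.2.1 p.2.2 := by fun_prop
  unfold bdry
  fun_prop

theorem measurable_dreg (σ : ℝ) (hq : Measurable (uncurry q))
    (hq' : Measurable (uncurry q'))
    (hn : Measurable₃ n) :
    Measurable fun p : ℝ × ℝ × ℝ => dreg σ q q' n p.1 p.2.1 p.2.2 :=
  (measurable_dsol σ hq hq' hn).sub (measurable_bdry hq)

theorem enorm_bdry (k l y : ℝ) : ‖bdry q k l y‖ₑ = ‖y / l‖ₑ * ‖q l y‖ₑ := by
  rw [bdry, enorm_mul, enorm_mul, enorm_mul, enorm_ph, one_mul, ← Complex.ofReal_div,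
    enorm_I, one_mul, ← ofReal_norm (_ : ℂ),
    Complex.norm_real, ofReal_norm]

theorem measurable_srcB (hq : Measurable (uncurry q)) :
    Measurable (uncurry (srcB q)) := by
  refine StronglyMeasurable.measurable ?_
  refine StronglyMeasurable.integral_prod_right (f := fun (p : ℝ × ℝ) l' =>
    q (p.1 - l') p.2 * (I * (p.2 / l') * q l' p.2)) ?_
  refine Measurable.stronglyMeasurable ?_
  have h1 : Measurable fun p : (ℝ × ℝ) × ℝ => q (p.1.1 - p.2) p.1.2 :=
    hq.comp (f := fun p : (ℝ × ℝ) × ℝ => (p.1.1 - p.2, p.1.2)) (by fun_prop)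
  have h2 : Measurable fun p : (ℝ × ℝ) × ℝ => q p.2 p.1.2 :=
    hq.comp (f := fun p : (ℝ × ℝ) × ℝ => (p.2, p.1.2)) (by fun_prop)
  have h3 : Measurable fun p : (ℝ × ℝ) × ℝ => (I * (p.1.2 / p.2) : ℂ) := by fun_prop
  exact h1.mul (h3.mul h2)

theorem measurable_src (hq : Measurable (uncurry q)) (hq' : Measurable (uncurry q'))
    (hr : Measurable (uncurry r)) : Measurable (uncurry (src q q' r)) := by
  have h0 : ∀ {p : ℝ → ℝ → ℂ}, Measurable (uncurry p) → Measurable fun x : ℝ × ℝ => p x.1 x.2 :=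
    fun h => h
  have h1 := h0 hq
  have h2 := h0 hq'
  have h3 := h0 hr
  change Measurable fun x : ℝ × ℝ => src q q' r x.1 x.2
  unfold src
  fun_prop

/-- In the convolution of `q` with the boundary term the phases at `l'` cancel, leaving `srcB`,
which is independent of `k`. That term alone keeps the outer factor `ph k l η` as its only
dependence on `k` and is therefore accessible to Plancherel. -/
theorem GoodParam.dnonlin_eq {k : ℝ} (g : GoodParam σ q q' n U k) (K : KPot q q' r U)
    (hn : Measurable₃ n) (hσ : σ = 1 ∨ σ = -1)
    {η : ℝ} (hη : massN n k η < ⊤) (hb : ∫⁻ l, wt l * (‖η / l‖ₑ * ‖q l η‖ₑ) < ⊤) (l : ℝ) :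
    dnonlin q q' n k l η = ph k l η * srcB q l η + ph k l η *
      (2 * I * nonlin (fun s η => s * η * q s η) n k l η + q l η * jump σ q n k +
        nonlin q (dreg σ q q' n) k l η) := by
  have hm1 : ∀ {p : ℝ → ℝ → ℝ → ℂ}, (Measurable fun x : ℝ × ℝ × ℝ => p x.1 x.2.1 x.2.2) →
      Measurable fun l' => p k l' η := fun h => h.comp (f := fun l' : ℝ => (k, l', η)) (by fun_prop)
  have hqm : Measurable fun l' => q (l - l') η :=
    K.mq.comp (f := fun l' => (l - l', η)) (by fun_prop)
  have hbi : Integrable fun l' => bdry q k l' η := by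
    refine ⟨(hm1 (measurable_bdry K.mq)).aestronglyMeasurable, lt_of_le_of_lt ?_ hb⟩
    refine lintegral_mono fun l' => ?_
    rw [enorm_bdry]
    exact le_mul_of_one_le_left (zero_le) (one_le_wt l')
  have hbd : ∀ {p : ℝ → ℂ}, Integrable p → Integrable fun l' => q (l - l') η * (ph k l' (-η) * p l') := by
    intro p hp
    have h1 : Integrable fun l' => ph k l' (-η) * p l' := by
      refine hp.bdd_mul (c := 1) (Measurable.aestronglyMeasurable (by fun_prop)) ?_
      exact ae_of_all _ fun η => by simp
    exact h1.bdd_mul (c := U η) hqm.aestronglyMeasurable (ae_of_all _ fun l' => K.bq _ _)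
  have hdi := g.integrable_dsol K hn η
  have e1 : nonlin q (dsol σ q q' n) k l η = srcB q l η + nonlin q (dreg σ q q' n) k l η := by
    have h1 : srcB q l η = ∫ l', q (l - l') η * (ph k l' (-η) * bdry q k l' η) := by
      unfold srcB
      refine integral_congr_ae (ae_of_all _ fun l' => ?_)
      simp only [bdry]
      linear_combination -(q (l - l') η * I * (η / l') * q l' η) * ph_mul_ph_neg k l' η
    have hdr : Integrable fun l' => dreg σ q q' n k l' η := hdi.sub hbi
    rw [h1, nonlin, nonlin, ← integral_add (hbd hbi) (hbd hdr)]
    refine integral_congr_ae (ae_of_all _ fun l' => ?_)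
    simp only [dreg]; ring
  rw [dnonlin, g.deriv_nonlin_eq K hn hσ hη l, e1]
  ring

theorem GoodParam.integrable_dnonlin {k : ℝ} (g : GoodParam σ q q' n U k) (K : KPot q q' r U)
    (hn : Measurable₃ n) (l : ℝ) :
    Integrable (dnonlin q q' n k l) := by
  have h := (K.integrable_dintegrand hn g l).sub ((K.integrable_dlin k l).const_mul (√(2 * π) : ℂ))
  refine h.congr (ae_of_all _ fun η => ?_)
  simp only [Pi.sub_apply, dintegrand_eq]; ring

/-- Only the term with `srcB` must be kept inside the integral, since its absolute value has no
decay in `k`. All others already lie in `L²(dk)` and may be estimated by their absolute values. -/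
theorem GoodParam.enorm_setIntegral_dnonlin_le {k : ℝ} (g : GoodParam σ q q' n U k)
    (K : KPot q q' r U) (hn : Measurable₃ n)
    (hσ : σ = 1 ∨ σ = -1) {l : ℝ} (hl : Integrable (srcB q l)) (s : Set ℝ) :
    ‖∫ η in s, dnonlin q q' n k l η‖ₑ ≤ ‖∫ η in s, ph k l η * srcB q l η‖ₑ +
      majD σ q q' n k l := by
  set G : ℝ → ℂ := fun η => dnonlin q q' n k l η - ph k l η * srcB q l η with hG
  have hi1 := g.integrable_dnonlin K hn l
  have hi2 := integrable_ph_mul k l hl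
  have hGi : Integrable G := hi1.sub hi2
  have h1 := enorm_integral_add_le (μ := volume.restrict s) hi2.integrableOn hGi.integrableOn.1
  have h2 : ∫ η in s, (ph k l η * srcB q l η + G η) = ∫ η in s, dnonlin q q' n k l η := by
    refine integral_congr_ae (ae_of_all _ fun η => ?_)
    simp only [hG]; ring
  rw [h2] at h1
  refine h1.trans ?_
  gcongr
  refine (setLIntegral_le_lintegral _ _).trans ?_
  have hq1 : Measurable (uncurry fun s η : ℝ => (s * η * q s η : ℂ)) := by
    have h3 : Measurable fun x : ℝ × ℝ => q x.1 x.2 := K.mq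
    change Measurable fun x : ℝ × ℝ => (x.1 * x.2 * q x.1 x.2 : ℂ)
    fun_prop
  have hc : ∀ {p : ℝ → ℝ → ℂ} {a : ℝ → ℝ → ℝ → ℝ≥0∞}, Measurable (uncurry p) →
      (Measurable fun x : ℝ × ℝ × ℝ => a x.1 x.2.1 x.2.2) →
      Measurable fun η => ∫⁻ l', ‖p (l - l') η‖ₑ * a k l' η := by
    intro p a hp ha
    refine Measurable.lintegral_prod_right' (f := fun x : ℝ × ℝ => ‖p (l - x.2) x.1‖ₑ * a k x.2 x.1) ?_
    exact (hp.comp (f := fun x : ℝ × ℝ => (l - x.2, x.1)) (by fun_prop)).enorm.mul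
      (ha.comp (f := fun x : ℝ × ℝ => (k, x.2, x.1)) (by fun_prop))
  have hqe : Measurable fun η => ‖q l η‖ₑ := K.mq.of_uncurry_left.enorm
  calc ∫⁻ η, ‖G η‖ₑ ≤ ∫⁻ η, (2 * (∫⁻ l', ‖((l - l' : ℝ) * η * q (l - l') η : ℂ)‖ₑ * ‖n k l' η‖ₑ) +
        ‖jump σ q n k‖ₑ * ‖q l η‖ₑ + ∫⁻ l', ‖q (l - l') η‖ₑ * ‖dreg σ q q' n k l' η‖ₑ) := by
        refine lintegral_mono_ae ?_
        filter_upwards [g.nfin, K.bfin] with η hη hb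
        have h4 : G η = ph k l η *
          (2 * I * nonlin (fun s η => s * η * q s η) n k l η + q l η * jump σ q n k +
          nonlin q (dreg σ q q' n) k l η) := by
          simp only [hG]; rw [g.dnonlin_eq K hn hσ hη hb]; ring
        rw [h4, enorm_mul, enorm_ph, one_mul]
        refine (enorm_add_le _ _).trans (add_le_add ((enorm_add_le _ _).trans (add_le_add ?_ ?_)) ?_)
        · rw [enorm_mul]
          gcongr
          · rw [← ofReal_norm]; simp
          · exact enorm_nonlin_le (fun s η : ℝ => (s * η * q s η : ℂ)) _ _ _ _
        · rw [enorm_mul, mul_comm]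
        · exact enorm_nonlin_le _ _ _ _ _
    _ = majD σ q q' n k l := by
        have m1 := hc (a := fun k l y => ‖n k l y‖ₑ) hq1 hn.enorm
        have m2 := hc (a := fun k l y => ‖dreg σ q q' n k l y‖ₑ) K.mq (measurable_dreg σ K.mq K.mq' hn).enorm
        rw [lintegral_add_right _ m2, lintegral_add_left (m1.const_mul _), lintegral_const_mul _ m1,
          lintegral_const_mul _ hqe]
        rfl

/-- The majorant of the derivative of the scattering solution. -/
def majT (σ : ℝ) (q q' r : ℝ → ℝ → ℂ) (n : ℝ → ℝ → ℝ → ℂ) (s : Set ℝ) (k l : ℝ) : ℝ≥0∞ :=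
  ‖∫ η in s, ph k l η * src q q' r l η‖ₑ + i2π * (‖∫ η in s, ph k l η * srcB q l η‖ₑ +
    majD σ q q' n k l)

/-- Subtracting the boundary term is necessary because its modulus does not depend on `k`, so that
it is not in `L²(dk)` wherever it is nonzero. The remainder satisfies an inequality that reproduces
itself through the convolution in `majD`. -/
theorem KPot.enorm_dreg_le (K : KPot q q' r U)
    (hn : Measurable₃ n) (hσ : σ = 1 ∨ σ = -1) :
    ∀ᵐ l : ℝ, ∀ k, GoodParam σ q q' n U k → ∀ᵐ y : ℝ,
      ‖dreg σ q q' n k l y‖ₑ ≤ majT σ q q' r n (ray σ l y) k l := by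
  filter_upwards [K.dlin_by_parts, K.gint] with l hl hB k g
  have hσ0 : σ ≠ 0 := by rcases hσ with rfl | rfl <;> norm_num
  filter_upwards [(hl.2 k).2 σ hσ0] with y hy
  have hs := sqrt_two_pi_ne_zero
  have e1 : intFrom σ l y (dintegrand q q' n k l) = (√(2 * π) : ℂ) * intFrom σ l y (dlin q q' k l) +
      intFrom σ l y (dnonlin q q' n k l) := by
    rw [← intFrom_const_mul, ← intFrom_add _ _ _ ((K.integrable_dlin k l).const_mul _)
      (g.integrable_dnonlin K hn l)]
    rfl
  have e2 : dreg σ q q' n k l y = I * intFrom σ l y (fun η => ph k l η * src q q' r l η) +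
      I / (√(2 * π) : ℂ) * intFrom σ l y (dnonlin q q' n k l) := by
    rw [dreg, dsol, e1, hy, bdry]
    field_simp
    ring
  have hI := enorm_I
  rw [e2]
  refine (enorm_add_le _ _).trans ?_
  rw [enorm_mul, enorm_mul, enorm_I_div, hI, one_mul, intFrom_eq, intFrom_eq, enorm_mul, enorm_mul,
    enorm_raySign, one_mul, one_mul, majT]
  gcongr
  exact g.enorm_setIntegral_dnonlin_le K hn hσ hB _

theorem KPot.enorm_dtau_le (K : KPot q q' r U)
    (hn : Measurable₃ n) (hσ : σ = 1 ∨ σ = -1) :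
    ∀ᵐ l : ℝ, ∀ k, GoodParam σ q q' n U k →
      i2π * ‖∫ η, dintegrand q q' n k l η‖ₑ ≤ majT σ q q' r n Set.univ k l := by
  filter_upwards [K.dlin_by_parts, K.gint] with l hl hB k g
  have e1 : ∫ η, dintegrand q q' n k l η =
      (√(2 * π) : ℂ) * (∫ η, ph k l η * src q q' r l η) + ∫ η, dnonlin q q' n k l η := by
    rw [← (hl.2 k).1, ← integral_const_mul, ← integral_add ((K.integrable_dlin k l).const_mul _)
      (g.integrable_dnonlin K hn l)]
    rfl
  have h3 := i2π_mul_enorm_sqrt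
  have h4 := g.enorm_setIntegral_dnonlin_le K hn hσ hB Set.univ
  simp only [Measure.restrict_univ] at h4
  rw [e1, majT]
  simp only [Measure.restrict_univ]
  calc _ ≤ i2π * (‖((√(2 * π) : ℝ) : ℂ)‖ₑ * ‖∫ η, ph k l η * src q q' r l η‖ₑ +
        ‖∫ η, dnonlin q q' n k l η‖ₑ) := by
        gcongr; refine (enorm_add_le _ _).trans (le_of_eq ?_); rw [enorm_mul]
    _ = ‖∫ η, ph k l η * src q q' r l η‖ₑ + i2π * ‖∫ η, dnonlin q q' n k l η‖ₑ := by
        rw [mul_add, ← mul_assoc, h3, one_mul]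
    _ ≤ _ := by gcongr

variable {σ : ℝ} {q q' r : ℝ → ℝ → ℂ} {U : ℝ → ℝ} {n : ℝ → ℝ → ℝ → ℂ}

/-! ### A priori bounds for the solution -/

theorem submul_wt {ε : ℝ} (hε : 0 ≤ ε) (l s : ℝ) :
    1 + ε * |l| ≤ (1 + ε * |s|) * (1 + ε * |l - s|) := by
  have h1 : |l| ≤ |s| + |l - s| := by simpa using abs_add_le s (l - s)
  have h2 : 0 ≤ ε * |s| * (ε * |l - s|) := by positivity
  nlinarith [mul_le_mul_of_nonneg_left h1 hε]

theorem enorm_one_add_abs_mul (y : ℝ) (z : ℂ) : ‖((1 + |y| : ℝ) : ℂ) * z‖ₑ = wt y * ‖z‖ₑ := by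
  rw [enorm_mul, ← ofReal_norm, Complex.norm_real, norm_eq_abs,
    abs_of_pos (by positivity), wt]

theorem l2n_inv_wt_lt_top : l2n volume (fun l => (wt l)⁻¹) < ⊤ := by
  rw [l2n_lt_top_iff]
  have h1 : Integrable fun x : ℝ => (1 + ‖x‖) ^ (-2 : ℝ) := integrable_one_add_norm (by simp)
  refine lt_of_le_of_lt (lintegral_mono fun l => ?_) h1.2
  have h0 : 0 < 1 + |l| := by positivity
  rw [wt, ← ENNReal.ofReal_inv_of_pos h0, ← ofReal_pow (by positivity),
    enorm_of_nonneg (by positivity)]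
  refine ofReal_le_ofReal (le_of_eq ?_)
  simp only [norm_eq_abs]
  rw [Real.rpow_neg (by positivity), inv_pow, Real.rpow_two]

/-- Cauchy-Schwarz in `l`: one power of the weight buys the passage from `L²(dl)` to `L¹(dl)`. -/
theorem normZ_sq_le {a : ℝ → ℝ → ℝ → ℝ≥0∞} (ha : Measurable fun p : ℝ × ℝ × ℝ => a p.1 p.2.1 p.2.2)
    (y : ℝ) : normZ (fun l => wt l ^ 2) a y ≤
      l2n volume (fun l => (wt l)⁻¹) * normX (fun l => wt l ^ 3) a y := by
  have hay : Measurable (uncurry fun k l : ℝ => wt l ^ 3 * a k l y) :=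
    ((measurable_wt.pow_const 3).comp measurable_snd).mul
      (ha.comp (f := fun p : ℝ × ℝ => (p.1, p.2, y)) (by fun_prop))
  have h1 : normX (fun l => wt l ^ 3) a y =
      l2n volume fun l => l2n volume fun k => wt l ^ 3 * a k l y := by
    rw [normX, Measure.volume_eq_prod, ← l2n_swap hay, ← l2n_prod hay]; rfl
  have hm : Measurable fun l => l2n volume fun k => wt l ^ 3 * a k l y := measurable_l2n_left hay
  rw [h1, normZ]
  refine le_trans (lintegral_mono fun l => ?_) (lintegral_mul_le_l2n (measurable_wt.inv).aemeasurable
    hm.aemeasurable)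
  have hk : Measurable fun k => a k l y := ha.comp (f := fun k : ℝ => (k, l, y)) (by fun_prop)
  rw [l2n_const_mul _ hk.aemeasurable, ← mul_assoc]
  gcongr
  have h0 : wt l ≠ 0 := (zero_lt_one.trans_le (one_le_wt l)).ne'
  rw [pow_succ' (wt l) 2, ← mul_assoc, ENNReal.inv_mul_cancel h0 (wt_lt_top l).ne, one_mul]

/-- The strict inequality `c < 1` survives a small perturbation. For `ε ≤ 1` the excess of
`(1+ε|s|)³` over `1` is at most `7ε(1+|s|)³`, the constant being `3 + 3 + 1`, and the third moment
of `q` is finite. -/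
theorem KPot.exists_weight (K : KPot q q' r U) (hc : i2π * ∫⁻ η, ∫⁻ s, ‖q s η‖ₑ < 1) :
    ∃ ε : ℝ, 0 < ε ∧ ε ≤ 1 ∧
      i2π * ∫⁻ η, ∫⁻ s, ofReal ((1 + ε * |s|) ^ 3) * ‖q s η‖ₑ < 1 := by
  set A : ℝ≥0∞ := ∫⁻ y, ∫⁻ l, wt l ^ 3 * ‖q l y‖ₑ with hA
  have hAt : A < ⊤ := by
    refine lt_of_le_of_lt (lintegral_mono fun y => lintegral_mono fun l => ?_) K.w3
    exact mul_le_mul_right (le_mul_of_one_le_left zero_le (one_le_wt y)) _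
  have hm0 : Measurable fun y => ∫⁻ l, ‖q l y‖ₑ :=
    Measurable.lintegral_prod_right' (f := fun p : ℝ × ℝ => ‖q p.2 p.1‖ₑ)
      (K.mq.comp measurable_swap).enorm
  have hq : ∀ y, Measurable fun l => ‖q l y‖ₑ := fun y => K.mq.of_uncurry_right.enorm
  have key : ∀ ε : ℝ, 0 < ε → ε ≤ 1 →
      i2π * ∫⁻ η, ∫⁻ s, ofReal ((1 + ε * |s|) ^ 3) * ‖q s η‖ₑ ≤
        i2π * (∫⁻ η, ∫⁻ s, ‖q s η‖ₑ) + ofReal ε * (i2π * (7 * A)) := by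
    intro ε h0 h1
    have hle : ∫⁻ η, ∫⁻ s, ofReal ((1 + ε * |s|) ^ 3) * ‖q s η‖ₑ ≤
        (∫⁻ η, ∫⁻ s, ‖q s η‖ₑ) + ofReal (7 * ε) * A := by
      rw [hA, ← lintegral_const_mul' _ _ ENNReal.ofReal_ne_top, ← lintegral_add_left hm0]
      refine lintegral_mono fun y => ?_
      rw [← lintegral_const_mul' _ _ ENNReal.ofReal_ne_top, ← lintegral_add_left (hq y)]
      refine lintegral_mono fun s => ?_
      have hs := abs_nonneg s
      have h2 : (1 + ε * |s|) ^ 3 ≤ 1 + 7 * ε * (1 + |s|) ^ 3 := by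
        have e1 : ε * |s| ≤ ε * (1 + |s|) ^ 3 := by gcongr; nlinarith [mul_nonneg hs hs, pow_nonneg hs 3]
        have e2 : (ε * |s|) ^ 2 ≤ ε * (1 + |s|) ^ 3 := by
          have : ε ^ 2 ≤ ε := by nlinarith
          calc (ε * |s|) ^ 2 = ε ^ 2 * |s| ^ 2 := by ring
            _ ≤ ε * (1 + |s|) ^ 3 := by
              gcongr
              nlinarith [mul_nonneg hs hs, pow_nonneg hs 3]
        have e3 : (ε * |s|) ^ 3 ≤ ε * (1 + |s|) ^ 3 := by
          have : ε ^ 3 ≤ ε := by nlinarith [mul_nonneg h0.le h0.le]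
          calc (ε * |s|) ^ 3 = ε ^ 3 * |s| ^ 3 := by ring
            _ ≤ ε * (1 + |s|) ^ 3 := by gcongr; linarith
        nlinarith
      calc ofReal ((1 + ε * |s|) ^ 3) * ‖q s y‖ₑ
          ≤ ofReal (1 + 7 * ε * (1 + |s|) ^ 3) * ‖q s y‖ₑ := by gcongr
        _ = _ := by
          rw [ENNReal.ofReal_add (by positivity) (by positivity), ofReal_one, add_mul, one_mul,
            ofReal_mul (by positivity), ofReal_pow (by positivity), wt, mul_assoc]
    refine (mul_le_mul_right hle _).trans (le_of_eq ?_)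
    rw [mul_add, mul_comm 7 ε, ofReal_mul h0.le]
    norm_num
    ring
  have hB : i2π * (7 * A) < ⊤ := mul_lt_top i2π_lt_top (mul_lt_top (by simp) hAt)
  have hlim : Tendsto (fun ε : ℝ => i2π * (∫⁻ η, ∫⁻ s, ‖q s η‖ₑ) +
      ofReal ε * (i2π * (7 * A))) (nhdsWithin 0 (Ioi 0))
      (nhds (i2π * (∫⁻ η, ∫⁻ s, ‖q s η‖ₑ) + ofReal 0 * (i2π * (7 * A)))) := by
    refine Filter.Tendsto.const_add _ (ENNReal.Tendsto.mul_const ?_ (Or.inr hB.ne))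
    exact ((ENNReal.continuous_ofReal.tendsto 0).mono_left nhdsWithin_le_nhds)
  rw [ENNReal.ofReal_zero, zero_mul, add_zero] at hlim
  have h1 := hlim.eventually (gt_mem_nhds hc)
  have h2 : ∀ᶠ ε : ℝ in nhdsWithin 0 (Ioi 0), ε ≤ 1 :=
    nhdsWithin_le_nhds (Iic_mem_nhds zero_lt_one)
  obtain ⟨ε, hε⟩ := (h1.and (h2.and self_mem_nhdsWithin)).exists
  exact ⟨ε, hε.2.2, hε.2.1, (key ε hε.2.2 hε.2.1).trans_lt hε.1⟩

theorem wt_le_mul {ε : ℝ} (h0 : 0 < ε) (h1 : ε ≤ 1) (l : ℝ) :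
    wt l ≤ ofReal ε⁻¹ * ofReal (1 + ε * |l|) := by
  rw [wt, ← ofReal_mul (by positivity)]
  refine ofReal_le_ofReal ?_
  have : 1 ≤ ε⁻¹ := (one_le_inv₀ h0).2 h1
  rw [mul_add, ← mul_assoc, inv_mul_cancel₀ h0.ne']
  linarith

/-- Weighted bounds for solutions of the integral equation with a regular potential. -/
theorem InteractionSol.exists_bound (h : InteractionSol σ q n) (K : KPot q q' r U)
    (hc : i2π * ∫⁻ η, ∫⁻ s, ‖q s η‖ₑ < 1) :
    ∃ C : ℝ≥0∞, C < ⊤ ∧ (∀ y, normX (fun l => wt l ^ 3) (fun k l y => ‖n k l y‖ₑ) y ≤ C) ∧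
      l2n volume (fun p : ℝ × ℝ => wt p.2 ^ 3 * ‖tau q n p.1 p.2‖ₑ) ≤ C ∧
      ∀ y, normZ (fun l => wt l ^ 2) (fun k l y => ‖n k l y‖ₑ) y ≤ C := by
  obtain ⟨ε, h0, h1, hε⟩ := K.exists_weight hc
  -- This weight is comparable to `wt l ^ 3` with constants depending on `ε`, so the contraction
  -- loses nothing but a finite factor `ε⁻³`.
  set w : ℝ → ℝ≥0∞ := fun l => ofReal ((1 + ε * |l|) ^ 3) with hw
  have hwm : Measurable w := by fun_prop
  have hsub : ∀ l s, w l ≤ w s * w (l - s) := fun l s => by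
    rw [hw]
    simp only
    rw [← ofReal_mul (by positivity), ← mul_pow]
    gcongr
    exact submul_wt h0.le l s
  have hw1 : ∀ l, 1 ≤ w l := fun l => by
    rw [hw]; simp only; rw [ENNReal.one_le_ofReal]
    exact one_le_pow₀ (by nlinarith [abs_nonneg l])
  have hww : ∀ l, w l ≤ wt l ^ 3 := fun l => by
    rw [hw, wt, ← ofReal_pow (by positivity)]
    simp only
    gcongr
    nlinarith [abs_nonneg l]
  have hwt : ∀ l, wt l ^ 3 ≤ ofReal ε⁻¹ ^ 3 * w l := fun l => by
    have := pow_le_pow_left₀ (zero_le) (wt_le_mul h0 h1 l) 3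
    rwa [mul_pow, ← ofReal_pow (by positivity : 0 ≤ 1 + ε * |l|)] at this
  obtain ⟨b1, b2⟩ := h.weighted_bounds K.mq K.integrable_q hwm hsub hw1
    (fun l => ofReal_lt_top) hε le_rfl
  set B := srcX w q / (1 - i2π * ∫⁻ η, ∫⁻ s, w s * ‖q s η‖ₑ) with hB
  have hBt : B < ⊤ := by
    refine ENNReal.div_lt_top ((srcX_mono hww q).trans_lt K.x3).ne ?_
    exact (tsub_pos_of_lt hε).ne'
  set E : ℝ≥0∞ := ofReal ε⁻¹ ^ 3 with hE
  have hEt : E < ⊤ := ENNReal.pow_lt_top ofReal_lt_top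
  have hnm : ∀ y, Measurable fun p : ℝ × ℝ => w p.2 * ‖n p.1 p.2 y‖ₑ := fun y =>
    (hwm.comp measurable_snd).mul (h.meas.enorm.comp (f := fun p : ℝ × ℝ => (p.1, p.2, y)) (by fun_prop))
  have c1 : ∀ y, normX (fun l => wt l ^ 3) (fun k l y => ‖n k l y‖ₑ) y ≤ E * B := fun y => by
    calc normX (fun l => wt l ^ 3) (fun k l y => ‖n k l y‖ₑ) y
        ≤ l2n volume (fun p : ℝ × ℝ => E * (w p.2 * ‖n p.1 p.2 y‖ₑ)) := by
          refine l2n_mono fun p => ?_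
          rw [← mul_assoc]; gcongr; exact hwt _
      _ = E * normX w (fun k l y => ‖n k l y‖ₑ) y := l2n_const_mul _ (hnm y).aemeasurable
      _ ≤ _ := by gcongr; exact b1 y
  have htm : Measurable fun p : ℝ × ℝ => w p.2 * ‖tau q n p.1 p.2‖ₑ :=
    (hwm.comp measurable_snd).mul (measurable_tau K.mq h.meas).enorm
  have c2 : l2n volume (fun p : ℝ × ℝ => wt p.2 ^ 3 * ‖tau q n p.1 p.2‖ₑ) ≤ E * (B / i2π) := by
    calc _ ≤ l2n volume (fun p : ℝ × ℝ => E * (w p.2 * ‖tau q n p.1 p.2‖ₑ)) := by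
          refine l2n_mono fun p => ?_
          rw [← mul_assoc]; gcongr; exact hwt _
      _ = E * l2n volume (fun p : ℝ × ℝ => w p.2 * ‖tau q n p.1 p.2‖ₑ) :=
          l2n_const_mul _ htm.aemeasurable
      _ ≤ _ := by
          gcongr
          rw [ENNReal.le_div_iff_mul_le (.inl i2π_ne_zero) (.inl i2π_ne_top), mul_comm]
          exact b2
  have c3 : ∀ y, normZ (fun l => wt l ^ 2) (fun k l y => ‖n k l y‖ₑ) y ≤
      l2n volume (fun l => (wt l)⁻¹) * (E * B) := fun y =>
    (normZ_sq_le h.meas.enorm y).trans (by gcongr; exact c1 y)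
  have f1 : E * B < ⊤ := mul_lt_top hEt hBt
  have f2 : E * (B / i2π) < ⊤ := mul_lt_top hEt (ENNReal.div_lt_top hBt.ne i2π_ne_zero)
  have f3 : l2n volume (fun l => (wt l)⁻¹) * (E * B) < ⊤ := mul_lt_top l2n_inv_wt_lt_top f1
  refine ⟨E * B + E * (B / i2π) + l2n volume (fun l => (wt l)⁻¹) * (E * B), ?_, fun y => ?_, ?_, fun y => ?_⟩
  · exact add_lt_top.2 ⟨add_lt_top.2 ⟨f1, f2⟩, f3⟩
  · exact (c1 y).trans ((le_add_right le_rfl).trans (le_add_right le_rfl))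
  · exact c2.trans ((le_add_left le_rfl).trans (le_add_right le_rfl))
  · exact (c3 y).trans (le_add_left le_rfl)

theorem measurable_wn (h : Measurable₃ n) :
    Measurable fun p : ℝ × ℝ × ℝ => wt p.2.1 * ‖n p.1 p.2.1 p.2.2‖ₑ :=
  (measurable_wt.comp (f := fun p : ℝ × ℝ × ℝ => p.2.1) (by fun_prop)).mul h.enorm

theorem wt_le_wt_pow (l : ℝ) {m : ℕ} (hm : m ≠ 0) : wt l ≤ wt l ^ m := le_self_pow₀ (one_le_wt l) hm

theorem l2n_massN_le (h : Measurable₃ n) (y : ℝ) :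
    l2n volume (fun k => massN n k y) ≤ normZ (fun l => wt l ^ 2) (fun k l y => ‖n k l y‖ₑ) y := by
  have hm := (measurable_wn h).comp (f := fun p : ℝ × ℝ => (p.1, p.2, y)) (by fun_prop)
  unfold massN
  refine (l2n_lintegral_le (F := fun k l => wt l * ‖n k l y‖ₑ) hm).trans (lintegral_mono fun l => ?_)
  have hk : Measurable fun k => ‖n k l y‖ₑ :=
    h.enorm.comp (f := fun k : ℝ => (k, l, y)) (by fun_prop)
  rw [l2n_const_mul _ hk.aemeasurable]
  gcongr
  exact wt_le_wt_pow l two_ne_zero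

/-- The majorant of `∫ |dintegrand| dη`, up to powers of `k`. -/
def majI (q q' : ℝ → ℝ → ℂ) (n : ℝ → ℝ → ℝ → ℂ) (k l : ℝ) : ℝ≥0∞ :=
  wt l * majConv (fun s η => ((1 + |η| : ℝ) : ℂ) * q s η) (fun k l y => ‖n k l y‖ₑ) k l +
    majConv q' (fun k l y => ‖n k l y‖ₑ) k l

/-- The contribution of the linear terms to `∫ |dintegrand| dη`. -/
def majL (q q' : ℝ → ℝ → ℂ) (l : ℝ) : ℝ≥0∞ :=
  (wt l * ∫⁻ η, wt η * ‖q l η‖ₑ) + ∫⁻ η, ‖q' l η‖ₑ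

theorem measurable_weighted_q (hq : Measurable (uncurry q)) :
    Measurable (uncurry fun s η : ℝ => ((1 + |η| : ℝ) : ℂ) * q s η) := by
  have h3 : Measurable fun x : ℝ × ℝ => q x.1 x.2 := hq
  change Measurable fun x : ℝ × ℝ => ((1 + |x.2| : ℝ) : ℂ) * q x.1 x.2
  fun_prop

/-- A crude bound by absolute values, which grows like `1 + |k|`. It serves only to know that
quantities are finite, for almost every `k` or after restriction to bounded `k`; the bound uniform
in `k` comes from the integrations by parts. -/
theorem KPot.lintegral_enorm_dintegrand_le (K : KPot q q' r U)
    (hn : Measurable₃ n) (k l : ℝ) :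
    ∫⁻ η, ‖dintegrand q q' n k l η‖ₑ ≤ wt k * (2 * ofReal √(2 * π) * majL q q' l +
      2 * majI q q' n k l) := by
  have hk := one_le_wt k
  have hc : ∀ η : ℝ, ‖(2 * I * (l + k) * η : ℂ)‖ₑ ≤ 2 * (wt l * wt k * wt η) := by
    intro η
    rw [← ofReal_norm, ← Complex.ofReal_add, norm_mul, norm_mul, norm_mul, Complex.norm_real,
      Complex.norm_real, Complex.norm_I, Complex.norm_ofNat, mul_one, wt, wt, wt,
      ← ofReal_mul (by positivity), ← ofReal_mul (by positivity),
      ← ENNReal.ofReal_ofNat 2, ← ofReal_mul (by positivity)]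
    refine ofReal_le_ofReal ?_
    rw [mul_assoc]
    gcongr
    · rw [norm_eq_abs]
      have := abs_add_le l k
      nlinarith [abs_nonneg l, abs_nonneg k, mul_nonneg (abs_nonneg l) (abs_nonneg k)]
    · rw [norm_eq_abs]; linarith
  have hs : ‖((√(2 * π) : ℝ) : ℂ)‖ₑ = ofReal √(2 * π) := by
    rw [enorm_real, enorm_of_nonneg (sqrt_nonneg _)]
  have hmq : ∀ {p : ℝ → ℝ → ℂ}, Measurable (uncurry p) → Measurable fun η =>
      ∫⁻ l', ‖p (l - l') η‖ₑ * ‖n k l' η‖ₑ := fun {p} hp => by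
    refine Measurable.lintegral_prod_right' (f := fun x : ℝ × ℝ => ‖p (l - x.2) x.1‖ₑ * ‖n k x.2 x.1‖ₑ) ?_
    exact (hp.comp (f := fun x : ℝ × ℝ => (l - x.2, x.1)) (by fun_prop)).enorm.mul
      (hn.enorm.comp (f := fun x : ℝ × ℝ => (k, x.2, x.1)) (by fun_prop))
  have hql : Measurable fun η => ‖q l η‖ₑ := K.mq.of_uncurry_left.enorm
  have hql' : Measurable fun η => ‖q' l η‖ₑ := K.mq'.of_uncurry_left.enorm
  have m2 := hmq (measurable_weighted_q K.mq)
  have m3 := hmq K.mq'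
  have m23 : Measurable fun η => 2 * (wt l * wt k) *
      (∫⁻ l', ‖((1 + |η| : ℝ) : ℂ) * q (l - l') η‖ₑ * ‖n k l' η‖ₑ) +
        ∫⁻ l', ‖q' (l - l') η‖ₑ * ‖n k l' η‖ₑ := (m2.const_mul _).add m3
  calc ∫⁻ η, ‖dintegrand q q' n k l η‖ₑ
      ≤ ∫⁻ η, (ofReal √(2 * π) * (2 * (wt l * wt k * (wt η * ‖q l η‖ₑ)) + ‖q' l η‖ₑ) +
        (2 * (wt l * wt k) * (∫⁻ l', ‖((1 + |η| : ℝ) : ℂ) * q (l - l') η‖ₑ * ‖n k l' η‖ₑ) +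
          ∫⁻ l', ‖q' (l - l') η‖ₑ * ‖n k l' η‖ₑ)) := by
        refine lintegral_mono fun η => ?_
        unfold dintegrand
        refine (enorm_add_le _ _).trans (add_le_add ?_ ?_)
        · rw [enorm_mul, enorm_mul, enorm_ph, one_mul, hs]
          gcongr
          refine (enorm_add_le _ _).trans (add_le_add ?_ le_rfl)
          rw [enorm_mul]
          refine (mul_le_mul_left (hc η) _).trans (le_of_eq (by ring))
        · rw [enorm_mul, enorm_ph, one_mul]
          refine (enorm_add_le _ _).trans (add_le_add ?_ (enorm_nonlin_le _ _ _ _ _))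
          rw [enorm_mul]
          have : ∫⁻ l', ‖((1 + |η| : ℝ) : ℂ) * q (l - l') η‖ₑ * ‖n k l' η‖ₑ =
              wt η * ∫⁻ l', ‖q (l - l') η‖ₑ * ‖n k l' η‖ₑ := by
            rw [← lintegral_const_mul' _ _ (wt_lt_top η).ne]
            refine lintegral_congr fun l' => ?_
            rw [enorm_one_add_abs_mul, mul_assoc]
          rw [this]
          refine (mul_le_mul' (hc η) (enorm_nonlin_le q n k l η)).trans (le_of_eq (by ring))
    _ = ofReal √(2 * π) * (2 * (wt l * wt k * ∫⁻ η, wt η * ‖q l η‖ₑ) + ∫⁻ η, ‖q' l η‖ₑ) +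
        (2 * (wt l * wt k) * majConv (fun s η => ((1 + |η| : ℝ) : ℂ) * q s η)
          (fun k l y => ‖n k l y‖ₑ) k l + majConv q' (fun k l y => ‖n k l y‖ₑ) k l) := by
        rw [lintegral_add_right _ (m23), lintegral_add_left (m2.const_mul _),
          lintegral_const_mul _ m2, lintegral_const_mul' _ _ ENNReal.ofReal_ne_top,
          lintegral_add_right _ hql', lintegral_const_mul' _ _ (by simp),
          lintegral_const_mul _ (show Measurable fun η => wt η * ‖q l η‖ₑ from measurable_wt.mul hql)]
        rfl
    _ ≤ _ := by
        have e : ∀ x : ℝ≥0∞, x ≤ 2 * (wt k * x) := fun x => by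
          calc x = 1 * (1 * x) := by ring
            _ ≤ 2 * (wt k * x) := by gcongr; norm_num
        calc _ ≤ ofReal √(2 * π) * (2 * (wt l * wt k * ∫⁻ η, wt η * ‖q l η‖ₑ) +
              2 * (wt k * ∫⁻ η, ‖q' l η‖ₑ)) +
              (2 * (wt l * wt k) * majConv (fun s η => ((1 + |η| : ℝ) : ℂ) * q s η)
              (fun k l y => ‖n k l y‖ₑ) k l +
              2 * (wt k * majConv q' (fun k l y => ‖n k l y‖ₑ) k l)) := by
              gcongr
              · exact e _
              · exact e _
          _ = _ := by unfold majL majI; ring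

theorem measurable_majI (hq : Measurable (uncurry q)) (hq' : Measurable (uncurry q'))
    (hn : Measurable₃ n) :
    Measurable fun p : ℝ × ℝ => majI q q' n p.1 p.2 :=
  ((measurable_wt.comp measurable_snd).mul
    (measurable_majConv (measurable_weighted_q hq) hn.enorm)).add (measurable_majConv hq' hn.enorm)

theorem measurable_majL (hq : Measurable (uncurry q)) (hq' : Measurable (uncurry q')) :
    Measurable (majL q q') := by
  have h1 : Measurable fun l => ∫⁻ η, wt η * ‖q l η‖ₑ :=
    Measurable.lintegral_prod_right' (f := fun p : ℝ × ℝ => wt p.2 * ‖q p.1 p.2‖ₑ)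
      ((measurable_wt.comp measurable_snd).mul hq.enorm)
  have h2 : Measurable fun l => ∫⁻ η, ‖q' l η‖ₑ :=
    Measurable.lintegral_prod_right' (f := fun p : ℝ × ℝ => ‖q' p.1 p.2‖ₑ) hq'.enorm
  exact (measurable_wt.mul h1).add h2

theorem KPot.lintegral_majL (K : KPot q q' r U) : ∫⁻ l, wt l * majL q q' l < ⊤ := by
  have hq := K.mq.enorm
  have h1 : Measurable fun p : ℝ × ℝ => wt p.1 ^ 3 * (wt p.2 * ‖q p.1 p.2‖ₑ) :=
    (measurable_wt.comp measurable_fst).pow_const 3 |>.mul ((measurable_wt.comp measurable_snd).mul hq)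
  have h2 : Measurable fun p : ℝ × ℝ => wt p.1 * ‖q' p.1 p.2‖ₑ :=
    (measurable_wt.comp measurable_fst).mul K.mq'.enorm
  have e1 : ∫⁻ l, ∫⁻ y, wt l ^ 3 * (wt y * ‖q l y‖ₑ) < ⊤ := by
    rw [lintegral_lintegral_swap h1.aemeasurable]; exact K.w3
  have e2 : ∫⁻ l, ∫⁻ y, wt l * ‖q' l y‖ₑ < ⊤ := by
    rw [lintegral_lintegral_swap h2.aemeasurable]; exact K.w1'
  have m1 : Measurable fun l => ∫⁻ y, wt l ^ 3 * (wt y * ‖q l y‖ₑ) :=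
    Measurable.lintegral_prod_right' (f := fun p : ℝ × ℝ => wt p.1 ^ 3 * (wt p.2 * ‖q p.1 p.2‖ₑ)) h1
  refine lt_of_le_of_lt (lintegral_mono fun l => ?_) ((lintegral_add_left m1 _).trans_lt
    (add_lt_top.2 ⟨e1, e2⟩))
  rw [lintegral_const_mul' _ _ (ENNReal.pow_lt_top (wt_lt_top l)).ne,
    lintegral_const_mul' _ _ (wt_lt_top l).ne, majL, mul_add, ← mul_assoc]
  gcongr
  rw [← pow_two]
  exact pow_le_pow_right₀ (one_le_wt l) (by norm_num)

theorem submul_wt_pow (m : ℕ) (l s : ℝ) : wt l ^ m ≤ wt s ^ m * wt (l - s) ^ m := by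
  rw [← mul_pow]
  gcongr
  rw [wt, wt, wt, ← ofReal_mul (by positivity)]
  refine ofReal_le_ofReal ?_
  simpa using submul_wt zero_le_one l s

theorem KPot.lintegral_majI (K : KPot q q' r U)
    (hn : Measurable₃ n) {C : ℝ≥0∞} (hC : C < ⊤)
    (hz : ∀ y, normZ (fun l => wt l ^ 2) (fun k l y => ‖n k l y‖ₑ) y ≤ C) :
    ∫⁻ l, wt l * l2n volume (fun k => majI q q' n k l) < ⊤ := by
  have mw2 : Measurable fun l => wt l ^ 2 := measurable_wt.pow_const 2
  have mI1 := measurable_majConv (a := fun k l y => ‖n k l y‖ₑ) (measurable_weighted_q K.mq) hn.enorm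
  have mI2 := measurable_majConv (a := fun k l y => ‖n k l y‖ₑ) K.mq' hn.enorm
  have hz1 : ∀ y, normZ wt (fun k l y => ‖n k l y‖ₑ) y ≤ C := fun y =>
    (lintegral_mono fun l => by gcongr; exact wt_le_wt_pow l two_ne_zero).trans (hz y)
  have e1 : ∫⁻ l, wt l ^ 2 * l2n volume (fun k => majConv (fun s η => ((1 + |η| : ℝ) : ℂ) * q s η)
      (fun k l y => ‖n k l y‖ₑ) k l) < ⊤ := by
    refine (lintegral_l2n_majConv_le (measurable_weighted_q K.mq) hn.enorm mw2 (submul_wt_pow 2)).trans_lt ?_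
    have : (∫⁻ y, ∫⁻ l, wt l ^ 3 * (wt y * ‖q l y‖ₑ)) * C < ⊤ := mul_lt_top K.w3 hC
    refine lt_of_le_of_lt ?_ this
    rw [← lintegral_mul_const' _ _ hC.ne]
    refine lintegral_mono fun y => mul_le_mul' (lintegral_mono fun l => ?_) (hz y)
    simp only [enorm_one_add_abs_mul]
    gcongr
    · exact one_le_wt l
    · norm_num
  have e2 : ∫⁻ l, wt l * l2n volume (fun k => majConv q' (fun k l y => ‖n k l y‖ₑ) k l) < ⊤ := by
    refine (lintegral_l2n_majConv_le K.mq' hn.enorm measurable_wt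
      (by simpa using submul_wt_pow 1)).trans_lt ?_
    have : (∫⁻ y, ∫⁻ l, wt l * ‖q' l y‖ₑ) * C < ⊤ := mul_lt_top K.w1' hC
    refine lt_of_le_of_lt ?_ this
    rw [← lintegral_mul_const' _ _ hC.ne]
    exact lintegral_mono fun y => mul_le_mul' le_rfl (hz1 y)
  have m1 : Measurable fun l => wt l ^ 2 * l2n volume (fun k => majConv
      (fun s η => ((1 + |η| : ℝ) : ℂ) * q s η) (fun k l y => ‖n k l y‖ₑ) k l) :=
    mw2.mul (measurable_l2n_left (F := fun k l => majConv (fun s η => ((1 + |η| : ℝ) : ℂ) * q s η)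
      (fun k l y => ‖n k l y‖ₑ) k l) mI1)
  refine lt_of_le_of_lt (lintegral_mono fun l => ?_) ((lintegral_add_left m1 _).trans_lt
    (add_lt_top.2 ⟨e1, e2⟩))
  have k1 := (mI1.comp (measurable_prodMk_right (y := l)))
  have k2 := (mI2.comp (measurable_prodMk_right (y := l)))
  calc wt l * l2n volume (fun k => majI q q' n k l) ≤ wt l * (wt l * _ + _) := by
        gcongr
        refine (l2n_add_le (k1.const_mul _).aemeasurable k2.aemeasurable).trans ?_
        gcongr
        · exact (l2n_const_mul _ k1.aemeasurable).le
    _ = _ := by rw [mul_add, ← mul_assoc, ← pow_two]; rfl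

/-- Almost every parameter is good. -/
theorem InteractionSol.ae_goodParam (h : InteractionSol σ q n) (K : KPot q q' r U)
    (hc : i2π * ∫⁻ η, ∫⁻ s, ‖q s η‖ₑ < 1) : ∀ᵐ k, GoodParam σ q q' n U k := by
  obtain ⟨C, hC, -, -, hz⟩ := h.exists_bound K hc
  have hn := h.meas
  have hM := measurable_massN hn
  -- Each of these quantities has finite `L²(dk)` norm by Minkowski's inequality and the a priori
  -- bounds, hence is finite for almost every `k`.
  have e1 : ∀ᵐ k : ℝ, ∫⁻ η : ℝ, ofReal ((1 + |η|) * U η) * massN n k η < ⊤ := by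
    have hU := K.mU
    have hm : Measurable fun p : ℝ × ℝ => ofReal ((1 + |p.2|) * U p.2) * massN n p.1 p.2 :=
      Measurable.mul (by fun_prop) hM
    refine ae_lt_top_of_l2n (Measurable.lintegral_prod_right' hm) ?_
    refine (l2n_lintegral_le hm).trans_lt ?_
    have h1 : (∫⁻ η, ofReal ((1 + |η|) * U η)) * C < ⊤ := by
      refine mul_lt_top ?_ hC
      refine lt_of_le_of_lt (lintegral_mono fun η => ?_) K.iU.2
      rw [← ofReal_norm]; exact ofReal_le_ofReal (le_abs_self _)
    refine lt_of_le_of_lt ?_ h1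
    rw [← lintegral_mul_const' _ _ hC.ne]
    refine lintegral_mono fun η => ?_
    have hMη : Measurable fun k => massN n k η := hM.comp measurable_prodMk_right
    rw [l2n_const_mul _ hMη.aemeasurable]
    gcongr
    exact (l2n_massN_le hn η).trans (hz η)
  have e2 : ∀ᵐ k : ℝ, ∀ᵐ η : ℝ, massN n k η < ⊤ := by
    rw [Measure.ae_ae_comm (p := fun k η => massN n k η < ⊤) (measurableSet_lt hM measurable_const)]
    refine ae_of_all _ fun η => ?_
    exact ae_lt_top_of_l2n (hM.comp measurable_prodMk_right)
      (((l2n_massN_le hn η).trans (hz η)).trans_lt hC)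
  have e3 : ∀ᵐ k : ℝ, ∫⁻ l, wt l * majI q q' n k l < ⊤ := by
    have hm : Measurable fun p : ℝ × ℝ => wt p.2 * majI q q' n p.1 p.2 :=
      (measurable_wt.comp measurable_snd).mul (measurable_majI K.mq K.mq' hn)
    refine ae_lt_top_of_l2n (Measurable.lintegral_prod_right' hm) ?_
    refine (l2n_lintegral_le hm).trans_lt ?_
    refine lt_of_le_of_lt (lintegral_mono fun l => ?_) (K.lintegral_majI hn hC hz)
    exact (l2n_const_mul _ ((measurable_majI K.mq K.mq' hn).comp measurable_prodMk_right).aemeasurable).le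
  filter_upwards [h.eqn, e1, e2, e3] with k h1 h2 h3 h4
  refine ⟨h1, h2, h3, ?_⟩
  have hL := measurable_majL K.mq K.mq'
  have hI : Measurable fun l => majI q q' n k l := (measurable_majI K.mq K.mq' hn).comp measurable_prodMk_left
  have mL : Measurable fun l => wt l * majL q q' l := measurable_wt.mul hL
  have mI : Measurable fun l => wt l * majI q q' n k l := measurable_wt.mul hI
  calc ∫⁻ l : ℝ, wt l * ∫⁻ η : ℝ, ‖dintegrand q q' n k l η‖ₑ
      ≤ ∫⁻ l, wt k * (2 * ofReal √(2 * π) * (wt l * majL q q' l) +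
        2 * (wt l * majI q q' n k l)) := by
        refine lintegral_mono fun l => ?_
        refine (mul_le_mul_right (K.lintegral_enorm_dintegrand_le hn k l) _).trans (le_of_eq (by ring))
    _ = wt k * (2 * ofReal √(2 * π) * (∫⁻ l, wt l * majL q q' l) +
        2 * ∫⁻ l, wt l * majI q q' n k l) := by
        rw [lintegral_const_mul' _ _ (wt_lt_top k).ne,
          lintegral_add_left (mL.const_mul _),
          lintegral_const_mul _ mL, lintegral_const_mul _ mI]
    _ < ⊤ := by
        refine mul_lt_top (wt_lt_top k) (add_lt_top.2 ⟨?_, ?_⟩)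
        · exact mul_lt_top (mul_lt_top (by simp) ofReal_lt_top) K.lintegral_majL
        · exact mul_lt_top (by simp) h4

variable {σ : ℝ} {q q' r : ℝ → ℝ → ℂ} {U : ℝ → ℝ} {n : ℝ → ℝ → ℝ → ℂ} {χ : ℝ → ℝ≥0∞}

/-! ### The bound for the derivative of the scattering data -/

theorem measurable_setIntegral_ph (l : ℝ) {g : ℝ → ℂ} (hg : Measurable g) (s : Set ℝ) :
    Measurable fun k : ℝ => ∫ η in s, ph k l η * g η := by
  refine StronglyMeasurable.measurable ?_
  refine StronglyMeasurable.integral_prod_right (f := fun k η => ph k l η * g η) ?_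
  refine Measurable.stronglyMeasurable ?_
  exact Measurable.mul (f := fun p : ℝ × ℝ => ph p.1 l p.2) (by fun_prop) (hg.comp measurable_snd)

theorem l2n_setIntegral_ph_le {l : ℝ} (hl : l ≠ 0) {g : ℝ → ℂ} (hg : Integrable g) {s : Set ℝ}
    (hs : MeasurableSet s) :
    l2n volume (fun k : ℝ => ‖∫ η in s, ph k l η * g η‖ₑ) ≤
      ofReal √(π / |l|) * l2n volume (fun η => ‖g η‖ₑ) := by
  have h := l2n_ph_le hl (hg.indicator hs)
  have h1 : ∀ k, ∫ η in s, ph k l η * g η = ∫ η, ph k l η * s.indicator g η := fun k => by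
    rw [← integral_indicator hs]
    simp only [Set.indicator_mul_right]
  simp_rw [h1]
  refine h.trans ?_
  gcongr
  refine l2n_mono fun η => ?_
  by_cases hη : η ∈ s <;> simp [hη]

/-- The truncated derivative of the scattering solution. -/
def adreg (σ : ℝ) (q q' : ℝ → ℝ → ℂ) (n : ℝ → ℝ → ℝ → ℂ) (χ : ℝ → ℝ≥0∞) (k l y : ℝ) : ℝ≥0∞ :=
  χ k * ‖dreg σ q q' n k l y‖ₑ

/-- The source of the equation for the derivative, in `L²(dk)`. -/
def majS (σ : ℝ) (q q' r : ℝ → ℝ → ℂ) (n : ℝ → ℝ → ℝ → ℂ) (l : ℝ) : ℝ≥0∞ :=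
  (ofReal √(π / |l|) * l2n volume fun η => ‖src q q' r l η‖ₑ) +
    i2π * (((ofReal √(π / |l|) * l2n volume fun η => ‖srcB q l η‖ₑ) +
    2 * l2n volume fun k => majConv (fun s η => s * η * q s η) (fun k l y => ‖n k l y‖ₑ) k l) +
    (l2n volume fun k => ‖jump σ q n k‖ₑ) * ∫⁻ η, ‖q l η‖ₑ)

theorem measurable_adreg (hq : Measurable (uncurry q))
    (hq' : Measurable (uncurry q'))
    (hn : Measurable₃ n) (hχ : Measurable χ) :
    Measurable fun p : ℝ × ℝ × ℝ => adreg σ q q' n χ p.1 p.2.1 p.2.2 :=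
  (hχ.comp measurable_fst).mul (measurable_dreg σ hq hq' hn).enorm

theorem measurable_sη_q (hq : Measurable (uncurry q)) :
    Measurable (uncurry fun s η : ℝ => (s * η * q s η : ℂ)) := by
  have h3 : Measurable fun x : ℝ × ℝ => q x.1 x.2 := hq
  change Measurable fun x : ℝ × ℝ => (x.1 * x.2 * q x.1 x.2 : ℂ)
  fun_prop

theorem measurable_jump (σ : ℝ) (hq : Measurable (uncurry q))
    (hn : Measurable₃ n) : Measurable (jump σ q n) := by
  have h : Measurable fun k => tau q n k 0 := (measurable_tau hq hn).comp (f := fun k : ℝ => (k, (0 : ℝ))) (by fun_prop)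
  unfold jump
  fun_prop

theorem l2n_combination_le {f₁ f₂ f₃ f₄ f₅ : ℝ → ℝ≥0∞} (m₁ : Measurable f₁) (m₂ : Measurable f₂)
    (m₃ : Measurable f₃) (m₄ : Measurable f₄) (m₅ : Measurable f₅) (i Q : ℝ≥0∞) :
    l2n volume (fun k => f₁ k + i * (((f₂ k + 2 * f₃ k) + Q * f₄ k) + f₅ k)) ≤
      l2n volume f₁ + i * (((l2n volume f₂ + 2 * l2n volume f₃) + Q * l2n volume f₄) +
        l2n volume f₅) := by
  have a1 : Measurable fun k => 2 * f₃ k := m₃.const_mul 2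
  have a2 : Measurable fun k => f₂ k + 2 * f₃ k := m₂.add a1
  have a3 : Measurable fun k => Q * f₄ k := m₄.const_mul Q
  have a4 : Measurable fun k => (f₂ k + 2 * f₃ k) + Q * f₄ k := a2.add a3
  have a5 : Measurable fun k => ((f₂ k + 2 * f₃ k) + Q * f₄ k) + f₅ k := a4.add m₅
  rw [← l2n_const_mul 2 m₃.aemeasurable, ← l2n_const_mul Q m₄.aemeasurable]
  refine (l2n_add_le m₁.aemeasurable (a5.const_mul i).aemeasurable).trans ?_
  rw [l2n_const_mul i a5.aemeasurable]
  gcongr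
  refine (l2n_add_le a4.aemeasurable m₅.aemeasurable).trans ?_
  gcongr
  refine (l2n_add_le a2.aemeasurable a3.aemeasurable).trans ?_
  gcongr
  exact l2n_add_le m₂.aemeasurable a1.aemeasurable

theorem mul_majConv (hχ : ∀ k, χ k ≤ 1) (k l : ℝ) :
    χ k * majConv q (fun k l y => ‖dreg σ q q' n k l y‖ₑ) k l = majConv q (adreg σ q q' n χ) k l := by
  have hk : χ k ≠ ⊤ := ((hχ k).trans_lt ENNReal.one_lt_top).ne
  unfold majConv adreg
  rw [← lintegral_const_mul' _ _ hk]
  refine lintegral_congr fun η => ?_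
  rw [← lintegral_const_mul' _ _ hk]
  refine lintegral_congr fun s => ?_
  ring

/-- The cutoff `χ ≤ 1` is dropped in the source terms but retained in the convolution with the
unknown. Thus the same truncated derivative stands on both sides of the inequality, with a source
independent of `χ`. -/
theorem l2n_majT_le (hq : Measurable (uncurry q))
    (hq' : Measurable (uncurry q')) (hr : Measurable (uncurry r))
    (hn : Measurable₃ n) (hχm : Measurable χ) (hχ : ∀ k, χ k ≤ 1)
    {l : ℝ} (hl : l ≠ 0) (h1 : Integrable (src q q' r l)) (h2 : Integrable (srcB q l)) {s : Set ℝ}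
    (hs : MeasurableSet s) :
    l2n volume (fun k => χ k * majT σ q q' r n s k l) ≤
      majS σ q q' r n l + i2π * l2n volume fun k => majConv q (adreg σ q q' n χ) k l := by
  have m1 : Measurable fun k => ‖∫ η in s, ph k l η * src q q' r l η‖ₑ :=
    (measurable_setIntegral_ph l (measurable_src hq hq' hr).of_uncurry_left s).enorm
  have m2 : Measurable fun k => ‖∫ η in s, ph k l η * srcB q l η‖ₑ :=
    (measurable_setIntegral_ph l (measurable_srcB hq).of_uncurry_left s).enorm
  have m3 : Measurable fun k => majConv (fun s η => s * η * q s η) (fun k l y => ‖n k l y‖ₑ) k l :=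
    (measurable_majConv (a := fun k l y => ‖n k l y‖ₑ) (measurable_sη_q hq) hn.enorm).comp
      (f := fun k : ℝ => (k, l)) (by fun_prop)
  have m4 : Measurable fun k => ‖jump σ q n k‖ₑ := (measurable_jump σ hq hn).enorm
  have m5 : Measurable fun k => majConv q (adreg σ q q' n χ) k l :=
    (measurable_majConv (a := adreg σ q q' n χ) hq (measurable_adreg hq hq' hn hχm)).comp
      (f := fun k : ℝ => (k, l)) (by fun_prop)
  have hpt : ∀ k, χ k * majT σ q q' r n s k l ≤ ‖∫ η in s, ph k l η * src q q' r l η‖ₑ +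
      i2π * (((‖∫ η in s, ph k l η * srcB q l η‖ₑ +
        2 * majConv (fun s η => s * η * q s η) (fun k l y => ‖n k l y‖ₑ) k l) +
        (∫⁻ η, ‖q l η‖ₑ) * ‖jump σ q n k‖ₑ) + majConv q (adreg σ q q' n χ) k l) := by
    intro k
    rw [← mul_majConv hχ, majT, majD]
    calc _ = χ k * ‖∫ η in s, ph k l η * src q q' r l η‖ₑ +
        i2π * ((χ k * ((‖∫ η in s, ph k l η * srcB q l η‖ₑ +
        2 * majConv (fun s η => s * η * q s η) (fun k l y => ‖n k l y‖ₑ) k l) +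
        (∫⁻ η, ‖q l η‖ₑ) * ‖jump σ q n k‖ₑ)) +
          χ k * majConv q (fun k l y => ‖dreg σ q q' n k l y‖ₑ) k l) := by ring
      _ ≤ _ := by
        gcongr
        · exact mul_le_of_le_one_left zero_le (hχ k)
        · exact mul_le_of_le_one_left zero_le (hχ k)
  have b1 := l2n_setIntegral_ph_le hl h1 hs
  have b2 := l2n_setIntegral_ph_le hl h2 hs
  calc _ ≤ _ := l2n_mono hpt
    _ ≤ _ := l2n_combination_le m1 m2 m3 m4 m5 i2π (∫⁻ η, ‖q l η‖ₑ)
    _ ≤ (ofReal √(π / |l|) * l2n volume fun η => ‖src q q' r l η‖ₑ) + i2π *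
      ((((ofReal √(π / |l|) * l2n volume fun η => ‖srcB q l η‖ₑ) +
      2 * l2n volume fun k => majConv (fun s η => s * η * q s η) (fun k l y => ‖n k l y‖ₑ) k l) +
      (∫⁻ η, ‖q l η‖ₑ) * l2n volume fun k => ‖jump σ q n k‖ₑ) +
      l2n volume fun k => majConv q (adreg σ q q' n χ) k l) :=
      add_le_add b1 (mul_le_mul_right (add_le_add (add_le_add (add_le_add b2 le_rfl) le_rfl) le_rfl) _)
    _ = _ := by
      unfold majS
      rw [mul_add, ← add_assoc, mul_comm (∫⁻ η, ‖q l η‖ₑ)]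

theorem measurable_majS (hq : Measurable (uncurry q))
    (hq' : Measurable (uncurry q')) (hr : Measurable (uncurry r))
    (hn : Measurable₃ n) : Measurable (majS σ q q' r n) := by
  have hsw : ∀ {p : ℝ → ℝ → ℂ}, Measurable (uncurry p) →
      Measurable fun l => l2n volume fun η => ‖p l η‖ₑ := fun {p} hp =>
    measurable_l2n_left (F := fun η l => ‖p l η‖ₑ) (hp.comp measurable_swap).enorm
  have m1 := hsw (measurable_src hq hq' hr)
  have m2 := hsw (measurable_srcB hq)
  have m3 := measurable_l2n_left (μ := (volume : Measure ℝ)) (F := fun k l => majConv (fun s η => s * η * q s η)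
    (fun k l y => ‖n k l y‖ₑ) k l)
    (measurable_majConv (a := fun k l y => ‖n k l y‖ₑ) (measurable_sη_q hq) hn.enorm)
  have m4 : Measurable fun l => ∫⁻ η, ‖q l η‖ₑ :=
    Measurable.lintegral_prod_right' (f := fun p : ℝ × ℝ => ‖q p.1 p.2‖ₑ) hq.enorm
  have m0 : Measurable fun l : ℝ => ofReal √(π / |l|) := by fun_prop
  exact (m0.mul m1).add ((((m0.mul m2).add (m3.const_mul 2)).add (m4.const_mul _)).const_mul _)

/-- At `l = 0` the phase does not depend on `k` and Plancherel gives nothing, but `q 0 y = 0`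
removes the linear term. The convolution term is bounded by `∫ |n| dl'`, which is in `L²(dk)`. -/
theorem l2n_jump_lt_top (hσ : σ = 1 ∨ σ = -1) (K : KPot q q' r U)
    (hn : Measurable₃ n) {C : ℝ≥0∞} (hC : C < ⊤)
    (hz : ∀ y, normZ (fun l => wt l ^ 2) (fun k l y => ‖n k l y‖ₑ) y ≤ C) :
    l2n volume (fun k => ‖jump σ q n k‖ₑ) < ⊤ := by
  have hU : ∫⁻ y, ‖(1 + |y|) * U y‖ₑ < ⊤ := K.iU.2
  have hMm := measurable_massN hn
  have hm : Measurable fun p : ℝ × ℝ => ‖(1 + |p.2|) * U p.2‖ₑ * massN n p.1 p.2 := by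
    have := K.mU
    exact Measurable.mul (by fun_prop) hMm
  have hpt : ∀ k, ‖jump σ q n k‖ₑ ≤ i2π * ∫⁻ η, ‖(1 + |η|) * U η‖ₑ * massN n k η := by
    intro k
    have e1 : ‖jump σ q n k‖ₑ = i2π * ‖tau q n k 0‖ₑ := by
      rw [jump, enorm_neg, enorm_mul, enorm_mul, enorm_I_div]
      rcases hσ with rfl | rfl <;> simp
    rw [e1]
    gcongr
    refine (enorm_integral_le_lintegral_enorm _).trans (lintegral_mono fun η => ?_)
    have hU0 : 0 ≤ U η := (norm_nonneg _).trans (K.bq 0 η)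
    have e2 : ‖integrand q n k 0 η‖ₑ = ‖nonlin q n k 0 η‖ₑ := by
      rw [integrand, K.q0, mul_zero, mul_zero, zero_add, enorm_mul, enorm_ph, one_mul]
    rw [e2]
    refine (enorm_nonlin_le q n k 0 η).trans ?_
    unfold massN
    rw [← lintegral_const_mul' _ _ enorm_ne_top]
    refine lintegral_mono fun l' => mul_le_mul' ?_ (le_mul_of_one_le_left zero_le (one_le_wt l'))
    rw [← ofReal_norm, ← ofReal_norm, norm_of_nonneg (by positivity)]
    refine ofReal_le_ofReal ((K.bq _ _).trans ?_)
    nlinarith [abs_nonneg η]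
  refine (l2n_mono hpt).trans_lt ?_
  rw [l2n_const_mul _ (Measurable.lintegral_prod_right' hm).aemeasurable]
  refine mul_lt_top i2π_lt_top ((l2n_lintegral_le hm).trans_lt ?_)
  refine lt_of_le_of_lt ?_ (mul_lt_top hU hC)
  rw [← lintegral_mul_const' _ _ hC.ne]
  refine lintegral_mono fun η => ?_
  have hk : Measurable fun k => massN n k η := hMm.comp measurable_prodMk_right
  change l2n volume (fun k => ‖(1 + |η|) * U η‖ₑ * massN n k η) ≤ _
  rw [l2n_const_mul _ hk.aemeasurable]
  gcongr
  exact (l2n_massN_le hn η).trans (hz η)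

theorem lintegral_majS_lt_top (hσ : σ = 1 ∨ σ = -1) (K : KPot q q' r U)
    (hn : Measurable₃ n) {C : ℝ≥0∞} (hC : C < ⊤)
    (hz : ∀ y, normZ (fun l => wt l ^ 2) (fun k l y => ‖n k l y‖ₑ) y ≤ C) :
    ∫⁻ l, wt l * majS σ q q' r n l < ⊤ := by
  have hsw : ∀ {p : ℝ → ℝ → ℂ}, Measurable (uncurry p) →
      Measurable fun l => wt l * (ofReal √(π / |l|) * l2n volume fun η => ‖p l η‖ₑ) := fun {p} hp =>
    measurable_wt.mul (Measurable.mul (by fun_prop) (measurable_l2n_left (F := fun η l => ‖p l η‖ₑ)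
      (hp.comp measurable_swap).enorm))
  have m1 := hsw (measurable_src K.mq K.mq' K.mr)
  have m2 := hsw (measurable_srcB K.mq)
  have m3 : Measurable fun l => wt l * l2n volume (fun k => majConv (fun s η => s * η * q s η)
    (fun k l y => ‖n k l y‖ₑ) k l) := measurable_wt.mul
    (measurable_l2n_left (F := fun k l => majConv (fun s η => s * η * q s η)
    (fun k l y => ‖n k l y‖ₑ) k l)
    (measurable_majConv (a := fun k l y => ‖n k l y‖ₑ) (measurable_sη_q K.mq) hn.enorm))
  have m4 : Measurable fun l => wt l * ∫⁻ η, ‖q l η‖ₑ := measurable_wt.mul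
    (Measurable.lintegral_prod_right' (f := fun p : ℝ × ℝ => ‖q p.1 p.2‖ₑ) K.mq.enorm)
  have hz1 : ∀ y, normZ wt (fun k l y => ‖n k l y‖ₑ) y ≤ C := fun y =>
    (lintegral_mono fun l => by gcongr; exact wt_le_wt_pow l two_ne_zero).trans (hz y)
  have f3 : ∫⁻ l, wt l * l2n volume (fun k => majConv (fun s η => s * η * q s η)
      (fun k l y => ‖n k l y‖ₑ) k l) < ⊤ := by
    refine (lintegral_l2n_majConv_le (a := fun k l y => ‖n k l y‖ₑ) (measurable_sη_q K.mq) hn.enorm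
      measurable_wt (by simpa using submul_wt_pow 1)).trans_lt ?_
    refine lt_of_le_of_lt ?_ (mul_lt_top K.w3 hC)
    rw [← lintegral_mul_const' _ _ hC.ne]
    refine lintegral_mono fun y => mul_le_mul' (lintegral_mono fun l => ?_) (hz1 y)
    have e1 : ∀ x : ℝ, ‖(x : ℂ)‖ₑ ≤ wt x := fun x => by
      rw [← ofReal_norm, Complex.norm_real, norm_eq_abs, wt]
      exact ofReal_le_ofReal (by linarith)
    calc wt l * ‖(l * y * q l y : ℂ)‖ₑ = wt l * (‖(l : ℂ)‖ₑ * ‖(y : ℂ)‖ₑ * ‖q l y‖ₑ) := by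
          rw [enorm_mul, enorm_mul]
      _ ≤ wt l * (wt l * wt y * ‖q l y‖ₑ) := by gcongr <;> exact e1 _
      _ = wt l ^ 2 * (wt y * ‖q l y‖ₑ) := by ring
      _ ≤ _ := by
        gcongr
        · exact one_le_wt l
        · norm_num
  have f4 : ∫⁻ l, wt l * ∫⁻ η, ‖q l η‖ₑ < ⊤ := by
    refine lt_of_le_of_lt (lintegral_mono fun l => ?_) K.lintegral_majL
    rw [majL]
    gcongr
    refine le_add_right ?_
    rw [← lintegral_const_mul' _ _ (wt_lt_top l).ne]
    refine lintegral_mono fun η => ?_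
    calc ‖q l η‖ₑ = 1 * (1 * ‖q l η‖ₑ) := by ring
      _ ≤ _ := by gcongr <;> exact one_le_wt _
  have fJ := l2n_jump_lt_top hσ K hn hC hz
  calc ∫⁻ l, wt l * majS σ q q' r n l = ∫⁻ l, (wt l * (ofReal √(π / |l|) *
        l2n volume fun η => ‖src q q' r l η‖ₑ) + (i2π * (wt l * (ofReal √(π / |l|) *
        l2n volume fun η => ‖srcB q l η‖ₑ)) + (i2π * 2 * (wt l * l2n volume (fun k => majConv
        (fun s η => s * η * q s η) (fun k l y => ‖n k l y‖ₑ) k l)) +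
        i2π * (l2n volume fun k => ‖jump σ q n k‖ₑ) * (wt l * ∫⁻ η, ‖q l η‖ₑ)))) := by
        refine lintegral_congr fun l => ?_
        unfold majS; ring
    _ < ⊤ := by
        rw [lintegral_add_left m1, lintegral_add_left (m2.const_mul _),
          lintegral_add_left (m3.const_mul _), lintegral_const_mul _ m2, lintegral_const_mul _ m3,
          lintegral_const_mul _ m4]
        refine add_lt_top.2 ⟨K.g1, add_lt_top.2 ⟨mul_lt_top i2π_lt_top K.gB,
          add_lt_top.2 ⟨mul_lt_top (mul_lt_top i2π_lt_top (by simp)) f3,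
          mul_lt_top (mul_lt_top i2π_lt_top fJ) f4⟩⟩⟩

/-- The truncated derivative has locally finite norm. -/
theorem normZ_adreg_finite (K : KPot q q' r U)
    (hn : Measurable₃ n) {C : ℝ≥0∞} (hC : C < ⊤)
    (hz : ∀ y, normZ (fun l => wt l ^ 2) (fun k l y => ‖n k l y‖ₑ) y ≤ C)
    (hχm : Measurable χ) (hχ2 : l2n volume χ < ⊤) {B : ℝ≥0∞} (hB : B < ⊤)
    (hχB : ∀ k, χ k * wt k ≤ B) (hχB2 : l2n volume (fun k => χ k * wt k) < ⊤) :
    ∫⁻ y, (∫⁻ l, wt l * ‖q l y‖ₑ) * normZ wt (adreg σ q q' n χ) y < ⊤ := by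
  have hI := measurable_majI K.mq K.mq' hn
  set A : ℝ≥0∞ := i2π * (2 * ofReal √(2 * π) * l2n volume (fun k => χ k * wt k) *
    (∫⁻ l, wt l * majL q q' l) + 2 * B * ∫⁻ l, wt l * l2n volume (fun k => majI q q' n k l)) with hA
  have hAt : A < ⊤ := by
    refine mul_lt_top i2π_lt_top (add_lt_top.2 ⟨?_, ?_⟩)
    · exact mul_lt_top (mul_lt_top (mul_lt_top (by simp) ofReal_lt_top)
        hχB2) K.lintegral_majL
    · exact mul_lt_top (mul_lt_top (by simp) hB) (K.lintegral_majI hn hC hz)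
  have hL := measurable_majL K.mq K.mq'
  -- The growth `wt k` of the crude bound is compensated by `χ k * wt k ≤ B`. The constant may
  -- depend on `χ`, since only finiteness is at stake.
  have key : ∀ y, normZ wt (adreg σ q q' n χ) y ≤ A + l2n volume χ * ∫⁻ l, wt l * (‖y / l‖ₑ * ‖q l y‖ₑ) := by
    intro y
    have hpt : ∀ k l, adreg σ q q' n χ k l y ≤ (i2π * (2 * ofReal √(2 * π) * majL q q' l) *
        (χ k * wt k) + i2π * (2 * B) * majI q q' n k l) + (‖y / l‖ₑ * ‖q l y‖ₑ) * χ k := by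
      intro k l
      have h1 : ‖dreg σ q q' n k l y‖ₑ ≤ i2π * (wt k * (2 * ofReal √(2 * π) * majL q q' l +
          2 * majI q q' n k l)) + ‖y / l‖ₑ * ‖q l y‖ₑ := by
        rw [← enorm_bdry k]
        unfold dreg
        refine (enorm_sub_le).trans (add_le_add ?_ le_rfl)
        rw [dsol, enorm_mul, enorm_I_div]
        gcongr
        exact (enorm_intFrom_le _ _ _ _).trans (K.lintegral_enorm_dintegrand_le hn k l)
      calc adreg σ q q' n χ k l y ≤ χ k * (i2π * (wt k * (2 * ofReal √(2 * π) * majL q q' l +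
          2 * majI q q' n k l)) + ‖y / l‖ₑ * ‖q l y‖ₑ) := by unfold adreg; gcongr
        _ = (i2π * (2 * ofReal √(2 * π) * majL q q' l) *
        (χ k * wt k) + i2π * (2 * (χ k * wt k)) * majI q q' n k l) + (‖y / l‖ₑ * ‖q l y‖ₑ) * χ k := by ring
        _ ≤ _ := by gcongr; exact hχB k
    have m1 : Measurable fun k => χ k * wt k := hχm.mul measurable_wt
    have hl2 : ∀ l, l2n volume (fun k => adreg σ q q' n χ k l y) ≤
        (i2π * (2 * ofReal √(2 * π) * majL q q' l) * l2n volume (fun k => χ k * wt k) +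
        i2π * (2 * B) * l2n volume (fun k => majI q q' n k l)) + (‖y / l‖ₑ * ‖q l y‖ₑ) * l2n volume χ := by
      intro l
      have m2 : Measurable fun k => majI q q' n k l := hI.comp measurable_prodMk_right
      refine (l2n_mono fun k => hpt k l).trans ?_
      refine (l2n_add_le ((m1.const_mul _).add (m2.const_mul _)).aemeasurable
        (hχm.const_mul _).aemeasurable).trans (add_le_add ((l2n_add_le (m1.const_mul _).aemeasurable
        (m2.const_mul _).aemeasurable).trans (add_le_add (l2n_const_mul _ m1.aemeasurable).le
        (l2n_const_mul _ m2.aemeasurable).le)) (l2n_const_mul _ hχm.aemeasurable).le)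
    have n1 : Measurable fun l => wt l * majL q q' l := measurable_wt.mul hL
    have n2 : Measurable fun l => wt l * l2n volume (fun k => majI q q' n k l) :=
      measurable_wt.mul (measurable_l2n_left (F := fun k l => majI q q' n k l) hI)
    have n3 : Measurable fun l => wt l * (‖y / l‖ₑ * ‖q l y‖ₑ) := by
      have : Measurable fun l => q l y := K.mq.of_uncurry_right
      fun_prop
    calc normZ wt (adreg σ q q' n χ) y
        ≤ ∫⁻ l, ((i2π * (2 * ofReal √(2 * π)) * l2n volume (fun k => χ k * wt k) *
          (wt l * majL q q' l) + i2π * (2 * B) * (wt l * l2n volume (fun k => majI q q' n k l))) +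
          l2n volume χ * (wt l * (‖y / l‖ₑ * ‖q l y‖ₑ))) := by
          unfold normZ
          refine lintegral_mono fun l => ?_
          refine (mul_le_mul_right (hl2 l) _).trans (le_of_eq (by ring))
      _ = _ := by
          rw [lintegral_add_right _ (n3.const_mul _), lintegral_add_right _ (n2.const_mul _),
            lintegral_const_mul _ n1, lintegral_const_mul _ n2, lintegral_const_mul _ n3, hA]
          ring
  have hκ := measurable_mass (w := wt) K.mq measurable_wt
  have hκt : ∫⁻ y, ∫⁻ l, wt l * ‖q l y‖ₑ < ⊤ := by
    refine lt_of_le_of_lt (lintegral_mono fun y => lintegral_mono fun l => ?_) K.w3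
    gcongr
    · exact wt_le_wt_pow l three_ne_zero
    · exact le_mul_of_one_le_left zero_le (one_le_wt y)
  calc ∫⁻ y, (∫⁻ l, wt l * ‖q l y‖ₑ) * normZ wt (adreg σ q q' n χ) y
      ≤ ∫⁻ y, (A * (∫⁻ l, wt l * ‖q l y‖ₑ) + l2n volume χ * ((∫⁻ l, wt l * ‖q l y‖ₑ) *
        ∫⁻ l, wt l * (‖y / l‖ₑ * ‖q l y‖ₑ))) := by
        refine lintegral_mono fun y => ?_
        refine (mul_le_mul_right (key y) _).trans (le_of_eq (by ring))
    _ < ⊤ := by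
        rw [lintegral_add_left (hκ.const_mul _), lintegral_const_mul _ hκ,
          lintegral_const_mul' _ _ hχ2.ne]
        exact add_lt_top.2 ⟨mul_lt_top hAt hκt, mul_lt_top hχ2 K.kb⟩

/-- The pointwise inequality holds for almost every `l`, then `k`, then `y`; to take the norm in `k`
at fixed `y` the quantifiers must be exchanged, which is why measurability of the majorant in all
variables is needed. -/
theorem ae_l2n_adreg_le (hσ : σ = 1 ∨ σ = -1) (h : InteractionSol σ q n) (K : KPot q q' r U)
    (hc : i2π * ∫⁻ η, ∫⁻ s, ‖q s η‖ₑ < 1) (hχm : Measurable χ) (hχ : ∀ k, χ k ≤ 1) :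
    ∀ᵐ y : ℝ, ∀ᵐ l : ℝ, l2n volume (fun k => adreg σ q q' n χ k l y) ≤
      majS σ q q' r n l + i2π * l2n volume fun k => majConv q (adreg σ q q' n χ) k l := by
  have hn := h.meas
  have hA := measurable_adreg (σ := σ) K.mq K.mq' hn hχm
  have hD : Measurable fun p : ℝ × ℝ => l2n volume fun k => adreg σ q q' n χ k p.1 p.2 :=
    measurable_l2n_left (F := fun k (p : ℝ × ℝ) => adreg σ q q' n χ k p.1 p.2) hA
  have hMC : Measurable fun l => l2n volume fun k => majConv q (adreg σ q q' n χ) k l :=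
    measurable_l2n_left (F := fun k l => majConv q (adreg σ q q' n χ) k l)
      (measurable_majConv K.mq hA)
  have hS := measurable_majS (σ := σ) K.mq K.mq' K.mr hn
  have hms : MeasurableSet {p : ℝ × ℝ | l2n volume (fun k => adreg σ q q' n χ k p.1 p.2) ≤
      majS σ q q' r n p.1 + i2π * l2n volume fun k => majConv q (adreg σ q q' n χ) k p.1} :=
    measurableSet_le hD ((hS.add (hMC.const_mul _)).comp measurable_fst)
  rw [← Measure.ae_ae_comm (p := fun l y => l2n volume (fun k => adreg σ q q' n χ k l y) ≤
      majS σ q q' r n l + i2π * l2n volume fun k => majConv q (adreg σ q q' n χ) k l) hms]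
  have h0 := Measure.ae_ne volume (0 : ℝ)
  filter_upwards [h0, K.gint, K.dlin_by_parts, K.enorm_dreg_le hn hσ] with l hl h2 h1 hle
  have hky : ∀ᵐ k : ℝ, ∀ᵐ y : ℝ, ‖dreg σ q q' n k l y‖ₑ ≤ majT σ q q' r n (ray σ l y) k l := by
    filter_upwards [h.ae_goodParam K hc] with k hk using hle k hk
  have hmT : Measurable fun p : ℝ × ℝ => majT σ q q' r n (ray σ l p.2) p.1 l := by
    have t : ∀ {g : ℝ → ℂ}, Measurable g →
        Measurable fun p : ℝ × ℝ => ‖∫ η in ray σ l p.2, ph p.1 l η * g η‖ₑ := by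
      intro g hg
      have e1 : ∀ p : ℝ × ℝ, ‖∫ η in ray σ l p.2, ph p.1 l η * g η‖ₑ =
          ‖intFrom σ l p.2 (fun η => ph p.1 l η * g η)‖ₑ := fun p => by
        rw [intFrom_eq, enorm_mul, enorm_raySign, one_mul]
      simp_rw [e1]
      refine Measurable.enorm (measurable_intFrom (l := fun _ => l) (y := fun p : ℝ × ℝ => p.2)
        (G := fun (p : ℝ × ℝ) η => ph p.1 l η * g η) σ (by fun_prop) (by fun_prop) ?_)
      exact Measurable.mul (f := fun p : (ℝ × ℝ) × ℝ => ph p.1.1 l p.2) (by fun_prop)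
        (hg.comp measurable_snd)
    have mD : Measurable fun p : ℝ × ℝ => majD σ q q' n p.1 l := by
      have a1 : Measurable fun p : ℝ × ℝ => majConv (fun s η => s * η * q s η)
          (fun k l y => ‖n k l y‖ₑ) p.1 l :=
        (measurable_majConv (a := fun k l y => ‖n k l y‖ₑ) (measurable_sη_q K.mq) hn.enorm).comp
          (f := fun p : ℝ × ℝ => (p.1, l)) (by fun_prop)
      have a2 : Measurable fun p : ℝ × ℝ => majConv q (fun k l y => ‖dreg σ q q' n k l y‖ₑ) p.1 l :=
        (measurable_majConv (a := fun k l y => ‖dreg σ q q' n k l y‖ₑ) K.mq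
          (measurable_dreg σ K.mq K.mq' hn).enorm).comp
          (f := fun p : ℝ × ℝ => (p.1, l)) (by fun_prop)
      have a3 : Measurable fun p : ℝ × ℝ => ‖jump σ q n p.1‖ₑ :=
        ((measurable_jump σ K.mq hn).comp measurable_fst).enorm
      exact ((a1.const_mul 2).add (a3.mul_const _)).add a2
    exact (t (measurable_src K.mq K.mq' K.mr).of_uncurry_left).add
      (((t (measurable_srcB K.mq).of_uncurry_left).add mD).const_mul _)
  have hdm : Measurable fun p : ℝ × ℝ => ‖dreg σ q q' n p.1 l p.2‖ₑ :=
    ((measurable_dreg σ K.mq K.mq' hn).comp (f := fun p : ℝ × ℝ => (p.1, l, p.2)) (by fun_prop)).enorm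
  rw [Measure.ae_ae_comm (p := fun k y => ‖dreg σ q q' n k l y‖ₑ ≤ majT σ q q' r n (ray σ l y) k l)
    (measurableSet_le hdm hmT)] at hky
  filter_upwards [hky] with y hy
  refine le_trans (l2n_mono_ae (hy.mono fun k hk => ?_)) (l2n_majT_le K.mq K.mq' K.mr hn hχm hχ hl h1.1 h2
    (measurableSet_ray σ l y))
  unfold adreg
  gcongr

/-- The contraction in `L¹(dl; L²(dk))`, with the crude bound providing finiteness. The derivative
of `tau` is dominated by the same right-hand side as the derivative of `n`. The result does not
depend on `χ`. -/
theorem lintegral_l2n_dtau_le (hσ : σ = 1 ∨ σ = -1) (h : InteractionSol σ q n) (K : KPot q q' r U)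
    (hc : i2π * ∫⁻ η, ∫⁻ s, ‖q s η‖ₑ < 1) {ε : ℝ} (h0 : 0 < ε) (h1 : ε ≤ 1)
    (hε : i2π * ∫⁻ η, ∫⁻ s, ofReal (1 + ε * |s|) * ‖q s η‖ₑ < 1)
    (hχm : Measurable χ) (hχ : ∀ k, χ k ≤ 1) (hχ2 : l2n volume χ < ⊤) {B : ℝ≥0∞} (hB : B < ⊤)
    (hχB : ∀ k, χ k * wt k ≤ B) (hχB2 : l2n volume (fun k => χ k * wt k) < ⊤) :
    ∫⁻ l, ofReal (1 + ε * |l|) *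
      (i2π * l2n volume fun k => χ k * ‖∫ η, dintegrand q q' n k l η‖ₑ) ≤
      (∫⁻ l, wt l * majS σ q q' r n l) /
        (1 - i2π * ∫⁻ η, ∫⁻ s, ofReal (1 + ε * |s|) * ‖q s η‖ₑ) := by
  obtain ⟨C, hC, -, -, hz⟩ := h.exists_bound K hc
  have hn := h.meas
  set w : ℝ → ℝ≥0∞ := fun l => ofReal (1 + ε * |l|) with hw
  have hwm : Measurable w := by fun_prop
  have hsub : ∀ l s, w l ≤ w s * w (l - s) := fun l s => by
    simp only [hw]
    rw [← ofReal_mul (by positivity)]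
    exact ofReal_le_ofReal (submul_wt h0.le l s)
  have hww : ∀ l, w l ≤ wt l := fun l => by
    simp only [hw, wt]
    refine ofReal_le_ofReal ?_
    nlinarith [abs_nonneg l]
  have hA := measurable_adreg (σ := σ) K.mq K.mq' hn hχm
  have hS := measurable_majS (σ := σ) K.mq K.mq' K.mr hn
  set stot : ℝ≥0∞ := ∫⁻ l, wt l * majS σ q q' r n l with hstot
  have hκ := measurable_mass (w := w) K.mq hwm
  set D : ℝ → ℝ≥0∞ := normZ w (adreg σ q q' n χ) with hD
  have hF : ∫⁻ l, w l * (majS σ q q' r n l + i2π * l2n volume fun k => majConv q (adreg σ q q' n χ) k l) ≤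
      stot + ∫⁻ η, (i2π * ∫⁻ s, w s * ‖q s η‖ₑ) * D η := by
    have m1 : Measurable fun l => w l * majS σ q q' r n l := hwm.mul hS
    simp_rw [mul_add]
    rw [lintegral_add_left m1]
    refine add_le_add ?_ ?_
    · exact lintegral_mono fun l => mul_le_mul_left (hww l) _
    · have := lintegral_l2n_majConv_le K.mq hA hwm hsub
      simp_rw [mul_assoc i2π, mul_left_comm _ i2π]
      rw [lintegral_const_mul' _ _ i2π_ne_top, lintegral_const_mul' _ _ i2π_ne_top]
      gcongr
  have hDle : ∀ᵐ y, D y ≤ stot + ∫⁻ η, (i2π * ∫⁻ s, w s * ‖q s η‖ₑ) * D η := by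
    filter_upwards [ae_l2n_adreg_le hσ h K hc hχm hχ] with y hy
    refine le_trans ?_ hF
    refine lintegral_mono_ae ?_
    filter_upwards [hy] with l hl
    gcongr
  have hfin : ∫⁻ η, (i2π * ∫⁻ s, w s * ‖q s η‖ₑ) * D η < ⊤ := by
    have := normZ_adreg_finite (σ := σ) K hn hC hz hχm hχ2 hB hχB hχB2
    refine lt_of_le_of_lt ?_ (mul_lt_top i2π_lt_top this)
    rw [← lintegral_const_mul' _ _ i2π_ne_top]
    refine lintegral_mono fun η => ?_
    rw [mul_assoc]
    refine mul_le_mul_right (mul_le_mul' (lintegral_mono fun l => ?_) (lintegral_mono fun l => ?_)) _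
    · exact mul_le_mul_left (hww l) _
    · exact mul_le_mul_left (hww l) _
  have hkc : ∫⁻ y, i2π * ∫⁻ s, w s * ‖q s y‖ₑ ≤ i2π * ∫⁻ η, ∫⁻ s, w s * ‖q s η‖ₑ :=
    (lintegral_const_mul' _ _ i2π_ne_top).le
  have hfinal := contraction_bound (hκ.const_mul i2π).aemeasurable hε hkc hfin hDle
  refine le_trans ?_ hfinal
  refine le_trans ?_ hF
  refine lintegral_mono_ae ?_
  have hl0 : ∀ᵐ l : ℝ, l ≠ 0 := by simp [ae_iff, measure_singleton]
  filter_upwards [hl0, K.gint, K.dlin_by_parts, K.enorm_dtau_le hn hσ] with l hl h2 h1 hle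
  gcongr
  have hdm : Measurable fun k => χ k * ‖∫ η, dintegrand q q' n k l η‖ₑ := by
    refine hχm.mul (Measurable.enorm (StronglyMeasurable.measurable ?_))
    refine StronglyMeasurable.integral_prod_right (f := fun k η => dintegrand q q' n k l η) ?_
    exact ((measurable_dintegrand K.mq K.mq' hn).comp (f := fun p : ℝ × ℝ => (p.1, l, p.2))
      (by fun_prop)).stronglyMeasurable
  rw [← l2n_const_mul _ hdm.aemeasurable]
  refine le_trans (l2n_mono_ae ?_) (l2n_majT_le (σ := σ) K.mq K.mq' K.mr hn hχm hχ hl h1.1 h2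
    MeasurableSet.univ)
  filter_upwards [h.ae_goodParam K hc] with k hk
  rw [mul_left_comm]
  gcongr
  exact hle k hk

/-- The derivative of the scattering data lies in a weighted `L¹(dl; L²(dk))`. -/
theorem InteractionSol.dtau_bound (hσ : σ = 1 ∨ σ = -1) (h : InteractionSol σ q n) (K : KPot q q' r U)
    (hc : i2π * ∫⁻ η, ∫⁻ s, ‖q s η‖ₑ < 1) :
    ∫⁻ l, wt l * l2n volume (fun k => ‖∫ η, dintegrand q q' n k l η‖ₑ) < ⊤ := by
  obtain ⟨C, hC, -, -, hz⟩ := h.exists_bound K hc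
  obtain ⟨ε, h0, h1, hε3⟩ := K.exists_weight hc
  have hn := h.meas
  have hε : i2π * ∫⁻ η, ∫⁻ s, ofReal (1 + ε * |s|) * ‖q s η‖ₑ < 1 := by
    refine lt_of_le_of_lt (mul_le_mul_right (lintegral_mono fun y => lintegral_mono fun s =>
      mul_le_mul_left (ofReal_le_ofReal ?_) _) _) hε3
    exact le_self_pow₀ (by nlinarith [abs_nonneg s]) three_ne_zero
  set B := (∫⁻ l, wt l * majS σ q q' r n l) /
    (1 - i2π * ∫⁻ η, ∫⁻ s, ofReal (1 + ε * |s|) * ‖q s η‖ₑ) with hB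
  have hBt : B < ⊤ := ENNReal.div_lt_top (lintegral_majS_lt_top hσ K hn hC hz).ne (tsub_pos_of_lt hε).ne'
  set f : ℝ → ℝ → ℝ≥0∞ := fun k l => ‖∫ η, dintegrand q q' n k l η‖ₑ with hf
  have hfm : Measurable (uncurry f) := by
    refine Measurable.enorm (StronglyMeasurable.measurable ?_)
    refine StronglyMeasurable.integral_prod_right
      (f := fun (p : ℝ × ℝ) η => dintegrand q q' n p.1 p.2 η) ?_
    exact ((measurable_dintegrand K.mq K.mq' hn).comp (f := fun p : (ℝ × ℝ) × ℝ => (p.1.1, p.1.2, p.2))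
      (by fun_prop)).stronglyMeasurable
  -- The cutoff in `k` makes all a priori norms finite; as the bounds are uniform in `R`, it is
  -- removed by monotone convergence.
  set χ : ℕ → ℝ → ℝ≥0∞ := fun R => (Icc (-R : ℝ) R).indicator 1 with hχ
  have hχm : ∀ R, Measurable (χ R) := fun R => measurable_one.indicator measurableSet_Icc
  have hχ1 : ∀ R k, χ R k ≤ 1 := fun R k => Set.indicator_le_self' (fun _ _ => zero_le) k
  have hχw : ∀ R k, χ R k * wt k ≤ wt R * χ R k := fun R k => by
    by_cases hk : k ∈ Icc (-R : ℝ) R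
    · simp only [hχ, indicator_of_mem hk, Pi.one_apply, one_mul, mul_one]
      refine ofReal_le_ofReal ?_
      have := abs_le.2 hk
      have h2 := le_abs_self (R : ℝ)
      linarith
    · simp [hχ, Set.indicator_of_notMem hk]
  have hχl : ∀ R, l2n volume (χ R) < ⊤ := fun R => by
    rw [l2n_lt_top_iff]
    refine lt_of_le_of_lt (lintegral_mono fun k => ?_)
      ((lintegral_indicator_one (measurableSet_Icc (a := (-R : ℝ)) (b := R))).trans_lt
      (by simp))
    by_cases hk : k ∈ Icc (-R : ℝ) R <;> simp [hχ, hk]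
  have key : ∀ R, ∫⁻ l, wt l * l2n volume (fun k => χ R k * f k l) ≤ ofReal ε⁻¹ * (B / i2π) := by
    intro R
    have h2 := lintegral_l2n_dtau_le hσ h K hc h0 h1 hε (hχm R) (hχ1 R) (hχl R) (B := wt R) (wt_lt_top _)
      (fun k => (hχw R k).trans (mul_le_of_le_one_right zero_le (hχ1 R k)))
      (lt_of_le_of_lt (l2n_mono (hχw R)) ((l2n_const_mul _ (hχm R).aemeasurable).trans_lt
        (mul_lt_top (wt_lt_top _) (hχl R))))
    have h3 : ∫⁻ l, ofReal (1 + ε * |l|) * l2n volume (fun k => χ R k * f k l) ≤ B / i2π := by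
      rw [ENNReal.le_div_iff_mul_le (.inl i2π_ne_zero) (.inl i2π_ne_top), mul_comm,
        ← lintegral_const_mul' _ _ i2π_ne_top]
      refine le_trans (le_of_eq (lintegral_congr fun l => ?_)) h2
      ring
    calc _ ≤ ∫⁻ l, ofReal ε⁻¹ * (ofReal (1 + ε * |l|) *
          l2n volume (fun k => χ R k * f k l)) := by
          refine lintegral_mono fun l => ?_
          rw [← mul_assoc]
          gcongr
          exact wt_le_mul h0 h1 l
      _ ≤ _ := by
          rw [lintegral_const_mul' _ _ ENNReal.ofReal_ne_top]
          gcongr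
  refine lt_of_le_of_lt ?_ (mul_lt_top ofReal_lt_top (ENNReal.div_lt_top hBt.ne i2π_ne_zero) :
    ofReal ε⁻¹ * (B / i2π) < ⊤)
  have hmono : ∀ l, Monotone fun R => l2n volume (fun k => χ R k * f k l) := by
    intro l R R' hRR
    refine l2n_mono fun k => ?_
    gcongr
    refine Set.indicator_le_indicator_of_subset (Set.Icc_subset_Icc ?_ ?_) (fun _ => zero_le) k
    · exact neg_le_neg (by exact_mod_cast hRR)
    · exact_mod_cast hRR
  have hsup : ∀ l, l2n volume (fun k => f k l) = ⨆ R, l2n volume (fun k => χ R k * f k l) := by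
    intro l
    have hfl : Measurable fun k => f k l := hfm.of_uncurry_right
    refine le_antisymm ?_ (iSup_le fun R => l2n_mono fun k => mul_le_of_le_one_left zero_le (hχ1 R k))
    rw [l2n_le_iff]
    have e : ∀ k, f k l ^ 2 = ⨆ R, (χ R k * f k l) ^ 2 := fun k => by
      refine le_antisymm ?_ (iSup_le fun R => by
        gcongr; exact mul_le_of_le_one_left zero_le (hχ1 R k))
      obtain ⟨R, hR⟩ := exists_nat_ge |k|
      refine le_trans (le_of_eq ?_) (le_iSup (fun R => (χ R k * f k l) ^ 2) R)
      have hk : k ∈ Icc (-R : ℝ) R := abs_le.1 hR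
      simp [hχ, hk]
    simp_rw [e]
    have hmm : ∀ R, Measurable fun k => (χ R k * f k l) ^ 2 := fun R =>
      ((hχm R).mul hfl).pow_const 2
    rw [lintegral_iSup hmm (fun R R' hRR k => by
      dsimp only
      gcongr
      refine Set.indicator_le_indicator_of_subset (Set.Icc_subset_Icc ?_ ?_) (fun _ => zero_le) k
      · exact neg_le_neg (by exact_mod_cast hRR)
      · exact_mod_cast hRR)]
    refine iSup_le fun R => ?_
    rw [← l2n_le_iff]
    exact le_iSup (fun R => l2n volume (fun k => χ R k * f k l)) R
  change ∫⁻ l, wt l * l2n volume (fun k => f k l) ≤ _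
  simp_rw [hsup, ENNReal.mul_iSup]
  rw [lintegral_iSup]
  · exact iSup_le key
  · intro R
    exact measurable_wt.mul (measurable_l2n_left (F := fun k l => χ R k * f k l)
      (((hχm R).comp measurable_fst).mul hfm))
  · intro R R' hRR l
    dsimp only
    gcongr
    exact hmono l hRR

theorem ae_ae_swap {P : ℝ × ℝ → Prop} (h : ∀ᵐ p, P p) : ∀ᵐ y : ℝ, ∀ᵐ x : ℝ, P (x, y) := by
  have h1 : ∀ᵐ p : ℝ × ℝ, P p.swap := by
    have := Measure.measurePreserving_swap (μ := (volume : Measure ℝ)) (ν := (volume : Measure ℝ))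
    exact this.quasiMeasurePreserving.ae h
  exact Measure.ae_ae_of_ae_prod h1

/-! ### The unitary Fourier transform on the line -/

/-- On `L¹ ∩ L²` the inverse Fourier transform of `L²` functions is given by the Fourier integral. -/
theorem fourierInv_toLp_ae_eq {f : ℝ → ℂ} (h1 : Integrable f) (h2 : MemLp f 2) :
    (𝓕⁻ (h2.toLp f) : Lp ℂ 2 (volume : Measure ℝ)) =ᵐ[volume] 𝓕⁻ f := by
  have hL : Continuous fun p : ℝ × ℝ => ((-innerₗ ℝ : ℝ →ₗ[ℝ] ℝ →ₗ[ℝ] ℝ) p.1) p.2 :=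
    continuous_inner.neg
  have hflip : (-innerₗ ℝ : ℝ →ₗ[ℝ] ℝ →ₗ[ℝ] ℝ).flip = -innerₗ ℝ := by
    ext; simp
  refine ae_eq_of_integral_contDiff_smul_eq
    ((Lp.memLp _).locallyIntegrable (by norm_num)) ?_ fun g hg hgc => ?_
  · exact (VectorFourier.fourierIntegral_continuous Real.continuous_fourierChar hL h1).locallyIntegrable
  · have hc : HasCompactSupport (fun x => (g x : ℂ)) := hgc.comp_left (g := fun r : ℝ => (r : ℂ)) rfl
    have hd : ContDiff ℝ _ (fun x => (g x : ℂ)) := Complex.ofRealCLM.contDiff.comp hg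
    set G : SchwartzMap ℝ ℂ := hc.toSchwartzMap hd with hG
    have h3 := congrArg (fun T => T G) (Lp.fourierInv_toTemperedDistribution_eq (h2.toLp f))
    simp only [TemperedDistribution.fourierInv_apply, Lp.toTemperedDistribution_apply] at h3
    have h4 : ∀ x, (G x : ℂ) = g x := fun x => rfl
    have h5 : ∫ x, g x • (𝓕⁻ (h2.toLp f) : Lp ℂ 2 (volume : Measure ℝ)) x =
        ∫ x, G x • (𝓕⁻ (h2.toLp f) : Lp ℂ 2 (volume : Measure ℝ)) x := by
      simp [h4]
    rw [h5, ← h3]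
    have h6 : ∫ x, (𝓕⁻ G : SchwartzMap ℝ ℂ) x • (h2.toLp f) x = ∫ x, f x • (𝓕⁻ (G : ℝ → ℂ)) x := by
      refine integral_congr_ae ?_
      filter_upwards [h2.coeFn_toLp] with x hx
      rw [hx, SchwartzMap.fourierInv_coe, smul_eq_mul, smul_eq_mul, mul_comm]
    rw [h6]
    have h7 := VectorFourier.integral_fourierIntegral_smul_eq_flip (L := -innerₗ ℝ) (μ := volume)
      (ν := volume) (f := f) (g := (G : ℝ → ℂ))
      Real.continuous_fourierChar hL h1 G.integrable
    rw [hflip] at h7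
    refine h7.symm.trans ?_
    refine integral_congr_ae (ae_of_all _ fun x => ?_)
    simp only [h4, smul_eq_mul, Complex.real_smul]
    rw [mul_comm]; rfl

/-- The unitary Fourier transform `(2π)^{-1/2} ∫ e^{-iξx} f(x) dx`. -/
def ft (f : ℝ → ℂ) (ξ : ℝ) : ℂ :=
  (√(2 * π) : ℂ)⁻¹ * ∫ x : ℝ, Complex.exp (-(I * ξ * x)) * f x

theorem pft_eq_ft (u : ℝ × ℝ → ℝ) (l y : ℝ) : pft u l y = ft (fun x => (u (x, y) : ℂ)) l := rfl

theorem norm_cexp_neg_I_mul (a b : ℝ) : ‖Complex.exp (-(I * a * b))‖ = 1 := by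
  rw [show -(I * a * b) = ((-(a * b) : ℝ) : ℂ) * I by push_cast; ring]
  exact Complex.norm_exp_ofReal_mul_I _

theorem norm_inv_sqrt_two_pi : ‖(√(2 * π) : ℂ)⁻¹‖ = (√(2 * π))⁻¹ := by
  rw [norm_inv, Complex.norm_real, norm_eq_abs, abs_of_pos sqrt_two_pi_pos]

theorem enorm_inv_sqrt_two_pi : ‖(√(2 * π) : ℂ)⁻¹‖ₑ = i2π := by
  rw [← ofReal_norm, norm_inv_sqrt_two_pi, i2π]

theorem inv_sqrt_two_pi_le_one : (√(2 * π))⁻¹ ≤ 1 := by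
  refine inv_le_one_of_one_le₀ (Real.one_le_sqrt.2 ?_)
  nlinarith [Real.pi_gt_three]

theorem i2π_le_one : i2π ≤ 1 := by
  rw [i2π]
  exact ENNReal.ofReal_le_one.2 inv_sqrt_two_pi_le_one

theorem enorm_ft_le (f : ℝ → ℂ) (ξ : ℝ) : ‖ft f ξ‖ₑ ≤ ∫⁻ x, ‖f x‖ₑ := by
  rw [ft, enorm_mul, enorm_inv_sqrt_two_pi]
  refine (mul_le_of_le_one_left zero_le i2π_le_one).trans ?_
  refine (enorm_integral_le_lintegral_enorm _).trans (le_of_eq (lintegral_congr fun x => ?_))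
  rw [enorm_mul, ← ofReal_norm, norm_cexp_neg_I_mul, ofReal_one, one_mul]

theorem integrable_cexp_mul {f : ℝ → ℂ} (hf : Integrable f) (ξ : ℝ) :
    Integrable fun x : ℝ => Complex.exp (-(I * ξ * x)) * f x := by
  refine hf.bdd_mul (c := 1) (Measurable.aestronglyMeasurable (by fun_prop)) ?_
  exact ae_of_all _ fun x => (norm_cexp_neg_I_mul ξ x).le

theorem lintegral_ft_sq {f : ℝ → ℂ} (h1 : Integrable f) (h2 : MemLp f 2) :
    ∫⁻ ξ, ‖ft f ξ‖ₑ ^ 2 = ∫⁻ x, ‖f x‖ₑ ^ 2 := by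
  simp_rw [ft, enorm_mul, mul_pow, enorm_inv_sqrt_two_pi]
  rw [lintegral_const_mul' _ _ (ENNReal.pow_ne_top i2π_ne_top), lintegral_cexp_sq h1 h2, ← mul_assoc, i2π,
    ← ofReal_pow (by positivity), ← ofReal_mul (by positivity), inv_pow,
    Real.sq_sqrt (by positivity), inv_mul_cancel₀ (by positivity), ofReal_one, one_mul]

theorem l2n_ft {f : ℝ → ℂ} (h1 : Integrable f) (h2 : MemLp f 2) :
    l2n volume (fun ξ => ‖ft f ξ‖ₑ) = l2n volume fun x => ‖f x‖ₑ := by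
  unfold l2n; rw [lintegral_ft_sq h1 h2]

theorem memLp_two_iff {α : Type*} [MeasurableSpace α] {μ : Measure α} {E : Type*}
    [NormedAddCommGroup E] {f : α → E} (hf : AEStronglyMeasurable f μ) :
    MemLp f 2 μ ↔ l2n μ (fun x => ‖f x‖ₑ) < ⊤ := by
  have h4 := eLpNorm_nnreal_pow_eq_lintegral (f := f) (μ := μ) (p := 2) (by norm_num)
  norm_num at h4
  rw [l2n_lt_top_iff, ← h4, ENNReal.pow_lt_top_iff]
  simp [MemLp, hf]

theorem eLpNorm_two_eq {α : Type*} [MeasurableSpace α] {μ : Measure α} {E : Type*}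
    [NormedAddCommGroup E] (f : α → E) : eLpNorm f 2 μ = l2n μ (fun x => ‖f x‖ₑ) := by
  have h4 := eLpNorm_nnreal_pow_eq_lintegral (f := f) (μ := μ) (p := 2) (by norm_num)
  norm_num at h4
  rw [l2n, ← h4, ENNReal_sq_rpow_half]

theorem ft_eq_fourier (f : ℝ → ℂ) (ξ : ℝ) : ft f ξ = (√(2 * π) : ℂ)⁻¹ * 𝓕 f ((2 * π)⁻¹ * ξ) := by
  have hπ := Real.pi_pos
  rw [ft, Real.fourier_real_eq_integral_exp_smul]
  congr 2; ext x
  rw [smul_eq_mul]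
  congr 2
  push_cast
  field_simp

theorem continuous_ft {f : ℝ → ℂ} (h : Integrable f) : Continuous (ft f) := by
  have h1 : Continuous (𝓕 f) := VectorFourier.fourierIntegral_continuous Real.continuous_fourierChar
    (by exact continuous_inner) h
  have h2 : ft f = fun ξ => (√(2 * π) : ℂ)⁻¹ * 𝓕 f ((2 * π)⁻¹ * ξ) := funext (ft_eq_fourier f)
  rw [h2]
  fun_prop

theorem memLp_ft {f : ℝ → ℂ} (h1 : Integrable f) (h2 : MemLp f 2) : MemLp (ft f) 2 := by
  rw [memLp_two_iff (continuous_ft h1).aestronglyMeasurable, l2n_ft h1 h2]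
  exact (memLp_two_iff h2.1).1 h2

/-- Fourier inversion, almost everywhere. -/
theorem ft_ft_neg_ae_eq {f : ℝ → ℂ} (h1 : Integrable f) (h2 : MemLp f 2) (h3 : Integrable (ft f)) :
    (fun y => ft (ft f) (-y)) =ᵐ[volume] f := by
  have hπ := Real.pi_pos
  have hs := sqrt_two_pi_ne_zero
  have hF : 𝓕 f = fun t => (√(2 * π) : ℂ) * ft f (2 * π * t) := by
    ext t
    rw [ft_eq_fourier, ← mul_assoc, ← mul_assoc, inv_mul_cancel₀ (by positivity : (2 * π) ≠ 0), one_mul,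
      mul_inv_cancel₀ hs, one_mul]
  have i1 : Integrable (𝓕 f) := by
    rw [hF]
    exact (h3.comp_mul_left' (by positivity)).const_mul _
  have i2 : MemLp (𝓕 f) 2 := by
    rw [memLp_two_iff i1.1, l2n_lt_top_iff, lintegral_fourier_sq h1 h2, ← l2n_lt_top_iff]
    exact (memLp_two_iff h2.1).1 h2
  have e1 : i2.toLp (𝓕 f) = 𝓕 (h2.toLp f) := by
    refine Lp.ext ?_
    filter_upwards [i2.coeFn_toLp, fourier_toLp_ae_eq h1 h2] with x hx hy
    rw [hx, hy]
  have e2 := fourierInv_toLp_ae_eq i1 i2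
  rw [e1, FourierTransform.fourierInv_fourier_eq] at e2
  have e3 : ∀ y, ft (ft f) (-y) = 𝓕⁻ (𝓕 f) y := by
    intro y
    rw [Real.fourierInv_eq_fourier_neg, ft_eq_fourier, Real.fourier_real_eq_integral_exp_smul,
      Real.fourier_real_eq_integral_exp_smul]
    have h4 := Measure.integral_comp_mul_left (fun v : ℝ =>
      Complex.exp (((-2 * π * v * ((2 * π)⁻¹ * -y) : ℝ) : ℂ) * I) • ft f v) (2 * π)
    have h5 : ∫ v : ℝ, Complex.exp (((-2 * π * v * -y : ℝ) : ℂ) * I) • 𝓕 f v =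
        (√(2 * π) : ℂ) * ∫ v : ℝ, Complex.exp (((-2 * π * (2 * π * v) * ((2 * π)⁻¹ * -y) : ℝ) : ℂ) *
          I) • ft f (2 * π * v) := by
      rw [← integral_const_mul]
      refine integral_congr_ae (ae_of_all _ fun v => ?_)
      have : (-2 * π * (2 * π * v) * ((2 * π)⁻¹ * -y) : ℝ) = -2 * π * v * -y := by field_simp
      simp only [this, hF, smul_eq_mul]
      ring
    rw [h5, h4, abs_of_pos (by positivity), Complex.real_smul]
    have hss : (√(2 * π) : ℂ) * √(2 * π) = 2 * π := by
      rw [← Complex.ofReal_mul, Real.mul_self_sqrt (by positivity)]; push_cast; rfl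
    rw [← mul_assoc]
    congr 1
    push_cast
    rw [← hss]
    field_simp
  filter_upwards [e2, h2.coeFn_toLp] with y hy hy2
  rw [e3, ← hy, hy2]

theorem hasDerivAt_ft {f : ℝ → ℂ} (h1 : Integrable f) (h2 : Integrable fun x : ℝ => (x : ℂ) * f x)
    (ξ : ℝ) : HasDerivAt (ft f) (ft (fun x => -(I * x * f x)) ξ) ξ := by
  have h := (hasDerivAt_integral_of_dominated_loc_of_deriv_le (μ := volume)
    (F := fun (ξ x : ℝ) => Complex.exp (-(I * ξ * x)) * f x)
    (F' := fun (ξ x : ℝ) => Complex.exp (-(I * ξ * x)) * (-(I * x * f x)))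
    (bound := fun x : ℝ => ‖(x : ℂ) * f x‖) (x₀ := ξ) (s := Set.univ) Filter.univ_mem
    (Filter.Eventually.of_forall fun ξ => (integrable_cexp_mul h1 ξ).1) (integrable_cexp_mul h1 ξ) ?_ ?_
    h2.norm ?_).2
  · exact h.const_mul _
  · have h3 : Integrable fun x : ℝ => -(I * x * f x) := by
      refine (h2.const_mul (-I)).congr (ae_of_all _ fun x => ?_)
      simp only; ring
    exact (integrable_cexp_mul h3 ξ).1
  · refine ae_of_all _ fun x s _ => ?_
    rw [norm_mul, norm_cexp_neg_I_mul, one_mul, norm_neg, mul_assoc, norm_mul, Complex.norm_I, one_mul]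
  · refine ae_of_all _ fun x s _ => ?_
    have h3 : HasDerivAt (fun s : ℝ => -(I * s * x)) (-(I * x)) s := by
      have := ((hasDerivAt_id s).ofReal_comp.const_mul I).mul_const (x : ℂ)
      simpa using! this.neg
    have h4 := h3.cexp.mul_const (f x)
    refine h4.congr_deriv ?_
    ring

/-! ### An interpolation inequality with weights -/

/-- One of the two summands is at least half of the right-hand side; in the second case one power of
the finite `X` cancels. -/
theorem ENNReal_sq_le_of_sq_le_add {X a b : ℝ≥0∞} (hX : X < ⊤) (h : X ^ 2 ≤ a + 2 * (b * X)) :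
    X ^ 2 ≤ 2 * a + 16 * b ^ 2 := by
  rcases le_total (2 * (b * X)) a with h1 | h1
  · refine (h.trans (add_le_add le_rfl h1)).trans ?_
    rw [two_mul]; exact le_add_right le_rfl
  · have h2 : X ^ 2 ≤ 4 * b * X := by
      refine (h.trans (add_le_add h1 le_rfl)).trans (le_of_eq ?_)
      ring
    have h3 : X ≤ 4 * b := by
      rcases eq_or_ne X 0 with h0 | h0
      · simp [h0]
      · rw [pow_two] at h2
        exact (ENNReal.mul_le_mul_iff_left h0 hX.ne).1 h2
    calc X ^ 2 ≤ (4 * b) ^ 2 := by gcongr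
      _ = 16 * b ^ 2 := by ring
      _ ≤ _ := le_add_left le_rfl

section Interpolation

variable {f f1 f2 : ℝ → ℂ}

/-- The truncated weight `(1 + s²)/(1 + εs²)`. -/
def wtr (ε s : ℝ) : ℝ := (1 + s ^ 2) / (1 + ε * s ^ 2)

/-- The derivative of `wtr`. -/
def wtr' (ε s : ℝ) : ℝ := 2 * s * (1 - ε) / (1 + ε * s ^ 2) ^ 2

theorem hasDerivAt_wtr {ε : ℝ} (hε : 0 < ε) (s : ℝ) : HasDerivAt (wtr ε) (wtr' ε s) s := by
  have h0 : (1 + ε * s ^ 2) ≠ 0 := by positivity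
  have h1 : HasDerivAt (fun s : ℝ => 1 + s ^ 2) (2 * s) s := by
    simpa using (hasDerivAt_pow 2 s).const_add 1
  have h2 : HasDerivAt (fun s : ℝ => 1 + ε * s ^ 2) (ε * (2 * s)) s := by
    simpa using ((hasDerivAt_pow 2 s).const_mul ε).const_add 1
  refine (h1.div h2 h0).congr_deriv ?_
  unfold wtr'
  field_simp
  ring

theorem wtr_nonneg {ε : ℝ} (hε : 0 < ε) (s : ℝ) : 0 ≤ wtr ε s := by unfold wtr; positivity

theorem wtr_le {ε : ℝ} (hε : 0 < ε) (s : ℝ) : wtr ε s ≤ 1 + s ^ 2 :=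
  div_le_self (by positivity) (by nlinarith [mul_nonneg hε.le (sq_nonneg s)])

theorem wtr_le_inv {ε : ℝ} (hε : 0 < ε) (h1 : ε ≤ 1) (s : ℝ) : wtr ε s ≤ ε⁻¹ := by
  unfold wtr
  rw [div_le_iff₀ (by positivity), mul_add, ← mul_assoc, inv_mul_cancel₀ hε.ne']
  have := (one_le_inv₀ hε).2 h1
  linarith

theorem abs_wtr'_le {ε : ℝ} (hε : 0 < ε) (h1 : ε ≤ 1) (s : ℝ) : |wtr' ε s| ≤ 2 * |s| := by
  unfold wtr'
  rw [abs_div, abs_mul, abs_mul, abs_of_nonneg (by linarith : 0 ≤ 1 - ε),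
    abs_of_pos (by norm_num : (0 : ℝ) < 2), abs_of_pos (by positivity : 0 < (1 + ε * s ^ 2) ^ 2)]
  refine (div_le_self (by have := abs_nonneg s; have : 0 ≤ 1 - ε := by linarith
                          positivity) (one_le_pow₀ (by nlinarith [mul_nonneg hε.le (sq_nonneg s)]))).trans ?_
  nlinarith [abs_nonneg s]

theorem abs_wtr'_le_inv {ε : ℝ} (hε : 0 < ε) (h1 : ε ≤ 1) (s : ℝ) : |wtr' ε s| ≤ 2 * ε⁻¹ := by
  have h2 : |s| ≤ ε⁻¹ * (1 + ε * s ^ 2) ^ 2 := by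
    have e1 : ε⁻¹ * (1 + ε * s ^ 2) ^ 2 = ε⁻¹ + 2 * s ^ 2 + ε * s ^ 4 := by field_simp; ring
    rw [e1]
    have e2 := (one_le_inv₀ hε).2 h1
    have e3 : 0 ≤ ε * s ^ 4 := by positivity
    have e4 := abs_nonneg s
    nlinarith [sq_nonneg (|s| - 1), sq_abs s]
  unfold wtr'
  rw [abs_div, abs_mul, abs_mul, abs_of_nonneg (by linarith : 0 ≤ 1 - ε),
    abs_of_pos (by norm_num : (0 : ℝ) < 2), abs_of_pos (by positivity : 0 < (1 + ε * s ^ 2) ^ 2),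
    div_le_iff₀ (by positivity), mul_assoc 2 ε⁻¹]
  have := abs_nonneg s
  nlinarith

/-- Integration by parts in `∫ w²|f'|²` leaves `∫ w² f'' f` and `∫ w w' f' f`, and Cauchy-Schwarz
puts the whole weight `w²` on `f`. The truncated weight and its derivative are bounded, so all
integrals converge and `X` is finite, while `wtr ε s ≤ 1 + s²` and `|wtr' ε s| ≤ 2|s|` keep the
constants independent of `ε`. -/
theorem interpolation_truncated (hf : ∀ s, HasDerivAt f (f1 s) s) (hf1 : ∀ s, HasDerivAt f1 (f2 s) s)
    (m0 : MemLp f 2) (m1 : MemLp f1 2) (m2 : MemLp f2 2) {ε : ℝ} (hε : 0 < ε) (h1 : ε ≤ 1) :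
    l2n volume (fun s => ofReal (wtr ε s) * ‖f1 s‖ₑ) ^ 2 ≤
      64 * (l2n volume (fun s => ofReal ((1 + s ^ 2) ^ 2) * ‖f s‖ₑ) *
        (l2n volume (fun s => ‖f2 s‖ₑ) + l2n volume fun s => ‖f s‖ₑ)) := by
  have hwm : Measurable (wtr ε) := by unfold wtr; fun_prop
  have hwm' : Measurable (wtr' ε) := by unfold wtr'; fun_prop
  set A := l2n volume (fun s => ofReal ((1 + s ^ 2) ^ 2) * ‖f s‖ₑ) with hA
  set X := l2n volume (fun s => ofReal (wtr ε s) * ‖f1 s‖ₑ) with hX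
  set b := l2n volume (fun s => ofReal |wtr' ε s| * ‖f s‖ₑ) with hb
  have hfm : Measurable f := (continuous_iff_continuousAt.2 fun s => (hf s).continuousAt).measurable
  have hfm1 : Measurable f1 := (continuous_iff_continuousAt.2 fun s => (hf1 s).continuousAt).measurable
  have hXt : X < ⊤ := by
    refine lt_of_le_of_lt (l2n_mono fun s => mul_le_mul_left (ofReal_le_ofReal
      (wtr_le_inv hε h1 s)) _) ?_
    rw [l2n_const_mul _ hfm1.enorm.aemeasurable]
    exact mul_lt_top ofReal_lt_top ((memLp_two_iff m1.1).1 m1)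
  have hb2 : b ^ 2 ≤ 4 * (A * l2n volume fun s => ‖f s‖ₑ) := by
    rw [hb, l2n_sq]
    have : ∫⁻ s, (ofReal ((1 + s ^ 2) ^ 2) * ‖f s‖ₑ) * ‖f s‖ₑ ≤ A * l2n volume fun s => ‖f s‖ₑ :=
      lintegral_mul_le_l2n (Measurable.aemeasurable (by fun_prop)) hfm.enorm.aemeasurable
    refine le_trans ?_ (mul_le_mul_right this 4)
    rw [← lintegral_const_mul' _ _ (by simp)]
    refine lintegral_mono fun s => ?_
    calc (ofReal |wtr' ε s| * ‖f s‖ₑ) ^ 2 ≤ (ofReal (2 * |s|) * ‖f s‖ₑ) ^ 2 := by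
          gcongr; exact abs_wtr'_le hε h1 s
      _ = ofReal ((2 * |s|) ^ 2) * ‖f s‖ₑ ^ 2 := by
          rw [mul_pow, ofReal_pow (by positivity)]
      _ ≤ ofReal (4 * (1 + s ^ 2) ^ 2) * ‖f s‖ₑ ^ 2 := by
          gcongr
          rw [mul_pow, sq_abs]
          nlinarith [sq_nonneg s, sq_nonneg (s ^ 2)]
      _ = _ := by
          rw [ofReal_mul (by norm_num), pow_two ‖f s‖ₑ, mul_assoc, mul_assoc]
          norm_num
  -- integration by parts
  set u : ℝ → ℂ := fun s => ((wtr ε s ^ 2 : ℝ) : ℂ) * (starRingEnd ℂ) (f1 s) with hu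
  set u' : ℝ → ℂ := fun s => ((2 * wtr ε s * wtr' ε s : ℝ) : ℂ) * (starRingEnd ℂ) (f1 s) +
    ((wtr ε s ^ 2 : ℝ) : ℂ) * (starRingEnd ℂ) (f2 s) with hu'
  have hud : ∀ s, HasDerivAt u (u' s) s := fun s => by
    have e1 : HasDerivAt (fun s => wtr ε s ^ 2) (2 * wtr ε s * wtr' ε s) s := by
      simpa using! (hasDerivAt_wtr hε s).pow 2
    exact e1.ofReal_comp.mul ((hf1 s).star)
  have bd : ∀ {c : ℝ → ℝ} {g : ℝ → ℂ} {C : ℝ}, Measurable c → (∀ s, |c s| ≤ C) → MemLp g 2 →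
      MemLp (fun s => (c s : ℂ) * (starRingEnd ℂ) (g s)) 2 := by
    intro c g C hc hC hg
    refine MemLp.of_le_mul (c := C) hg ?_ (ae_of_all _ fun s => ?_)
    · exact (Complex.measurable_ofReal.comp hc).aestronglyMeasurable.mul
        (Complex.continuous_conj.comp_aestronglyMeasurable hg.1)
    · simp only [norm_mul, Complex.norm_real, norm_eq_abs, RCLike.norm_conj]
      gcongr
      exact hC s
  have hw0 := wtr_nonneg hε
  have hwi := wtr_le_inv hε h1
  have c1 : ∀ s, |wtr ε s ^ 2| ≤ ε⁻¹ ^ 2 := fun s => by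
    rw [abs_of_nonneg (sq_nonneg _)]; exact pow_le_pow_left₀ (hw0 s) (hwi s) 2
  have c2 : ∀ s, |2 * wtr ε s * wtr' ε s| ≤ 2 * ε⁻¹ * (2 * ε⁻¹) := fun s => by
    rw [abs_mul, abs_mul, abs_of_nonneg (hw0 s), abs_of_pos (by norm_num : (0 : ℝ) < 2)]
    gcongr
    · exact hwi s
    · exact abs_wtr'_le_inv hε h1 s
  have mu : MemLp u 2 := bd (hwm.pow_const 2) c1 m1
  have mu' : MemLp u' 2 := (bd (by fun_prop) c2 m1).add (bd (hwm.pow_const 2) c1 m2)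
  have iu1 : Integrable (u * f1) := mu.integrable_mul m1
  have hparts := integral_mul_deriv_eq_deriv_mul_of_integrable (fun x _ => hud x) (fun x _ => hf x)
    iu1 (mu'.integrable_mul m0) (mu.integrable_mul m0)
  have huf : ∀ s, u s * f1 s = ((wtr ε s ^ 2 * ‖f1 s‖ ^ 2 : ℝ) : ℂ) := fun s => by
    simp only [hu]
    rw [mul_assoc, mul_comm ((starRingEnd ℂ) (f1 s)), Complex.mul_conj, Complex.normSq_eq_norm_sq]
    push_cast; ring
  have hX2 : X ^ 2 = ‖∫ s, u s * f1 s‖ₑ := by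
    rw [hX, l2n_sq]
    simp_rw [huf]
    rw [show ∫ s, ((wtr ε s ^ 2 * ‖f1 s‖ ^ 2 : ℝ) : ℂ) = ((∫ s, wtr ε s ^ 2 * ‖f1 s‖ ^ 2 : ℝ) : ℂ) from
      integral_ofReal, ← ofReal_norm (_ : ℂ), Complex.norm_real, norm_of_nonneg
      (integral_nonneg fun s => by positivity), ofReal_integral_eq_lintegral_ofReal]
    · refine lintegral_congr fun s => ?_
      rw [mul_pow, ofReal_mul (by positivity), ofReal_pow (hw0 s),
        ofReal_pow (norm_nonneg _), ofReal_norm]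
    · refine iu1.norm.congr (ae_of_all _ fun s => ?_)
      simp only [Pi.mul_apply, huf, Complex.norm_real]
      exact norm_of_nonneg (by positivity)
    · exact ae_of_all _ fun s => by positivity
  have hfm2 : AEMeasurable (fun s => ‖f2 s‖ₑ) := m2.1.enorm
  have hmain : X ^ 2 ≤ A * l2n volume (fun s => ‖f2 s‖ₑ) + 2 * (b * X) := by
    rw [hX2, hparts, enorm_neg]
    have e1 : ∫⁻ s, (ofReal |wtr' ε s| * ‖f s‖ₑ) * (ofReal (wtr ε s) * ‖f1 s‖ₑ) ≤ b * X :=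
      lintegral_mul_le_l2n (Measurable.aemeasurable (by fun_prop)) (Measurable.aemeasurable (by fun_prop))
    have e2 : ∫⁻ s, (ofReal ((1 + s ^ 2) ^ 2) * ‖f s‖ₑ) * ‖f2 s‖ₑ ≤
        A * l2n volume fun s => ‖f2 s‖ₑ :=
      lintegral_mul_le_l2n (Measurable.aemeasurable (by fun_prop)) hfm2
    calc ‖∫ s, u' s * f s‖ₑ ≤ ∫⁻ s, ‖u' s * f s‖ₑ := enorm_integral_le_lintegral_enorm _
      _ ≤ ∫⁻ s, (2 * ((ofReal |wtr' ε s| * ‖f s‖ₑ) * (ofReal (wtr ε s) * ‖f1 s‖ₑ)) +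
          (ofReal ((1 + s ^ 2) ^ 2) * ‖f s‖ₑ) * ‖f2 s‖ₑ) := by
          refine lintegral_mono fun s => ?_
          rw [enorm_mul]
          have hc : ∀ z : ℂ, ‖(starRingEnd ℂ) z‖ₑ = ‖z‖ₑ := fun z => by
            rw [← ofReal_norm, RCLike.norm_conj, ofReal_norm]
          have hr : ∀ x : ℝ, ‖(x : ℂ)‖ₑ = ofReal |x| := fun x => by
            rw [← ofReal_norm, Complex.norm_real, norm_eq_abs]
          have e3 : ‖u' s‖ₑ ≤ 2 * ofReal (wtr ε s) * ofReal |wtr' ε s| * ‖f1 s‖ₑ +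
              ofReal ((1 + s ^ 2) ^ 2) * ‖f2 s‖ₑ := by
            refine (enorm_add_le _ _).trans (add_le_add ?_ ?_)
            · rw [enorm_mul, hc, hr, abs_mul, abs_mul, abs_of_nonneg (hw0 s),
                ofReal_mul (by have := hw0 s; positivity), ofReal_mul (by positivity)]
              norm_num
            · rw [enorm_mul, hc, hr, abs_of_nonneg (by positivity)]
              gcongr
              · exact hw0 s
              · exact wtr_le hε s
          refine (mul_le_mul_left e3 _).trans (le_of_eq ?_)
          ring
      _ ≤ 2 * (b * X) + A * l2n volume fun s => ‖f2 s‖ₑ := by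
          rw [lintegral_add_left (Measurable.const_mul (by fun_prop) _), lintegral_const_mul' _ _ (by simp)]
          gcongr
      _ = _ := add_comm _ _
  refine (ENNReal_sq_le_of_sq_le_add hXt hmain).trans ?_
  calc 2 * (A * l2n volume fun s => ‖f2 s‖ₑ) + 16 * b ^ 2
      ≤ 64 * (A * l2n volume fun s => ‖f2 s‖ₑ) + 16 * (4 * (A * l2n volume fun s => ‖f s‖ₑ)) := by
        gcongr; norm_num
    _ = _ := by ring

/-- A weighted interpolation inequality. -/
theorem interpolation (hf : ∀ s, HasDerivAt f (f1 s) s) (hf1 : ∀ s, HasDerivAt f1 (f2 s) s)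
    (m0 : MemLp f 2) (m1 : MemLp f1 2) (m2 : MemLp f2 2) :
    l2n volume (fun s => ofReal (1 + s ^ 2) * ‖f1 s‖ₑ) ^ 2 ≤
      64 * (l2n volume (fun s => ofReal ((1 + s ^ 2) ^ 2) * ‖f s‖ₑ) *
        (l2n volume (fun s => ‖f2 s‖ₑ) + l2n volume fun s => ‖f s‖ₑ)) := by
  have hfm1 : Measurable f1 := (continuous_iff_continuousAt.2 fun s => (hf1 s).continuousAt).measurable
  -- The truncation parameter is `ε = 1/(R+1)`; Fatou's lemma removes it.
  have hpos : ∀ R : ℕ, (0 : ℝ) < ((R : ℝ) + 1)⁻¹ := fun R => by positivity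
  have hle : ∀ R : ℕ, ((R : ℝ) + 1)⁻¹ ≤ 1 := fun R => inv_le_one_of_one_le₀ (by simp)
  have hlim : ∀ s, Tendsto (fun R : ℕ => (ofReal (wtr ((R : ℝ) + 1)⁻¹ s) * ‖f1 s‖ₑ) ^ 2)
      atTop (nhds ((ofReal (1 + s ^ 2) * ‖f1 s‖ₑ) ^ 2)) := fun s => by
    refine (ENNReal.continuous_pow 2).continuousAt.tendsto.comp ?_
    refine ENNReal.Tendsto.mul_const ?_ (Or.inr enorm_ne_top)
    refine (ENNReal.continuous_ofReal.tendsto _).comp ?_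
    have h1 : Tendsto (fun R : ℕ => ((R : ℝ) + 1)⁻¹) atTop (nhds 0) := by
      simpa using tendsto_one_div_add_atTop_nhds_zero_nat (𝕜 := ℝ)
    have h2 : Tendsto (fun e : ℝ => wtr e s) (nhds 0) (nhds (1 + s ^ 2)) := by
      have : ContinuousAt (fun e : ℝ => wtr e s) 0 := by
        unfold wtr
        refine ContinuousAt.div (by fun_prop) (by fun_prop) (by simp)
      simpa [ContinuousAt, wtr] using this
    exact h2.comp h1
  rw [l2n_sq]
  simp_rw [← (hlim _).liminf_eq]
  refine (lintegral_liminf_le fun R => ?_).trans ?_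
  · have : Measurable (wtr ((R : ℝ) + 1)⁻¹) := by unfold wtr; fun_prop
    fun_prop
  · refine Filter.liminf_le_of_le (by isBoundedDefault) fun b hb => ?_
    obtain ⟨R, hR⟩ := hb.exists
    refine hR.trans ?_
    rw [← l2n_sq]
    exact interpolation_truncated hf hf1 m0 m1 m2 (hpos R) (hle R)

end Interpolation

/-! ### Distributional regularity in one variable on the Fourier side -/

/-- The operator `(1 - ∂²)²`. -/
def lop (ψ : ℝ → ℝ) (x : ℝ) : ℝ := ψ x - 2 * iteratedDeriv 2 ψ x + iteratedDeriv 4 ψ x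

theorem memLp_mul_prod {ψ β : ℝ → ℝ} (hψ : MemLp ψ 2) (hβ : MemLp β 2) :
    MemLp (fun p : ℝ × ℝ => ψ p.1 * β p.2) 2 := by
  have hm : AEStronglyMeasurable (fun p : ℝ × ℝ => ψ p.1 * β p.2) volume := by
    rw [Measure.volume_eq_prod]
    exact hψ.1.comp_fst.mul hβ.1.comp_snd
  rw [memLp_two_iff hm]
  rw [l2n_lt_top_iff, Measure.volume_eq_prod]
  simp_rw [enorm_mul, mul_pow]
  rw [lintegral_prod_mul (f := fun x => ‖ψ x‖ₑ ^ 2) (g := fun x => ‖β x‖ₑ ^ 2)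
    (hψ.1.enorm.pow_const 2) (hβ.1.enorm.pow_const 2)]
  exact mul_lt_top (l2n_lt_top_iff.1 ((memLp_two_iff hψ.1).1 hψ))
    (l2n_lt_top_iff.1 ((memLp_two_iff hβ.1).1 hβ))

theorem locallyIntegrable_integral_mul {f : ℝ × ℝ → ℝ} (hf : MemLp f 2) {ψ : ℝ → ℝ} (hψ : MemLp ψ 2) :
    LocallyIntegrable fun y => ∫ x, f (x, y) * ψ x := by
  rw [locallyIntegrable_iff]
  intro K hK
  have hβ : MemLp (K.indicator (fun _ : ℝ => (1 : ℝ))) 2 :=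
    memLp_indicator_const 2 hK.measurableSet 1 (Or.inr hK.measure_lt_top.ne)
  have h1 : Integrable fun p : ℝ × ℝ => f p * (ψ p.1 * K.indicator (fun _ : ℝ => (1 : ℝ)) p.2) :=
    hf.integrable_mul (memLp_mul_prod hψ hβ)
  rw [Measure.volume_eq_prod] at h1
  have h2 := h1.integral_prod_right
  rw [← integrable_indicator_iff hK.measurableSet]
  refine h2.congr (ae_of_all _ fun y => ?_)
  by_cases hy : y ∈ K <;> simp [hy]

theorem integral_mul_integral {f : ℝ × ℝ → ℝ} (hf : MemLp f 2) {ψ β : ℝ → ℝ} (hψ : MemLp ψ 2)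
    (hβ : MemLp β 2) :
    ∫ y, β y * ∫ x, f (x, y) * ψ x = ∫ p, f p * (ψ p.1 * β p.2) := by
  have h1 : Integrable fun p : ℝ × ℝ => f p * (ψ p.1 * β p.2) :=
    hf.integrable_mul (memLp_mul_prod hψ hβ)
  rw [Measure.volume_eq_prod] at h1 ⊢
  rw [integral_prod_symm _ h1]
  refine integral_congr_ae (ae_of_all _ fun y => ?_)
  simp only
  rw [← integral_const_mul]
  refine integral_congr_ae (ae_of_all _ fun x => ?_)
  simp only; ring

theorem contDiff_iteratedDeriv {ψ : ℝ → ℝ} (hψ : ContDiff ℝ (⊤ : ℕ∞) ψ) (n : ℕ) :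
    Continuous (iteratedDeriv n ψ) :=
  hψ.continuous_iteratedDeriv n (by exact_mod_cast le_top)

theorem hasCompactSupport_iteratedDeriv {ψ : ℝ → ℝ} (hψ : HasCompactSupport ψ) (n : ℕ) :
    HasCompactSupport (iteratedDeriv n ψ) := by
  induction n with
  | zero => simpa using hψ
  | succ n ih => rw [iteratedDeriv_succ]; exact ih.deriv

theorem memLp_lop {ψ : ℝ → ℝ} (hψ : ContDiff ℝ (⊤ : ℕ∞) ψ) (hc : HasCompactSupport ψ) :
    MemLp (lop ψ) 2 := by
  have h := fun n => (contDiff_iteratedDeriv hψ n).memLp_of_hasCompactSupport (p := 2)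
    (μ := (volume : Measure ℝ)) (hasCompactSupport_iteratedDeriv hc n)
  have h0 : MemLp ψ 2 volume := hψ.continuous.memLp_of_hasCompactSupport hc
  exact (h0.sub ((h 2).const_mul 2)).add (h 4)

/-- Among product test functions `ψ(x) β(y)`, letting `β` vary localizes the distributional identity
to almost every line of constant `y`. -/
theorem ae_integral_eq_of_test {u v : ℝ × ℝ → ℝ} (hu : MemLp u 2) (hv : MemLp v 2)
    (htest : ∀ ψ β : ℝ → ℝ, ContDiff ℝ (⊤ : ℕ∞) ψ → HasCompactSupport ψ → ContDiff ℝ (⊤ : ℕ∞) β →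
      HasCompactSupport β → ∫ p : ℝ × ℝ, v p * (ψ p.1 * β p.2) = ∫ p : ℝ × ℝ, u p * (lop ψ p.1 * β p.2))
    {ψ : ℝ → ℝ} (hψ : ContDiff ℝ (⊤ : ℕ∞) ψ) (hc : HasCompactSupport ψ) :
    ∀ᵐ y : ℝ, ∫ x, v (x, y) * ψ x = ∫ x, u (x, y) * lop ψ x := by
  have m1 : MemLp ψ 2 volume := hψ.continuous.memLp_of_hasCompactSupport hc
  have m2 := memLp_lop hψ hc
  refine ae_eq_of_integral_contDiff_smul_eq (locallyIntegrable_integral_mul hv m1)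
    (locallyIntegrable_integral_mul hu m2) fun β hβ hβc => ?_
  have m3 : MemLp β 2 volume := hβ.continuous.memLp_of_hasCompactSupport hβc
  simp only [smul_eq_mul]
  rw [integral_mul_integral hv m1 m3, integral_mul_integral hu m2 m3]
  exact htest ψ β hψ hc hβ hβc

/-- A smooth cutoff function. -/
def cutoff : ContDiffBump (0 : ℝ) := ⟨1, 2, one_pos, one_lt_two⟩

/-- Dilated cutoff functions. -/
def cutoffR (R : ℕ) (x : ℝ) : ℝ := cutoff (((R : ℝ) + 1)⁻¹ * x)

theorem contDiff_cutoffR (R : ℕ) : ContDiff ℝ (⊤ : ℕ∞) (cutoffR R) :=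
  cutoff.contDiff.comp (contDiff_const.mul contDiff_id)

theorem hasCompactSupport_cutoffR (R : ℕ) : HasCompactSupport (cutoffR R) := by
  have h : ((R : ℝ) + 1)⁻¹ ≠ 0 := by positivity
  exact cutoff.hasCompactSupport.comp_homeomorph (Homeomorph.mulLeft₀ _ h)

theorem abs_cutoffR_le (R : ℕ) (x : ℝ) : |cutoffR R x| ≤ 1 := by
  rw [cutoffR, abs_of_nonneg cutoff.nonneg]; exact cutoff.le_one

theorem cutoffR_eventuallyEq (x : ℝ) : ∀ᶠ R : ℕ in atTop, cutoffR R =ᶠ[nhds x] fun _ => 1 := by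
  obtain ⟨N, hN⟩ := exists_nat_ge (|x| + 1)
  filter_upwards [Filter.eventually_ge_atTop N] with R hR
  filter_upwards [Metric.ball_mem_nhds x one_pos] with z hz
  refine cutoff.one_of_mem_closedBall ?_
  rw [Metric.mem_ball, Real.dist_eq] at hz
  have h1 : |z| ≤ |x| + 1 := by
    have := abs_add_le (z - x) x
    rw [sub_add_cancel] at this
    linarith
  have hR' : (N : ℝ) ≤ R := by exact_mod_cast hR
  have h3 : (0 : ℝ) < R + 1 := by positivity
  rw [Metric.mem_closedBall, Real.dist_eq, sub_zero, abs_mul, abs_of_pos (inv_pos.2 h3)]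
  change ((R : ℝ) + 1)⁻¹ * |z| ≤ 1
  rw [inv_mul_le_iff₀ h3]
  linarith

theorem exists_bound_iteratedDeriv_cutoffR : ∃ M : ℝ, 0 ≤ M ∧ ∀ j ≤ 4, ∀ R x,
    |iteratedDeriv j (cutoffR R) x| ≤ M := by
  have h : ∀ j, ∃ M : ℝ, ∀ x, ‖iteratedDeriv j cutoff x‖ ≤ M := fun j =>
    (hasCompactSupport_iteratedDeriv cutoff.hasCompactSupport j).exists_bound_of_continuous
      (contDiff_iteratedDeriv cutoff.contDiff j)
  choose M hM using h
  have hM0 : ∀ j, 0 ≤ M j := fun j => (norm_nonneg _).trans (hM j 0)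
  refine ⟨∑ j ∈ Finset.range 5, M j, Finset.sum_nonneg fun j _ => hM0 j, fun j hj R x => ?_⟩
  have h1 : iteratedDeriv j (cutoffR R) x =
      ((R : ℝ) + 1)⁻¹ ^ j * iteratedDeriv j cutoff (((R : ℝ) + 1)⁻¹ * x) :=
    congrFun (iteratedDeriv_comp_const_mul (n := j) cutoff.contDiff _) x
  have h2 : ((R : ℝ) + 1)⁻¹ ^ j ≤ 1 := pow_le_one₀ (by positivity) (inv_le_one_of_one_le₀ (by simp))
  rw [h1, abs_mul, abs_of_nonneg (by positivity)]
  calc _ ≤ 1 * M j := by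
        gcongr
        exact hM j _
    _ ≤ _ := by
        rw [one_mul]
        exact Finset.single_le_sum (f := M) (fun j _ => hM0 j) (Finset.mem_range.2 (by omega))

/-- Trigonometric functions are not admissible test functions, so they are cut off. The derivatives
of the dilated cutoffs are bounded uniformly in `R`, and near any given point the cutoff is
eventually `1`; dominated convergence with the integrable `g` concludes. -/
theorem tendsto_integral_lop {g e : ℝ → ℝ} (hg : Integrable g) (he : ContDiff ℝ (⊤ : ℕ∞) e) {B : ℝ}
    (hB : ∀ j x, |iteratedDeriv j e x| ≤ B ^ j) :
    Tendsto (fun R => ∫ x, g x * lop (fun x => cutoffR R x * e x) x) atTop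
      (nhds (∫ x, g x * lop e x)) := by
  obtain ⟨M, hM0, hM⟩ := exists_bound_iteratedDeriv_cutoffR
  have hsm : ∀ R, ContDiff ℝ (⊤ : ℕ∞) fun x => cutoffR R x * e x := fun R => (contDiff_cutoffR R).mul he
  have hbd : ∀ n ≤ 4, ∃ C : ℝ, 0 ≤ C ∧ ∀ R x, |iteratedDeriv n (fun x => cutoffR R x * e x) x| ≤ C := by
    intro n hn
    refine ⟨∑ i ∈ Finset.range (n + 1), (n.choose i : ℝ) * M * |B ^ (n - i)|,
      Finset.sum_nonneg fun i _ => by positivity, fun R x => ?_⟩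
    rw [iteratedDeriv_fun_mul ((contDiff_cutoffR R).contDiffAt.of_le (by exact_mod_cast le_top))
      (he.contDiffAt.of_le (by exact_mod_cast le_top))]
    refine (Finset.abs_sum_le_sum_abs _ _).trans (Finset.sum_le_sum fun i hi => ?_)
    rw [abs_mul, abs_mul, Nat.abs_cast]
    have hi' : i ≤ n := Nat.lt_succ_iff.1 (Finset.mem_range.1 hi)
    exact mul_le_mul (mul_le_mul_of_nonneg_left (hM i (hi'.trans hn) R x) (Nat.cast_nonneg _))
      ((hB _ x).trans (le_abs_self _)) (abs_nonneg _) (by positivity)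
  obtain ⟨C0, hC0, h0⟩ := hbd 0 (by norm_num)
  obtain ⟨C2, hC2, h2⟩ := hbd 2 (by norm_num)
  obtain ⟨C4, hC4, h4⟩ := hbd 4 (by norm_num)
  refine tendsto_integral_of_dominated_convergence (fun x => ‖g x‖ * (C0 + 2 * C2 + C4)) (fun R => ?_)
    (hg.norm.mul_const _) (fun R => ae_of_all _ fun x => ?_)
    (ae_of_all _ fun x => ?_)
  · refine hg.1.mul (Continuous.aestronglyMeasurable ?_)
    have := contDiff_iteratedDeriv (hsm R)
    have h5 := (hsm R).continuous
    unfold lop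
    have h6 := this 2
    have h7 := this 4
    fun_prop
  · rw [norm_mul]
    gcongr
    have e0 := h0 R x
    rw [iteratedDeriv_zero] at e0
    have e2 := h2 R x
    have e4 := h4 R x
    rw [norm_eq_abs, lop]
    rw [abs_le] at e0 e2 e4 ⊢
    constructor <;> linarith [e0.1, e0.2, e2.1, e2.2, e4.1, e4.2]
  · refine Filter.Tendsto.const_mul _ (tendsto_const_nhds.congr' ?_)
    filter_upwards [cutoffR_eventuallyEq x] with R hR
    have h5 : (fun x => cutoffR R x * e x) =ᶠ[nhds x] e := by
      filter_upwards [hR] with z hz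
      simp [hz]
    have h6 : cutoffR R x * e x = e x := h5.eq_of_nhds
    simp only [lop]
    rw [h5.iteratedDeriv_eq 2, h5.iteratedDeriv_eq 4, h6]

theorem lop_cos (l x : ℝ) : lop (fun x => cos (l * x)) x = (1 + l ^ 2) ^ 2 * cos (l * x) := by
  have h : ∀ n, iteratedDeriv n (fun x => cos (l * x)) x = l ^ n * iteratedDeriv n cos (l * x) :=
    fun n => congrFun (iteratedDeriv_comp_const_mul (n := n) Real.contDiff_cos l) x
  rw [lop, h, h]
  simp [iteratedDeriv_succ]
  ring

theorem lop_sin (l x : ℝ) : lop (fun x => sin (l * x)) x = (1 + l ^ 2) ^ 2 * sin (l * x) := by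
  have h : ∀ n, iteratedDeriv n (fun x => sin (l * x)) x = l ^ n * iteratedDeriv n sin (l * x) :=
    fun n => congrFun (iteratedDeriv_comp_const_mul (n := n) Real.contDiff_sin l) x
  rw [lop, h, h]
  simp [iteratedDeriv_succ]
  ring

theorem ft_ofReal {g : ℝ → ℝ} (hg : Integrable g) (l : ℝ) :
    ft (fun x => (g x : ℂ)) l = (√(2 * π) : ℂ)⁻¹ *
      (((∫ x, g x * cos (l * x) : ℝ) : ℂ) - I * ((∫ x, g x * sin (l * x) : ℝ) : ℂ)) := by
  have hb : ∀ {t : ℝ → ℝ}, Continuous t → (∀ x, |t x| ≤ 1) → Integrable fun x => ((g x * t x : ℝ) : ℂ) := by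
    intro t ht h1
    refine Integrable.ofReal ?_
    exact hg.mul_bdd (c := 1) ht.aestronglyMeasurable (ae_of_all _ h1)
  have hcos := hb (t := fun x => cos (l * x)) (by fun_prop) (fun x => Real.abs_cos_le_one _)
  have hsin := hb (t := fun x => sin (l * x)) (by fun_prop) (fun x => Real.abs_sin_le_one _)
  have e1 : ((∫ x, g x * cos (l * x) : ℝ) : ℂ) = ∫ x, ((g x * cos (l * x) : ℝ) : ℂ) := integral_ofReal.symm
  have e2 : ((∫ x, g x * sin (l * x) : ℝ) : ℂ) = ∫ x, ((g x * sin (l * x) : ℝ) : ℂ) := integral_ofReal.symm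
  have e3 : I * ∫ x, ((g x * sin (l * x) : ℝ) : ℂ) =
      ∫ x, I * ((g x * sin (l * x) : ℝ) : ℂ) := (integral_const_mul _ _).symm
  rw [ft, e1, e2, e3, ← integral_sub hcos (hsin.const_mul _)]
  congr 1
  refine integral_congr_ae (ae_of_all _ fun x => ?_)
  simp only
  rw [show -(I * l * x) = ((-(l * x) : ℝ) : ℂ) * I by push_cast; ring,
    Complex.exp_mul_I, ← Complex.ofReal_cos, ← Complex.ofReal_sin, Real.cos_neg, Real.sin_neg]
  push_cast; ring

/-- Regularity in the sense of distributions gives weighted bounds on the Fourier side. -/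
theorem lintegral_pft_le_of_test {u v : ℝ × ℝ → ℝ} (hu : MemLp u 2) (hv : MemLp v 2) (hvm : Measurable v)
    (hux : ∀ᵐ y, Integrable fun x => u (x, y))
    (htest : ∀ ψ β : ℝ → ℝ, ContDiff ℝ (⊤ : ℕ∞) ψ → HasCompactSupport ψ → ContDiff ℝ (⊤ : ℕ∞) β →
      HasCompactSupport β → ∫ p : ℝ × ℝ, v p * (ψ p.1 * β p.2) = ∫ p : ℝ × ℝ, u p * (lop ψ p.1 * β p.2))
    {W : ℝ → ℝ≥0∞} (hW : Measurable W) (hWt : ∀ y, W y ≠ ⊤) :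
    ∫⁻ l, ∫⁻ y, W y * (ofReal ((1 + l ^ 2) ^ 2) * ‖pft u l y‖ₑ) ^ 2 ≤
      ∫⁻ y, W y * ∫⁻ x, ‖v (x, y)‖ₑ ^ 2 := by
  have hvy : ∀ᵐ y : ℝ, ∫⁻ x, ‖v (x, y)‖ₑ ^ 2 < ⊤ := by
    have h1 := l2n_lt_top_iff.1 ((memLp_two_iff hv.1).1 hv)
    rw [Measure.volume_eq_prod, lintegral_prod_symm _ (hvm.enorm.pow_const 2).aemeasurable] at h1
    exact ae_lt_top (Measurable.lintegral_prod_left' (hvm.enorm.pow_const 2)) h1.ne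
  have hvmem : ∀ᵐ y : ℝ, MemLp (fun x => v (x, y)) 2 := by
    filter_upwards [hvy] with y hy
    have hm : AEStronglyMeasurable (fun x => v (x, y)) volume :=
      (hvm.comp measurable_prodMk_right).aestronglyMeasurable
    rw [memLp_two_iff hm, l2n_lt_top_iff]
    exact hy
  -- Sections of `v` are only square integrable, so their Fourier integral need not converge. The
  -- cut off sections are integrable, and Plancherel bounds their transforms uniformly in `R`.
  set F : ℕ → ℝ → ℝ → ℂ := fun R l y => ft (fun x => ((v (x, y) * cutoffR R x : ℝ) : ℂ)) l with hF
  have hcm : ∀ R, Measurable (cutoffR R) := fun R => (contDiff_cutoffR R).continuous.measurable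
  have hFm : ∀ R, Measurable (uncurry (F R)) := by
    intro R
    refine Measurable.const_mul (StronglyMeasurable.measurable ?_) _
    refine StronglyMeasurable.integral_prod_right (f := fun (p : ℝ × ℝ) (x : ℝ) =>
      Complex.exp (-(I * p.1 * x)) * ((v (x, p.2) * cutoffR R x : ℝ) : ℂ)) ?_
    refine Measurable.stronglyMeasurable ?_
    have h1 : Measurable fun p : (ℝ × ℝ) × ℝ => v (p.2, p.1.2) := hvm.comp (by fun_prop)
    have h2 : Measurable fun p : (ℝ × ℝ) × ℝ => cutoffR R p.2 := (hcm R).comp (by fun_prop)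
    exact Measurable.mul (f := fun p : (ℝ × ℝ) × ℝ => Complex.exp (-(I * p.1.1 * p.2)))
      (by fun_prop) (Complex.measurable_ofReal.comp (h1.mul h2))
  have hint : ∀ᵐ y : ℝ, ∀ R, Integrable (fun x => v (x, y) * cutoffR R x) ∧
      MemLp (fun x => v (x, y) * cutoffR R x) 2 := by
    filter_upwards [hvmem] with y hy R
    have h2 : MemLp (cutoffR R) 2 volume :=
      (contDiff_cutoffR R).continuous.memLp_of_hasCompactSupport (hasCompactSupport_cutoffR R)
    refine ⟨hy.integrable_mul h2, ?_⟩
    refine MemLp.of_le_mul (c := 1) hy (hy.1.mul h2.1) (ae_of_all _ fun x => ?_)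
    rw [norm_mul, one_mul]
    exact mul_le_of_le_one_right (norm_nonneg _) (abs_cutoffR_le R x)
  have hlim : ∀ l : ℝ, ∀ᵐ y : ℝ, Tendsto (fun R => F R l y) atTop
      (nhds ((((1 + l ^ 2) ^ 2 : ℝ) : ℂ) * pft u l y)) := by
    intro l
    have hcd : ContDiff ℝ (⊤ : ℕ∞) fun x : ℝ => cos (l * x) :=
      Real.contDiff_cos.comp (contDiff_const.mul contDiff_id)
    have hsd : ContDiff ℝ (⊤ : ℕ∞) fun x : ℝ => sin (l * x) :=
      Real.contDiff_sin.comp (contDiff_const.mul contDiff_id)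
    have hcb : ∀ j x, |iteratedDeriv j (fun x => cos (l * x)) x| ≤ |l| ^ j := fun j x => by
      rw [congrFun (iteratedDeriv_comp_const_mul (n := j) Real.contDiff_cos l) x, abs_mul, abs_pow]
      exact mul_le_of_le_one_right (by positivity) (Real.abs_iteratedDeriv_cos_le_one j _)
    have hsb : ∀ j x, |iteratedDeriv j (fun x => sin (l * x)) x| ≤ |l| ^ j := fun j x => by
      rw [congrFun (iteratedDeriv_comp_const_mul (n := j) Real.contDiff_sin l) x, abs_mul, abs_pow]
      exact mul_le_of_le_one_right (by positivity) (Real.abs_iteratedDeriv_sin_le_one j _)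
    have hA : ∀ᵐ y : ℝ, ∀ R, ∫ x, v (x, y) * (cutoffR R x * cos (l * x)) =
        ∫ x, u (x, y) * lop (fun x => cutoffR R x * cos (l * x)) x :=
      ae_all_iff.2 fun R => ae_integral_eq_of_test hu hv htest ((contDiff_cutoffR R).mul hcd)
        (hasCompactSupport_cutoffR R).mul_right
    have hB : ∀ᵐ y : ℝ, ∀ R, ∫ x, v (x, y) * (cutoffR R x * sin (l * x)) =
        ∫ x, u (x, y) * lop (fun x => cutoffR R x * sin (l * x)) x :=
      ae_all_iff.2 fun R => ae_integral_eq_of_test hu hv htest ((contDiff_cutoffR R).mul hsd)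
        (hasCompactSupport_cutoffR R).mul_right
    filter_upwards [hA, hB, hux, hint] with y h1 h2 h3 h4
    have t1 := tendsto_integral_lop h3 hcd hcb
    have t2 := tendsto_integral_lop h3 hsd hsb
    simp_rw [← h1, lop_cos] at t1
    simp_rw [← h2, lop_sin] at t2
    have e1 : ∀ R, F R l y = (√(2 * π) : ℂ)⁻¹ *
        (((∫ x, v (x, y) * (cutoffR R x * cos (l * x)) : ℝ) : ℂ) -
          I * ((∫ x, v (x, y) * (cutoffR R x * sin (l * x)) : ℝ) : ℂ)) := fun R => by
      simp only [hF]
      rw [ft_ofReal (h4 R).1]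
      simp_rw [mul_assoc]
    simp_rw [e1]
    have e2 : (((1 + l ^ 2) ^ 2 : ℝ) : ℂ) * pft u l y = (√(2 * π) : ℂ)⁻¹ *
        (((∫ x, u (x, y) * ((1 + l ^ 2) ^ 2 * cos (l * x)) : ℝ) : ℂ) -
          I * ((∫ x, u (x, y) * ((1 + l ^ 2) ^ 2 * sin (l * x)) : ℝ) : ℂ)) := by
      rw [pft_eq_ft, ft_ofReal h3]
      simp_rw [mul_left_comm _ ((1 + l ^ 2) ^ 2)]
      rw [integral_const_mul, integral_const_mul]
      push_cast; ring
    rw [e2]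
    refine Filter.Tendsto.const_mul _ (Filter.Tendsto.sub ?_ (Filter.Tendsto.const_mul _ ?_))
    · exact (Complex.continuous_ofReal.tendsto _).comp t1
    · exact (Complex.continuous_ofReal.tendsto _).comp t2
  have hGm : ∀ R, Measurable fun p : ℝ × ℝ => W p.2 * ‖F R p.1 p.2‖ₑ ^ 2 := fun R =>
    (hW.comp measurable_snd).mul ((hFm R).enorm.pow_const 2)
  have hR : ∀ R, ∫⁻ l, ∫⁻ y, W y * ‖F R l y‖ₑ ^ 2 ≤ ∫⁻ y, W y * ∫⁻ x, ‖v (x, y)‖ₑ ^ 2 := by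
    intro R
    rw [lintegral_lintegral_swap (hGm R).aemeasurable]
    refine lintegral_mono_ae ?_
    filter_upwards [hint] with y hy
    have hm : Measurable fun l => ‖F R l y‖ₑ ^ 2 := (hFm R).of_uncurry_right.enorm.pow_const 2
    rw [lintegral_const_mul _ hm]
    refine mul_le_mul_right ?_ _
    refine (lintegral_ft_sq (f := fun x => ((v (x, y) * cutoffR R x : ℝ) : ℂ)) (hy R).1.ofReal
      (hy R).2.ofReal).trans_le ?_
    refine lintegral_mono fun x => ?_
    have : ‖((v (x, y) * cutoffR R x : ℝ) : ℂ)‖ₑ ≤ ‖v (x, y)‖ₑ := by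
      rw [← ofReal_norm, ← ofReal_norm, Complex.norm_real, norm_mul]
      refine ofReal_le_ofReal (mul_le_of_le_one_right (norm_nonneg _) (abs_cutoffR_le R x))
    gcongr
  -- For each `l` the transforms of the cut off sections converge for almost every `y` to `(1+l²)²
  -- ũ(l;y)`, so Fatou's lemma transfers the uniform bound.
  calc ∫⁻ l, ∫⁻ y, W y * (ofReal ((1 + l ^ 2) ^ 2) * ‖pft u l y‖ₑ) ^ 2
      ≤ ∫⁻ l, ∫⁻ y, Filter.liminf (fun R => W y * ‖F R l y‖ₑ ^ 2) atTop := by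
        refine lintegral_mono fun l => lintegral_mono_ae ?_
        filter_upwards [hlim l] with y hy
        have e3 : ofReal ((1 + l ^ 2) ^ 2) * ‖pft u l y‖ₑ =
            ‖(((1 + l ^ 2) ^ 2 : ℝ) : ℂ) * pft u l y‖ₑ := by
          rw [enorm_mul, ← ofReal_norm (((1 + l ^ 2) ^ 2 : ℝ) : ℂ), Complex.norm_real, norm_of_nonneg (by positivity)]
        rw [e3]
        have t : Tendsto (fun R => ‖F R l y‖ₑ ^ 2) atTop
            (nhds (‖(((1 + l ^ 2) ^ 2 : ℝ) : ℂ) * pft u l y‖ₑ ^ 2)) :=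
          ((ENNReal.continuous_pow 2).tendsto _).comp (hy.enorm)
        exact (ENNReal.Tendsto.const_mul t (Or.inr (hWt y))).liminf_eq.ge
    _ ≤ ∫⁻ l, Filter.liminf (fun R => ∫⁻ y, W y * ‖F R l y‖ₑ ^ 2) atTop :=
        lintegral_mono fun l => lintegral_liminf_le fun R => (hGm R).comp measurable_prodMk_left
    _ ≤ Filter.liminf (fun R => ∫⁻ l, ∫⁻ y, W y * ‖F R l y‖ₑ ^ 2) atTop :=
        lintegral_liminf_le fun R => Measurable.lintegral_prod_right' (hGm R)
    _ ≤ _ := by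
        refine Filter.liminf_le_of_le (by isBoundedDefault) fun b hb => ?_
        obtain ⟨R, hR'⟩ := hb.exists
        exact hR'.trans (hR R)

/-! ### The partial Fourier transform of a regular potential -/

/-- The weighted norm of the sections of the potential in `x`. -/
def gnorm (u : ℝ × ℝ → ℝ) (y : ℝ) : ℝ≥0∞ := l2n volume fun x => wt x ^ 4 * ‖u (x, y)‖ₑ

/-- The weighted norm of the sections of the partial Fourier transform in `l`. -/
def hnorm (u : ℝ × ℝ → ℝ) (y : ℝ) : ℝ≥0∞ := l2n volume fun l => wt l ^ 4 * ‖pft u l y‖ₑ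

/-- The weighted norm of the Fourier transform in both variables, in the second variable. -/
def hhnorm (u : ℝ × ℝ → ℝ) (l : ℝ) : ℝ≥0∞ := l2n volume fun s => wt s ^ 4 * ‖ft (pft u l) s‖ₑ

/-- The weighted norm of the sections of the partial Fourier transform in `y`. -/
def anorm (u : ℝ × ℝ → ℝ) (l : ℝ) : ℝ≥0∞ := l2n volume fun y => wt y ^ 4 * ‖pft u l y‖ₑ

/-- The properties of (a representative of) the potential which are used. -/
structure RegPot (u : ℝ × ℝ → ℝ) : Prop where
  meas : Measurable u
  gfin : ∀ y, gnorm u y < ⊤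
  gw : l2n volume (fun y => wt y ^ 5 * gnorm u y) < ⊤
  zero : ∀ y, pft u 0 y = 0
  hw : l2n volume (fun y => wt y ^ 4 * hnorm u y) < ⊤
  hhfin : l2n volume (hhnorm u) < ⊤

/-- The `L²` norm of the inverse weight. -/
def cI : ℝ≥0∞ := l2n volume fun x => (wt x)⁻¹

theorem cI_lt_top : cI < ⊤ := l2n_inv_wt_lt_top

theorem wt_ne_zero (x : ℝ) : wt x ≠ 0 := (zero_lt_one.trans_le (one_le_wt x)).ne'

theorem wt_eq (x : ℝ) : wt x = 1 + ‖x‖ₑ := by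
  rw [wt, ENNReal.ofReal_add zero_le_one (abs_nonneg x), ofReal_one, ← ofReal_norm,
    norm_eq_abs]

theorem enorm_le_wt (x : ℝ) : ‖x‖ₑ ≤ wt x := by rw [wt_eq]; exact le_add_self

/-- Cauchy-Schwarz against the square integrable `wt⁻¹`. -/
theorem lintegral_le_l2n_wt {f : ℝ → ℝ≥0∞} (hf : AEMeasurable f) :
    ∫⁻ x, f x ≤ cI * l2n volume fun x => wt x * f x := by
  have h : ∀ x, f x = (wt x)⁻¹ * (wt x * f x) := fun x => by
    rw [← mul_assoc, ENNReal.inv_mul_cancel (wt_ne_zero x) (wt_lt_top x).ne, one_mul]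
  rw [lintegral_congr h]
  exact lintegral_mul_le_l2n measurable_wt.inv.aemeasurable (measurable_wt.aemeasurable.mul hf)

theorem lintegral_lt_top_of_l2n_wt {f : ℝ → ℝ≥0∞} (hf : AEMeasurable f)
    (h : l2n volume (fun x => wt x * f x) < ⊤) : ∫⁻ x, f x < ⊤ :=
  (lintegral_le_l2n_wt hf).trans_lt (mul_lt_top cI_lt_top h)

theorem wt_sq_le (x : ℝ) : wt x ^ 2 ≤ 2 * ofReal (1 + x ^ 2) := by
  rw [wt, ← ofReal_pow (by positivity), ← ENNReal.ofReal_ofNat, ← ofReal_mul (by norm_num)]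
  refine ofReal_le_ofReal ?_
  nlinarith [sq_nonneg (1 - |x|), sq_abs x]

theorem ofReal_one_add_sq_le (x : ℝ) : ofReal (1 + x ^ 2) ≤ wt x ^ 2 := by
  rw [wt, ← ofReal_pow (by positivity)]
  refine ofReal_le_ofReal ?_
  nlinarith [abs_nonneg x, sq_abs x]

theorem wt_pow_four_le (x : ℝ) : wt x ^ 4 ≤ 4 * ofReal ((1 + x ^ 2) ^ 2) := by
  rw [ofReal_pow (by positivity), show wt x ^ 4 = (wt x ^ 2) ^ 2 by ring]
  refine (pow_le_pow_left' (wt_sq_le x) 2).trans (le_of_eq ?_)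
  rw [mul_pow]; norm_num

theorem ofReal_one_add_sq_sq_le (x : ℝ) : ofReal ((1 + x ^ 2) ^ 2) ≤ wt x ^ 4 := by
  rw [ofReal_pow (by positivity), show wt x ^ 4 = (wt x ^ 2) ^ 2 by ring]
  exact pow_le_pow_left' (ofReal_one_add_sq_le x) 2

/-- The first derivative of the partial Fourier transform in the dual variable. -/
def pft' (u : ℝ × ℝ → ℝ) (l y : ℝ) : ℂ := ft (fun x => -(I * x * (u (x, y) : ℂ))) l

/-- The second derivative of the partial Fourier transform in the dual variable. -/
def pft'' (u : ℝ × ℝ → ℝ) (l y : ℝ) : ℂ :=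
  ft (fun x => -(I * x * -(I * x * (u (x, y) : ℂ)))) l

theorem measurable_ft_section {F : ℝ → ℝ → ℂ} (hF : Measurable (uncurry F)) :
    Measurable fun p : ℝ × ℝ => ft (fun x => F x p.2) p.1 := by
  refine Measurable.const_mul (StronglyMeasurable.measurable ?_) _
  refine StronglyMeasurable.integral_prod_right (f := fun (p : ℝ × ℝ) (x : ℝ) =>
    Complex.exp (-(I * p.1 * x)) * F x p.2) (Measurable.stronglyMeasurable ?_)
  have h1 : Measurable fun p : (ℝ × ℝ) × ℝ => F p.2 p.1.2 :=
    hF.comp (f := fun p : (ℝ × ℝ) × ℝ => (p.2, p.1.2)) (by fun_prop)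
  exact Measurable.mul (f := fun p : (ℝ × ℝ) × ℝ => Complex.exp (-(I * p.1.1 * p.2)))
    (by fun_prop) h1

theorem measurable_pft {u : ℝ × ℝ → ℝ} (hu : Measurable u) :
    Measurable (uncurry (pft u)) :=
  measurable_ft_section (F := fun x y => (u (x, y) : ℂ)) (Complex.measurable_ofReal.comp hu)

theorem measurable_pft' {u : ℝ × ℝ → ℝ} (hu : Measurable u) :
    Measurable (uncurry (pft' u)) := by
  refine measurable_ft_section (F := fun x y => -(I * x * (u (x, y) : ℂ))) ?_
  have h := Complex.measurable_ofReal.comp hu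
  exact Measurable.neg (Measurable.mul (f := fun p : ℝ × ℝ => I * p.1) (by fun_prop) h)

theorem integrable_of_lintegral {f : ℝ → ℂ} (hf : Measurable f) (h : ∫⁻ x, ‖f x‖ₑ < ⊤) : Integrable f :=
  ⟨hf.aestronglyMeasurable, h⟩

theorem memLp_two_of_l2n {f : ℝ → ℂ} (hf : Measurable f) (h : l2n volume (fun x => ‖f x‖ₑ) < ⊤) :
    MemLp f 2 := (memLp_two_iff hf.aestronglyMeasurable).2 h

namespace RegPot

variable {u : ℝ × ℝ → ℝ}

theorem measurable_section (R : RegPot u) (y : ℝ) : Measurable fun x => (u (x, y) : ℂ) :=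
  Complex.measurable_ofReal.comp (R.meas.comp measurable_prodMk_right)

theorem measurable_enorm_section (R : RegPot u) (y : ℝ) : Measurable fun x => ‖u (x, y)‖ₑ :=
  (R.meas.comp measurable_prodMk_right).enorm

theorem lintegral_wt_pow_three_le (R : RegPot u) (y : ℝ) : ∫⁻ x, wt x ^ 3 * ‖u (x, y)‖ₑ ≤ cI * gnorm u y := by
  have hm := R.measurable_enorm_section y
  refine (lintegral_le_l2n_wt (by fun_prop)).trans (le_of_eq ?_)
  congr 1
  unfold gnorm
  congr 1; ext x; ring

theorem lintegral_le (R : RegPot u) {f : ℝ → ℂ} {y : ℝ} (h : ∀ x, ‖f x‖ₑ ≤ wt x ^ 2 * ‖u (x, y)‖ₑ) :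
    ∫⁻ x, ‖f x‖ₑ ≤ cI * gnorm u y := by
  refine (lintegral_mono fun x => (h x).trans ?_).trans (R.lintegral_wt_pow_three_le y)
  gcongr
  · exact one_le_wt x
  · norm_num

theorem l2n_le {f : ℝ → ℂ} {y : ℝ} (h : ∀ x, ‖f x‖ₑ ≤ wt x ^ 2 * ‖u (x, y)‖ₑ) :
    l2n volume (fun x => ‖f x‖ₑ) ≤ gnorm u y := by
  refine l2n_mono fun x => (h x).trans ?_
  gcongr
  · exact one_le_wt x
  · norm_num

theorem bound_lt_top (R : RegPot u) (y : ℝ) : cI * gnorm u y < ⊤ := mul_lt_top cI_lt_top (R.gfin y)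

theorem enorm_section_zero (x y : ℝ) : ‖(u (x, y) : ℂ)‖ₑ ≤ wt x ^ 2 * ‖u (x, y)‖ₑ := by
  rw [enorm_real]
  exact le_mul_of_one_le_left zero_le (one_le_pow_of_one_le' (one_le_wt x) 2)

theorem enorm_section_one (x y : ℝ) :
    ‖-(I * x * (u (x, y) : ℂ))‖ₑ ≤ wt x ^ 2 * ‖u (x, y)‖ₑ := by
  rw [enorm_neg, enorm_I_mul, enorm_real]
  gcongr
  exact (enorm_le_wt x).trans (wt_le_wt_pow x two_ne_zero)

theorem enorm_section_two (x y : ℝ) :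
    ‖-(I * x * -(I * x * (u (x, y) : ℂ)))‖ₑ ≤ wt x ^ 2 * ‖u (x, y)‖ₑ := by
  rw [enorm_neg, enorm_I_mul, enorm_neg, enorm_I_mul, enorm_real, ← mul_assoc, sq]
  gcongr <;> exact enorm_le_wt x

theorem integrable_zero (R : RegPot u) (y : ℝ) : Integrable fun x => (u (x, y) : ℂ) :=
  integrable_of_lintegral (R.measurable_section y)
    ((R.lintegral_le fun x => enorm_section_zero x y).trans_lt (R.bound_lt_top y))

theorem integrable_one (R : RegPot u) (y : ℝ) : Integrable fun x : ℝ => -(I * x * (u (x, y) : ℂ)) := by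
  have hm := R.measurable_section y
  exact integrable_of_lintegral (by fun_prop)
    ((R.lintegral_le fun x => enorm_section_one x y).trans_lt (R.bound_lt_top y))

theorem integrable_two (R : RegPot u) (y : ℝ) :
    Integrable fun x : ℝ => -(I * x * -(I * x * (u (x, y) : ℂ))) := by
  have hm := R.measurable_section y
  exact integrable_of_lintegral (by fun_prop)
    ((R.lintegral_le fun x => enorm_section_two x y).trans_lt (R.bound_lt_top y))

theorem memLp_zero (R : RegPot u) (y : ℝ) : MemLp (fun x => (u (x, y) : ℂ)) 2 :=
  memLp_two_of_l2n (R.measurable_section y)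
    ((RegPot.l2n_le fun x => enorm_section_zero x y).trans_lt (R.gfin y))

theorem memLp_one (R : RegPot u) (y : ℝ) : MemLp (fun x : ℝ => -(I * x * (u (x, y) : ℂ))) 2 := by
  have hm := R.measurable_section y
  exact memLp_two_of_l2n (by fun_prop)
    ((RegPot.l2n_le fun x => enorm_section_one x y).trans_lt (R.gfin y))

theorem memLp_two (R : RegPot u) (y : ℝ) : MemLp (fun x : ℝ => -(I * x * -(I * x * (u (x, y) : ℂ)))) 2 := by
  have hm := R.measurable_section y
  exact memLp_two_of_l2n (by fun_prop)
    ((RegPot.l2n_le fun x => enorm_section_two x y).trans_lt (R.gfin y))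

theorem hasDerivAt_pft (R : RegPot u) (y l : ℝ) : HasDerivAt (fun l => pft u l y) (pft' u l y) l := by
  refine hasDerivAt_ft (R.integrable_zero y) ?_ l
  refine ((R.integrable_one y).const_mul I).congr (ae_of_all _ fun x => ?_)
  simp only
  linear_combination (-(x : ℂ) * u (x, y)) * Complex.I_mul_I

theorem hasDerivAt_pft' (R : RegPot u) (y l : ℝ) : HasDerivAt (fun l => pft' u l y) (pft'' u l y) l := by
  refine hasDerivAt_ft (R.integrable_one y) ?_ l
  refine ((R.integrable_two y).const_mul I).congr (ae_of_all _ fun x => ?_)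
  simp only
  linear_combination ((x : ℂ) * (I * x * u (x, y))) * Complex.I_mul_I

theorem enorm_pft_le (R : RegPot u) (l y : ℝ) : ‖pft u l y‖ₑ ≤ cI * gnorm u y :=
  (enorm_ft_le _ _).trans (R.lintegral_le fun x => enorm_section_zero x y)

theorem enorm_pft'_le (R : RegPot u) (l y : ℝ) : ‖pft' u l y‖ₑ ≤ cI * gnorm u y :=
  (enorm_ft_le _ _).trans (R.lintegral_le fun x => enorm_section_one x y)

theorem norm_pft_le (R : RegPot u) (l y : ℝ) : ‖pft u l y‖ ≤ (cI * gnorm u y).toReal := by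
  rw [← toReal_enorm]
  exact ENNReal.toReal_mono (R.bound_lt_top y).ne (R.enorm_pft_le l y)

theorem norm_pft'_le (R : RegPot u) (l y : ℝ) : ‖pft' u l y‖ ≤ (cI * gnorm u y).toReal := by
  rw [← toReal_enorm]
  exact ENNReal.toReal_mono (R.bound_lt_top y).ne (R.enorm_pft'_le l y)

/-- Mean value inequality starting from `ũ(0;y) = 0`. This first order vanishing is what makes the
factors `1/l` and `|l|^{-1/2}` of the scattering theory integrable. -/
theorem enorm_pft_le_mul (R : RegPot u) (l y : ℝ) : ‖pft u l y‖ₑ ≤ ‖l‖ₑ * (cI * gnorm u y) := by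
  have h := (convex_univ (𝕜 := ℝ) (E := ℝ)).norm_image_sub_le_of_norm_hasDerivWithin_le
    (fun l _ => (R.hasDerivAt_pft y l).hasDerivWithinAt) (fun l _ => R.norm_pft'_le l y)
    (Set.mem_univ 0) (Set.mem_univ l)
  rw [R.zero y, sub_zero, sub_zero] at h
  rw [← ofReal_norm, ← ofReal_norm, ← ofReal_toReal (R.bound_lt_top y).ne,
    ← ofReal_mul (norm_nonneg _), mul_comm]
  exact ofReal_le_ofReal h

/-- The interpolation inequality for the derivative in the dual variable. -/
theorem l2n_pft'_le (R : RegPot u) (y : ℝ) :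
    l2n volume (fun l => wt l ^ 2 * ‖pft' u l y‖ₑ) ≤ 24 * (hnorm u y + gnorm u y) := by
  have m0 := memLp_ft (R.integrable_zero y) (R.memLp_zero y)
  have m1 := memLp_ft (R.integrable_one y) (R.memLp_one y)
  have m2 := memLp_ft (R.integrable_two y) (R.memLp_two y)
  have h := interpolation (R.hasDerivAt_pft y) (R.hasDerivAt_pft' y) m0 m1 m2
  have h0 : l2n volume (fun l => ‖pft u l y‖ₑ) ≤ gnorm u y :=
    (l2n_ft (R.integrable_zero y) (R.memLp_zero y)).trans_le (RegPot.l2n_le fun x => enorm_section_zero x y)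
  have h2 : l2n volume (fun l => ‖pft'' u l y‖ₑ) ≤ gnorm u y :=
    (l2n_ft (R.integrable_two y) (R.memLp_two y)).trans_le (RegPot.l2n_le fun x => enorm_section_two x y)
  have h1 : l2n volume (fun l => ofReal ((1 + l ^ 2) ^ 2) * ‖pft u l y‖ₑ) ≤ hnorm u y :=
    l2n_mono fun l => by gcongr; exact ofReal_one_add_sq_sq_le l
  have hq' : Measurable fun l => ‖pft' u l y‖ₑ := (measurable_pft' R.meas).of_uncurry_right.enorm
  have h3 : l2n volume (fun l => wt l ^ 2 * ‖pft' u l y‖ₑ) ≤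
      2 * l2n volume (fun l => ofReal (1 + l ^ 2) * ‖pft' u l y‖ₑ) := by
    rw [← l2n_const_mul _ (by fun_prop)]
    refine l2n_mono fun l => ?_
    rw [← mul_assoc]
    gcongr
    exact wt_sq_le l
  refine h3.trans ?_
  have h4 : l2n volume (fun l => ofReal (1 + l ^ 2) * ‖pft' u l y‖ₑ) ≤
      12 * (hnorm u y + gnorm u y) := by
    rw [← ENNReal_sq_le_sq]
    refine h.trans ?_
    calc _ ≤ 64 * (hnorm u y * (gnorm u y + gnorm u y)) := by gcongr
      _ ≤ 144 * (hnorm u y * hnorm u y + 2 * (hnorm u y * gnorm u y) + gnorm u y * gnorm u y) := by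
        have : 64 * (hnorm u y * (gnorm u y + gnorm u y)) = 64 * (2 * (hnorm u y * gnorm u y)) := by ring
        rw [this]
        refine mul_le_mul (by norm_num) (le_add_right le_add_self) zero_le zero_le
      _ = _ := by ring
  calc _ ≤ 2 * (12 * (hnorm u y + gnorm u y)) := by gcongr
    _ = _ := by ring

end RegPot

/-! ### Elementary weights near the origin -/

/-- The weight `|l|^{-1/8}`. -/
def zwt (l : ℝ) : ℝ≥0∞ := ofReal (|l| ^ (-(1 / 8) : ℝ))

/-- The weight `√(π/|l|)`. -/
def swt (l : ℝ) : ℝ≥0∞ := ofReal √(π / |l|)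

@[fun_prop] theorem measurable_zwt : Measurable zwt := by unfold zwt; fun_prop

@[fun_prop] theorem measurable_swt : Measurable swt := by unfold swt; fun_prop

/-- Eighth roots make all exponents integral: `|l|^{-1/2}`, `|l|⁻¹` and `|l|^{-3/2}` are the powers
`4`, `8` and `12`, and the seventh power is still integrable at the origin. -/
theorem zwt_pow (l : ℝ) (n : ℕ) : zwt l ^ n = ofReal (|l| ^ (-(n / 8) : ℝ)) := by
  rw [zwt, ← ofReal_pow (by positivity), ← Real.rpow_natCast, ← Real.rpow_mul (abs_nonneg l)]
  congr 2; ring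

theorem zwt_pow_eight_mul {l : ℝ} (hl : l ≠ 0) : zwt l ^ 8 * ‖l‖ₑ = 1 := by
  rw [zwt_pow, ← ofReal_norm, norm_eq_abs, ← ofReal_mul (by positivity)]
  norm_num
  rw [Real.rpow_neg_one, inv_mul_cancel₀ (abs_ne_zero.2 hl)]

theorem one_le_zwt {l : ℝ} (hl : l ≠ 0) (h1 : |l| < 1) : 1 ≤ zwt l := by
  rw [zwt, ENNReal.one_le_ofReal]
  exact Real.one_le_rpow_of_pos_of_le_one_of_nonpos (abs_pos.2 hl) h1.le (by norm_num)

theorem sqrt_pi_le_two : √π ≤ 2 := by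
  rw [Real.sqrt_le_left (by norm_num)]; linarith [Real.pi_lt_four]

theorem swt_le_zwt (l : ℝ) : swt l ≤ 2 * zwt l ^ 4 := by
  rw [swt, zwt_pow, ← ENNReal.ofReal_ofNat, ← ofReal_mul (by norm_num)]
  refine ofReal_le_ofReal ?_
  rw [Real.sqrt_div Real.pi_pos.le, div_eq_mul_inv]
  have : (√|l|)⁻¹ = |l| ^ (-((4 : ℕ) / 8) : ℝ) := by
    rw [Real.rpow_neg (abs_nonneg l), Real.sqrt_eq_rpow]
    norm_num
  rw [this]
  gcongr
  exact sqrt_pi_le_two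

theorem swt_le_two {l : ℝ} (h : 1 ≤ |l|) : swt l ≤ 2 := by
  refine (swt_le_zwt l).trans (mul_le_of_le_one_right zero_le (pow_le_one₀ zero_le ?_))
  rw [zwt, ENNReal.ofReal_le_one]
  exact Real.rpow_le_one_of_one_le_of_nonpos h (by norm_num)

theorem swt_mul_enorm_le {l : ℝ} (h : |l| < 1) : swt l * ‖l‖ₑ ≤ 2 := by
  rcases eq_or_ne l 0 with rfl | hl
  · simp
  have h1 := one_le_zwt hl h
  calc swt l * ‖l‖ₑ ≤ 2 * zwt l ^ 8 * ‖l‖ₑ := by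
        gcongr
        refine (swt_le_zwt l).trans ?_
        gcongr
        · norm_num
    _ = 2 := by rw [mul_assoc, zwt_pow_eight_mul hl, mul_one]

theorem wt_le_two {l : ℝ} (h : |l| < 1) : wt l ≤ 2 := by
  rw [wt, ← ENNReal.ofReal_ofNat]
  exact ofReal_le_ofReal (by linarith)

theorem enorm_inv_le_one {l : ℝ} (h : 1 ≤ |l|) : ‖l‖ₑ⁻¹ ≤ 1 := by
  rw [ENNReal.inv_le_one, ← ofReal_norm, ENNReal.one_le_ofReal]; exact h

theorem lintegral_zwt_pow_lt_top : ∫⁻ l in Ioo (-1 : ℝ) 1, zwt l ^ 7 < ⊤ := by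
  have h1 : IntegrableOn (fun x : ℝ => x ^ (-(7 / 8) : ℝ)) (Ioo 0 1) :=
    (intervalIntegral.integrableOn_Ioo_rpow_iff zero_lt_one).2 (by norm_num)
  have h2 : ∫⁻ l in Ioo (0 : ℝ) 1, zwt l ^ 7 < ⊤ := by
    refine lt_of_le_of_lt (le_of_eq ?_) h1.2
    refine setLIntegral_congr_fun measurableSet_Ioo fun l hl => ?_
    simp only [zwt_pow]
    rw [enorm_of_nonneg (by have := hl.1; positivity), abs_of_pos hl.1]
    norm_num
  have h3 : ∫⁻ l in Ioo (-1 : ℝ) 0, zwt l ^ 7 < ⊤ := by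
    refine lt_of_le_of_lt (le_of_eq ?_) h2
    have e := (Measure.measurePreserving_neg (volume : Measure ℝ)).setLIntegral_comp_preimage
      (s := Ioo (0 : ℝ) 1) measurableSet_Ioo (f := fun l => zwt l ^ 7) (by fun_prop)
    rw [← e]
    simp [zwt]
  have h4 : Ioo (-1 : ℝ) 1 ⊆ (Ioo (-1) 0 ∪ Ioo 0 1) ∪ {0} := by
    intro x hx
    rcases lt_trichotomy x 0 with h | h | h
    · exact Or.inl (Or.inl ⟨hx.1, h⟩)
    · exact Or.inr h
    · exact Or.inl (Or.inr ⟨h, hx.2⟩)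
  refine (lintegral_mono_set h4).trans_lt ((lintegral_union_le _ _ _).trans_lt ?_)
  refine add_lt_top.2 ⟨(lintegral_union_le _ _ _).trans_lt (add_lt_top.2 ⟨h3, h2⟩), ?_⟩
  simp

theorem add_sq_le (x y : ℝ≥0∞) : (x + y) ^ 2 ≤ 4 * (x ^ 2 + y ^ 2) := by
  rcases le_total x y with h | h
  · calc (x + y) ^ 2 ≤ (y + y) ^ 2 := by gcongr
      _ = 4 * y ^ 2 := by ring
      _ ≤ _ := by gcongr; exact le_add_self
  · calc (x + y) ^ 2 ≤ (x + x) ^ 2 := by gcongr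
      _ = 4 * x ^ 2 := by ring
      _ ≤ _ := by gcongr; exact le_self_add

/-! ### Fourier inversion in the second variable -/

theorem ft_neg (f : ℝ → ℂ) (ξ : ℝ) : ft (fun x => -f x) ξ = -ft f ξ := by
  simp only [ft, mul_neg, integral_neg]

theorem l2n_comp_neg (f : ℝ → ℝ≥0∞) : l2n volume (fun y => f (-y)) = l2n volume f := by
  unfold l2n
  rw [← lintegral_neg_eq_self (fun y => f y ^ 2)]

/-- The derivative of the inverse Fourier transform of `Q`. -/
def ftI (Q : ℝ → ℂ) (y : ℝ) : ℂ := ft (fun s => I * s * Q s) (-y)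

theorem integrable_of_wt_four {Q : ℝ → ℂ} (hfin : l2n volume (fun s => wt s ^ 4 * ‖Q s‖ₑ) < ⊤) {m : ℕ}
    (hm : m ≤ 3) {f : ℝ → ℂ} (hf : Measurable f) (h : ∀ s, ‖f s‖ₑ ≤ wt s ^ m * ‖Q s‖ₑ) :
    Integrable f ∧ MemLp f 2 := by
  refine ⟨integrable_of_lintegral hf (lintegral_lt_top_of_l2n_wt (by fun_prop) ?_),
    memLp_two_of_l2n hf ?_⟩
  · refine (l2n_mono fun s => ?_).trans_lt hfin
    calc wt s * ‖f s‖ₑ ≤ wt s * (wt s ^ m * ‖Q s‖ₑ) := by gcongr; exact h s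
      _ = wt s ^ (m + 1) * ‖Q s‖ₑ := by ring
      _ ≤ _ := by gcongr; exacts [one_le_wt s, by omega]
  · refine (l2n_mono fun s => (h s).trans ?_).trans_lt hfin
    gcongr; exacts [one_le_wt s, by omega]

theorem memLp_comp_neg {f : ℝ → ℂ} (hf : MemLp f 2) : MemLp (fun y => f (-y)) 2 :=
  hf.comp_measurePreserving (Measure.measurePreserving_neg volume)

section Inversion

variable {f : ℝ → ℂ}

/-- Cauchy-Schwarz splits the four powers of the weight as `0 + 4`, and Plancherel identifies the
unweighted norm with that of `f`. -/
theorem wt_sq_ft_le (hf : Measurable f) (ha : l2n volume (fun y => wt y ^ 4 * ‖f y‖ₑ) < ⊤) :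
    l2n volume (fun s => wt s ^ 2 * ‖ft f s‖ₑ) ^ 2 ≤
      l2n volume (fun y => wt y ^ 4 * ‖f y‖ₑ) * l2n volume (fun s => wt s ^ 4 * ‖ft f s‖ₑ) := by
  have h0 := integrable_of_wt_four ha (m := 0) (by norm_num) hf (fun s => by simp)
  have hQ : Measurable (ft f) := (continuous_ft h0.1).measurable
  rw [l2n_sq]
  calc ∫⁻ s, (wt s ^ 2 * ‖ft f s‖ₑ) ^ 2 = ∫⁻ s, ‖ft f s‖ₑ * (wt s ^ 4 * ‖ft f s‖ₑ) := by
        congr 1; ext s; ring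
    _ ≤ l2n volume (fun s => ‖ft f s‖ₑ) * l2n volume (fun s => wt s ^ 4 * ‖ft f s‖ₑ) :=
        lintegral_mul_le_l2n (by fun_prop) (by fun_prop)
    _ ≤ _ := by
        gcongr
        rw [l2n_ft h0.1 h0.2]
        exact l2n_mono fun y => le_mul_of_one_le_left zero_le (one_le_pow_of_one_le' (one_le_wt y) 4)

/-- Two rounds of interpolation, from weight `4` to `2` and from `2` to `1`, give homogeneity `3/4`
in the norm of `f` and `1/4` in that of its transform. The large share of `f` matters, because for
`f = ũ(l;·)` its norm is `O(|l|)`. -/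
theorem lintegral_ft_pow_four_le (hf : Measurable f) (ha : l2n volume (fun y => wt y ^ 4 * ‖f y‖ₑ) < ⊤) :
    (∫⁻ s, ‖ft f s‖ₑ) ^ 4 ≤ cI ^ 4 * (l2n volume (fun y => wt y ^ 4 * ‖f y‖ₑ) ^ 3 *
      (l2n volume (fun s => wt s ^ 4 * ‖ft f s‖ₑ) + l2n volume (fun y => wt y ^ 4 * ‖f y‖ₑ))) := by
  have h0 := integrable_of_wt_four ha (m := 0) (by norm_num) hf (fun s => by simp)
  have hQ : Measurable (ft f) := (continuous_ft h0.1).measurable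
  have h1 := wt_sq_ft_le hf ha
  set a := l2n volume (fun y => wt y ^ 4 * ‖f y‖ₑ)
  set b := l2n volume (fun s => wt s ^ 4 * ‖ft f s‖ₑ)
  set M := l2n volume (fun s => wt s ^ 2 * ‖ft f s‖ₑ)
  have h2 : l2n volume (fun s => wt s * ‖ft f s‖ₑ) ^ 2 ≤ a * M := by
    rw [l2n_sq]
    calc ∫⁻ s, (wt s * ‖ft f s‖ₑ) ^ 2 = ∫⁻ s, ‖ft f s‖ₑ * (wt s ^ 2 * ‖ft f s‖ₑ) := by
          congr 1; ext s; ring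
      _ ≤ l2n volume (fun s => ‖ft f s‖ₑ) * M :=
          lintegral_mul_le_l2n (by fun_prop) (by fun_prop)
      _ ≤ _ := by
          gcongr
          rw [l2n_ft h0.1 h0.2]
          exact l2n_mono fun y => le_mul_of_one_le_left zero_le (one_le_pow_of_one_le' (one_le_wt y) 4)
  calc (∫⁻ s, ‖ft f s‖ₑ) ^ 4 ≤ (cI * l2n volume (fun s => wt s * ‖ft f s‖ₑ)) ^ 4 :=
        pow_le_pow_left' (lintegral_le_l2n_wt (by fun_prop)) 4
    _ = cI ^ 4 * (l2n volume (fun s => wt s * ‖ft f s‖ₑ) ^ 2) ^ 2 := by ring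
    _ ≤ cI ^ 4 * (a * M) ^ 2 := by gcongr
    _ = cI ^ 4 * (a ^ 2 * M ^ 2) := by ring
    _ ≤ cI ^ 4 * (a ^ 2 * (a * b)) := by gcongr
    _ = cI ^ 4 * (a ^ 3 * b) := by ring
    _ ≤ _ := by gcongr; exact le_self_add

theorem hasDerivAt_ft_ft_neg (hf : Measurable f) (ha : l2n volume (fun y => wt y ^ 4 * ‖f y‖ₑ) < ⊤)
    (hb : l2n volume (fun s => wt s ^ 4 * ‖ft f s‖ₑ) < ⊤) (y : ℝ) :
    HasDerivAt (fun y => ft (ft f) (-y)) (ftI (ft f) y) y := by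
  have h0 := integrable_of_wt_four ha (m := 0) (by norm_num) hf (fun s => by simp)
  have hQ : Measurable (ft f) := (continuous_ft h0.1).measurable
  have q0 := integrable_of_wt_four hb (m := 0) (by norm_num) hQ (fun s => by simp)
  have q1 := integrable_of_wt_four hb (m := 1) (by norm_num) (f := fun s : ℝ => (s : ℂ) * ft f s)
    (by fun_prop) (fun s => by
      rw [enorm_mul, ← ofReal_norm (s : ℂ), Complex.norm_real, ofReal_norm, pow_one]
      gcongr; exact enorm_le_wt s)
  have h := (hasDerivAt_ft q0.1 q1.1 (-y)).scomp y (hasDerivAt_neg y)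
  refine h.congr_deriv ?_
  rw [ft_neg, ftI, neg_smul, one_smul, neg_neg]

theorem ft_ft_neg_ae_eq' (hf : Measurable f) (ha : l2n volume (fun y => wt y ^ 4 * ‖f y‖ₑ) < ⊤)
    (hb : l2n volume (fun s => wt s ^ 4 * ‖ft f s‖ₑ) < ⊤) : (fun y => ft (ft f) (-y)) =ᵐ[volume] f := by
  have h0 := integrable_of_wt_four ha (m := 0) (by norm_num) hf (fun s => by simp)
  have hQ : Measurable (ft f) := (continuous_ft h0.1).measurable
  exact ft_ft_neg_ae_eq h0.1 h0.2 (integrable_of_wt_four hb (m := 0) (by norm_num) hQ (fun s => by simp)).1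

theorem ae_enorm_le_lintegral_ft (hf : Measurable f) (ha : l2n volume (fun y => wt y ^ 4 * ‖f y‖ₑ) < ⊤)
    (hb : l2n volume (fun s => wt s ^ 4 * ‖ft f s‖ₑ) < ⊤) : ∀ᵐ y, ‖f y‖ₑ ≤ ∫⁻ s, ‖ft f s‖ₑ := by
  filter_upwards [ft_ft_neg_ae_eq' hf ha hb] with y hy
  rw [← hy]
  exact enorm_ft_le _ _

/-- The weighted interpolation inequality is applied to the inverse transform of `ft f`, whose
second derivative has the `L²` norm of `s² ft f`; that norm is itself interpolated by `wt_sq_ft_le`.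
Again the homogeneity in the norm of `f` is `3/4`. -/
theorem l2n_ftI_pow_four_le (hf : Measurable f) (ha : l2n volume (fun y => wt y ^ 4 * ‖f y‖ₑ) < ⊤)
    (hb : l2n volume (fun s => wt s ^ 4 * ‖ft f s‖ₑ) < ⊤) :
    l2n volume (fun y => wt y ^ 2 * ‖ftI (ft f) y‖ₑ) ^ 4 ≤
      32 ^ 4 * (l2n volume (fun y => wt y ^ 4 * ‖f y‖ₑ) ^ 3 *
      (l2n volume (fun s => wt s ^ 4 * ‖ft f s‖ₑ) + l2n volume (fun y => wt y ^ 4 * ‖f y‖ₑ))) := by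
  have h0 := integrable_of_wt_four ha (m := 0) (by norm_num) hf (fun s => by simp)
  have hQ : Measurable (ft f) := (continuous_ft h0.1).measurable
  have q0 := integrable_of_wt_four hb (m := 0) (by norm_num) hQ (fun s => by simp)
  have q1 := integrable_of_wt_four hb (m := 1) (by norm_num) (f := fun s : ℝ => I * s * ft f s)
    (by fun_prop) (fun s => by rw [enorm_I_mul, pow_one]; gcongr; exact enorm_le_wt s)
  have e2 : ∀ s : ℝ, ‖I * s * (I * s * ft f s)‖ₑ ≤ wt s ^ 2 * ‖ft f s‖ₑ := fun s => by
    rw [enorm_I_mul, enorm_I_mul, ← mul_assoc, sq]; gcongr <;> exact enorm_le_wt s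
  have q2 := integrable_of_wt_four hb (m := 2) (by norm_num)
    (f := fun s : ℝ => I * s * (I * s * ft f s)) (by fun_prop) e2
  have hI : Measurable (ftI (ft f)) := (continuous_ft q1.1).measurable.comp measurable_neg
  have d1 : ∀ y, HasDerivAt (ftI (ft f)) (ftI (fun s : ℝ => I * s * ft f s) y) y := by
    intro y
    have q1' : Integrable fun s : ℝ => (s : ℂ) * (I * s * ft f s) := by
      refine (q2.1.const_mul (-I)).congr (ae_of_all _ fun s => ?_)
      simp only
      linear_combination (-(s : ℂ) * (I * s * ft f s)) * Complex.I_mul_I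
    have h := (hasDerivAt_ft q1.1 q1' (-y)).scomp y (hasDerivAt_neg y)
    refine h.congr_deriv ?_
    rw [ft_neg, ftI, neg_smul, one_smul, neg_neg]
  have hint := interpolation (hasDerivAt_ft_ft_neg hf ha hb) d1 (memLp_comp_neg (memLp_ft q0.1 q0.2))
    (memLp_comp_neg (memLp_ft q1.1 q1.2)) (memLp_comp_neg (memLp_ft q2.1 q2.2))
  have h1 := wt_sq_ft_le hf ha
  set a := l2n volume (fun y => wt y ^ 4 * ‖f y‖ₑ) with ha'
  set b := l2n volume (fun s => wt s ^ 4 * ‖ft f s‖ₑ)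
  set M := l2n volume (fun s => wt s ^ 2 * ‖ft f s‖ₑ)
  have i1 : l2n volume (fun s => ofReal ((1 + s ^ 2) ^ 2) * ‖ft (ft f) (-s)‖ₑ) ≤ a := by
    refine l2n_mono_ae ?_
    filter_upwards [ft_ft_neg_ae_eq' hf ha hb] with y hy
    rw [hy]
    gcongr
    exact ofReal_one_add_sq_sq_le y
  have i2 : l2n volume (fun s => ‖ftI (fun s : ℝ => I * s * ft f s) s‖ₑ) ≤ M := by
    refine (l2n_comp_neg fun y => ‖ft (fun s : ℝ => I * s * (I * s * ft f s)) y‖ₑ).trans_le ?_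
    rw [l2n_ft q2.1 q2.2]
    exact l2n_mono e2
  have i3 : l2n volume (fun s => ‖ft (ft f) (-s)‖ₑ) ≤ a := by
    refine l2n_mono_ae ?_
    filter_upwards [ft_ft_neg_ae_eq' hf ha hb] with y hy
    rw [hy]
    exact le_mul_of_one_le_left zero_le (one_le_pow_of_one_le' (one_le_wt y) 4)
  have i4 : l2n volume (fun y => wt y ^ 2 * ‖ftI (ft f) y‖ₑ) ≤
      2 * l2n volume (fun y => ofReal (1 + y ^ 2) * ‖ftI (ft f) y‖ₑ) := by
    rw [← l2n_const_mul _ (by fun_prop)]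
    refine l2n_mono fun l => ?_
    rw [← mul_assoc]
    gcongr
    exact wt_sq_le l
  set J := l2n volume (fun y => ofReal (1 + y ^ 2) * ‖ftI (ft f) y‖ₑ)
  have i5 : J ^ 2 ≤ 64 * (a * (M + a)) := hint.trans (by gcongr)
  calc _ ≤ (2 * J) ^ 4 := by gcongr
    _ = 16 * (J ^ 2) ^ 2 := by ring
    _ ≤ 16 * (64 * (a * (M + a))) ^ 2 := by gcongr
    _ = 65536 * (a ^ 2 * (M + a) ^ 2) := by ring
    _ ≤ 65536 * (a ^ 2 * (4 * (M ^ 2 + a ^ 2))) := by gcongr; exact add_sq_le M a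
    _ ≤ 65536 * (a ^ 2 * (4 * (a * b + a ^ 2))) := by gcongr
    _ = 262144 * (a ^ 3 * (b + a)) := by ring
    _ ≤ _ := by gcongr; norm_num

end Inversion

/-! ### Regular potentials satisfy the assumptions of the scattering theory -/

/-- The derivative in `y` of the partial Fourier transform, via Fourier inversion. -/
def rpft (u : ℝ × ℝ → ℝ) (l y : ℝ) : ℂ := ftI (ft (pft u l)) y

/-- The bound for the partial Fourier transform. -/
def ubd (u : ℝ × ℝ → ℝ) (y : ℝ) : ℝ := (cI * gnorm u y).toReal

/-- The weighted norm of the bound for the potential. -/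
def kconst (u : ℝ × ℝ → ℝ) : ℝ≥0∞ := l2n volume fun y => wt y ^ 5 * (cI * gnorm u y)

/-- The weighted norm of the derivative of the partial Fourier transform in `y`. -/
def pnorm (u : ℝ × ℝ → ℝ) (l : ℝ) : ℝ≥0∞ := l2n volume fun y => wt y ^ 2 * ‖rpft u l y‖ₑ

/-- The supremum bound for the partial Fourier transform. -/
def snorm (u : ℝ × ℝ → ℝ) (l : ℝ) : ℝ≥0∞ := ∫⁻ s, ‖ft (pft u l) s‖ₑ

theorem measurable_ft_pft {u : ℝ × ℝ → ℝ} (hu : Measurable u) :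
    Measurable fun p : ℝ × ℝ => ft (pft u p.1) p.2 :=
  (measurable_ft_section (F := fun y l => pft u l y)
    ((measurable_pft hu).comp (f := fun p : ℝ × ℝ => (p.2, p.1)) (by fun_prop))).comp
    (f := fun p : ℝ × ℝ => (p.2, p.1)) (by fun_prop)

theorem measurable_rpft {u : ℝ × ℝ → ℝ} (hu : Measurable u) :
    Measurable (uncurry (rpft u)) := by
  have h1 : Measurable fun p : ℝ × ℝ => I * p.1 * ft (pft u p.2) p.1 :=
    Measurable.mul (by fun_prop) ((measurable_ft_pft hu).comp (f := fun p : ℝ × ℝ => (p.2, p.1)) (by fun_prop))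
  exact (measurable_ft_section (F := fun s l => I * s * ft (pft u l) s) h1).comp
    (f := fun p : ℝ × ℝ => (-p.2, p.1)) (by fun_prop)

theorem measurable_gnorm {u : ℝ × ℝ → ℝ} (hu : Measurable u) : Measurable (gnorm u) :=
  measurable_l2n_left (F := fun x y => wt x ^ 4 * ‖u (x, y)‖ₑ)
    (((measurable_wt.comp measurable_fst).pow_const 4).mul hu.enorm)

theorem measurable_hnorm {u : ℝ × ℝ → ℝ} (hu : Measurable u) : Measurable (hnorm u) :=
  measurable_l2n_left (F := fun l y => wt l ^ 4 * ‖pft u l y‖ₑ)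
    (((measurable_wt.comp measurable_fst).pow_const 4).mul (measurable_pft hu).enorm)

theorem measurable_anorm {u : ℝ × ℝ → ℝ} (hu : Measurable u) : Measurable (anorm u) :=
  measurable_l2n_left (F := fun y l => wt y ^ 4 * ‖pft u l y‖ₑ)
    (((measurable_wt.comp measurable_fst).pow_const 4).mul
      ((measurable_pft hu).comp (f := fun p : ℝ × ℝ => (p.2, p.1)) (by fun_prop)).enorm)

theorem measurable_hhnorm {u : ℝ × ℝ → ℝ} (hu : Measurable u) : Measurable (hhnorm u) :=
  measurable_l2n_left (F := fun s l => wt s ^ 4 * ‖ft (pft u l) s‖ₑ)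
    (((measurable_wt.comp measurable_fst).pow_const 4).mul
      ((measurable_ft_pft hu).comp (f := fun p : ℝ × ℝ => (p.2, p.1)) (by fun_prop)).enorm)

theorem measurable_pnorm {u : ℝ × ℝ → ℝ} (hu : Measurable u) : Measurable (pnorm u) :=
  measurable_l2n_left (F := fun y l => wt y ^ 2 * ‖rpft u l y‖ₑ)
    (((measurable_wt.comp measurable_fst).pow_const 2).mul
      ((measurable_rpft hu).comp (f := fun p : ℝ × ℝ => (p.2, p.1)) (by fun_prop)).enorm)

theorem measurable_snorm {u : ℝ × ℝ → ℝ} (hu : Measurable u) : Measurable (snorm u) :=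
  Measurable.lintegral_prod_right' (f := fun p : ℝ × ℝ => ‖ft (pft u p.1) p.2‖ₑ)
    (measurable_ft_pft hu).enorm

namespace RegPot

variable {u : ℝ × ℝ → ℝ}

theorem ofReal_ubd (R : RegPot u) (y : ℝ) : ofReal (ubd u y) = cI * gnorm u y :=
  ofReal_toReal (R.bound_lt_top y).ne

theorem kconst_lt_top (R : RegPot u) : kconst u < ⊤ := by
  have hg := measurable_gnorm R.meas
  have : kconst u = cI * l2n volume (fun y => wt y ^ 5 * gnorm u y) := by
    rw [← l2n_const_mul _ (by fun_prop)]
    unfold kconst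
    congr 1; ext y; ring
  rw [this]
  exact mul_lt_top cI_lt_top R.gw

theorem anorm_le (R : RegPot u) (l : ℝ) : anorm u l ≤ kconst u := by
  refine l2n_mono fun y => ?_
  gcongr
  · exact one_le_wt y
  · norm_num
  · exact R.enorm_pft_le l y

theorem anorm_le_mul (R : RegPot u) (l : ℝ) : anorm u l ≤ ‖l‖ₑ * kconst u := by
  have hg := measurable_gnorm R.meas
  rw [kconst, ← l2n_const_mul _ (by fun_prop)]
  refine l2n_mono fun y => ?_
  calc wt y ^ 4 * ‖pft u l y‖ₑ ≤ wt y ^ 5 * (‖l‖ₑ * (cI * gnorm u y)) := by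
        gcongr
        · exact one_le_wt y
        · norm_num
        · exact R.enorm_pft_le_mul l y
    _ = _ := by ring

theorem anorm_lt_top (R : RegPot u) (l : ℝ) : anorm u l < ⊤ := (R.anorm_le l).trans_lt R.kconst_lt_top

/-- The sum of the weighted norms in the second variable. -/
theorem l2n_wt_anorm_lt_top (R : RegPot u) : l2n volume (fun l => wt l ^ 4 * anorm u l) < ⊤ := by
  have hq := measurable_pft R.meas
  have hq2 : Measurable fun p : ℝ × ℝ => ‖pft u p.1 p.2‖ₑ := hq.enorm
  have e1 : ∀ l, wt l ^ 4 * anorm u l = l2n volume fun y => wt l ^ 4 * (wt y ^ 4 * ‖pft u l y‖ₑ) := by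
    intro l
    have h : Measurable fun y => ‖pft u l y‖ₑ := hq.of_uncurry_left.enorm
    rw [l2n_const_mul _ (by fun_prop)]; rfl
  have e2 : ∀ y, wt y ^ 4 * hnorm u y = l2n volume fun l => wt l ^ 4 * (wt y ^ 4 * ‖pft u l y‖ₑ) := by
    intro y
    have h : Measurable fun l => ‖pft u l y‖ₑ := hq.of_uncurry_right.enorm
    rw [hnorm, ← l2n_const_mul _ (by fun_prop)]
    congr 1; ext l; ring
  simp_rw [e1]
  have hm : Measurable (uncurry fun l y : ℝ => wt l ^ 4 * (wt y ^ 4 * ‖pft u l y‖ₑ)) :=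
    Measurable.mul (f := fun p : ℝ × ℝ => wt p.1 ^ 4) (by fun_prop)
      (Measurable.mul (f := fun p : ℝ × ℝ => wt p.2 ^ 4) (by fun_prop) hq2)
  rw [l2n_swap hm]
  simp_rw [← e2]
  exact R.hw

theorem l2n_sum_lt_top (R : RegPot u) :
    l2n volume (fun l => wt l ^ 4 * anorm u l + hhnorm u l) < ⊤ := by
  have h1 := measurable_anorm R.meas
  have h2 := measurable_hhnorm R.meas
  exact (l2n_add_le (by fun_prop) (by fun_prop)).trans_lt
    (add_lt_top.2 ⟨R.l2n_wt_anorm_lt_top, R.hhfin⟩)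

theorem measurable_pft_left (R : RegPot u) (l : ℝ) : Measurable (pft u l) :=
  (measurable_pft R.meas).of_uncurry_left

theorem hhnorm_ae_lt_top (R : RegPot u) : ∀ᵐ l, hhnorm u l < ⊤ :=
  ae_lt_top_of_l2n (measurable_hhnorm R.meas) R.hhfin

theorem pnorm_pow_four_le (R : RegPot u) {l : ℝ} (hl : hhnorm u l < ⊤) :
    pnorm u l ^ 4 ≤ 32 ^ 4 * (anorm u l ^ 3 * (hhnorm u l + anorm u l)) :=
  l2n_ftI_pow_four_le (R.measurable_pft_left l) (R.anorm_lt_top l) hl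

theorem snorm_pow_four_le (R : RegPot u) (l : ℝ) :
    snorm u l ^ 4 ≤ cI ^ 4 * (anorm u l ^ 3 * (hhnorm u l + anorm u l)) :=
  lintegral_ft_pow_four_le (R.measurable_pft_left l) (R.anorm_lt_top l)

end RegPot

/-- Homogeneity `3/4` in `a` converts the four powers of the weight available for `a` into three
powers for `X`; the geometric mean is then replaced by the sum. -/
theorem wt_pow_three_mul_le {l : ℝ} {X D a b : ℝ≥0∞} (h : X ^ 4 ≤ D ^ 4 * (a ^ 3 * (b + a))) :
    wt l ^ 3 * X ≤ D * (wt l ^ 4 * a + b) := by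
  rw [← ENNReal.pow_le_pow_left_iff (n := 4) (by norm_num)]
  have h1 : a ≤ wt l ^ 4 * a := le_mul_of_one_le_left zero_le (one_le_pow_of_one_le' (one_le_wt l) 4)
  calc (wt l ^ 3 * X) ^ 4 = wt l ^ 12 * X ^ 4 := by ring
    _ ≤ wt l ^ 12 * (D ^ 4 * (a ^ 3 * (b + a))) := by gcongr
    _ = D ^ 4 * ((wt l ^ 4 * a) ^ 3 * (b + a)) := by ring
    _ ≤ D ^ 4 * ((wt l ^ 4 * a + b) ^ 3 * (wt l ^ 4 * a + b)) := by
        exact mul_le_mul' le_rfl (mul_le_mul' (pow_le_pow_left' le_self_add 3)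
          ((add_le_add le_rfl h1).trans_eq (add_comm _ _)))
    _ = _ := by ring

/-- The singular factor is `|l|^{-3/2}`. With `a ≤ |l|K` the quantity `X` gains `|l|^{3/4}`, so the
product is at most a constant times `|l|^{-3/4}(b+K)^{1/4}`. Comparing `b + K` with `|l|^{-1/2}`
separates the two factors into an integrable power of `|l|` and a term controlled by the square
integrability of `b`. -/
theorem zwt_mul_le {l : ℝ} (hl : l ≠ 0) {X D K a b : ℝ≥0∞} (h : X ^ 4 ≤ D ^ 4 * (a ^ 3 * (b + a)))
    (h1 : a ≤ K) (h2 : a ≤ ‖l‖ₑ * K) (hK : 1 ≤ K) :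
    zwt l ^ 12 * X ≤ D * K * (zwt l ^ 7 + (b + K) ^ 2) := by
  have e : (zwt l ^ 12 * X) ^ 4 ≤ (D * K) ^ 4 * (zwt l ^ 24 * (b + K)) := by
    calc (zwt l ^ 12 * X) ^ 4 = zwt l ^ 48 * X ^ 4 := by ring
      _ ≤ zwt l ^ 48 * (D ^ 4 * ((‖l‖ₑ * K) ^ 3 * (b + K))) := by
          gcongr
          exact h.trans (by gcongr)
      _ = (zwt l ^ 8 * ‖l‖ₑ) ^ 3 * (zwt l ^ 24 * (D ^ 4 * (K ^ 3 * (b + K)))) := by ring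
      _ = zwt l ^ 24 * (D ^ 4 * (K ^ 3 * (b + K))) := by rw [zwt_pow_eight_mul hl]; ring
      _ ≤ zwt l ^ 24 * (D ^ 4 * (K ^ 4 * (b + K))) := by
          exact mul_le_mul' le_rfl (mul_le_mul' le_rfl (mul_le_mul' (pow_le_pow_right₀ hK (by norm_num)) le_rfl))
      _ = _ := by ring
  have hb : 1 ≤ b + K := hK.trans le_add_self
  rcases le_total (b + K) (zwt l ^ 4) with h3 | h3
  · refine le_trans ?_ (mul_le_mul_right le_self_add _)
    rw [← ENNReal.pow_le_pow_left_iff (n := 4) (by norm_num)]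
    refine e.trans ?_
    calc _ ≤ (D * K) ^ 4 * (zwt l ^ 24 * zwt l ^ 4) := by gcongr
      _ = _ := by ring
  · refine le_trans ?_ (mul_le_mul_right le_add_self _)
    rw [← ENNReal.pow_le_pow_left_iff (n := 4) (by norm_num)]
    refine e.trans ?_
    calc _ = (D * K) ^ 4 * ((zwt l ^ 4) ^ 6 * (b + K) * 1) := by ring
      _ ≤ (D * K) ^ 4 * ((b + K) ^ 6 * (b + K) * (b + K)) := by gcongr
      _ = _ := by ring

namespace RegPot

variable {u : ℝ × ℝ → ℝ}

theorem lintegral_wt_le_sum {X : ℝ → ℝ≥0∞} (hX : Measurable X) {D : ℝ≥0∞}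
    (h : ∀ᵐ l, wt l ^ 3 * X l ≤ D * (wt l ^ 4 * anorm u l + hhnorm u l))
    (hu : Measurable u) :
    ∫⁻ l, wt l * X l ≤ cI * (D * l2n volume (fun l => wt l ^ 4 * anorm u l + hhnorm u l)) := by
  have h1 := measurable_anorm hu
  have h2 := measurable_hhnorm hu
  refine (lintegral_le_l2n_wt (by fun_prop)).trans ?_
  gcongr
  rw [← l2n_const_mul _ (by fun_prop)]
  refine l2n_mono_ae (h.mono fun l hl => le_trans ?_ hl)
  rw [← mul_assoc, ← sq]
  gcongr
  · exact one_le_wt l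
  · norm_num

theorem lintegral_wt_pnorm_lt_top (R : RegPot u) : ∫⁻ l, wt l * pnorm u l < ⊤ := by
  refine (lintegral_wt_le_sum (measurable_pnorm R.meas) (D := 32) ?_ R.meas).trans_lt ?_
  · filter_upwards [R.hhnorm_ae_lt_top] with l hl
    exact wt_pow_three_mul_le (R.pnorm_pow_four_le hl)
  · exact mul_lt_top cI_lt_top (mul_lt_top (by simp) R.l2n_sum_lt_top)

theorem lintegral_wt_snorm_lt_top (R : RegPot u) : ∫⁻ l, wt l * snorm u l < ⊤ := by
  refine (lintegral_wt_le_sum (measurable_snorm R.meas) (D := cI) ?_ R.meas).trans_lt ?_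
  · exact .of_forall fun l => wt_pow_three_mul_le (R.snorm_pow_four_le l)
  · exact mul_lt_top cI_lt_top (mul_lt_top cI_lt_top R.l2n_sum_lt_top)

/-- The quartic bound for the supremum norm. -/
theorem lintegral_wt_snorm_pow_four_lt_top (R : RegPot u) : ∫⁻ l, (wt l * snorm u l) ^ 4 < ⊤ := by
  have h1 := measurable_anorm R.meas
  have h2 := measurable_hhnorm R.meas
  set B : ℝ → ℝ≥0∞ := fun l => wt l ^ 4 * anorm u l + hhnorm u l with hB
  refine lt_of_le_of_lt (b := cI ^ 4 * kconst u ^ 2 * ∫⁻ l, B l ^ 2) ?_ ?_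
  · rw [← lintegral_const_mul _ (by fun_prop)]
    refine lintegral_mono fun l => ?_
    have h3 : anorm u l ≤ wt l ^ 4 * anorm u l :=
      le_mul_of_one_le_left zero_le (one_le_pow_of_one_le' (one_le_wt l) 4)
    calc (wt l * snorm u l) ^ 4 = wt l ^ 4 * snorm u l ^ 4 := by ring
      _ ≤ wt l ^ 4 * (cI ^ 4 * (anorm u l ^ 3 * (hhnorm u l + anorm u l))) := by
          gcongr; exact R.snorm_pow_four_le l
      _ = cI ^ 4 * anorm u l ^ 2 * ((wt l ^ 4 * anorm u l) * (hhnorm u l + anorm u l)) := by ring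
      _ ≤ cI ^ 4 * kconst u ^ 2 * (B l * B l) := by
          exact mul_le_mul' (mul_le_mul' le_rfl (pow_le_pow_left' (R.anorm_le l) 2))
            (mul_le_mul' le_self_add ((add_le_add le_rfl h3).trans_eq (add_comm _ _)))
      _ = _ := by rw [sq (B l)]
  · refine mul_lt_top (mul_lt_top (ENNReal.pow_lt_top cI_lt_top)
      (ENNReal.pow_lt_top R.kconst_lt_top)) (l2n_lt_top_iff.1 R.l2n_sum_lt_top)

theorem lintegral_wt_enorm_pft_le (R : RegPot u) (y : ℝ) : ∫⁻ l, wt l * ‖pft u l y‖ₑ ≤ cI * hnorm u y := by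
  have h : Measurable fun l => ‖pft u l y‖ₑ := (measurable_pft R.meas).of_uncurry_right.enorm
  refine (lintegral_le_l2n_wt (by fun_prop)).trans ?_
  gcongr
  refine l2n_mono fun l => ?_
  rw [← mul_assoc, ← sq]
  gcongr
  · exact one_le_wt l
  · norm_num

theorem enorm_div_mul_le (R : RegPot u) (l y : ℝ) : wt l * (‖y / l‖ₑ * ‖pft u l y‖ₑ) ≤
    ‖y‖ₑ * ((Ioo (-1 : ℝ) 1).indicator (fun _ => 2 * (cI * gnorm u y)) l + wt l * ‖pft u l y‖ₑ) := by
  rcases eq_or_ne l 0 with rfl | hl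
  · simp
  have hl' : ‖l‖ₑ ≠ 0 := by simpa using hl
  have e : ‖y / l‖ₑ = ‖y‖ₑ * ‖l‖ₑ⁻¹ := by rw [div_eq_mul_inv, enorm_mul, enorm_inv hl]
  rw [e, mul_assoc, mul_left_comm]
  gcongr
  by_cases h : |l| < 1
  · rw [indicator_of_mem (show l ∈ Ioo (-1 : ℝ) 1 from abs_lt.1 h)]
    refine le_trans ?_ le_self_add
    refine mul_le_mul' (wt_le_two h) ?_
    · calc ‖l‖ₑ⁻¹ * ‖pft u l y‖ₑ ≤ ‖l‖ₑ⁻¹ * (‖l‖ₑ * (cI * gnorm u y)) := by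
            gcongr; exact R.enorm_pft_le_mul l y
        _ = _ := by rw [← mul_assoc, ENNReal.inv_mul_cancel hl' enorm_ne_top, one_mul]
  · refine le_trans ?_ le_add_self
    gcongr
    exact mul_le_of_le_one_left zero_le (enorm_inv_le_one (not_lt.1 h))

theorem lintegral_div_le (R : RegPot u) (y : ℝ) :
    ∫⁻ l, wt l * (‖y / l‖ₑ * ‖pft u l y‖ₑ) ≤ wt y * (4 * (cI * gnorm u y) + cI * hnorm u y) := by
  have h : Measurable fun l => ‖pft u l y‖ₑ := (measurable_pft R.meas).of_uncurry_right.enorm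
  refine (lintegral_mono fun l => R.enorm_div_mul_le l y).trans ?_
  rw [lintegral_const_mul' _ _ enorm_ne_top]
  refine mul_le_mul (enorm_le_wt y) ?_ zero_le zero_le
  rw [lintegral_add_right _ (by fun_prop), lintegral_indicator measurableSet_Ioo, setLIntegral_const,
    Real.volume_Ioo]
  refine add_le_add (le_of_eq ?_) (R.lintegral_wt_enorm_pft_le y)
  norm_num
  ring

theorem hnorm_ae_lt_top (R : RegPot u) : ∀ᵐ y, hnorm u y < ⊤ := by
  have h1 := measurable_hnorm R.meas
  filter_upwards [ae_lt_top_of_l2n (by fun_prop) R.hw] with y hy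
  exact lt_of_le_of_lt (le_mul_of_one_le_left zero_le (one_le_pow_of_one_le' (one_le_wt y) 4)) hy

theorem l2n_wt_sum_lt_top (R : RegPot u) :
    l2n volume (fun y => wt y ^ 2 * (4 * (cI * gnorm u y) + cI * hnorm u y)) < ⊤ := by
  have hg := measurable_gnorm R.meas
  have hh := measurable_hnorm R.meas
  have e : ∀ y, wt y ^ 2 * (4 * (cI * gnorm u y) + cI * hnorm u y) ≤
      4 * cI * (wt y ^ 5 * gnorm u y) + cI * (wt y ^ 4 * hnorm u y) := fun y => by
    calc _ = 4 * cI * (wt y ^ 2 * gnorm u y) + cI * (wt y ^ 2 * hnorm u y) := by ring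
      _ ≤ _ := by gcongr <;> first | exact one_le_wt y | norm_num
  refine (l2n_mono e).trans_lt ((l2n_add_le (by fun_prop) (by fun_prop)).trans_lt ?_)
  rw [l2n_const_mul _ (by fun_prop), l2n_const_mul _ (by fun_prop)]
  exact add_lt_top.2 ⟨mul_lt_top (mul_lt_top (by simp) cI_lt_top) R.gw,
    mul_lt_top cI_lt_top R.hw⟩

theorem kb (R : RegPot u) : ∫⁻ y : ℝ, (∫⁻ l, wt l * ‖pft u l y‖ₑ) *
    ∫⁻ l, wt l * (‖y / l‖ₑ * ‖pft u l y‖ₑ) < ⊤ := by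
  have hg := measurable_gnorm R.meas
  have hh := measurable_hnorm R.meas
  refine lt_of_le_of_lt (b := ∫⁻ y, (cI * hnorm u y) * (wt y * (4 * (cI * gnorm u y) + cI * hnorm u y)))
    (lintegral_mono fun y => mul_le_mul (R.lintegral_wt_enorm_pft_le y) (R.lintegral_div_le y)
      zero_le zero_le) ?_
  refine (lintegral_mul_le_l2n (by fun_prop) (by fun_prop)).trans_lt (mul_lt_top ?_ ?_)
  · refine (l2n_mono fun y => ?_).trans_lt R.l2n_wt_sum_lt_top
    exact le_add_self.trans (le_mul_of_one_le_left zero_le (one_le_pow_of_one_le' (one_le_wt y) 2))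
  · refine (l2n_mono fun y => ?_).trans_lt R.l2n_wt_sum_lt_top
    gcongr
    exact wt_le_wt_pow y two_ne_zero

end RegPot

/-- The norm of the derivative of the partial Fourier transform in the dual variable. -/
def dnorm (u : ℝ × ℝ → ℝ) (l : ℝ) : ℝ≥0∞ := l2n volume fun y => ‖pft' u l y‖ₑ

theorem measurable_dnorm {u : ℝ × ℝ → ℝ} (hu : Measurable u) : Measurable (dnorm u) :=
  measurable_l2n_left (F := fun y l => ‖pft' u l y‖ₑ)
    ((measurable_pft' hu).comp (f := fun p : ℝ × ℝ => (p.2, p.1)) (by fun_prop)).enorm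

namespace RegPot

variable {u : ℝ × ℝ → ℝ}

theorem lintegral_wt_anorm_lt_top (R : RegPot u) : ∫⁻ l, wt l ^ 2 * anorm u l < ⊤ := by
  have h := measurable_anorm R.meas
  refine lintegral_lt_top_of_l2n_wt (by fun_prop) ((l2n_mono fun l => ?_).trans_lt R.l2n_wt_anorm_lt_top)
  calc wt l * (wt l ^ 2 * anorm u l) = wt l ^ 3 * anorm u l := by ring
    _ ≤ _ := by gcongr; exacts [one_le_wt l, by norm_num]

theorem dnorm_le (R : RegPot u) (l : ℝ) : dnorm u l ≤ kconst u :=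
  l2n_mono fun y => (R.enorm_pft'_le l y).trans
    (le_mul_of_one_le_left zero_le (one_le_pow_of_one_le' (one_le_wt y) 5))

theorem lintegral_wt_dnorm_lt_top (R : RegPot u) : ∫⁻ l, wt l * dnorm u l < ⊤ := by
  have hd := measurable_dnorm R.meas
  have hg := measurable_gnorm R.meas
  have hh := measurable_hnorm R.meas
  have hq := measurable_pft' R.meas
  have hq2 : Measurable fun p : ℝ × ℝ => ‖pft' u p.1 p.2‖ₑ := hq.enorm
  refine lintegral_lt_top_of_l2n_wt (by fun_prop) ?_
  have e1 : ∀ l, wt l * (wt l * dnorm u l) = l2n volume fun y => wt l ^ 2 * ‖pft' u l y‖ₑ := by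
    intro l
    have h : Measurable fun y => ‖pft' u l y‖ₑ := hq.of_uncurry_left.enorm
    rw [l2n_const_mul _ (by fun_prop), ← mul_assoc, ← sq]; rfl
  simp_rw [e1]
  have hm : Measurable (uncurry fun l y : ℝ => wt l ^ 2 * ‖pft' u l y‖ₑ) :=
    Measurable.mul (f := fun p : ℝ × ℝ => wt p.1 ^ 2) (by fun_prop) hq2
  rw [l2n_swap hm]
  refine (l2n_mono fun y => R.l2n_pft'_le y).trans_lt ?_
  rw [l2n_const_mul _ (by fun_prop)]
  refine mul_lt_top (by simp) ?_
  refine (l2n_mono fun y => ?_).trans_lt ((l2n_add_le (f := fun y => wt y ^ 4 * hnorm u y)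
    (g := fun y => wt y ^ 5 * gnorm u y) (by fun_prop) (by fun_prop)).trans_lt
      (add_lt_top.2 ⟨R.hw, R.gw⟩))
  exact add_le_add (le_mul_of_one_le_left zero_le (one_le_pow_of_one_le' (one_le_wt y) 4))
    (le_mul_of_one_le_left zero_le (one_le_pow_of_one_le' (one_le_wt y) 5))

theorem w3 (R : RegPot u) : ∫⁻ y, ∫⁻ l, wt l ^ 3 * (wt y * ‖pft u l y‖ₑ) < ⊤ := by
  have hh := measurable_hnorm R.meas
  have e : ∀ y, ∫⁻ l, wt l ^ 3 * (wt y * ‖pft u l y‖ₑ) ≤ cI * (wt y * hnorm u y) := fun y => by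
    have h : Measurable fun l => ‖pft u l y‖ₑ := (measurable_pft R.meas).of_uncurry_right.enorm
    refine (lintegral_le_l2n_wt (by fun_prop)).trans (le_of_eq ?_)
    rw [hnorm, ← l2n_const_mul (wt y) (by fun_prop)]
    exact congrArg (fun f => cI * l2n volume f) (funext fun l => by ring)
  refine (lintegral_mono e).trans_lt ?_
  rw [lintegral_const_mul _ (by fun_prop)]
  refine mul_lt_top cI_lt_top (lintegral_lt_top_of_l2n_wt (by fun_prop) ?_)
  refine (l2n_mono fun y => ?_).trans_lt R.hw
  rw [← mul_assoc, ← sq]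
  gcongr; exacts [one_le_wt y, by norm_num]

theorem w1' (R : RegPot u) : ∫⁻ y, ∫⁻ l, wt l * ‖pft' u l y‖ₑ < ⊤ := by
  have hg := measurable_gnorm R.meas
  have hh := measurable_hnorm R.meas
  have e : ∀ y, ∫⁻ l, wt l * ‖pft' u l y‖ₑ ≤ cI * (24 * (hnorm u y + gnorm u y)) := fun y => by
    have h : Measurable fun l => ‖pft' u l y‖ₑ := (measurable_pft' R.meas).of_uncurry_right.enorm
    refine (lintegral_le_l2n_wt (by fun_prop)).trans ?_
    gcongr
    refine le_trans (le_of_eq ?_) (R.l2n_pft'_le y)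
    congr 1; ext l; ring
  refine (lintegral_mono e).trans_lt ?_
  rw [lintegral_const_mul _ (by fun_prop), lintegral_const_mul _ (by fun_prop),
    lintegral_add_left (by fun_prop)]
  refine mul_lt_top cI_lt_top (mul_lt_top (by simp) (add_lt_top.2 ⟨?_, ?_⟩))
  · refine lintegral_lt_top_of_l2n_wt (by fun_prop) ((l2n_mono fun y => ?_).trans_lt R.hw)
    gcongr; exact wt_le_wt_pow y (by norm_num)
  · refine lintegral_lt_top_of_l2n_wt (by fun_prop) ((l2n_mono fun y => ?_).trans_lt R.gw)
    gcongr; exact wt_le_wt_pow y (by norm_num)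

theorem iU (R : RegPot u) : Integrable fun y => (1 + |y|) * ubd u y := by
  have hg := measurable_gnorm R.meas
  have hm : Measurable (ubd u) := by unfold ubd; fun_prop
  refine ⟨Measurable.aestronglyMeasurable (by fun_prop), ?_⟩
  have e : ∀ y, ‖(1 + |y|) * ubd u y‖ₑ = wt y * (cI * gnorm u y) := fun y => by
    have h0 : 0 ≤ ubd u y := ENNReal.toReal_nonneg
    rw [enorm_of_nonneg (mul_nonneg (by positivity) h0),
      ofReal_mul (by positivity), R.ofReal_ubd, wt]
  rw [HasFiniteIntegral, lintegral_congr e]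
  refine lintegral_lt_top_of_l2n_wt (by fun_prop) ((l2n_mono fun y => ?_).trans_lt R.kconst_lt_top)
  rw [← mul_assoc, ← sq]
  gcongr; exacts [one_le_wt y, by norm_num]

theorem x3 (R : RegPot u) : l2n volume (fun l => wt l ^ 3 * (ofReal √(π / |l|) *
    l2n volume fun y => ‖pft u l y‖ₑ)) < ⊤ := by
  have ha := measurable_anorm R.meas
  have e : ∀ l, wt l ^ 3 * (ofReal √(π / |l|) * l2n volume fun y => ‖pft u l y‖ₑ) ≤
      (Ioo (-1 : ℝ) 1).indicator (fun _ => 16 * kconst u) l + 2 * (wt l ^ 4 * anorm u l) := by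
    intro l
    change wt l ^ 3 * (swt l * _) ≤ _
    have h0 : l2n volume (fun y => ‖pft u l y‖ₑ) ≤ anorm u l :=
      l2n_mono fun y => le_mul_of_one_le_left zero_le (one_le_pow_of_one_le' (one_le_wt y) 4)
    by_cases h : |l| < 1
    · rw [indicator_of_mem (show l ∈ Ioo (-1 : ℝ) 1 from abs_lt.1 h)]
      refine le_trans ?_ le_self_add
      calc _ ≤ 2 ^ 3 * (swt l * (‖l‖ₑ * kconst u)) :=
            mul_le_mul' (pow_le_pow_left' (wt_le_two h) 3)
              (mul_le_mul' le_rfl (h0.trans (R.anorm_le_mul l)))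
        _ = 8 * (swt l * ‖l‖ₑ) * kconst u := by ring
        _ ≤ 8 * 2 * kconst u := by gcongr; exact swt_mul_enorm_le h
        _ = _ := by norm_num
    · refine le_trans ?_ le_add_self
      calc _ ≤ wt l ^ 4 * (2 * anorm u l) :=
            mul_le_mul' (pow_le_pow_right₀ (one_le_wt l) (by norm_num))
              (mul_le_mul' (swt_le_two (not_lt.1 h)) h0)
        _ = _ := by ring
  refine (l2n_mono e).trans_lt ((l2n_add_le ?_ (by fun_prop)).trans_lt (add_lt_top.2 ⟨?_, ?_⟩))
  · exact (measurable_const.indicator measurableSet_Ioo).aemeasurable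
  · rw [l2n_lt_top_iff]
    have : ∀ l : ℝ, (Ioo (-1 : ℝ) 1).indicator (fun _ => 16 * kconst u) l ^ 2 =
        (Ioo (-1 : ℝ) 1).indicator (fun _ => (16 * kconst u) ^ 2) l := fun l => by
      by_cases h : l ∈ Ioo (-1 : ℝ) 1 <;> simp [h]
    simp_rw [this]
    rw [lintegral_indicator measurableSet_Ioo, setLIntegral_const, Real.volume_Ioo]
    exact mul_lt_top (ENNReal.pow_lt_top (mul_lt_top (by simp) R.kconst_lt_top))
      ofReal_lt_top
  · rw [l2n_const_mul _ (by fun_prop)]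
    exact mul_lt_top (by simp) R.l2n_wt_anorm_lt_top

theorem bfin (R : RegPot u) : ∀ᵐ y : ℝ, ∫⁻ l, wt l * (‖y / l‖ₑ * ‖pft u l y‖ₑ) < ⊤ := by
  filter_upwards [R.hnorm_ae_lt_top] with y hy
  refine (R.lintegral_div_le y).trans_lt (mul_lt_top (wt_lt_top y) (add_lt_top.2
    ⟨mul_lt_top (by simp) (R.bound_lt_top y), mul_lt_top cI_lt_top hy⟩))

theorem enorm_srcB_le (u : ℝ × ℝ → ℝ) (l η : ℝ) : ‖srcB (pft u) l η‖ₑ ≤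
    ∫⁻ l', ‖pft u (l - l') η‖ₑ * (‖η / l'‖ₑ * ‖pft u l' η‖ₑ) := by
  unfold srcB
  refine (enorm_integral_le_lintegral_enorm _).trans (le_of_eq (lintegral_congr fun l' => ?_))
  rw [enorm_mul, enorm_mul, enorm_mul, ← Complex.ofReal_div,
    enorm_I, one_mul,
    enorm_real]

theorem gint (R : RegPot u) (l : ℝ) : Integrable (srcB (pft u) l) := by
  have hg := measurable_gnorm R.meas
  have hh := measurable_hnorm R.meas
  refine integrable_of_lintegral (measurable_srcB (measurable_pft R.meas)).of_uncurry_left ?_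
  have e : ∀ η, ‖srcB (pft u) l η‖ₑ ≤
      (cI * gnorm u η) * (wt η * (4 * (cI * gnorm u η) + cI * hnorm u η)) := fun η => by
    have h : Measurable fun l => ‖pft u l η‖ₑ := (measurable_pft R.meas).of_uncurry_right.enorm
    refine (enorm_srcB_le u l η).trans ?_
    refine le_trans ?_ (mul_le_mul_right (R.lintegral_div_le η) _)
    rw [← lintegral_const_mul' _ _ (R.bound_lt_top η).ne]
    refine lintegral_mono fun l' => mul_le_mul' (R.enorm_pft_le _ _) ?_
    exact le_mul_of_one_le_left zero_le (one_le_wt l')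
  refine (lintegral_mono e).trans_lt ?_
  refine (lintegral_mul_le_l2n (by fun_prop) (by fun_prop)).trans_lt (mul_lt_top ?_ ?_)
  · refine (l2n_mono fun y => ?_).trans_lt R.kconst_lt_top
    exact le_mul_of_one_le_left zero_le (one_le_pow_of_one_le' (one_le_wt y) 5)
  · refine (l2n_mono fun y => ?_).trans_lt R.l2n_wt_sum_lt_top
    gcongr
    exact wt_le_wt_pow y two_ne_zero

/-- The factor `ũ(l-l';·)` is estimated in supremum norm by the integral of its Fourier transform in
`y`, the other factor in `L²(dy)`, where one power of the weight absorbs the multiplication by `y`.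
-/
theorem l2n_srcB_le (R : RegPot u) (l : ℝ) : l2n volume (fun y => ‖srcB (pft u) l y‖ₑ) ≤
    ∫⁻ l', snorm u (l - l') * (‖l'‖ₑ⁻¹ * anorm u l') := by
  have hq := measurable_pft R.meas
  have hm : Measurable (uncurry fun η l' : ℝ =>
      ‖pft u (l - l') η‖ₑ * (‖η / l'‖ₑ * ‖pft u l' η‖ₑ)) := by
    have h1 : Measurable fun p : ℝ × ℝ => ‖pft u (l - p.2) p.1‖ₑ :=
      (hq.comp (f := fun p : ℝ × ℝ => (l - p.2, p.1)) (by fun_prop)).enorm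
    have h2 : Measurable fun p : ℝ × ℝ => ‖pft u p.2 p.1‖ₑ :=
      (hq.comp (f := fun p : ℝ × ℝ => (p.2, p.1)) (by fun_prop)).enorm
    exact h1.mul (Measurable.mul (f := fun p : ℝ × ℝ => ‖p.1 / p.2‖ₑ) (by fun_prop) h2)
  refine (l2n_mono fun y => enorm_srcB_le u l y).trans ((l2n_lintegral_le hm).trans ?_)
  refine lintegral_mono_ae ?_
  have h0 := Measure.ae_ne volume (0 : ℝ)
  have h1 : ∀ᵐ l', hhnorm u (l - l') < ⊤ :=
    (quasiMeasurePreserving_sub_left_of_right_invariant volume l).ae R.hhnorm_ae_lt_top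
  filter_upwards [h0, h1] with l' hl' hs
  have hb := ae_enorm_le_lintegral_ft (R.measurable_pft_left (l - l')) (R.anorm_lt_top _) hs
  have hl0 : ‖l'‖ₑ⁻¹ ≠ ⊤ := ENNReal.inv_ne_top.2 (by simpa using hl')
  have h2 : Measurable fun η => ‖pft u l' η‖ₑ := hq.of_uncurry_left.enorm
  rw [anorm, ← l2n_const_mul _ (by fun_prop), ← l2n_const_mul _ (by fun_prop)]
  refine l2n_mono_ae (hb.mono fun η hη => ?_)
  refine mul_le_mul' hη ?_
  rw [div_eq_mul_inv, enorm_mul, enorm_inv hl', mul_comm ‖η‖ₑ, mul_assoc]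
  gcongr
  exact (enorm_le_wt η).trans (wt_le_wt_pow η (by norm_num))

/-- Near the origin one compares `P` with `|l|^{-1/4}`: either the product is at most a multiple of
`|l|^{-3/4}`, or it is bounded by `P³ ≤ P + P⁴`. Hence the need for a fourth moment of `snorm`. -/
theorem swt_mul_le {l : ℝ} (hl : l ≠ 0) (P : ℝ≥0∞) :
    swt l * P ≤ 2 * ((Ioo (-1 : ℝ) 1).indicator (fun l => zwt l ^ 7) l + (P + P ^ 4)) := by
  by_cases h : |l| < 1
  · rw [indicator_of_mem (show l ∈ Ioo (-1 : ℝ) 1 from abs_lt.1 h)]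
    refine (mul_le_mul_left (swt_le_zwt l) P).trans ?_
    rw [mul_assoc]
    refine mul_le_mul' le_rfl ?_
    rcases le_total P (zwt l ^ 2) with h1 | h1
    · refine le_trans ?_ le_self_add
      calc zwt l ^ 4 * P ≤ zwt l ^ 4 * zwt l ^ 2 := by gcongr
        _ = zwt l ^ 6 := by ring
        _ ≤ _ := pow_le_pow_right₀ (one_le_zwt hl h) (by norm_num)
    · refine le_trans ?_ le_add_self
      calc zwt l ^ 4 * P = (zwt l ^ 2) ^ 2 * P := by ring
        _ ≤ P ^ 2 * P := by gcongr
        _ = P ^ 3 := by ring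
        _ ≤ P + P ^ 4 := by
          rcases le_total P 1 with h2 | h2
          · exact (pow_le_of_le_one zero_le h2 (by norm_num)).trans le_self_add
          · exact (pow_le_pow_right₀ h2 (by norm_num)).trans le_add_self
  · refine mul_le_mul' (swt_le_two (not_lt.1 h)) (le_add_self.trans' le_self_add)

/-- The factor `|l|^{-1/2}` is not compatible with the convolution, so `l` is integrated first at
fixed `l'`. Splitting that factor from the translated `snorm` gives a bound uniform in `l'`; the
remaining `|l'|⁻¹` is absorbed by the vanishing of `ũ` at `0`. -/
theorem gB (R : RegPot u) : ∫⁻ l, wt l * (ofReal √(π / |l|) *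
    l2n volume fun y => ‖srcB (pft u) l y‖ₑ) < ⊤ := by
  have ha := measurable_anorm R.meas
  have hs := measurable_snorm R.meas
  have h0 := Measure.ae_ne volume (0 : ℝ)
  set N : ℝ≥0∞ := 2 * ((∫⁻ l in Ioo (-1 : ℝ) 1, zwt l ^ 7) +
    ((∫⁻ l, wt l * snorm u l) + ∫⁻ l, (wt l * snorm u l) ^ 4)) with hN
  have hNt : N < ⊤ := mul_lt_top (by simp) (add_lt_top.2 ⟨lintegral_zwt_pow_lt_top,
    add_lt_top.2 ⟨R.lintegral_wt_snorm_lt_top, R.lintegral_wt_snorm_pow_four_lt_top⟩⟩)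
  have h1 : ∀ l', ∫⁻ l, swt l * (wt (l - l') * snorm u (l - l')) ≤ N := by
    intro l'
    calc _ ≤ ∫⁻ l, 2 * ((Ioo (-1 : ℝ) 1).indicator (fun l => zwt l ^ 7) l +
          ((wt (l - l') * snorm u (l - l')) + (wt (l - l') * snorm u (l - l')) ^ 4)) :=
          lintegral_mono_ae (h0.mono fun l hl => swt_mul_le hl _)
      _ = N := by
          have m1 : Measurable ((Ioo (-1 : ℝ) 1).indicator (fun l => zwt l ^ 7)) :=
            (by fun_prop : Measurable fun l => zwt l ^ 7).indicator measurableSet_Ioo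
          rw [lintegral_const_mul _ (by fun_prop), lintegral_add_left m1,
            lintegral_add_left (by fun_prop), lintegral_indicator measurableSet_Ioo,
            lintegral_sub_right_eq_self (fun l => wt l * snorm u l) l',
            lintegral_sub_right_eq_self (fun l => (wt l * snorm u l) ^ 4) l']
  have h2 : ∀ l, wt l * (swt l * l2n volume fun y => ‖srcB (pft u) l y‖ₑ) ≤
      ∫⁻ l', (wt l' * (‖l'‖ₑ⁻¹ * anorm u l')) * (swt l * (wt (l - l') * snorm u (l - l'))) := by
    intro l
    calc _ ≤ wt l * (swt l * ∫⁻ l', snorm u (l - l') * (‖l'‖ₑ⁻¹ * anorm u l')) := by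
          gcongr; exact R.l2n_srcB_le l
      _ = ∫⁻ l', wt l * (swt l * (snorm u (l - l') * (‖l'‖ₑ⁻¹ * anorm u l'))) := by
          rw [← lintegral_const_mul _ (by fun_prop), ← lintegral_const_mul _ (by fun_prop)]
      _ ≤ _ := by
          refine lintegral_mono fun l' => ?_
          have h3 := submul_wt_pow 1 l l'
          simp only [pow_one] at h3
          calc _ ≤ (wt l' * wt (l - l')) * (swt l * (snorm u (l - l') * (‖l'‖ₑ⁻¹ * anorm u l'))) :=
                mul_le_mul_left h3 _
            _ = _ := by ring
  have hm : Measurable (uncurry fun l l' : ℝ => (wt l' * (‖l'‖ₑ⁻¹ * anorm u l')) *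
      (swt l * (wt (l - l') * snorm u (l - l')))) := by
    have := ha.comp (measurable_snd : Measurable fun p : ℝ × ℝ => p.2)
    have := hs.comp (f := fun p : ℝ × ℝ => p.1 - p.2) (by fun_prop)
    unfold uncurry
    fun_prop
  refine (lintegral_mono h2).trans_lt ?_
  rw [lintegral_lintegral_swap hm.aemeasurable]
  have h3 : ∀ l', ∫⁻ l, (wt l' * (‖l'‖ₑ⁻¹ * anorm u l')) * (swt l * (wt (l - l') * snorm u (l - l'))) ≤
      (wt l' * (‖l'‖ₑ⁻¹ * anorm u l')) * N := fun l' => by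
    rw [lintegral_const_mul _ (by fun_prop)]
    gcongr
    exact h1 l'
  refine (lintegral_mono h3).trans_lt ?_
  rw [lintegral_mul_const _ (by fun_prop)]
  refine mul_lt_top ?_ hNt
  refine lt_of_le_of_lt (b := ∫⁻ l, ((Ioo (-1 : ℝ) 1).indicator (fun _ => 2 * kconst u) l +
    wt l ^ 2 * anorm u l)) (lintegral_mono_ae (h0.mono fun l hl => ?_)) ?_
  · by_cases h : |l| < 1
    · rw [indicator_of_mem (show l ∈ Ioo (-1 : ℝ) 1 from abs_lt.1 h)]
      refine le_trans (mul_le_mul' (wt_le_two h) ?_) le_self_add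
      calc ‖l‖ₑ⁻¹ * anorm u l ≤ ‖l‖ₑ⁻¹ * (‖l‖ₑ * kconst u) := by gcongr; exact R.anorm_le_mul l
        _ = kconst u := by
          rw [← mul_assoc, ENNReal.inv_mul_cancel (by simpa using hl) enorm_ne_top, one_mul]
    · refine le_trans (mul_le_mul' (wt_le_wt_pow l two_ne_zero) ?_) le_add_self
      exact mul_le_of_le_one_left zero_le (enorm_inv_le_one (not_lt.1 h))
  · rw [lintegral_add_right _ (by fun_prop), lintegral_indicator measurableSet_Ioo, setLIntegral_const,
      Real.volume_Ioo]
    exact add_lt_top.2 ⟨mul_lt_top (mul_lt_top (by simp) R.kconst_lt_top)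
      ofReal_lt_top, R.lintegral_wt_anorm_lt_top⟩

theorem l2n_src_le (R : RegPot u) {l : ℝ} (hl : l ≠ 0) :
    l2n volume (fun y => ‖src (pft u) (pft' u) (rpft u) l y‖ₑ) ≤
      ‖l‖ₑ * anorm u l + (dnorm u l + ‖l‖ₑ⁻¹ * (anorm u l + pnorm u l)) := by
  have hq : Measurable fun y => ‖pft u l y‖ₑ := (R.measurable_pft_left l).enorm
  have hq' : Measurable fun y => ‖pft' u l y‖ₑ := (measurable_pft' R.meas).of_uncurry_left.enorm
  have hr : Measurable fun y => ‖rpft u l y‖ₑ := (measurable_rpft R.meas).of_uncurry_left.enorm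
  have e : ∀ y, ‖src (pft u) (pft' u) (rpft u) l y‖ₑ ≤ ‖l‖ₑ * (wt y ^ 4 * ‖pft u l y‖ₑ) +
      (‖pft' u l y‖ₑ + ‖l‖ₑ⁻¹ * (wt y ^ 4 * ‖pft u l y‖ₑ + wt y ^ 2 * ‖rpft u l y‖ₑ)) := by
    intro y
    unfold src
    have ey : ‖(y : ℂ)‖ₑ ≤ wt y := by
      rw [enorm_real]; exact enorm_le_wt y
    have el : ‖(l : ℂ)‖ₑ = ‖l‖ₑ := by rw [enorm_real]
    rw [add_sub_assoc]
    refine (enorm_add_le _ _).trans (add_le_add ?_ ((enorm_sub_le).trans (add_le_add le_rfl ?_)))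
    · rw [mul_assoc (I * (l : ℂ)), enorm_I_mul, enorm_mul]
      gcongr
      exact ey.trans (wt_le_wt_pow y (by norm_num))
    · rw [div_eq_inv_mul, enorm_mul, enorm_inv (by exact_mod_cast hl), el]
      gcongr
      refine (enorm_add_le _ _).trans (add_le_add ?_ ?_)
      · exact le_mul_of_one_le_left zero_le (one_le_pow_of_one_le' (one_le_wt y) 4)
      · rw [enorm_mul]
        gcongr
        exact ey.trans (wt_le_wt_pow y (by norm_num))
  refine (l2n_mono e).trans ((l2n_add_le (by fun_prop) (by fun_prop)).trans ?_)
  rw [l2n_const_mul _ (by fun_prop)]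
  refine add_le_add le_rfl ((l2n_add_le hq'.aemeasurable (by fun_prop)).trans (add_le_add le_rfl ?_))
  rw [l2n_const_mul _ (by fun_prop)]
  gcongr
  exact l2n_add_le (by fun_prop) (by fun_prop)

/-- For `|l| < 1` the critical term is `|l|^{-1/2} |l|⁻¹ ‖y ∂_y ũ‖`, handled by `zwt_mul_le`; in the
term with `|l|⁻¹ ũ` the zero of `ũ` cancels the pole. For `|l| ≥ 1` no factor is singular. -/
theorem g1_pointwise (R : RegPot u) {l : ℝ} (hl : l ≠ 0) (hb : hhnorm u l < ⊤) :
    wt l * (swt l * l2n volume fun y => ‖src (pft u) (pft' u) (rpft u) l y‖ₑ) ≤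
      (Ioo (-1 : ℝ) 1).indicator (fun l => 12 * kconst u * zwt l ^ 7 +
        4 * (32 * (kconst u + 1) * (zwt l ^ 7 + (hhnorm u l + (kconst u + 1)) ^ 2))) l +
      2 * (2 * (wt l ^ 2 * anorm u l) + wt l * dnorm u l + wt l * pnorm u l) := by
  refine (mul_le_mul_right (mul_le_mul_right (R.l2n_src_le hl) _) _).trans ?_
  by_cases h : |l| < 1
  · rw [indicator_of_mem (show l ∈ Ioo (-1 : ℝ) 1 from abs_lt.1 h)]
    refine le_trans ?_ le_self_add
    have hz := one_le_zwt hl h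
    have hinv : ‖l‖ₑ⁻¹ = zwt l ^ 8 := by
      rw [← one_mul ‖l‖ₑ⁻¹, ← zwt_pow_eight_mul hl, mul_assoc,
        ENNReal.mul_inv_cancel (by simpa using hl) enorm_ne_top, mul_one]
    have hl1 : ‖l‖ₑ ≤ 1 := by
      rw [← ofReal_norm, ENNReal.ofReal_le_one]; exact h.le
    have hp := zwt_mul_le (K := kconst u + 1) hl (R.pnorm_pow_four_le hb) ((R.anorm_le l).trans le_self_add)
      ((R.anorm_le_mul l).trans (by gcongr; exact le_self_add)) le_add_self
    have ha1 : ‖l‖ₑ⁻¹ * anorm u l ≤ kconst u := by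
      calc ‖l‖ₑ⁻¹ * anorm u l ≤ ‖l‖ₑ⁻¹ * (‖l‖ₑ * kconst u) := by gcongr; exact R.anorm_le_mul l
        _ = kconst u := by
          rw [← mul_assoc, ENNReal.inv_mul_cancel (by simpa using hl) enorm_ne_top, one_mul]
    calc _ ≤ 2 * (2 * zwt l ^ 4 * (1 * kconst u + (kconst u + (kconst u + ‖l‖ₑ⁻¹ * pnorm u l)))) := by
          refine mul_le_mul' (wt_le_two h) (mul_le_mul' (swt_le_zwt l) (add_le_add
            (mul_le_mul' hl1 (R.anorm_le l)) (add_le_add (R.dnorm_le l) ?_)))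
          rw [mul_add]
          exact add_le_add ha1 le_rfl
      _ = 12 * kconst u * zwt l ^ 4 + 4 * (zwt l ^ 12 * pnorm u l) := by rw [hinv]; ring
      _ ≤ _ := by
          refine add_le_add (mul_le_mul' le_rfl (pow_le_pow_right₀ hz (by norm_num))) ?_
          exact mul_le_mul' le_rfl hp
  · refine le_trans ?_ le_add_self
    have h1 := enorm_inv_le_one (not_lt.1 h)
    calc _ ≤ wt l * (2 * (wt l * anorm u l + (dnorm u l + 1 * (wt l * anorm u l + pnorm u l)))) := by
          gcongr
          · exact swt_le_two (not_lt.1 h)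
          · exact enorm_le_wt l
          · exact le_mul_of_one_le_left zero_le (one_le_wt l)
      _ = _ := by ring

theorem g1 (R : RegPot u) : ∫⁻ l, wt l * (ofReal √(π / |l|) *
    l2n volume fun y => ‖src (pft u) (pft' u) (rpft u) l y‖ₑ) < ⊤ := by
  have ha := measurable_anorm R.meas
  have hd := measurable_dnorm R.meas
  have hp := measurable_pnorm R.meas
  have hh := measurable_hhnorm R.meas
  have h0 := Measure.ae_ne volume (0 : ℝ)
  have hk := R.kconst_lt_top
  have hk1 : kconst u + 1 < ⊤ := add_lt_top.2 ⟨hk, by simp⟩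
  refine (lintegral_mono_ae (h0.mp (R.hhnorm_ae_lt_top.mono fun l hb hl => R.g1_pointwise hl hb))).trans_lt ?_
  rw [lintegral_add_right _ (by fun_prop), lintegral_indicator measurableSet_Ioo,
    lintegral_const_mul _ (by fun_prop), lintegral_add_right _ (by fun_prop),
    lintegral_add_right _ (by fun_prop), lintegral_const_mul _ (by fun_prop),
    lintegral_add_left (by fun_prop), lintegral_const_mul _ (by fun_prop),
    lintegral_const_mul _ (by fun_prop), lintegral_const_mul _ (by fun_prop), lintegral_add_left (by fun_prop)]
  have hz := lintegral_zwt_pow_lt_top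
  have hsq : ∫⁻ l in Ioo (-1 : ℝ) 1, (hhnorm u l + (kconst u + 1)) ^ 2 < ⊤ := by
    refine lt_of_le_of_lt (lintegral_mono fun l => add_sq_le _ _) ?_
    rw [lintegral_const_mul _ (by fun_prop), lintegral_add_left (by fun_prop), setLIntegral_const]
    refine mul_lt_top (by simp) (add_lt_top.2 ⟨?_, mul_lt_top
      (ENNReal.pow_lt_top hk1) (by simp)⟩)
    exact (setLIntegral_le_lintegral _ _).trans_lt (l2n_lt_top_iff.1 R.hhfin)
  have c4 : (4 : ℝ≥0∞) < ⊤ := by simp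
  have c12 : (12 : ℝ≥0∞) < ⊤ := by simp
  have c32 : (32 : ℝ≥0∞) < ⊤ := by simp
  have c2 : (2 : ℝ≥0∞) < ⊤ := by simp
  exact add_lt_top.2 ⟨add_lt_top.2 ⟨mul_lt_top (mul_lt_top c12 hk) hz,
    mul_lt_top c4 (mul_lt_top (mul_lt_top c32 hk1)
      (add_lt_top.2 ⟨hz, hsq⟩))⟩,
    mul_lt_top c2 (add_lt_top.2 ⟨add_lt_top.2 ⟨mul_lt_top c2
      R.lintegral_wt_anorm_lt_top, R.lintegral_wt_dnorm_lt_top⟩, R.lintegral_wt_pnorm_lt_top⟩)⟩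

theorem yint (R : RegPot u) : ∀ᵐ l : ℝ, Integrable fun y => ((1 + |y| : ℝ) : ℂ) * rpft u l y := by
  have hp : ∀ᵐ l, pnorm u l < ⊤ := by
    have hm := measurable_pnorm R.meas
    filter_upwards [ae_lt_top (by fun_prop) R.lintegral_wt_pnorm_lt_top.ne] with l hl
    exact lt_of_le_of_lt (le_mul_of_one_le_left zero_le (one_le_wt l)) hl
  filter_upwards [hp] with l hl
  have hr : Measurable (rpft u l) := (measurable_rpft R.meas).of_uncurry_left
  refine integrable_of_lintegral (by fun_prop) ?_
  simp_rw [enorm_one_add_abs_mul]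
  refine lintegral_lt_top_of_l2n_wt (by fun_prop) (lt_of_le_of_lt (le_of_eq ?_) hl)
  unfold pnorm
  congr 1; ext y; ring

/-- A regular potential satisfies the assumptions of the scattering theory. -/
theorem kpot (R : RegPot u) : KPot (pft u) (pft' u) (rpft u) (ubd u) where
  mq := measurable_pft R.meas
  mq' := measurable_pft' R.meas
  mr := measurable_rpft R.meas
  mU := by
    have hg := measurable_gnorm R.meas
    unfold ubd; fun_prop
  hd := R.hasDerivAt_pft
  bq := R.norm_pft_le
  bq' := R.norm_pft'_le
  iU := R.iU
  q0 := R.zero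
  w3 := R.w3
  w1' := R.w1'
  x3 := R.x3
  bfin := R.bfin
  kb := R.kb
  yderiv := by
    filter_upwards [R.hhnorm_ae_lt_top] with l hl
    exact ⟨fun y => ft (ft (pft u l)) (-y),
      hasDerivAt_ft_ft_neg (R.measurable_pft_left l) (R.anorm_lt_top l) hl,
      ft_ft_neg_ae_eq' (R.measurable_pft_left l) (R.anorm_lt_top l) hl⟩
  yint := R.yint
  gint := ae_of_all _ R.gint
  g1 := R.g1
  gB := R.gB

end RegPot

/-! ### Regular representatives of elements of `E_{1,w}` -/

/-- The function `1/|l|` is not integrable at `0`, whereas `|f|` stays above `|f 0|/2` near `0`. -/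
theorem lintegral_sq_div_eq_top {f : ℝ → ℂ} (hf : Continuous f) (h0 : f 0 ≠ 0) :
    ∫⁻ l : ℝ, ‖f l‖ₑ ^ 2 / ‖l‖ₑ = ⊤ := by
  by_contra h
  have hc : 0 < ‖f 0‖ / 2 := by positivity
  have hev : ∀ᶠ l in nhds (0 : ℝ), ‖f 0‖ / 2 < ‖f l‖ :=
    hf.norm.continuousAt.eventually (lt_mem_nhds (half_lt_self (norm_pos_iff.2 h0)))
  obtain ⟨ε, hε, hb⟩ := Metric.eventually_nhds_iff.1 hev
  have hi : ¬ IntegrableOn (fun x : ℝ => x ^ (-1 : ℝ)) (Ioo 0 ε) := fun hi => by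
    simpa using (intervalIntegral.integrableOn_Ioo_rpow_iff hε).1 hi
  refine hi ⟨Measurable.aestronglyMeasurable (by fun_prop), ?_⟩
  refine lt_of_le_of_lt (b := (ofReal (‖f 0‖ / 2) ^ 2)⁻¹ * ∫⁻ l : ℝ, ‖f l‖ₑ ^ 2 / ‖l‖ₑ) ?_ ?_
  · have hc' : ofReal (‖f 0‖ / 2) ^ 2 ≠ 0 := by positivity
    rw [← lintegral_const_mul' _ _ (ENNReal.inv_ne_top.2 hc')]
    refine le_trans (setLIntegral_mono' measurableSet_Ioo fun l hl => ?_) (setLIntegral_le_lintegral _ _)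
    have h1 : ofReal (‖f 0‖ / 2) ^ 2 ≤ ‖f l‖ₑ ^ 2 := by
      gcongr
      rw [← ofReal_norm]
      refine ofReal_le_ofReal (hb ?_).le
      rw [Real.dist_eq, sub_zero, abs_of_pos hl.1]; exact hl.2
    simp only
    rw [Real.rpow_neg_one, enorm_inv hl.1.ne', div_eq_mul_inv (‖f l‖ₑ ^ 2), ← mul_assoc]
    refine le_mul_of_one_le_left zero_le ?_
    rw [← ENNReal.inv_mul_cancel hc' (by finiteness)]
    gcongr
  · exact mul_lt_top (by simp; positivity) (lt_top_iff_ne_top.2 h)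

theorem isTest_mul {ψ β : ℝ → ℝ} (h1 : ContDiff ℝ (⊤ : ℕ∞) ψ) (h2 : HasCompactSupport ψ)
    (h3 : ContDiff ℝ (⊤ : ℕ∞) β) (h4 : HasCompactSupport β) : IsTest fun p : ℝ × ℝ => ψ p.1 * β p.2 := by
  refine ⟨(h1.comp contDiff_fst).mul (h3.comp contDiff_snd), ?_⟩
  refine HasCompactSupport.intro (h2.isCompact.prod h4.isCompact) fun p hp => ?_
  by_contra h
  have := mul_ne_zero_iff.1 h
  exact hp ⟨subset_tsupport _ this.1, subset_tsupport _ this.2⟩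

theorem dx_mul (n : ℕ) (ψ β : ℝ → ℝ) (p : ℝ × ℝ) :
    dx n (fun p => ψ p.1 * β p.2) p = iteratedDeriv n ψ p.1 * β p.2 := by
  simp only [dx, iteratedDeriv_mul_const_field]

theorem dy_mul (n : ℕ) (ψ β : ℝ → ℝ) (p : ℝ × ℝ) :
    dy n (fun p => ψ p.1 * β p.2) p = ψ p.1 * iteratedDeriv n β p.2 := by
  simp only [dy, iteratedDeriv_const_mul_field]

theorem ft_ft_swap {F : ℝ × ℝ → ℂ} (hF : Integrable F) (l s : ℝ) :
    ft (fun y => ft (fun x => F (x, y)) l) s = ft (fun x => ft (fun y => F (x, y)) s) l := by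
  simp only [ft, ← integral_const_mul]
  have hi : Integrable fun p : ℝ × ℝ => (√(2 * π) : ℂ)⁻¹ * (Complex.exp (-(I * s * p.2)) *
      ((√(2 * π) : ℂ)⁻¹ * (Complex.exp (-(I * l * p.1)) * F p))) := by
    refine Integrable.const_mul (Integrable.bdd_mul (c := 1) (Integrable.const_mul
      (Integrable.bdd_mul (c := 1) hF (Measurable.aestronglyMeasurable (by fun_prop)) ?_) _)
      (Measurable.aestronglyMeasurable (by fun_prop)) ?_) _ <;>
    exact ae_of_all _ fun p => (norm_cexp_neg_I_mul _ _).le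
  rw [Measure.volume_eq_prod] at hi
  rw [← integral_integral_swap (f := fun x y : ℝ => (√(2 * π) : ℂ)⁻¹ * (Complex.exp (-(I * s * y)) *
    ((√(2 * π) : ℂ)⁻¹ * (Complex.exp (-(I * l * x)) * F (x, y))))) hi]
  refine integral_congr_ae (ae_of_all _ fun x => integral_congr_ae
    (ae_of_all _ fun y => ?_))
  simp only; ring

theorem wt_pow_five_le (y : ℝ) : wt y ^ 5 ≤ 8 * ofReal ((1 + y ^ 2) ^ (5 / 2 : ℝ)) := by
  rw [← ENNReal_sq_le_sq, ENNReal.ofReal_rpow_of_pos (by positivity) |>.symm, mul_pow,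
    ← ENNReal.rpow_natCast (_ ^ (5 / 2 : ℝ)), ← ENNReal.rpow_mul]
  norm_num
  calc (wt y ^ 5) ^ 2 = (wt y ^ 2) ^ 5 := by ring
    _ ≤ (2 * ofReal (1 + y ^ 2)) ^ 5 := pow_le_pow_left' (wt_sq_le y) 5
    _ = 32 * ofReal (1 + y ^ 2) ^ 5 := by rw [mul_pow]; norm_num
    _ ≤ _ := by gcongr; norm_num

/-- The bounds on the Fourier side for a representative with integrable sections. -/
theorem hnorm_bound {u u₂ : ℝ × ℝ → ℝ} (hu : MemE1w u) (he : u =ᵐ[volume] u₂) (hm : Measurable u₂)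
    (hi : Integrable u₂) : l2n volume (fun y => wt y ^ 4 * hnorm u₂ y) < ⊤ := by
  obtain ⟨v, hv, ht⟩ := hu.smooth_x
  have hv2 : MemLp v 2 := by
    refine MemLp.of_le_mul (c := 1) hv ?_ (ae_of_all _ fun p => ?_)
    · have h1 : AEStronglyMeasurable (fun p : ℝ × ℝ => ((1 + p.2 ^ 2) ^ 2)⁻¹) volume :=
        Measurable.aestronglyMeasurable (by fun_prop)
      refine (h1.mul hv.1).congr (ae_of_all _ fun p => ?_)
      simp only [Pi.mul_apply]
      rw [← mul_assoc, inv_mul_cancel₀ (by positivity), one_mul]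
    · rw [one_mul, norm_mul]
      refine le_mul_of_one_le_left (norm_nonneg _) ?_
      rw [norm_of_nonneg (by positivity)]
      exact one_le_pow₀ (by nlinarith [sq_nonneg p.2])
  set v₁ := hv2.1.aemeasurable.mk v with hv1
  have hvm : Measurable v₁ := hv2.1.aemeasurable.measurable_mk
  have hve : v =ᵐ[volume] v₁ := hv2.1.aemeasurable.ae_eq_mk
  have hu2 : MemLp u₂ 2 := hu.memLp.ae_eq he
  have hq := measurable_pft hm
  rw [Measure.volume_eq_prod] at hi
  have key := lintegral_pft_le_of_test hu2 (hv2.ae_eq hve) hvm hi.prod_left_ae ?_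
    (W := fun y => wt y ^ 8) (by fun_prop) (fun y => ENNReal.pow_ne_top (wt_lt_top y).ne)
  · have hA : ∫⁻ y, wt y ^ 8 * ∫⁻ x, ‖v₁ (x, y)‖ₑ ^ 2 < ⊤ := by
      have h1 := l2n_lt_top_iff.1 ((memLp_two_iff hv.1).1 hv)
      refine lt_of_le_of_lt (b := 16 * ∫⁻ p : ℝ × ℝ, ‖(1 + p.2 ^ 2) ^ 2 * v p‖ₑ ^ 2) ?_
        (mul_lt_top (by simp) h1)
      have e : ∫⁻ p : ℝ × ℝ, ‖(1 + p.2 ^ 2) ^ 2 * v p‖ₑ ^ 2 =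
          ∫⁻ y, ∫⁻ x, (ofReal ((1 + y ^ 2) ^ 2) * ‖v₁ (x, y)‖ₑ) ^ 2 := by
        rw [lintegral_congr_ae (g := fun p : ℝ × ℝ => (ofReal ((1 + p.2 ^ 2) ^ 2) * ‖v₁ p‖ₑ) ^ 2)
          (hve.mono fun p hp => ?_), Measure.volume_eq_prod, lintegral_prod_symm _ (by fun_prop)]
        simp only
        rw [← hp, enorm_mul, enorm_of_nonneg (by positivity)]
      rw [e, ← lintegral_const_mul' _ _ (by simp)]
      refine lintegral_mono fun y => ?_
      have h2 : Measurable fun x => ‖v₁ (x, y)‖ₑ ^ 2 := by fun_prop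
      simp_rw [mul_pow]
      rw [lintegral_const_mul _ h2, ← mul_assoc]
      gcongr
      calc wt y ^ 8 = (wt y ^ 4) ^ 2 := by ring
        _ ≤ (4 * ofReal ((1 + y ^ 2) ^ 2)) ^ 2 := pow_le_pow_left' (wt_pow_four_le y) 2
        _ = _ := by rw [mul_pow]; norm_num
    rw [l2n_lt_top_iff]
    refine lt_of_le_of_lt ?_ (mul_lt_top (by simp : (16 : ℝ≥0∞) < ⊤) (key.trans_lt hA))
    have hm2 : Measurable fun p : ℝ × ℝ => wt p.2 ^ 8 *
        (ofReal ((1 + p.1 ^ 2) ^ 2) * ‖pft u₂ p.1 p.2‖ₑ) ^ 2 :=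
      Measurable.mul (by fun_prop) ((Measurable.mul (by fun_prop) hq.enorm).pow_const 2)
    rw [lintegral_lintegral_swap hm2.aemeasurable, ← lintegral_const_mul' _ _ (by simp)]
    refine lintegral_mono fun y => ?_
    rw [mul_pow, hnorm, l2n_sq, ← lintegral_const_mul' _ _ (by finiteness [wt_lt_top y]),
      ← lintegral_const_mul' _ _ (by simp)]
    refine lintegral_mono fun l => ?_
    calc _ = wt y ^ 8 * ((wt l ^ 4) ^ 2 * ‖pft u₂ l y‖ₑ ^ 2) := by ring
      _ ≤ wt y ^ 8 * ((4 * ofReal ((1 + l ^ 2) ^ 2)) ^ 2 * ‖pft u₂ l y‖ₑ ^ 2) := by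
        gcongr; exact wt_pow_four_le l
      _ = _ := by ring
  · intro ψ β h1 h2 h3 h4
    have := ht _ (isTest_mul h1 h2 h3 h4)
    simp only [dx_mul] at this
    rw [integral_congr_ae (hve.mono fun p hp => by rw [← hp]), this]
    refine integral_congr_ae (he.mono fun p hp => ?_)
    simp only [hp, lop]; ring

/-- The roles of `x` and `y` are exchanged, so the regularity in `y` becomes decay of the partial
transform in `y` at fixed `x`. Plancherel in `x` then replaces `x` by `l`, the two partial
transforms commuting by Fubini. -/
theorem hhnorm_bound {u u₂ : ℝ × ℝ → ℝ} (hu : MemE1w u) (he : u =ᵐ[volume] u₂) (hm : Measurable u₂)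
    (hi : Integrable u₂) : l2n volume (hhnorm u₂) < ⊤ := by
  obtain ⟨v, hv2, ht⟩ := hu.smooth_y
  set v₁ := hv2.1.aemeasurable.mk v with hv1
  have hvm : Measurable v₁ := hv2.1.aemeasurable.measurable_mk
  have hve : v =ᵐ[volume] v₁ := hv2.1.aemeasurable.ae_eq_mk
  have hu2 : MemLp u₂ 2 := hu.memLp.ae_eq he
  have hsw := Measure.measurePreserving_swap (μ := (volume : Measure ℝ)) (ν := (volume : Measure ℝ))
  have hi' := hi
  rw [Measure.volume_eq_prod] at hi'
  set us : ℝ × ℝ → ℝ := fun p => u₂ p.swap with hus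
  have hqs := measurable_pft (u := us) (by fun_prop)
  have hvs : MemLp (fun p : ℝ × ℝ => v₁ p.swap) 2 := (hv2.ae_eq hve).comp_measurePreserving hsw
  have key := lintegral_pft_le_of_test (u := us) (v := fun p => v₁ p.swap)
    (hu2.comp_measurePreserving hsw) hvs (by fun_prop) hi'.prod_right_ae ?_ (W := fun y => 1)
    (by fun_prop) (by simp)
  · have hA : ∫⁻ y : ℝ, 1 * ∫⁻ x : ℝ, ‖v₁ (Prod.swap (x, y))‖ₑ ^ 2 < ⊤ := by
      have h1 := l2n_lt_top_iff.1 ((memLp_two_iff hvs.1).1 hvs)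
      rw [Measure.volume_eq_prod, lintegral_prod_symm _ (by fun_prop)] at h1
      simpa using h1
    have hfin := key.trans_lt hA
    simp only [one_mul] at hfin
    have hms : Measurable fun s => ∫⁻ x, (ofReal ((1 + s ^ 2) ^ 2) * ‖pft us s x‖ₑ) ^ 2 :=
      Measurable.lintegral_prod_right' (f := fun p : ℝ × ℝ =>
        (ofReal ((1 + p.1 ^ 2) ^ 2) * ‖pft us p.1 p.2‖ₑ) ^ 2)
        ((Measurable.mul (by fun_prop) hqs.enorm).pow_const 2)
    have hF : Measurable (uncurry fun l s : ℝ => wt s ^ 4 * ‖ft (pft u₂ l) s‖ₑ) :=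
      Measurable.mul (by fun_prop) (measurable_ft_pft hm).enorm
    change l2n volume (fun l => l2n volume fun s => wt s ^ 4 * ‖ft (pft u₂ l) s‖ₑ) < ⊤
    rw [l2n_swap hF, l2n_lt_top_iff]
    refine lt_of_le_of_lt ?_ (mul_lt_top (by simp : (16 : ℝ≥0∞) < ⊤) hfin)
    rw [← lintegral_const_mul' _ _ (by simp)]
    refine lintegral_mono_ae ?_
    filter_upwards [ae_lt_top hms hfin.ne] with s hs
    have e1 : ∀ l, ft (pft u₂ l) s = ft (fun x => pft us s x) l := fun l =>
      ft_ft_swap (F := fun p => (u₂ p : ℂ)) hi.ofReal l s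
    have hx : Measurable fun x => pft us s x := hqs.of_uncurry_left
    have i1 : Integrable fun x => pft us s x := by
      refine integrable_of_lintegral hx (lt_of_le_of_lt (lintegral_mono fun x => enorm_ft_le _ _) ?_)
      have h2 := hi.2
      rw [HasFiniteIntegral, Measure.volume_eq_prod, lintegral_prod _ (by fun_prop)] at h2
      refine lt_of_le_of_lt (le_of_eq ?_) h2
      refine lintegral_congr fun x => lintegral_congr fun y => ?_
      rw [enorm_real]; rfl
    have i2 : MemLp (fun x => pft us s x) 2 := by
      refine memLp_two_of_l2n hx (l2n_lt_top_iff.2 (lt_of_le_of_lt (lintegral_mono fun x => ?_) hs))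
      gcongr
      refine le_mul_of_one_le_left zero_le ?_
      rw [ENNReal.one_le_ofReal]
      exact one_le_pow₀ (by nlinarith [sq_nonneg s])
    rw [l2n_sq]
    simp_rw [e1, mul_pow]
    rw [lintegral_const_mul' _ _ (by finiteness [wt_lt_top s]), lintegral_ft_sq i1 i2,
      ← lintegral_const_mul' _ _ (by finiteness [wt_lt_top s]), ← lintegral_const_mul' _ _ (by simp)]
    refine lintegral_mono fun x => ?_
    calc _ ≤ (4 * ofReal ((1 + s ^ 2) ^ 2)) ^ 2 * ‖pft us s x‖ₑ ^ 2 := by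
          gcongr; exact wt_pow_four_le s
      _ = _ := by ring
  · intro ψ β h1 h2 h3 h4
    have := ht _ (isTest_mul h3 h4 h1 h2)
    simp only [dy_mul] at this
    have e1 := hsw.integral_comp MeasurableEquiv.prodComm.measurableEmbedding
      (fun p : ℝ × ℝ => v₁ p * (β p.1 * ψ p.2))
    have e2 := hsw.integral_comp MeasurableEquiv.prodComm.measurableEmbedding
      (fun p : ℝ × ℝ => u₂ p * (β p.1 * lop ψ p.2))
    simp only [← Measure.volume_eq_prod, Prod.fst_swap, Prod.snd_swap] at e1 e2
    simp only [hus, mul_comm (ψ _), mul_comm (lop ψ _)]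
    rw [e1, e2, integral_congr_ae (hve.symm.mono fun p hp => by rw [hp]), this]
    refine integral_congr_ae (he.mono fun p hp => ?_)
    simp only [hp, lop]; ring

/-- Elements of `E_{1,w}` with `ũ(0;y) = 0` have regular representatives. -/
theorem MemE1w.exists_regPot {u : ℝ × ℝ → ℝ} (hu : MemE1w u) (hN : normInvHalf u < ⊤) :
    ∃ u₂, RegPot u₂ ∧ ∀ᵐ y, ∀ l, pft u l y = pft u₂ l y := by
  set u₁ := hu.memLp.1.aemeasurable.mk u with hu1
  have hm : Measurable u₁ := hu.memLp.1.aemeasurable.measurable_mk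
  have he : u =ᵐ[volume] u₁ := hu.memLp.1.aemeasurable.ae_eq_mk
  have hp1 : ∀ᵐ y, ∀ l, pft u l y = pft u₁ l y := by
    filter_upwards [ae_ae_swap he] with y hy l
    unfold pft
    congr 1
    exact integral_congr_ae (hy.mono fun x hx => by simp only [hx])
  have hg := measurable_gnorm hm
  have hgw : l2n volume (fun y => wt y ^ 5 * gnorm u₁ y) < ⊤ := by
    have e1 : ∀ y, wt y ^ 5 * gnorm u₁ y = l2n volume fun x => wt y ^ 5 * (wt x ^ 4 * ‖u₁ (x, y)‖ₑ) :=
      fun y => by rw [l2n_const_mul _ (by fun_prop)]; rfl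
    have hmF : Measurable (uncurry fun x y : ℝ => wt y ^ 5 * (wt x ^ 4 * ‖u₁ (x, y)‖ₑ)) := by
      unfold uncurry; fun_prop
    simp_rw [e1]
    rw [← l2n_swap hmF, ← l2n_prod hmF, ← Measure.volume_eq_prod]
    refine lt_of_le_of_lt (l2n_mono_ae (g := fun p => 32 * ‖(1 + p.1 ^ 2) ^ 2 *
      (1 + p.2 ^ 2) ^ (5 / 2 : ℝ) * u p‖ₑ) (he.mono fun p hp => ?_)) ?_
    · rw [hp, enorm_mul, enorm_mul, enorm_of_nonneg (by positivity),
        enorm_of_nonneg (by positivity)]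
      calc wt p.2 ^ 5 * (wt p.1 ^ 4 * ‖u₁ (p.1, p.2)‖ₑ) ≤
          8 * ofReal ((1 + p.2 ^ 2) ^ (5 / 2 : ℝ)) *
          (4 * ofReal ((1 + p.1 ^ 2) ^ 2) * ‖u₁ (p.1, p.2)‖ₑ) := by
            gcongr
            · exact wt_pow_five_le _
            · exact wt_pow_four_le _
        _ = _ := by ring
    · rw [l2n_const_mul _ hu.weighted.1.enorm]
      exact mul_lt_top (by simp) ((memLp_two_iff hu.weighted.1).1 hu.weighted)
  have hgfin : ∀ᵐ y, gnorm u₁ y < ⊤ := by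
    filter_upwards [ae_lt_top_of_l2n (by fun_prop) hgw] with y hy
    exact lt_of_le_of_lt (le_mul_of_one_le_left zero_le (one_le_pow_of_one_le' (one_le_wt y) 5)) hy
  -- For almost every `y` the section is integrable, so its transform is continuous; a nonzero value
  -- at `0` would make the integral with `|l|⁻¹` diverge.
  have hzero : ∀ᵐ y, pft u₁ 0 y = 0 := by
    have h1 : ∫⁻ l : ℝ, ∫⁻ y : ℝ, ‖pft u₁ l y‖ₑ ^ 2 / ‖l‖ₑ < ⊤ := by
      unfold normInvHalf at hN
      rw [ENNReal.rpow_lt_top_iff_of_pos (by norm_num)] at hN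
      refine lt_of_le_of_lt (lintegral_mono fun l => lintegral_mono_ae ?_) hN
      filter_upwards [hp1] with y hy
      rw [hy]
    have hmm : Measurable fun p : ℝ × ℝ => ‖pft u₁ p.1 p.2‖ₑ ^ 2 / ‖p.1‖ₑ :=
      ((measurable_pft hm).enorm.pow_const 2).div (by fun_prop)
    rw [lintegral_lintegral_swap hmm.aemeasurable] at h1
    filter_upwards [hgfin, ae_lt_top (Measurable.lintegral_prod_left' hmm) h1.ne] with y hy hfin
    by_contra h
    have hi : Integrable fun x => (u₁ (x, y) : ℂ) := by
      refine integrable_of_lintegral (by fun_prop) (lintegral_lt_top_of_l2n_wt (by fun_prop) ?_)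
      refine (l2n_mono fun x => ?_).trans_lt hy
      rw [enorm_real]
      gcongr
      exact wt_le_wt_pow x (by norm_num)
    exact hfin.ne (lintegral_sq_div_eq_top (continuous_ft hi) h)
  -- Setting the potential to zero on the lines outside this set of full measure makes the bounds
  -- and the vanishing at `l = 0` hold for every `y`.
  set G : Set ℝ := {y | gnorm u₁ y < ⊤ ∧ pft u₁ 0 y = 0} with hG
  have hp0 : Measurable (pft u₁ 0) := (measurable_pft hm).of_uncurry_left
  have hGm : MeasurableSet G := (measurableSet_lt hg measurable_const).inter
    (hp0 (measurableSet_singleton 0))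
  have hGae : ∀ᵐ y, y ∈ G := by filter_upwards [hgfin, hzero] with y h1 h2 using ⟨h1, h2⟩
  set u₂ : ℝ × ℝ → ℝ := (Prod.snd ⁻¹' G).indicator u₁ with hu2
  have hm2 : Measurable u₂ := hm.indicator (measurable_snd hGm)
  have s1 : ∀ y ∈ G, ∀ x, u₂ (x, y) = u₁ (x, y) := fun y hy x =>
    indicator_of_mem (show (x, y) ∈ Prod.snd ⁻¹' G from hy) u₁
  have s0 : ∀ y ∉ G, ∀ x, u₂ (x, y) = 0 := fun y hy x =>
    Set.indicator_of_notMem (show (x, y) ∉ Prod.snd ⁻¹' G from hy) u₁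
  have g1 : ∀ y ∈ G, gnorm u₂ y = gnorm u₁ y := fun y hy => by simp only [gnorm, s1 y hy]
  have g0 : ∀ y ∉ G, gnorm u₂ y = 0 := fun y hy => by simp [gnorm, s0 y hy]
  have p1 : ∀ y ∈ G, ∀ l, pft u₂ l y = pft u₁ l y := fun y hy l => by simp only [pft, s1 y hy]
  have p0 : ∀ y ∉ G, ∀ l, pft u₂ l y = 0 := fun y hy l => by simp [pft, s0 y hy]
  have he2 : u =ᵐ[volume] u₂ := by
    have h1 : ∀ᵐ p : ℝ × ℝ, p.2 ∈ G := by
      rw [Measure.volume_eq_prod]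
      exact Measure.quasiMeasurePreserving_snd.ae hGae
    filter_upwards [he, h1] with p hp h2
    rw [hp, ← s1 p.2 h2 p.1]
  have hg2 := measurable_gnorm hm2
  have hgw2 : l2n volume (fun y => wt y ^ 5 * gnorm u₂ y) < ⊤ := by
    refine lt_of_le_of_lt (l2n_mono_ae (hGae.mono fun y hy => ?_)) hgw
    rw [g1 y hy]
  have hi2 : Integrable u₂ := by
    refine ⟨hm2.aestronglyMeasurable, ?_⟩
    rw [HasFiniteIntegral, Measure.volume_eq_prod, lintegral_prod_symm _ (by fun_prop)]
    have h1 : ∀ y, ∫⁻ x, ‖u₂ (x, y)‖ₑ ≤ cI * gnorm u₂ y := fun y => by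
      refine (lintegral_le_l2n_wt (by fun_prop)).trans ?_
      refine mul_le_mul' le_rfl (l2n_mono fun x => mul_le_mul' (wt_le_wt_pow x (by norm_num)) le_rfl)
    refine (lintegral_mono h1).trans_lt ?_
    rw [lintegral_const_mul _ hg2]
    refine mul_lt_top cI_lt_top (lintegral_lt_top_of_l2n_wt (by fun_prop) ?_)
    refine (l2n_mono fun y => ?_).trans_lt hgw2
    gcongr
    exact wt_le_wt_pow y (by norm_num)
  refine ⟨u₂, ⟨hm2, fun y => ?_, hgw2, fun y => ?_, hnorm_bound hu he2 hm2 hi2,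
    hhnorm_bound hu he2 hm2 hi2⟩, ?_⟩
  · by_cases hy : y ∈ G
    · rw [g1 y hy]; exact hy.1
    · rw [g0 y hy]; simp
  · by_cases hy : y ∈ G
    · rw [p1 y hy]; exact hy.2
    · exact p0 y hy 0
  · filter_upwards [hp1, hGae] with y h1 h2 l
    rw [h1, p1 y h2]

/-! ### Existence of scattering solutions: the Neumann series -/

/-- The terms of the Neumann series. -/
def nterm (σ : ℝ) (q : ℝ → ℝ → ℂ) : ℕ → ℝ → ℝ → ℝ → ℂ
  | 0 => fun k l y => I * intFrom σ l y fun η => ph k l η * q l η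
  | j + 1 => fun k l y => I / (√(2 * π) : ℂ) *
      intFrom σ l y fun η => ph k l η * nonlin q (nterm σ q j) k l η

/-- Majorants of the terms of the Neumann series. -/
def nmaj (q : ℝ → ℝ → ℂ) : ℕ → ℝ → ℝ≥0∞
  | 0 => fun l => ∫⁻ η, ‖q l η‖ₑ
  | j + 1 => fun l => ∫⁻ s, (i2π * ∫⁻ η, ‖q s η‖ₑ) * nmaj q j (l - s)

/-- Minkowski's integral inequality with counting measure. -/
theorem l2n_tsum_le {α : Type*} [MeasurableSpace α] {μ : Measure α} [SFinite μ] {F : ℕ → α → ℝ≥0∞}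
    (hF : ∀ j, Measurable (F j)) : l2n μ (fun a => ∑' j, F j a) ≤ ∑' j, l2n μ (F j) := by
  have h : Measurable (uncurry fun (a : α) (j : ℕ) => F j a) := measurable_from_prod_countable_left hF
  simpa [lintegral_count] using l2n_lintegral_le (μ := μ) (ν := Measure.count) h

section Neumann

variable {σ : ℝ} {q q' r : ℝ → ℝ → ℂ} {U : ℝ → ℝ}

theorem measurable_nterm (hq : Measurable (uncurry q)) (j : ℕ) :
    Measurable fun p : ℝ × ℝ × ℝ => nterm σ q j p.1 p.2.1 p.2.2 := by
  induction j with
  | zero =>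
    have h1 : Measurable fun p : (ℝ × ℝ × ℝ) × ℝ => q p.1.2.1 p.2 :=
      hq.comp (f := fun p : (ℝ × ℝ × ℝ) × ℝ => (p.1.2.1, p.2)) (by fun_prop)
    exact (measurable_intFrom (G := fun (p : ℝ × ℝ × ℝ) η => ph p.1 p.2.1 η * q p.2.1 η) σ (by fun_prop)
      (by fun_prop) (Measurable.mul (f := fun p : (ℝ × ℝ × ℝ) × ℝ => ph p.1.1 p.1.2.1 p.2)
        (by fun_prop) h1)).const_mul _
  | succ j ih =>
    have h1 : Measurable fun p : (ℝ × ℝ × ℝ) × ℝ => nonlin q (nterm σ q j) p.1.1 p.1.2.1 p.2 :=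
      (measurable_nonlin hq ih).comp (f := fun p : (ℝ × ℝ × ℝ) × ℝ => (p.1.1, p.1.2.1, p.2)) (by fun_prop)
    exact (measurable_intFrom (G := fun (p : ℝ × ℝ × ℝ) η => ph p.1 p.2.1 η *
      nonlin q (nterm σ q j) p.1 p.2.1 η) σ (by fun_prop) (by fun_prop)
      (Measurable.mul (f := fun p : (ℝ × ℝ × ℝ) × ℝ => ph p.1.1 p.1.2.1 p.2)
        (by fun_prop) h1)).const_mul _

theorem measurable_nmaj (hq : Measurable (uncurry q)) (j : ℕ) : Measurable (nmaj q j) := by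
  have h0 : Measurable fun s => ∫⁻ η, ‖q s η‖ₑ :=
    Measurable.lintegral_prod_right' (f := fun p : ℝ × ℝ => ‖q p.1 p.2‖ₑ) hq.enorm
  induction j with
  | zero => exact h0
  | succ j ih => exact Measurable.lintegral_prod_right' (f := fun p : ℝ × ℝ =>
      (i2π * ∫⁻ η, ‖q p.2 η‖ₑ) * nmaj q j (p.1 - p.2)) (by fun_prop)

theorem nmaj_succ (hq : Measurable (uncurry q)) (j : ℕ) (l : ℝ) :
    nmaj q (j + 1) l = i2π * ∫⁻ η, ∫⁻ l', ‖q (l - l') η‖ₑ * nmaj q j l' := by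
  have hm := measurable_nmaj hq j
  have h1 : Measurable fun p : ℝ × ℝ => ‖q (l - p.2) p.1‖ₑ :=
    (hq.comp (f := fun p : ℝ × ℝ => (l - p.2, p.1)) (by fun_prop)).enorm
  rw [show nmaj q (j + 1) l = ∫⁻ s, (i2π * ∫⁻ η, ‖q s η‖ₑ) * nmaj q j (l - s) from rfl,
    lintegral_lintegral_swap (Measurable.mul h1 (hm.comp measurable_snd)).aemeasurable,
    ← lintegral_const_mul' _ _ i2π_ne_top,
    ← lintegral_sub_left_eq_self (fun s => (i2π * ∫⁻ η, ‖q s η‖ₑ) * nmaj q j (l - s)) l]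
  refine lintegral_congr fun l' => ?_
  rw [lintegral_mul_const _ (by fun_prop), sub_sub_cancel, mul_assoc]

theorem enorm_intFrom_ph_le (σ k l y : ℝ) (g : ℝ → ℂ) :
    ‖intFrom σ l y fun η => ph k l η * g η‖ₑ ≤ ∫⁻ η, ‖g η‖ₑ :=
  (enorm_intFrom_le _ _ _ _).trans (le_of_eq (lintegral_congr fun η => by rw [enorm_mul, enorm_ph, one_mul]))

theorem enorm_nterm_le (hq : Measurable (uncurry q)) (j : ℕ) (k l y : ℝ) :
    ‖nterm σ q j k l y‖ₑ ≤ nmaj q j l := by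
  induction j generalizing k l y with
  | zero =>
    rw [nterm, enorm_mul, enorm_I, one_mul]
    exact enorm_intFrom_ph_le _ _ _ _ _
  | succ j ih =>
    rw [nterm, enorm_mul, enorm_I_div, nmaj_succ hq]
    gcongr
    refine (enorm_intFrom_ph_le _ _ _ _ _).trans (lintegral_mono fun η => ?_)
    exact (enorm_nonlin_le _ _ _ _ _).trans (lintegral_mono fun l' => mul_le_mul' le_rfl (ih _ _ _))

theorem l2n_nmaj_le (hq : Measurable (uncurry q)) (j : ℕ) :
    l2n volume (nmaj q j) ≤ (i2π * ∫⁻ s, ∫⁻ η, ‖q s η‖ₑ) ^ j * l2n volume (nmaj q 0) := by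
  induction j with
  | zero => simp
  | succ j ih =>
    have h0 := measurable_nmaj hq 0
    have hm := measurable_nmaj hq j
    have h1 : Measurable fun s => i2π * ∫⁻ η, ‖q s η‖ₑ := h0.const_mul _
    calc l2n volume (nmaj q (j + 1))
        ≤ ∫⁻ s, l2n volume fun l => (i2π * ∫⁻ η, ‖q s η‖ₑ) * nmaj q j (l - s) :=
          l2n_lintegral_le (F := fun l s => (i2π * ∫⁻ η, ‖q s η‖ₑ) * nmaj q j (l - s))
            (by unfold uncurry; fun_prop)
      _ = ∫⁻ s, (i2π * ∫⁻ η, ‖q s η‖ₑ) * l2n volume (nmaj q j) := by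
          refine lintegral_congr fun s => ?_
          rw [l2n_const_mul _ (by fun_prop)]
          congr 1
          unfold l2n
          rw [lintegral_sub_right_eq_self (fun l => nmaj q j l ^ 2) s]
      _ = (i2π * ∫⁻ s, ∫⁻ η, ‖q s η‖ₑ) * l2n volume (nmaj q j) := by
          rw [lintegral_mul_const _ h1, lintegral_const_mul' _ _ i2π_ne_top]
      _ ≤ _ := (mul_le_mul' le_rfl ih).trans_eq (by ring)

theorem normX_nterm_le (hq : Measurable (uncurry q)) (hqi : ∀ l, Integrable (q l)) (j : ℕ) (y : ℝ) :
    normX (fun _ => 1) (fun k l y => ‖nterm σ q j k l y‖ₑ) y ≤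
      (i2π * ∫⁻ η, ∫⁻ s, ‖q s η‖ₑ) ^ j * srcX (fun _ => 1) q := by
  induction j generalizing y with
  | zero =>
    rw [pow_zero, one_mul]
    refine le_trans (l2n_mono fun p => ?_) (l2n_lin_le (w := fun _ => 1) hq hqi measurable_const σ y)
    simp only [nterm]
    rw [enorm_mul, enorm_I, one_mul]
  | succ j ih =>
    have hn := measurable_nterm (σ := σ) hq j
    have hmc := measurable_majConv (a := fun k l y => ‖nterm σ q j k l y‖ₑ) hq hn.enorm
    have h1 := l2n_majConv_le (a := fun k l y => ‖nterm σ q j k l y‖ₑ) (w := fun _ => 1) hq hn.enorm measurable_const (by simp)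
    have hm1 := measurable_mass (w := fun _ => 1) hq measurable_const
    simp only [one_mul] at h1 hm1
    calc _ ≤ l2n volume fun p : ℝ × ℝ => i2π * majConv q (fun k l y => ‖nterm σ q j k l y‖ₑ) p.1 p.2 := by
          refine l2n_mono fun p => ?_
          simp only [nterm]
          rw [one_mul, enorm_mul, enorm_I_div]
          gcongr
          exact (enorm_intFrom_ph_le _ _ _ _ _).trans (lintegral_mono fun η => enorm_nonlin_le _ _ _ _ _)
      _ ≤ i2π * ∫⁻ η, (∫⁻ s, ‖q s η‖ₑ) *
          ((i2π * ∫⁻ η, ∫⁻ s, ‖q s η‖ₑ) ^ j * srcX (fun _ => 1) q) := by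
          rw [l2n_const_mul _ hmc.aemeasurable]
          gcongr
          refine h1.trans (lintegral_mono fun η => ?_)
          gcongr
          exact ih η
      _ = _ := by rw [lintegral_mul_const _ hm1]; ring

/-- Scattering solutions exist. -/
theorem KPot.exists_interactionSol (K : KPot q q' r U) (hc : i2π * ∫⁻ η, ∫⁻ s, ‖q s η‖ₑ < 1) (σ : ℝ) :
    ∃ n, InteractionSol σ q n ∧ ∃ C : ℝ≥0, ∀ k y, l2n volume (fun l => ‖n k l y‖ₑ) ≤ C := by
  have hq := K.mq
  have hmj := measurable_nmaj hq
  have hnt := measurable_nterm (σ := σ) hq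
  set c := i2π * ∫⁻ η, ∫⁻ s, ‖q s η‖ₑ with hcdef
  have hcs : i2π * ∫⁻ s, ∫⁻ η, ‖q s η‖ₑ = c := by
    rw [hcdef, lintegral_lintegral_swap (f := fun s η => ‖q s η‖ₑ) hq.enorm.aemeasurable]
  have hg : ∑' j, c ^ j < ⊤ := by
    rw [ENNReal.tsum_geometric]
    exact ENNReal.inv_lt_top.2 (tsub_pos_of_lt hc)
  have hU0 : ∀ l, nmaj q 0 l ≤ ∫⁻ y, ofReal ((1 + |y|) * U y) := fun l => by
    refine lintegral_mono fun y => ?_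
    rw [← ofReal_norm]
    refine ofReal_le_ofReal ((K.bq l y).trans ?_)
    exact le_mul_of_one_le_left ((norm_nonneg _).trans (K.bq l y)) (by linarith [abs_nonneg y])
  have hUt : ∫⁻ y, ofReal ((1 + |y|) * U y) < ⊤ := K.iU.lintegral_lt_top
  have h2 : l2n volume (nmaj q 0) < ⊤ := by
    rw [l2n_lt_top_iff]
    refine lt_of_le_of_lt (lintegral_mono fun l => ?_ : _ ≤ ∫⁻ l,
      (∫⁻ y, ofReal ((1 + |y|) * U y)) * nmaj q 0 l) ?_
    · rw [sq]; gcongr; exact hU0 l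
    · rw [lintegral_const_mul _ (hmj 0)]
      refine mul_lt_top hUt ?_
      have h3 : i2π * ∫⁻ l, nmaj q 0 l < ⊤ := hcs.trans_lt (hc.trans ENNReal.one_lt_top)
      exact (ENNReal.lt_top_of_mul_ne_top_right h3.ne (by rw [i2π]; simpa using sqrt_two_pi_pos))
  have hA : l2n volume (fun l => ∑' j, nmaj q j l) < ⊤ := by
    refine (l2n_tsum_le hmj).trans_lt ((ENNReal.tsum_le_tsum fun j => l2n_nmaj_le hq j).trans_lt ?_)
    rw [hcs, ENNReal.tsum_mul_right]
    exact mul_lt_top hg h2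
  -- From the second term on, the majorant is a convolution of two `L²` functions, hence finite at
  -- every `l`, not only almost everywhere. This allows the series to solve the equation for all `l`
  -- and `y`.
  have hfin1 : ∀ l, ∑' j, nmaj q (j + 1) l < ⊤ := fun l => by
    have m1 : Measurable fun s => i2π * ∫⁻ η, ‖q s η‖ₑ := (hmj 0).const_mul _
    have e : ∑' j, nmaj q (j + 1) l = ∫⁻ s, (i2π * ∫⁻ η, ‖q s η‖ₑ) * ∑' j, nmaj q j (l - s) := by
      simp_rw [← ENNReal.tsum_mul_left]
      rw [lintegral_tsum fun j => Measurable.aemeasurable (by have := hmj j; fun_prop)]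
      rfl
    rw [e]
    have m2 : Measurable fun l => ∑' j, nmaj q j l := Measurable.tsum hmj
    refine (lintegral_mul_le_l2n (by fun_prop) (by fun_prop)).trans_lt (mul_lt_top ?_ ?_)
    · exact (l2n_const_mul (f := nmaj q 0) _ (hmj 0).aemeasurable).trans_lt
        (mul_lt_top i2π_lt_top h2)
    · refine lt_of_le_of_lt (le_of_eq ?_) hA
      unfold l2n
      rw [lintegral_sub_left_eq_self (fun s => (∑' j, nmaj q j s) ^ 2) l]
  have hfin : ∀ l, ∑' j, nmaj q j l < ⊤ := fun l => by
    rw [_root_.tsum_eq_zero_add' ENNReal.summable]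
    exact add_lt_top.2 ⟨(hU0 l).trans_lt hUt, hfin1 l⟩
  have hle : ∀ k l y, ∑' j, ‖nterm σ q j k l y‖ₑ ≤ ∑' j, nmaj q j l := fun k l y =>
    ENNReal.tsum_le_tsum fun j => enorm_nterm_le hq j k l y
  have hsum : ∀ k l y, Summable fun j => nterm σ q j k l y := fun k l y =>
    Summable.of_enorm ((hle k l y).trans_lt (hfin l)).ne
  set n : ℝ → ℝ → ℝ → ℂ := fun k l y => ∑' j, nterm σ q j k l y with hn
  have hnle : ∀ k l y, ‖n k l y‖ₑ ≤ ∑' j, ‖nterm σ q j k l y‖ₑ := fun k l y => by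
    exact enorm_tsum_le_tsum_enorm
  have hnm : Measurable fun p : ℝ × ℝ × ℝ => n p.1 p.2.1 p.2.2 :=
    Measurable.tsum fun j => hnt j
  have hC : ∃ C : ℝ≥0, ∀ k y, l2n volume (fun l => ‖n k l y‖ₑ) ≤ C :=
    ⟨(l2n volume fun l => ∑' j, nmaj q j l).toNNReal, fun k y => (l2n_mono fun l => (hnle k l y).trans (hle k l y)).trans_eq
      (ENNReal.coe_toNNReal hA.ne).symm⟩
  refine ⟨n, ⟨hnm, ?_, ae_of_all _ fun k l y => ?_⟩, hC⟩
  · have hX : ∑' j, c ^ j * srcX (fun _ => 1) q < ⊤ := by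
      rw [ENNReal.tsum_mul_right]
      exact mul_lt_top hg ((srcX_mono (fun l => one_le_pow_of_one_le' (one_le_wt l) 3) q).trans_lt K.x3)
    refine ⟨(∑' j, c ^ j * srcX (fun _ => 1) q).toNNReal, ae_of_all _ fun y => le_trans ?_ (ENNReal.coe_toNNReal hX.ne).ge⟩
    refine (l2n_mono (g := fun p : ℝ × ℝ => ∑' j, ‖nterm σ q j p.1 p.2 y‖ₑ) fun p => hnle p.1 p.2 y).trans
      ((l2n_tsum_le (F := fun j (p : ℝ × ℝ) => ‖nterm σ q j p.1 p.2 y‖ₑ) fun j => ?_).trans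
      (ENNReal.tsum_le_tsum fun j => ?_))
    · exact ((hnt j).comp (f := fun p : ℝ × ℝ => (p.1, p.2, y)) (by fun_prop)).enorm
    · simpa [normX] using normX_nterm_le (σ := σ) hq K.integrable_q j y
  · have mS : ∀ j, Measurable fun p : ℝ × ℝ => ‖q (l - p.2) p.1‖ₑ * ‖nterm σ q j k p.2 p.1‖ₑ := fun j =>
      (hq.comp (f := fun p : ℝ × ℝ => (l - p.2, p.1)) (by fun_prop)).enorm.mul
        ((hnt j).comp (f := fun p : ℝ × ℝ => (k, p.2, p.1)) (by fun_prop)).enorm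
    -- Absolute convergence of the whole series under both integrals; it justifies interchanging the
    -- sum with the convolution and with the integral over the ray.
    have hT : ∑' j, ∫⁻ η, ∫⁻ l', ‖q (l - l') η‖ₑ * ‖nterm σ q j k l' η‖ₑ < ⊤ := by
      refine ENNReal.lt_top_of_mul_ne_top_right (a := i2π) (ne_of_lt ?_)
        (by rw [i2π]; simpa using sqrt_two_pi_pos)
      rw [← ENNReal.tsum_mul_left]
      refine lt_of_le_of_lt (ENNReal.tsum_le_tsum fun j => ?_) (hfin1 l)
      rw [nmaj_succ hq]
      gcongr
      exact enorm_nterm_le hq j _ _ _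
    have hTη : ∀ᵐ η : ℝ, ∑' j, ∫⁻ l', ‖q (l - l') η‖ₑ * ‖nterm σ q j k l' η‖ₑ < ⊤ := by
      have m1 := fun j => Measurable.lintegral_prod_right' (ν := volume) (mS j)
      refine ae_lt_top (Measurable.tsum m1) ?_
      rw [lintegral_tsum fun j => (m1 j).aemeasurable]
      exact hT.ne
    have hnl : ∀ᵐ η : ℝ, nonlin q n k l η = ∑' j, nonlin q (nterm σ q j) k l η := by
      filter_upwards [hTη] with η hη
      unfold nonlin
      rw [← integral_tsum]
      · simp_rw [tsum_mul_left]; rfl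
      · intro j
        have h1 : Measurable fun l' => q (l - l') η :=
          hq.comp (f := fun l' : ℝ => (l - l', η)) (by fun_prop)
        have h3 : Measurable fun l' => nterm σ q j k l' η :=
          (hnt j).comp (f := fun l' : ℝ => (k, l', η)) (by fun_prop)
        exact Measurable.aestronglyMeasurable (by fun_prop)
      · simp_rw [enorm_mul, enorm_ph, one_mul]
        exact hη.ne
    have hN : ∀ j, Measurable (nonlin q (nterm σ q j) k l) := fun j =>
      (measurable_nonlin hq (hnt j)).comp (f := fun η : ℝ => (k, l, η)) (by fun_prop)
    have hNn : Measurable (nonlin q n k l) :=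
      (measurable_nonlin hq hnm).comp (f := fun η : ℝ => (k, l, η)) (by fun_prop)
    have hNT : ∑' j, ∫⁻ η, ‖ph k l η * nonlin q (nterm σ q j) k l η‖ₑ < ⊤ := by
      refine lt_of_le_of_lt (ENNReal.tsum_le_tsum fun j => lintegral_mono fun η => ?_) hT
      rw [enorm_mul, enorm_ph, one_mul]
      exact enorm_nonlin_le _ _ _ _ _
    have e2 : intFrom σ l y (fun η => ph k l η * nonlin q n k l η) =
        ∑' j, intFrom σ l y fun η => ph k l η * nonlin q (nterm σ q j) k l η := by
      rw [intFrom_congr_ae σ l y (g := fun η => ∑' j, ph k l η * nonlin q (nterm σ q j) k l η)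
        (hnl.mono fun η hη => by simp only [hη, tsum_mul_left])]
      simp only [intFrom_eq]
      rw [tsum_mul_left]
      congr 1
      refine integral_tsum (fun j => Measurable.aestronglyMeasurable (by have := hN j; fun_prop)) (ne_of_lt ?_)
      exact lt_of_le_of_lt (ENNReal.tsum_le_tsum fun j => setLIntegral_le_lintegral _ _) hNT
    have hi : Integrable fun η => ph k l η * nonlin q n k l η := by
      refine integrable_ph_mul k l (integrable_of_lintegral hNn ?_)
      refine lt_of_le_of_lt (lintegral_mono_ae (g := fun η => ∑' j,
        ‖ph k l η * nonlin q (nterm σ q j) k l η‖ₑ) (hnl.mono fun η hη => ?_)) ?_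
      · rw [hη]
        refine (enorm_tsum_le_tsum_enorm).trans (ENNReal.tsum_le_tsum fun j => ?_)
        rw [enorm_mul, enorm_ph, one_mul]
      · rw [lintegral_tsum fun j => Measurable.aemeasurable (by have := hN j; fun_prop)]
        exact hNT
    have hI : integrand q n k l = fun η => (√(2 * π) : ℂ) * (ph k l η * q l η) +
      ph k l η * nonlin q n k l η := rfl
    rw [hI, intFrom_add _ _ _ ((integrable_ph_mul k l (K.integrable_q l)).const_mul _) hi,
      intFrom_const_mul, e2, mul_add, ← mul_assoc, div_mul_cancel₀ _ sqrt_two_pi_ne_zero, ← tsum_mul_left]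
    exact (hsum k l y).tsum_eq_zero_add

end Neumann

/-! ### Scattering solutions in the interaction picture -/

theorem exp_eq_ph (k l y η : ℝ) :
    Complex.exp (-(I * l * (l + 2 * k) * (y - η))) = ph k l (-y) * ph k l η := by
  unfold ph
  rw [← Complex.exp_add]
  congr 1
  push_cast; ring

section Bridge

variable {σ : ℝ} {u : ℝ × ℝ → ℝ} {q : ℝ → ℝ → ℂ} {n m : ℝ → ℝ → ℝ → ℂ}

theorem ph_mul_conv {k η : ℝ} (hp : ∀ l, pft u l η = q l η)
    (hm : ∀ᵐ l', m k l' η = ph k l' (-η) * n k l' η) (l : ℝ) :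
    ph k l η * conv u m k l η = integrand q n k l η := by
  rw [conv, integrand, nonlin, mul_add, hp, integral_congr_ae (hm.mono fun l' h => by rw [h, hp])]
  ring

theorem intFrom_conv {k : ℝ} (hp : ∀ᵐ η, ∀ l, pft u l η = q l η)
    (hm : ∀ᵐ η, ∀ᵐ l', m k l' η = ph k l' (-η) * n k l' η) (l y : ℝ) :
    intFrom σ l y (fun η => Complex.exp (-(I * l * (l + 2 * k) * (y - η))) * conv u m k l η) =
      ph k l (-y) * intFrom σ l y (integrand q n k l) := by
  rw [← intFrom_const_mul]
  refine intFrom_congr_ae _ _ _ ?_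
  filter_upwards [hp, hm] with η h1 h2
  rw [exp_eq_ph, mul_assoc, ph_mul_conv h1 h2]

theorem InteractionSol.isScatteringSolution (h : InteractionSol σ q n)
    (hC : ∃ C : ℝ≥0, ∀ k y, l2n volume (fun l => ‖n k l y‖ₑ) ≤ C)
    (hp : ∀ᵐ y, ∀ l, pft u l y = q l y) :
    IsScatteringSolution σ u fun k l y => ph k l (-y) * n k l y where
  measurable := (Measurable.mul (f := fun p : ℝ × ℝ × ℝ => ph p.1 p.2.1 (-p.2.2)) (by fun_prop)
    h.meas).aestronglyMeasurable
  mem_X := by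
    obtain ⟨C, hC⟩ := h.bdd
    refine ⟨C, hC.mono fun y hy => ?_⟩
    simp_rw [eLpNorm_two_eq, enorm_mul, enorm_ph, one_mul]
    exact hy
  mem_Y := by
    obtain ⟨C, hC⟩ := hC
    refine ⟨C, ae_of_all _ fun p => ?_⟩
    simp_rw [eLpNorm_two_eq, enorm_mul, enorm_ph, one_mul]
    exact hC _ _
  eqn := by
    rw [Measure.volume_eq_prod]
    refine Measure.quasiMeasurePreserving_fst.ae (p := fun k => ∀ p : ℝ × ℝ,
      ph k p.1 (-p.2) * n k p.1 p.2 = I / (√(2 * π) : ℂ) * intFrom σ p.1 p.2 (fun η =>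
      Complex.exp (-(I * p.1 * (p.1 + 2 * k) * (p.2 - η))) *
        conv u (fun k l y => ph k l (-y) * n k l y) k p.1 η)) (h.eqn.mono fun k hk p => ?_) |>.mono
        fun p hp => hp p.2
    rw [intFrom_conv (n := n) hp (by simp), hk]
    ring

/-- A given solution is determined only up to null sets. Defining `n` by the right-hand side of the
integral equation makes the equation hold for all `l` and `y` for almost every `k`, since the
integrals do not see changes on null sets; for the same reason the scattering data are unaffected.
-/
theorem IsScatteringSolution.exists_interactionSol (h : IsScatteringSolution σ u m)
    (hq : Measurable (uncurry q)) (hp : ∀ᵐ y, ∀ l, pft u l y = q l y) :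
    ∃ n, InteractionSol σ q n ∧ ∀ᵐ k, ∀ l, scatData σ u m k l =
      if 0 < σ * (l - k) then -(I / (2 * π)) * tau q n k (l - k) else 0 := by
  set M := h.measurable.aemeasurable.mk _ with hM
  have hMm : Measurable M := h.measurable.aemeasurable.measurable_mk
  have hMe : ∀ᵐ p : ℝ × ℝ × ℝ, m p.1 p.2.1 p.2.2 = M p := h.measurable.aemeasurable.ae_eq_mk
  set n₀ : ℝ → ℝ → ℝ → ℂ := fun k l y => ph k l y * M (k, l, y) with hn0
  have hn0m : Measurable fun p : ℝ × ℝ × ℝ => n₀ p.1 p.2.1 p.2.2 :=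
    Measurable.mul (f := fun p : ℝ × ℝ × ℝ => ph p.1 p.2.1 p.2.2) (by fun_prop) hMm
  set n : ℝ → ℝ → ℝ → ℂ := fun k l y => I / (√(2 * π) : ℂ) * intFrom σ l y (integrand q n₀ k l)
    with hn
  have hnm : Measurable fun p : ℝ × ℝ × ℝ => n p.1 p.2.1 p.2.2 := by
    refine (measurable_intFrom (G := fun (p : ℝ × ℝ × ℝ) => integrand q n₀ p.1 p.2.1) σ (by fun_prop)
      (by fun_prop) ?_).const_mul _
    exact (measurable_integrand hq hn0m).comp (f := fun p : (ℝ × ℝ × ℝ) × ℝ => (p.1.1, p.1.2.1, p.2))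
      (by fun_prop)
  have hm0 : ∀ k l y, ph k l y * m k l y = n₀ k l y → m k l y = ph k l (-y) * n₀ k l y :=
    fun k l y h => by
      rw [← h, ← mul_assoc, mul_comm (ph k l (-y)), ph_mul_ph_neg, one_mul]
  have sec : ∀ {P : ℝ × ℝ × ℝ → Prop}, (∀ᵐ p, P p) → ∀ᵐ k : ℝ, ∀ᵐ y : ℝ, ∀ᵐ l : ℝ, P (k, l, y) :=
    fun h => (Measure.ae_ae_of_ae_prod h).mono fun k hk => ae_ae_swap hk
  have hs0 : ∀ᵐ k : ℝ, ∀ᵐ y : ℝ, ∀ᵐ l : ℝ, m k l y = ph k l (-y) * n₀ k l y :=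
    (sec hMe).mono fun k hk => hk.mono fun y hy => hy.mono fun l hl => hm0 k l y (by rw [hl])
  have hmn : ∀ᵐ p : ℝ × ℝ × ℝ, m p.1 p.2.1 p.2.2 = ph p.1 p.2.1 (-p.2.2) * n p.1 p.2.1 p.2.2 := by
    have h1 := (Measure.quasiMeasurePreserving_fst (μ := (volume : Measure ℝ))
      (ν := (volume : Measure (ℝ × ℝ)))).ae hs0
    rw [← Measure.volume_eq_prod] at h1
    filter_upwards [h.eqn, h1] with p he h2
    rw [he, intFrom_conv hp h2]
    ring
  have hsn := sec hmn
  refine ⟨n, ⟨hnm, ?_, ?_⟩, ?_⟩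
  · obtain ⟨C, hC⟩ := h.mem_X
    have h3 : ∀ᵐ y : ℝ, ∀ᵐ p : ℝ × ℝ, m p.1 p.2 y = ph p.1 p.2 (-y) * n p.1 p.2 y := by
      have h4 : ∀ᵐ z : (ℝ × ℝ) × ℝ, m z.1.1 z.1.2 z.2 = ph z.1.1 z.1.2 (-z.2) * n z.1.1 z.1.2 z.2 :=
        (measurePreserving_prodAssoc (volume : Measure ℝ) (volume : Measure ℝ)
          (volume : Measure ℝ)).quasiMeasurePreserving.ae hmn
      have := Measure.measurePreserving_swap (μ := (volume : Measure ℝ)) (ν := (volume : Measure (ℝ × ℝ)))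
      exact Measure.ae_ae_of_ae_prod (this.quasiMeasurePreserving.ae h4)
    refine ⟨C, ?_⟩
    filter_upwards [hC, h3] with y h1 h2
    rw [eLpNorm_two_eq] at h1
    refine le_trans (l2n_mono_ae (h2.mono fun p h5 => ?_)) h1
    have h6 : ‖m p.1 p.2 y‖ₑ = ‖n p.1 p.2 y‖ₑ := by
      rw [h5, enorm_mul (ph _ _ _), enorm_ph, one_mul]
    exact h6.ge
  · filter_upwards [hs0, hsn] with k h1 h2 l y
    simp only [hn]
    congr 1
    refine intFrom_congr_ae _ _ _ ?_
    filter_upwards [hp, h1, h2] with η h3 h4 h5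
    rw [← ph_mul_conv h3 h4, ← ph_mul_conv h3 h5]
  · filter_upwards [hsn] with k h2 l
    unfold scatData tau
    congr 2
    refine integral_congr_ae ?_
    filter_upwards [hp, h2] with η h3 h4
    rw [← ph_mul_conv h3 h4]
    congr 1
    unfold ph
    congr 1
    push_cast; ring

end Bridge

/-! ### Integral operators with square integrable kernels -/

/-- Cauchy-Schwarz in `l` for almost every `k`. Besides kernels acting on a fixed `L²` function, it
covers functions `W` of both variables that are bounded in `L²(dl)` uniformly in `k`. -/
theorem pairing {G : ℝ × ℝ → ℂ} {W : ℝ → ℝ → ℂ} {C : ℝ≥0} (hG : MemLp G 2)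
    (hW : AEStronglyMeasurable (uncurry W) volume)
    (hC : ∀ k, l2n volume (fun l => ‖W k l‖ₑ) ≤ C) :
    (∀ᵐ k, Integrable fun l => G (k, l) * W k l) ∧ MemLp (fun k => ∫ l, G (k, l) * W k l) 2 ∧
      eLpNorm (fun k => ∫ l, G (k, l) * W k l) 2 volume ≤ C * eLpNorm G 2 volume := by
  have hGm := hG.1
  rw [Measure.volume_eq_prod] at hGm hW
  have hm := hGm.mul hW
  have h1 : ∀ᵐ k, ∫⁻ l, ‖G (k, l) * W k l‖ₑ ≤ C * l2n volume fun l => ‖G (k, l)‖ₑ := by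
    filter_upwards [hGm.prodMk_left, hW.prodMk_left] with k hg hw
    simp_rw [enorm_mul]
    refine (lintegral_mul_le_l2n hg.enorm hw.enorm).trans ?_
    rw [mul_comm]
    gcongr
    exact hC k
  have h2 : l2n volume (fun k => l2n volume fun l => ‖G (k, l)‖ₑ) = eLpNorm G 2 volume := by
    rw [eLpNorm_two_eq, Measure.volume_eq_prod]
    unfold l2n
    rw [lintegral_prod _ (hGm.enorm.pow_const 2)]
    congr 2
    ext k
    exact l2n_sq (μ := (volume : Measure ℝ)) (g := fun l => ‖G (k, l)‖ₑ)
  have h3 : AEMeasurable fun k => l2n volume fun l => ‖G (k, l)‖ₑ :=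
    (hGm.enorm.pow_const 2).lintegral_prod_right'.pow_const _
  have h4 : ∀ᵐ k, l2n volume (fun l => ‖G (k, l)‖ₑ) < ⊤ := by
    have := ae_lt_top' (h3.pow_const 2) (l2n_lt_top_iff.1 (h2.trans_lt hG.2)).ne
    exact this.mono fun k hk => by simpa [ENNReal.pow_lt_top_iff] using hk
  have h5 : eLpNorm (fun k => ∫ l, G (k, l) * W k l) 2 volume ≤ C * eLpNorm G 2 volume := by
    rw [eLpNorm_two_eq, ← h2, ← l2n_const_mul _ h3]
    exact l2n_mono_ae (h1.mono fun k hk => (enorm_integral_le_lintegral_enorm _).trans hk)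
  refine ⟨?_, ⟨hm.integral_prod_right', h5.trans_lt (mul_lt_top (by simp) hG.2)⟩, h5⟩
  filter_upwards [h1, h4, hm.prodMk_left] with k h1 h4 hk
  exact ⟨hk, h1.trans_lt (mul_lt_top (by simp) h4)⟩

/-- Square integrable kernels. -/
abbrev Ker : Type := Lp ℂ 2 (volume : Measure (ℝ × ℝ))

theorem ae_section {f g : ℝ × ℝ → ℂ} (h : f =ᵐ[volume] g) : ∀ᵐ k : ℝ, ∀ᵐ l : ℝ, f (k, l) = g (k, l) :=
  Measure.ae_ae_of_ae_prod h

theorem norm_toLp_le {α : Type*} [MeasurableSpace α] {μ : Measure α} {f : α → ℂ} (hf : MemLp f 2 μ)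
    {c : ℝ} (hc : 0 ≤ c) (h : eLpNorm f 2 μ ≤ ofReal c) : ‖hf.toLp‖ ≤ c := by
  rw [Lp.norm_toLp]
  exact ENNReal.toReal_le_of_le_ofReal hc h

theorem eLpNorm_coe_eq {α : Type*} [MeasurableSpace α] {μ : Measure α} (f : Lp ℂ 2 μ) :
    eLpNorm f 2 μ = ofReal ‖f‖ := by
  rw [Lp.norm_def, ofReal_toReal (Lp.eLpNorm_ne_top f)]

theorem toLp_eq_add {f g h : ℝ → ℂ} (hf : MemLp f 2 volume) (hg : MemLp g 2 volume) (hh : MemLp h 2 volume)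
    (e : f =ᵐ[volume] g + h) : hf.toLp = hg.toLp + hh.toLp :=
  (MemLp.toLp_congr _ (hg.add hh) e).trans (MemLp.toLp_add _ _)

theorem toLp_eq_smul {c : ℝ} {f g : ℝ → ℂ} (hf : MemLp f 2 volume) (hg : MemLp g 2 volume)
    (e : f =ᵐ[volume] c • g) : hf.toLp = c • hg.toLp :=
  (MemLp.toLp_congr _ (hg.const_smul c) e).trans (MemLp.toLp_const_smul c _)

/-- The map `G ↦ (k ↦ ∫ G(k,l) W(k,l) dl)`. -/
def pairOp (W : ℝ → ℝ → ℂ) (hW : AEStronglyMeasurable (uncurry W) volume) (C : ℝ≥0)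
    (hC : ∀ k, l2n volume (fun l => ‖W k l‖ₑ) ≤ C) : Ker →L[ℝ] L2 :=
  LinearMap.mkContinuous
    { toFun := fun G => (pairing (Lp.memLp G) hW hC).2.1.toLp
      map_add' := fun G H => by
        refine toLp_eq_add _ _ _ ?_
        filter_upwards [ae_section (Lp.coeFn_add G H), (pairing (Lp.memLp G) hW hC).1,
          (pairing (Lp.memLp H) hW hC).1] with k h1 h2 h3
        rw [Pi.add_apply, ← integral_add h2 h3]
        exact integral_congr_ae (h1.mono fun l hl => by simp only [hl, Pi.add_apply, add_mul])
      map_smul' := fun c G => by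
        refine toLp_eq_smul _ _ ?_
        filter_upwards [ae_section (Lp.coeFn_smul c G)] with k h1
        rw [Pi.smul_apply, ← integral_smul]
        exact integral_congr_ae (h1.mono fun l hl => by
          simp only [hl, Pi.smul_apply, smul_mul_assoc, RingHom.id_apply]) } C fun G => by
      refine norm_toLp_le (pairing (Lp.memLp G) hW hC).2.1 (by positivity)
        ((pairing (Lp.memLp G) hW hC).2.2.trans_eq ?_)
      rw [eLpNorm_coe_eq, ofReal_mul (NNReal.coe_nonneg C), ENNReal.ofReal_coe_nnreal]

theorem coe_pairOp {W : ℝ → ℝ → ℂ} {hW : AEStronglyMeasurable (uncurry W) volume} {C : ℝ≥0}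
    {hC : ∀ k, l2n volume (fun l => ‖W k l‖ₑ) ≤ C} {G : ℝ × ℝ → ℂ} (hG : MemLp G 2) :
    pairOp W hW C hC hG.toLp = (pairing hG hW hC).2.1.toLp := by
  refine MemLp.toLp_congr (pairing (Lp.memLp _) hW hC).2.1 _ ?_
  filter_upwards [ae_section hG.coeFn_toLp] with k hk
  exact integral_congr_ae (hk.mono fun l hl => by simp only [hl])

theorem aesm_snd (f : L2) : AEStronglyMeasurable (uncurry fun _ l : ℝ => f l) volume :=
  (Lp.aestronglyMeasurable f).comp_snd

theorem l2n_coe_le (f : L2) (_ : ℝ) : l2n volume (fun l => ‖f l‖ₑ) ≤ ‖f‖₊ := by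
  rw [← eLpNorm_two_eq, eLpNorm_coe_eq, ofReal_norm, enorm_eq_nnnorm]

theorem pairing_coe {G : ℝ × ℝ → ℂ} (hG : MemLp G 2) (f : L2) :
    (∀ᵐ k, Integrable fun l => G (k, l) * f l) ∧ MemLp (fun k => ∫ l, G (k, l) * f l) 2 :=
  let h := pairing hG (aesm_snd f) (l2n_coe_le f); ⟨h.1, h.2.1⟩

/-- The integral operator with a given kernel. -/
def kerOp : Ker →L[ℝ] L2 →L[ℝ] L2 :=
  LinearMap.mkContinuous₂
    (LinearMap.mk₂ ℝ (fun G f => pairOp _ (aesm_snd f) _ (l2n_coe_le f) G)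
      (fun G H f => map_add _ G H) (fun c G f => map_smul _ c G)
      (fun G f g => by
        refine toLp_eq_add (pairing_coe (Lp.memLp G) (f + g)).2
          (pairing_coe (Lp.memLp G) f).2 (pairing_coe (Lp.memLp G) g).2 ?_
        filter_upwards [(pairing_coe (Lp.memLp G) f).1, (pairing_coe (Lp.memLp G) g).1] with k h2 h3
        rw [Pi.add_apply, ← integral_add h2 h3]
        exact integral_congr_ae ((Lp.coeFn_add f g).mono fun l hl => by
          simp only [hl, Pi.add_apply, mul_add]))
      (fun c G f => by
        refine toLp_eq_smul (pairing_coe (Lp.memLp G) (c • f)).2 (pairing_coe (Lp.memLp G) f).2 ?_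
        refine ae_of_all _ fun k => ?_
        rw [Pi.smul_apply, ← integral_smul]
        exact integral_congr_ae ((Lp.coeFn_smul c f).mono fun l hl => by
          simp only [hl, Pi.smul_apply, mul_smul_comm]))) 1 fun G f => by
      rw [one_mul, mul_comm]
      exact (pairOp _ (aesm_snd f) _ (l2n_coe_le f)).le_of_opNorm_le
        (LinearMap.mkContinuous_norm_le _ (NNReal.coe_nonneg ‖f‖₊) _) G

theorem coe_kerOp {G : ℝ × ℝ → ℂ} (hG : MemLp G 2) (f : L2) :
    kerOp hG.toLp f = (pairing_coe hG f).2.toLp :=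
  coe_pairOp (hW := aesm_snd f) (hC := l2n_coe_le f) hG

theorem norm_kerOp_le (G : Ker) : ‖kerOp G‖ ≤ ‖G‖ := by
  refine (ContinuousLinearMap.le_of_opNorm_le _
    (LinearMap.mkContinuous₂_norm_le _ zero_le_one _) G).trans (one_mul _).le

/-! ### The Cauchy projectors as contractions of `L²` -/

section Cauchy

variable {s : Set ℝ} (hs : MeasurableSet s)

theorem norm_restrictL2_le (f : L2) : ‖restrictL2 s hs f‖ ≤ ‖f‖ :=
  norm_toLp_le _ (norm_nonneg f) ((eLpNorm_indicator_le _).trans (eLpNorm_coe_eq f).le)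

/-- `restrictL2` as a continuous linear map. -/
def restrictCLM : L2 →L[ℝ] L2 :=
  LinearMap.mkContinuous
    { toFun := restrictL2 s hs
      map_add' := fun f g => by
        refine toLp_eq_add _ _ _ ?_
        filter_upwards [Lp.coeFn_add f g] with x hx
        by_cases h : x ∈ s
        · simpa only [Pi.add_apply, indicator_of_mem h] using hx
        · simp [h]
      map_smul' := fun c f => by
        refine toLp_eq_smul _ _ ?_
        filter_upwards [Lp.coeFn_smul c f] with x hx
        by_cases h : x ∈ s <;> simp [h, hx] } 1
    fun f => by rw [one_mul]; exact norm_restrictL2_le hs f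

/-- The Fourier multiplier with the indicator of `s`. -/
def freqProj : L2 →L[ℝ] L2 :=
  ((Lp.fourierTransformₗᵢ ℝ ℂ).symm.toContinuousLinearEquiv.toContinuousLinearMap.restrictScalars ℝ).comp
    ((restrictCLM hs).comp
      ((Lp.fourierTransformₗᵢ ℝ ℂ).toContinuousLinearEquiv.toContinuousLinearMap.restrictScalars ℝ))

theorem norm_freqProj_apply_le (f : L2) : ‖freqProj hs f‖ ≤ ‖f‖ := by
  refine ((Lp.fourierTransformₗᵢ ℝ ℂ).symm.norm_map _).le.trans ?_
  exact (norm_restrictL2_le hs _).trans_eq ((Lp.fourierTransformₗᵢ ℝ ℂ).norm_map f)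

/-- The Cauchy projector `C₊` as a continuous linear map. -/
def cauchyP : L2 →L[ℝ] L2 := freqProj measurableSet_Ioi (s := Ioi 0)

/-- The Cauchy projector `C₋` as a continuous linear map. -/
def cauchyM : L2 →L[ℝ] L2 := -freqProj measurableSet_Iio (s := Iio 0)

theorem cauchyP_apply (f : L2) : cauchyP f = cauchyPlus f := rfl

theorem cauchyM_apply (f : L2) : cauchyM f = cauchyMinus f := rfl

theorem norm_cauchyP_apply_le (f : L2) : ‖cauchyP f‖ ≤ ‖f‖ := norm_freqProj_apply_le _ f

theorem norm_cauchyM_apply_le (f : L2) : ‖cauchyM f‖ ≤ ‖f‖ :=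
  (norm_neg _).trans_le (norm_freqProj_apply_le _ f)

end Cauchy

/-! ### Differentiability in `x` of the oscillating kernel -/

/-- Taylor's formula for `|θ| ≤ 1` and the triangle inequality beyond; a bound valid for all `θ` is
needed, because `l - k` is unbounded. -/
theorem norm_exp_mul_I_sub_le (θ : ℝ) : ‖Complex.exp (θ * I) - 1 - θ * I‖ ≤ 3 * θ ^ 2 := by
  have hn : ‖(θ * I : ℂ)‖ = |θ| := by simp
  rcases le_total |θ| 1 with h | h
  · have := Complex.norm_exp_sub_one_sub_id_le (hn.trans_le h)
    rw [hn, sq_abs] at this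
    nlinarith [sq_nonneg θ]
  · refine (norm_sub_le _ _).trans ((add_le_add_left (norm_sub_le _ _) _).trans ?_)
    rw [Complex.norm_exp_ofReal_mul_I, hn, norm_one]
    nlinarith [sq_abs θ]

theorem osc_add {t : ℝ} (ht : 0 < t) (x h y k l : ℝ) :
    osc t (x + h) y k l = osc t x y k l * Complex.exp ((((l - k) * h : ℝ) : ℂ) * I) := by
  have : (t : ℂ) ≠ 0 := by exact_mod_cast ht.ne'
  rw [osc, osc, ← Complex.exp_add, S0, S0]
  congr 1
  push_cast
  field_simp
  ring

/-- The factor `i (l - k)`. -/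
def lam (p : ℝ × ℝ) : ℂ := ((p.2 - p.1 : ℝ) : ℂ) * I

theorem enorm_lam_le (p : ℝ × ℝ) : ‖lam p‖ₑ ≤ wt (p.2 - p.1) := by
  rw [← ofReal_norm, lam, wt]
  refine ofReal_le_ofReal ?_
  rw [norm_mul, Complex.norm_I, mul_one, Complex.norm_real, norm_eq_abs]
  linarith

section Osc

theorem aesm_osc {P : ℝ × ℝ → ℂ} (hm : AEStronglyMeasurable P volume) (t x y : ℝ) :
    AEStronglyMeasurable (fun p : ℝ × ℝ => osc t x y p.1 p.2 * P p) volume :=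
  (continuous_osc t x y).aestronglyMeasurable.mul hm

theorem aesm_lam {P : ℝ × ℝ → ℂ} (hm : AEStronglyMeasurable P volume) :
    AEStronglyMeasurable (fun p : ℝ × ℝ => lam p * P p) volume := by
  have : Continuous lam := by unfold lam; fun_prop
  exact this.aestronglyMeasurable.mul hm

theorem enorm_osc (t x y k l : ℝ) : ‖osc t x y k l‖ₑ = 1 := by
  rw [← ofReal_norm, norm_osc, ofReal_one]

theorem memLp_osc {P : ℝ × ℝ → ℂ} (hm : AEStronglyMeasurable P volume)
    (hP : l2n volume (fun p : ℝ × ℝ => ‖P p‖ₑ) < ⊤) (t x y : ℝ) :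
    MemLp (fun p : ℝ × ℝ => osc t x y p.1 p.2 * P p) 2 := by
  rw [memLp_two_iff (aesm_osc hm t x y)]
  simpa only [enorm_mul, enorm_osc, one_mul] using hP

theorem l2n_le_wt {P : ℝ × ℝ → ℂ} : l2n volume (fun p : ℝ × ℝ => ‖P p‖ₑ) ≤
    l2n volume (fun p : ℝ × ℝ => wt (p.2 - p.1) ^ 2 * ‖P p‖ₑ) :=
  l2n_mono fun _ => le_mul_of_one_le_left' (one_le_pow₀ (one_le_wt _))

theorem l2n_lam_le {P : ℝ × ℝ → ℂ} : l2n volume (fun p : ℝ × ℝ => ‖lam p * P p‖ₑ) ≤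
    l2n volume (fun p : ℝ × ℝ => wt (p.2 - p.1) ^ 2 * ‖P p‖ₑ) :=
  l2n_mono fun p => by
    rw [enorm_mul]
    gcongr
    exact (enorm_lam_le p).trans (le_self_pow₀ (one_le_wt _) two_ne_zero)

/-- The Taylor remainder in the increment `h` is at most `3(l-k)²h²` times the kernel, so two
moments of the kernel in `l - k` suffice for differentiability in `L²(dk dl)`. -/
theorem hasDerivAt_osc {P : ℝ × ℝ → ℂ} (hm : AEStronglyMeasurable P volume)
    (hP : l2n volume (fun p : ℝ × ℝ => wt (p.2 - p.1) ^ 2 * ‖P p‖ₑ) < ⊤) {t : ℝ} (ht : 0 < t) (x y : ℝ) :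
    HasDerivAt (fun x => (memLp_osc hm (l2n_le_wt.trans_lt hP) t x y).toLp)
      (memLp_osc (aesm_lam hm) (l2n_lam_le.trans_lt hP) t x y).toLp x := by
  have hM := fun x => memLp_osc hm (l2n_le_wt.trans_lt hP) t x y
  have hM' := memLp_osc (aesm_lam hm) (l2n_lam_le.trans_lt hP) t x y
  rw [hasDerivAt_iff_isLittleO_nhds_zero]
  set A := (l2n volume (fun p : ℝ × ℝ => wt (p.2 - p.1) ^ 2 * ‖P p‖ₑ)).toReal with hA
  refine Asymptotics.IsBigO.trans_isLittleO (g := fun h : ℝ => h ^ 2) ?_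
    (by simpa using Asymptotics.isLittleO_pow_id (𝕜 := ℝ) one_lt_two)
  refine Asymptotics.IsBigO.of_bound (3 * A) (Filter.Eventually.of_forall fun h => ?_)
  rw [← MemLp.toLp_sub, ← MemLp.toLp_const_smul, ← MemLp.toLp_sub]
  refine norm_toLp_le _ (by positivity) ?_
  have hc : ofReal (3 * A * ‖h ^ 2‖) = ofReal (3 * h ^ 2) *
      l2n volume (fun p : ℝ × ℝ => wt (p.2 - p.1) ^ 2 * ‖P p‖ₑ) := by
    rw [norm_eq_abs, abs_of_nonneg (sq_nonneg h), mul_right_comm, ofReal_mul (by positivity), hA,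
      ofReal_toReal hP.ne]
  rw [hc, eLpNorm_two_eq, ← l2n_const_mul]
  · refine l2n_mono fun p => ?_
    have e : ((fun p : ℝ × ℝ => osc t (x + h) y p.1 p.2 * P p) - (fun p => osc t x y p.1 p.2 * P p) -
        h • fun p => osc t x y p.1 p.2 * (lam p * P p)) p = osc t x y p.1 p.2 * P p *
        (Complex.exp ((((p.2 - p.1) * h : ℝ) : ℂ) * I) - 1 - ((p.2 - p.1) * h : ℝ) * I) := by
      simp only [Pi.sub_apply, Pi.smul_apply, osc_add ht, lam, Complex.real_smul]
      push_cast
      ring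
    rw [e, enorm_mul, enorm_mul, enorm_osc, one_mul, mul_comm, ← mul_assoc]
    gcongr
    rw [← ofReal_norm, wt, ← ofReal_pow (by positivity), ← ofReal_mul (by positivity)]
    refine ofReal_le_ofReal ((norm_exp_mul_I_sub_le _).trans ?_)
    have h1 : (p.2 - p.1) ^ 2 ≤ (1 + |p.2 - p.1|) ^ 2 := by
      rw [← sq_abs]; gcongr; linarith
    nlinarith [mul_le_mul_of_nonneg_left h1 (sq_nonneg h)]
  · have := hm.enorm
    exact AEMeasurable.mul (by fun_prop) this

end Osc

/-! ### Affine fixed point equations depending on a parameter -/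

section Affine

variable {X : Type*} [NormedAddCommGroup X] [NormedSpace ℝ X] [CompleteSpace X]

theorem affine_unique {S : X →L[ℝ] X} (hS : ‖S‖ ≤ 1 / 2) (b w : X) :
    w = b + S w ↔ w = Ring.inverse (1 - S) b := by
  obtain ⟨v, hv⟩ : IsUnit (1 - S) := isUnit_one_sub_of_norm_lt_one (by linarith)
  rw [← hv, Ring.inverse_unit]
  have e1 : ∀ z, (v⁻¹ : (X →L[ℝ] X)ˣ).1 (v.1 z) = z := fun z => DFunLike.congr_fun v.inv_mul z
  have e2 : ∀ z, v.1 ((v⁻¹ : (X →L[ℝ] X)ˣ).1 z) = z := fun z => DFunLike.congr_fun v.mul_inv z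
  have e3 : v.1 w = w - S w := by rw [hv]; rfl
  rw [← sub_eq_iff_eq_add, ← e3]
  exact ⟨fun h => by rw [← h, e1], fun h => by rw [h, e2]⟩

/-- Inversion is differentiable at invertible operators, so the solution is differentiable;
differentiating the fixed point equation shows that its derivative solves an equation with the same
operator. The bound `‖S‖ ≤ 1/2` is then used for both equations. -/
theorem affine_family {S : ℝ → X →L[ℝ] X} {b : ℝ → X} (hS : ∀ x, ‖S x‖ ≤ 1 / 2) {S' : X →L[ℝ] X} {b' : X} {x : ℝ}
    (hS' : HasDerivAt S S' x) (hb' : HasDerivAt b b' x) :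
    DifferentiableAt ℝ (fun x => Ring.inverse (1 - S x) (b x)) x ∧
    ‖Ring.inverse (1 - S x) (b x)‖ ≤ 2 * ‖b x‖ ∧
    ‖deriv (fun x => Ring.inverse (1 - S x) (b x)) x‖ ≤ 2 * (‖b'‖ + ‖S'‖ * (2 * ‖b x‖)) := by
  set M := fun x => Ring.inverse (1 - S x) (b x) with hM
  have hfix : ∀ x, M x = b x + S x (M x) := fun x => (affine_unique (hS x) _ _).2 rfl
  have hu : IsUnit (1 - S x) := isUnit_one_sub_of_norm_lt_one (by linarith [hS x])
  have hd : DifferentiableAt ℝ M x := by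
    have h1 : DifferentiableAt ℝ (Ring.inverse : (X →L[ℝ] X) → _) (1 - S x) := by
      exact differentiableAt_inverse hu
    exact (h1.comp x (hS'.differentiableAt.const_sub 1)).clm_apply hb'.differentiableAt
  have half : ∀ (y : X) z, y = z + S x y → ‖y‖ ≤ 2 * ‖z‖ := fun y z h => by
    have h1 := (S x).le_of_opNorm_le (hS x) y
    have h2 := norm_add_le z (S x y)
    rw [← h] at h2
    linarith
  have hn := half _ _ (hfix x)
  refine ⟨hd, hn, ?_⟩
  have h2 := hb'.add (hS'.clm_apply hd.hasDerivAt)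
  have h3 : deriv M x = b' + S' (M x) + S x (deriv M x) := by
    rw [add_assoc]
    exact hd.hasDerivAt.unique (h2.congr_of_eventuallyEq (Filter.Eventually.of_forall hfix))
  refine (half _ _ h3).trans ?_
  gcongr
  exact (norm_add_le _ _).trans (by gcongr; exact S'.le_of_opNorm_le_of_le le_rfl hn)

end Affine

/-! ### From bounds on the scattering data to the Riemann-Hilbert problem -/

/-- The properties of the scattering data on which the analysis of the Riemann-Hilbert problem rests. -/
structure ScatKernel (T : ℝ → ℝ → ℂ) : Prop where
  meas : AEStronglyMeasurable (fun p : ℝ × ℝ => T p.1 p.2) volume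
  small : l2n volume (fun p : ℝ × ℝ => ‖T p.1 p.2‖ₑ) ≤ ofReal (1 / 4)
  wgt : l2n volume (fun p : ℝ × ℝ => wt (p.2 - p.1) ^ 3 * ‖T p.1 p.2‖ₑ) < ⊤
  dec : ∃ D : ℝ, 0 ≤ D ∧ ∀ t x y M, (∀ k α β, ‖∫ l in α..β, osc t x y k l‖ ≤ M) →
    eLpNorm (fun k => ∫ l, osc t x y k l * T k l) 2 volume ≤ ofReal (D * M) ∧
    eLpNorm (fun k => ∫ l, osc t x y k l * (lam (k, l) * T k l)) 2 volume ≤ ofReal (D * M)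

/-- The inverse weight. -/
def rwt (k l : ℝ) : ℂ := ((1 + |l - k| : ℝ) : ℂ)⁻¹

theorem continuous_wtC : Continuous fun p : ℝ × ℝ => ((1 + |p.2 - p.1| : ℝ) : ℂ) := by fun_prop

theorem wtC_ne (k l : ℝ) : ((1 + |l - k| : ℝ) : ℂ) ≠ 0 := by
  exact_mod_cast (by positivity : (1 + |l - k| : ℝ) ≠ 0)

theorem enorm_wtC (k l : ℝ) : ‖((1 + |l - k| : ℝ) : ℂ)‖ₑ = wt (l - k) := by
  rw [← ofReal_norm, Complex.norm_real, norm_of_nonneg (by positivity), wt]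

theorem aesm_rwt : AEStronglyMeasurable (uncurry rwt) volume :=
  (continuous_wtC.inv₀ fun _ => wtC_ne _ _).aestronglyMeasurable

theorem l2n_rwt (k : ℝ) : l2n volume (fun l => ‖rwt k l‖ₑ) ≤ cI.toNNReal := by
  rw [ENNReal.coe_toNNReal cI_lt_top.ne, cI]
  simp_rw [rwt, enorm_inv (wtC_ne k _), enorm_wtC]
  unfold l2n
  rw [lintegral_sub_right_eq_self fun l => (wt l)⁻¹ ^ 2]

/-- The operator acts on `μ = 1 + w`, and the constant `1` is not in `L²`; so the image of `1` and
the action on `w` are treated separately. The former is a bounded linear image of the kernel in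
weighted `L²`, which gives its differentiability in `x`, while its decay in `t` comes from the
oscillatory integrals. -/
theorem ScatKernel.exists_ops {T : ℝ → ℝ → ℂ} (hT : ScatKernel T) :
    ∃ (A A' : ℝ → ℝ → ℝ → L2 →L[ℝ] L2) (b b' : ℝ → ℝ → ℝ → L2) (D : ℝ), 0 ≤ D ∧
      (∀ t x y, ‖A t x y‖ ≤ 1 / 4) ∧ (∀ t x y, ‖A' t x y‖ ≤ D) ∧
      (∀ t x y, 0 < t → HasDerivAt (fun x => A t x y) (A' t x y) x ∧
        HasDerivAt (fun x => b t x y) (b' t x y) x) ∧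
      (∀ t x y M, (∀ k α β, ‖∫ l in α..β, osc t x y k l‖ ≤ M) → ‖b t x y‖ ≤ D * M ∧ ‖b' t x y‖ ≤ D * M) ∧
      ∀ t x y, ∀ w : L2, (∀ᵐ k, Integrable (kernelT T t x y (fun l => 1 + w l) k)) ∧
        ∃ h : MemLp (opT T t x y (fun l => 1 + w l)) 2 volume, h.toLp = b t x y + A t x y w := by
  set P : ℝ × ℝ → ℂ := fun p => T p.1 p.2 with hPd
  -- Writing `T = Q · rwt` with `rwt k` bounded in `L²(dl)` turns `∫ T dl` into a pairing. One power
  -- of the weight is spent here and two on differentiability, which accounts for the third power in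
  -- `ScatKernel.wgt`.
  set Q : ℝ × ℝ → ℂ := fun p => ((1 + |p.2 - p.1| : ℝ) : ℂ) * P p with hQd
  have hP : AEStronglyMeasurable P volume := hT.meas
  have hQ : AEStronglyMeasurable Q volume := continuous_wtC.aestronglyMeasurable.mul hP
  have wQ : l2n volume (fun p : ℝ × ℝ => wt (p.2 - p.1) ^ 2 * ‖Q p‖ₑ) < ⊤ := by
    refine lt_of_eq_of_lt ?_ hT.wgt
    congr 1; ext p
    rw [hQd, enorm_mul, enorm_wtC, ← mul_assoc, ← pow_succ]
  have wP : l2n volume (fun p : ℝ × ℝ => wt (p.2 - p.1) ^ 2 * ‖P p‖ₑ) < ⊤ :=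
    (l2n_mono fun p => by gcongr; exacts [one_le_wt _, by norm_num]).trans_lt hT.wgt
  have mP := memLp_osc hP (l2n_le_wt.trans_lt wP)
  have mQ := memLp_osc hQ (l2n_le_wt.trans_lt wQ)
  have mP' := memLp_osc (aesm_lam hP) (l2n_lam_le.trans_lt wP)
  have mQ' := memLp_osc (aesm_lam hQ) (l2n_lam_le.trans_lt wQ)
  obtain ⟨D, hD, hdec⟩ := hT.dec
  set E := (l2n volume (fun p : ℝ × ℝ => wt (p.2 - p.1) ^ 2 * ‖P p‖ₑ)).toReal with hE
  set Φ := pairOp rwt aesm_rwt _ l2n_rwt with hΦ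
  have QR : ∀ k l, Q (k, l) * rwt k l = T k l := fun k l => by
    simp only [hQd, rwt, hPd]
    rw [mul_right_comm, mul_inv_cancel₀ (wtC_ne k l), one_mul]
  have cQ : ∀ t x y k l, osc t x y k l * Q (k, l) * rwt k l = osc t x y k l * T k l := fun t x y k l => by
    rw [mul_assoc, QR]
  have cQ' : ∀ t x y k l, osc t x y k l * (lam (k, l) * Q (k, l)) * rwt k l =
      osc t x y k l * (lam (k, l) * T k l) := fun t x y k l => by
    rw [mul_assoc, mul_assoc, QR]
  refine ⟨fun t x y => kerOp (mP t x y).toLp, fun t x y => kerOp (mP' t x y).toLp,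
    fun t x y => Φ (mQ t x y).toLp, fun t x y => Φ (mQ' t x y).toLp, D + E, by positivity,
    fun t x y => ?_, fun t x y => ?_, fun t x y ht => ⟨?_, ?_⟩, fun t x y M hM => ?_, fun t x y w => ?_⟩
  · refine (norm_kerOp_le _).trans (norm_toLp_le _ (by norm_num) ?_)
    rw [eLpNorm_two_eq]
    simpa only [enorm_mul, enorm_osc, one_mul] using hT.small
  · refine (norm_kerOp_le _).trans ((norm_toLp_le _ ENNReal.toReal_nonneg ?_).trans
      (le_add_of_nonneg_left hD))
    rw [eLpNorm_two_eq, ofReal_toReal wP.ne]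
    simp only [enorm_mul (osc _ _ _ _ _), enorm_osc, one_mul]
    exact l2n_lam_le
  · exact kerOp.hasFDerivAt.comp_hasDerivAt x (hasDerivAt_osc hP wP ht x y)
  · exact Φ.hasFDerivAt.comp_hasDerivAt x (hasDerivAt_osc hQ wQ ht x y)
  · have hM0 : 0 ≤ M := (norm_nonneg _).trans (hM 0 0 0)
    have hle : D * M ≤ (D + E) * M :=
      mul_le_mul_of_nonneg_right (le_add_of_nonneg_right ENNReal.toReal_nonneg) hM0
    obtain ⟨h1, h2⟩ := hdec t x y M hM
    constructor
    · refine le_trans ?_ hle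
      simp only [hΦ, coe_pairOp]
      refine norm_toLp_le _ (by positivity) ?_
      simpa only [cQ] using h1
    · refine le_trans ?_ hle
      simp only [hΦ, coe_pairOp]
      refine norm_toLp_le _ (by positivity) ?_
      simpa only [cQ'] using h2
  · obtain ⟨i1, m1, -⟩ := pairing (mQ t x y) aesm_rwt l2n_rwt
    obtain ⟨i2, m2⟩ := pairing_coe (mP t x y) w
    simp only [cQ] at i1 m1
    have e : ∀ k l, kernelT T t x y (fun l => 1 + w l) k l =
        osc t x y k l * T k l + osc t x y k l * P (k, l) * w l := fun k l => by
      rw [kernelT, osc, mul_add, mul_one]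
    have e1 : opT T t x y (fun l => 1 + w l) =ᵐ[volume]
        (fun k => ∫ l, osc t x y k l * T k l) + fun k => ∫ l, osc t x y k l * P (k, l) * w l := by
      filter_upwards [i1, i2] with k h1 h2
      simp only [opT, e, Pi.add_apply]
      exact integral_add h1 h2
    refine ⟨?_, (memLp_congr_ae e1).2 (m1.add m2), ?_⟩
    · filter_upwards [i1, i2] with k h1 h2
      exact (h1.add h2).congr (ae_of_all _ fun l => (e k l).symm)
    · rw [toLp_eq_add _ m1 m2 e1]
      simp only [hΦ, coe_kerOp, coe_pairOp, cQ]

/-- Unique solvability of the nonlocal Riemann-Hilbert problem, and bounds for its solution. -/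
theorem ScatKernel.exists_solution {Tp Tm : ℝ → ℝ → ℂ} (hp : ScatKernel Tp) (hm : ScatKernel Tm) :
    ∃ M : ℝ → ℝ → ℝ → L2,
      (∀ t x y : ℝ, ∀ w : L2, IsRHPSolution Tp Tm t x y w ↔ w = M t x y) ∧
      (∀ t x y : ℝ, 0 < t → DifferentiableAt ℝ (fun s => M t s y) x) ∧
      ∃ D : ℝ, 0 ≤ D ∧ ∀ t x y N : ℝ, 0 < t → (∀ k α β, ‖∫ l in α..β, osc t x y k l‖ ≤ N) →
        ‖M t x y‖ ≤ D * N ∧ ‖deriv (fun s => M t s y) x‖ ≤ D * N := by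
  obtain ⟨A, A', b, b', D, hD, hA, hA', hd, hb, hs⟩ := hp.exists_ops
  obtain ⟨B, B', c, c', E, hE, hB, hB', hd2, hc, hs2⟩ := hm.exists_ops
  set S : ℝ → ℝ → ℝ → L2 →L[ℝ] L2 := fun t x y => cauchyP.comp (B t x y) + cauchyM.comp (A t x y) with hS
  set f : ℝ → ℝ → ℝ → L2 := fun t x y => cauchyP (c t x y) + cauchyM (b t x y) with hf
  have comb : ∀ {F G : L2 →L[ℝ] L2} {r s : ℝ}, 0 ≤ r → 0 ≤ s → ‖F‖ ≤ r → ‖G‖ ≤ s →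
      ‖cauchyP.comp F + cauchyM.comp G‖ ≤ r + s := fun hr hs hF hG => by
    refine (norm_add_le _ _).trans (add_le_add ?_ ?_)
    · exact ContinuousLinearMap.opNorm_le_bound _ hr fun z =>
        (norm_cauchyP_apply_le _).trans (ContinuousLinearMap.le_of_opNorm_le _ hF z)
    · exact ContinuousLinearMap.opNorm_le_bound _ hs fun z =>
        (norm_cauchyM_apply_le _).trans (ContinuousLinearMap.le_of_opNorm_le _ hG z)
  have comb2 : ∀ {g h : L2} {r s : ℝ}, ‖g‖ ≤ r → ‖h‖ ≤ s → ‖cauchyP g + cauchyM h‖ ≤ r + s :=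
    fun hg hh => (norm_add_le _ _).trans
      (add_le_add ((norm_cauchyP_apply_le _).trans hg) ((norm_cauchyM_apply_le _).trans hh))
  -- Two kernels of norm at most `1/4`, composed with contractions.
  have hS1 : ∀ t x y, ‖S t x y‖ ≤ 1 / 2 := fun t x y =>
    (comb (by norm_num) (by norm_num) (hB t x y) (hA t x y)).trans (by norm_num)
  have hSd : ∀ t x y, 0 < t → HasDerivAt (fun x => S t x y)
      (cauchyP.comp (B' t x y) + cauchyM.comp (A' t x y)) x := fun t x y ht =>
    ((ContinuousLinearMap.compL ℝ L2 L2 L2 cauchyP).hasFDerivAt.comp_hasDerivAt x (hd2 t x y ht).1).add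
      ((ContinuousLinearMap.compL ℝ L2 L2 L2 cauchyM).hasFDerivAt.comp_hasDerivAt x (hd t x y ht).1)
  have hfd : ∀ t x y, 0 < t → HasDerivAt (fun x => f t x y)
      (cauchyP (c' t x y) + cauchyM (b' t x y)) x := fun t x y ht =>
    (cauchyP.hasFDerivAt.comp_hasDerivAt x (hd2 t x y ht).2).add
      (cauchyM.hasFDerivAt.comp_hasDerivAt x (hd t x y ht).2)
  have key := fun t x y ht => affine_family (fun x => hS1 t x y) (hSd t x y ht) (hfd t x y ht)
  refine ⟨fun t x y => Ring.inverse (1 - S t x y) (f t x y), fun t x y w => ?_,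
    fun t x y ht => (key t x y ht).1, 2 * ((D + E) + (E + D) * (2 * (D + E))) + 2 * (D + E), by positivity,
    fun t x y N ht hN => ?_⟩
  · rw [← affine_unique (hS1 t x y)]
    obtain ⟨i1, m1, e1⟩ := hs t x y w
    obtain ⟨i2, m2, e2⟩ := hs2 t x y w
    have e : cauchyPlus m2.toLp + cauchyMinus m1.toLp = f t x y + S t x y w := by
      rw [← cauchyP_apply, ← cauchyM_apply, e1, e2, map_add, map_add]
      exact add_add_add_comm _ _ _ _
    rw [← e]
    exact ⟨fun h => h.eqn.2.2, fun h => ⟨i1, i2, m1, m2, h⟩⟩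
  · have hN0 : 0 ≤ N := (norm_nonneg _).trans (hN 0 0 0)
    obtain ⟨-, h1, h2⟩ := key t x y ht
    have h3 : ‖f t x y‖ ≤ (D + E) * N := by
      have := comb2 (hc t x y N hN).1 (hb t x y N hN).1
      linarith
    have h4 : ‖cauchyP (c' t x y) + cauchyM (b' t x y)‖ ≤ (D + E) * N := by
      have := comb2 (hc t x y N hN).2 (hb t x y N hN).2
      linarith
    have h5 := comb hE hD (hB' t x y) (hA' t x y)
    have h6 : 0 ≤ 2 * ((D + E) + (E + D) * (2 * (D + E))) * N := by positivity
    have h7 : 0 ≤ 2 * (D + E) * N := by positivity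
    constructor
    · refine h1.trans ?_
      nlinarith
    · refine h2.trans ?_
      calc _ ≤ 2 * ((D + E) * N + (E + D) * (2 * ((D + E) * N))) := by gcongr
        _ ≤ _ := by nlinarith

/-! ### The scattering data of a small regular potential -/

theorem l2n_comp_shear {H : ℝ → ℝ → ℝ≥0∞} (hH : Measurable (uncurry H)) :
    l2n volume (fun p : ℝ × ℝ => H p.1 (p.2 - p.1)) = l2n volume (uncurry H) := by
  have h1 : Measurable (uncurry fun k l => H k (l - k)) :=
    hH.comp (f := fun p : ℝ × ℝ => (p.1, p.2 - p.1)) (by fun_prop)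
  rw [Measure.volume_eq_prod, l2n_prod hH]
  refine (l2n_prod h1).trans ?_
  congr 1; ext k
  unfold l2n
  rw [lintegral_sub_right_eq_self fun l => H k l ^ 2]

theorem enorm_I_div_two_pi : ‖-(I / (2 * π))‖ₑ = i2π * i2π := by
  rw [← enorm_I_div, ← enorm_mul, ← ofReal_norm, ← ofReal_norm]
  congr 1
  rw [norm_neg, norm_mul, norm_div, norm_div, Complex.norm_real, norm_of_nonneg (sqrt_nonneg _),
    Complex.norm_I, div_mul_div_comm, mul_self_sqrt (by positivity)]
  simp [abs_of_pos pi_pos]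

theorem enorm_integral_osc_le {σ : ℝ} (hσ : σ = 1 ∨ σ = -1) {t x y M k : ℝ}
    (hM : ∀ α β, ‖∫ l in α..β, osc t x y k l‖ ≤ M) {T g g' : ℝ → ℂ}
    (hT : ∀ l, T l = if 0 < σ * (l - k) then g (l - k) else 0)
    (hg : ∀ s, HasDerivAt g (g' s) s) (hgi : Integrable g) (hgi' : Integrable g') :
    ‖∫ l, osc t x y k l * T l‖ₑ ≤ ofReal M * ∫⁻ s, ‖g' s‖ₑ := by
  have hM0 : 0 ≤ M := (norm_nonneg _).trans (hM 0 0)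
  have ho : Continuous (osc t x y k) := by unfold osc S0; fun_prop
  have hi : ∫ s, ‖g' (s - k)‖ = ∫ s, ‖g' s‖ := integral_sub_right_eq_self (fun s => ‖g' s‖) k
  have hd : ∀ s, HasDerivAt (fun l => g (l - k)) (g' (s - k)) s := fun s => (hg (s - k)).comp_sub_const s k
  have e : ∀ s : Set ℝ, MeasurableSet s → (∀ l, 0 < σ * (l - k) ↔ l ∈ s) →
      ∫ l, osc t x y k l * T l = ∫ l in s, osc t x y k l * g (l - k) := fun s hs h => by
    rw [← integral_indicator hs]
    congr 1; ext l
    by_cases hl : l ∈ s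
    · rw [indicator_of_mem hl, hT, if_pos ((h l).2 hl)]
    · rw [Set.indicator_of_notMem hl, hT, if_neg (mt (h l).1 hl), mul_zero]
  have key : ‖∫ l, osc t x y k l * T l‖ ≤ M * ∫ s, ‖g' s‖ := by
    rw [← hi]
    rcases hσ with rfl | rfl
    · rw [e (Ioi k) measurableSet_Ioi fun l => by simp]
      exact norm_integral_Ioi_mul_le ho hM (fun s => (norm_osc _ _ _ _ _).le) hd (hgi.comp_sub_right k)
        (hgi'.comp_sub_right k) k
    · rw [e (Iio k) measurableSet_Iio fun l => by simp]
      exact norm_integral_Iio_mul_le ho hM (fun s => (norm_osc _ _ _ _ _).le) hd (hgi.comp_sub_right k)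
        (hgi'.comp_sub_right k) k
  rw [← ofReal_norm, ← ofReal_integral_norm_eq_lintegral_enorm hgi', ← ofReal_mul hM0]
  exact ofReal_le_ofReal key

variable {σ : ℝ} {q q' r : ℝ → ℝ → ℂ} {U : ℝ → ℝ} {n : ℝ → ℝ → ℝ → ℂ}

/-- In the variables `k` and `s = l - k` the scattering data are `tau` cut off at `s = 0`. Smallness
is the unweighted contraction bound, the moments are its weighted form, and the decay follows from
the bound on the derivative of `tau`. -/
theorem InteractionSol.scatKernel (hσ : σ = 1 ∨ σ = -1) (h : InteractionSol σ q n) (K : KPot q q' r U)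
    {N : ℝ≥0∞} (hc : i2π * ∫⁻ η, ∫⁻ s, ‖q s η‖ₑ < 1)
    (hN : N ≤ (1 - i2π * ∫⁻ η, ∫⁻ s, ‖q s η‖ₑ) / 4)
    (hsrc : i2π * srcX (fun _ => 1) q ≤ N) {T : ℝ → ℝ → ℂ}
    (hT : ∀ᵐ k, ∀ l, T k l =
      if 0 < σ * (l - k) then -(I / (2 * π)) * tau q n k (l - k) else 0) : ScatKernel T := by
  set τ := tau q n with hτd
  set τ' : ℝ → ℝ → ℂ := fun k l => ∫ η, dintegrand q q' n k l η with hτ'd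
  have hτ : Measurable (uncurry τ) := measurable_tau K.mq h.meas
  have hτ' : Measurable (uncurry τ') := by
    refine (StronglyMeasurable.integral_prod_right
      (f := fun (p : ℝ × ℝ) η => dintegrand q q' n p.1 p.2 η) ?_).measurable
    exact ((measurable_dintegrand K.mq K.mq' h.meas).comp
      (f := fun p : (ℝ × ℝ) × ℝ => (p.1.1, p.1.2, p.2)) (by fun_prop)).stronglyMeasurable
  have hq1 : ∀ {P : ℝ → Prop}, (∀ᵐ k, P k) → ∀ᵐ p : ℝ × ℝ, P p.1 := fun hk => by
    rw [Measure.volume_eq_prod]; exact Measure.quasiMeasurePreserving_fst.ae hk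
  have hTp : ∀ᵐ p : ℝ × ℝ, T p.1 p.2 =
      if 0 < σ * (p.2 - p.1) then -(I / (2 * π)) * τ p.1 (p.2 - p.1) else 0 :=
    (hq1 hT).mono fun p hp => hp p.2
  have hTle : ∀ᵐ p : ℝ × ℝ, ‖T p.1 p.2‖ₑ ≤ i2π * i2π * ‖τ p.1 (p.2 - p.1)‖ₑ := hTp.mono fun p hp => by
    rw [hp]
    split_ifs
    · rw [enorm_mul, enorm_I_div_two_pi]
    · simp
  obtain ⟨C, hC, -, hw3, -⟩ := h.exists_bound K hc
  have hdt := h.dtau_bound hσ K hc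
  set F : ℝ → ℝ≥0∞ := fun k => (∫⁻ l, wt l * ‖τ k l‖ₑ) + ∫⁻ l, wt l * ‖τ' k l‖ₑ with hF
  have m1 : Measurable (uncurry fun k l => wt l * ‖τ k l‖ₑ) := by
    have := hτ.enorm; exact Measurable.mul (by fun_prop) this
  have m2 : Measurable (uncurry fun k l => wt l * ‖τ' k l‖ₑ) := by
    have := hτ'.enorm; exact Measurable.mul (by fun_prop) this
  have hF1 : l2n volume (fun k => ∫⁻ l, wt l * ‖τ k l‖ₑ) < ⊤ := by
    have m3 : Measurable (uncurry fun k l => wt l * (wt l * ‖τ k l‖ₑ)) :=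
      Measurable.mul (by fun_prop) m1
    refine (l2n_mono fun k => lintegral_le_l2n_wt m1.of_uncurry_left.aemeasurable).trans_lt ?_
    rw [l2n_const_mul _ (by
      exact (Measurable.lintegral_prod_right' (m3.pow_const 2)).aemeasurable.pow_const _), ← l2n_prod m3]
    refine mul_lt_top cI_lt_top (lt_of_le_of_lt ?_ (hw3.trans_lt hC))
    refine l2n_mono fun p => ?_
    rw [uncurry, ← mul_assoc, ← sq]
    gcongr
    exacts [one_le_wt _, by norm_num]
  have hF2 : l2n volume (fun k => ∫⁻ l, wt l * ‖τ' k l‖ₑ) < ⊤ := by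
    refine (l2n_lintegral_le m2).trans_lt (lt_of_eq_of_lt ?_ hdt)
    refine lintegral_congr fun l => ?_
    exact l2n_const_mul _ hτ'.of_uncurry_right.enorm.aemeasurable
  have mF : Measurable F := m1.lintegral_prod_right'.add m2.lintegral_prod_right'
  have hFt : l2n volume F < ⊤ := (l2n_add_le m1.lintegral_prod_right'.aemeasurable
    m2.lintegral_prod_right'.aemeasurable).trans_lt (add_lt_top.2 ⟨hF1, hF2⟩)
  have hFae : ∀ᵐ k, F k < ⊤ := ae_lt_top_of_l2n mF hFt
  have hi1 : i2π ≤ 1 := ENNReal.ofReal_le_one.2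
    (inv_le_one_of_one_le₀ (one_le_sqrt.2 (by linarith [pi_gt_three])))
  -- Both decay estimates at once: `v = 1` for the data and `v(s) = is` for their `x`-derivative.
  -- The linear growth of `v` is the reason for the weight `wt` in the bounds of `tau` and its
  -- derivative.
  have main : ∀ (v v' : ℝ → ℂ), (∀ l, HasDerivAt v (v' l) l) → Measurable v → Measurable v' →
      (∀ l, ‖v l‖ₑ ≤ wt l) → (∀ l, ‖v' l‖ₑ ≤ 1) → ∀ t x y M,
      (∀ k α β, ‖∫ l in α..β, osc t x y k l‖ ≤ M) →
      eLpNorm (fun k => ∫ l, osc t x y k l * (v (l - k) * T k l)) 2 volume ≤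
        ofReal ((l2n volume F).toReal * M) := by
    intro v v' hv mv mv' bv bv' t x y M hM
    have hM0 : 0 ≤ M := (norm_nonneg _).trans (hM 0 0 0)
    rw [mul_comm, ofReal_mul hM0, ofReal_toReal hFt.ne, eLpNorm_two_eq,
      ← l2n_const_mul _ mF.aemeasurable]
    refine l2n_mono_ae ?_
    filter_upwards [hT, hFae, h.ae_goodParam K hc] with k hk hFk hg
    set g : ℝ → ℂ := fun s => v s * (-(I / (2 * π)) * τ k s) with hgd
    set g' : ℝ → ℂ := fun s => v' s * (-(I / (2 * π)) * τ k s) +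
      v s * (-(I / (2 * π)) * τ' k s) with hg'd
    have hcc : ∀ z : ℂ, ‖-(I / (2 * π)) * z‖ₑ ≤ ‖z‖ₑ := fun z => by
      rw [enorm_mul, enorm_I_div_two_pi]
      exact mul_le_of_le_one_left' (mul_le_one' hi1 hi1)
    have mk : Measurable (τ k) := hτ.of_uncurry_left
    have mk' : Measurable (τ' k) := hτ'.of_uncurry_left
    have hgF : ∫⁻ s, ‖g s‖ₑ ≤ F k := by
      refine (lintegral_mono fun s => ?_).trans le_self_add
      rw [enorm_mul]
      exact mul_le_mul' (bv s) (hcc _)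
    have hgF' : ∫⁻ s, ‖g' s‖ₑ ≤ F k := by
      simp only [hF]
      rw [← lintegral_add_left (f := fun l => wt l * ‖τ k l‖ₑ) m1.of_uncurry_left]
      refine lintegral_mono fun s => (enorm_add_le _ _).trans ?_
      rw [enorm_mul, enorm_mul (v s)]
      exact add_le_add (mul_le_mul' ((bv' s).trans (one_le_wt s)) (hcc _)) (mul_le_mul' (bv s) (hcc _))
    refine (enorm_integral_osc_le hσ (hM k) (g := g) (g' := g') (fun l => ?_) (fun s => ?_)
      (integrable_of_lintegral (by fun_prop) (hgF.trans_lt hFk))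
      (integrable_of_lintegral (by fun_prop) (hgF'.trans_lt hFk))).trans ?_
    · rw [hk]
      split_ifs <;> simp [hgd]
    · exact (hv s).mul ((K.hasDerivAt_tau h.meas hg s).const_mul _)
    · gcongr
  refine ⟨?_, ?_, ?_, (l2n volume F).toReal, ENNReal.toReal_nonneg, fun t x y M hM => ⟨?_, ?_⟩⟩
  · refine (Measurable.aestronglyMeasurable ?_).congr (hTp.mono fun p hp => hp.symm)
    refine Measurable.ite (measurableSet_lt measurable_const (by fun_prop)) ?_ measurable_const
    exact (hτ.comp (f := fun p : ℝ × ℝ => (p.1, p.2 - p.1)) (by fun_prop)).const_mul _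
  · refine (l2n_mono_ae hTle).trans ?_
    rw [l2n_comp_shear (H := fun k l => i2π * i2π * ‖τ k l‖ₑ) (hτ.enorm.const_mul _)]
    refine (l2n_const_mul (f := uncurry fun k l => ‖τ k l‖ₑ) _ hτ.enorm.aemeasurable).trans_le ?_
    -- The prefactor `1/(2π)` of the data is `i2π * i2π`: one factor belongs to the bound of `tau`,
    -- the other to the source, so the hypothesis on `N` gives exactly `1/4`.
    have := (h.weighted_bounds K.mq K.integrable_q measurable_const (w := fun _ => 1) (by simp) (by simp)
      (by simp) hc (by simp)).2
    simp only [one_mul] at this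
    rw [mul_assoc]
    refine (mul_le_mul_right this _).trans ?_
    rw [← mul_div_assoc]
    refine ENNReal.div_le_of_le_mul ((hsrc.trans hN).trans_eq ?_)
    rw [ENNReal.div_eq_inv_mul]
    congr 1
    rw [ENNReal.ofReal_div_of_pos (by norm_num)]
    simp
  · refine lt_of_le_of_lt (l2n_mono_ae (g := fun p => i2π * i2π *
      (wt (p.2 - p.1) ^ 3 * ‖τ p.1 (p.2 - p.1)‖ₑ)) (hTle.mono fun p hp => ?_)) ?_
    · rw [mul_left_comm]
      gcongr
    · have m3 : Measurable (uncurry fun k l => wt l ^ 3 * ‖τ k l‖ₑ) := by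
        have := hτ.enorm; exact Measurable.mul (by fun_prop) this
      rw [l2n_comp_shear (H := fun k l => i2π * i2π * (wt l ^ 3 * ‖τ k l‖ₑ)) (m3.const_mul _)]
      refine (l2n_const_mul (f := uncurry fun k l => wt l ^ 3 * ‖τ k l‖ₑ) _
        m3.aemeasurable).trans_lt ?_
      exact mul_lt_top (mul_lt_top i2π_lt_top i2π_lt_top) (hw3.trans_lt hC)
  · have := main (fun _ => 1) (fun _ => 0) (fun l => hasDerivAt_const l 1) measurable_const
      measurable_const (by simp [one_le_wt]) (by simp) t x y M hM
    simpa only [one_mul] using this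
  · refine main (fun l => (l : ℂ) * I) (fun _ => I) (fun l => ?_) (by fun_prop)
      measurable_const (fun l => ?_) (fun l => ?_) t x y M hM
    · simpa using (hasDerivAt_id l).ofReal_comp.mul_const I
    · simpa [lam] using enorm_lam_le (0, l)
    · exact enorm_I.le

/-! ### The smallness hypotheses in terms of a regular representative -/

variable {u : ℝ × ℝ → ℝ} {q : ℝ → ℝ → ℂ}

theorem i2π_mul_lintegral (hq : Measurable (uncurry q)) (hp : ∀ᵐ y, ∀ l, pft u l y = q l y) :
    i2π * ∫⁻ η, ∫⁻ s, ‖q s η‖ₑ = smallC u := by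
  rw [lintegral_lintegral_swap (f := fun η s => ‖q s η‖ₑ)
    (hq.comp measurable_swap).enorm.aemeasurable, smallC, ENNReal.div_eq_inv_mul, i2π,
    ENNReal.ofReal_inv_of_pos sqrt_two_pi_pos]
  congr 1
  refine lintegral_congr fun l => lintegral_congr_ae (hp.mono fun y hy => ?_)
  simp only [hy l]

/-- The square of the Plancherel factor times that of `i2π` is `(2π)⁻¹ π/|l| = 1/(2|l|)`, so the
source is dominated by the norm with `|l|⁻¹`. -/
theorem i2π_mul_srcX_le (hq : Measurable (uncurry q)) (hp : ∀ᵐ y, ∀ l, pft u l y = q l y) :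
    i2π * srcX (fun _ => 1) q ≤ normInvHalf u := by
  have hm : Measurable fun l => ofReal √(π / |l|) * l2n volume fun y => ‖q l y‖ₑ := by
    have := measurable_l2n_left (μ := volume) (F := fun y l => ‖q l y‖ₑ) (hq.comp measurable_swap).enorm
    exact Measurable.mul (by fun_prop) this
  unfold srcX
  simp only [one_mul]
  rw [← l2n_const_mul _ hm.aemeasurable, l2n_le_iff, normInvHalf, ENNReal_rpow_half_sq]
  refine lintegral_mono_ae ?_
  filter_upwards [Measure.ae_ne volume (0 : ℝ)] with l hl
  have e : ∫⁻ y, ‖pft u l y‖ₑ ^ 2 / ‖l‖ₑ = (∫⁻ y, ‖q l y‖ₑ ^ 2) * ‖l‖ₑ⁻¹ := by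
    simp_rw [div_eq_mul_inv]
    rw [← lintegral_mul_const _ (hq.of_uncurry_left.enorm.pow_const 2)]
    exact lintegral_congr_ae (hp.mono fun y hy => by simp only [hy l])
  have hl' : 0 < |l| := abs_pos.2 hl
  rw [e, ← mul_assoc, mul_pow, l2n_sq, mul_comm]
  gcongr
  rw [i2π, ← ofReal_mul (by positivity), ← ofReal_pow (by positivity), ← ofReal_norm,
    norm_eq_abs, ← ENNReal.ofReal_inv_of_pos hl']
  refine ofReal_le_ofReal ?_
  rw [mul_pow, inv_pow, sq_sqrt (by positivity), sq_sqrt (by positivity)]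
  have : (2 * π)⁻¹ * (π / |l|) = 1 / 2 * |l|⁻¹ := by field_simp
  rw [this]
  exact mul_le_of_le_one_left (by positivity) (by norm_num)

end KPI

end

/-! ### The proposition -/

theorem proposition5p3 (u : ℝ × ℝ → ℝ) (hu : KPI.MemE1w u)
    (hc : KPI.smallC u < 1)
    (hinv : KPI.normInvHalf u < (1 - KPI.smallC u) / 4)
    (hct : KPI.smallCt u < 1) :
    -- the scattering solutions exist
    (∃ mp, KPI.IsScatteringSolution 1 u mp) ∧ (∃ mm, KPI.IsScatteringSolution (-1) u mm) ∧
    -- and for the scattering data `T⁺`, `T⁻` built from them, whichever representatives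
    ∀ mp mm, KPI.IsScatteringSolution 1 u mp → KPI.IsScatteringSolution (-1) u mm →
      -- there is a unique solution `μ^l = 1 + M t x y` of the nonlocal RHP
      ∃ M : ℝ → ℝ → ℝ → KPI.L2,
        (∀ t x y : ℝ, 0 < t → ∀ w : KPI.L2,
          KPI.IsRHPSolution (KPI.scatData 1 u mp) (KPI.scatData (-1) u mm) t x y w ↔
            w = M t x y) ∧
        (∀ t x y : ℝ, 0 < t → DifferentiableAt ℝ (fun s => M t s y) x) ∧
        ∀ δ : ℝ, 0 < δ → ∃ C : ℝ, ∀ t x y : ℝ, 0 < t →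
          (δ < KPI.aParam t x y →
            ‖M t x y‖ ≤ C * t ^ (-1 : ℝ) ∧
            ‖deriv (fun s => M t s y) x‖ ≤ C * t ^ (-1 : ℝ)) ∧
          (|KPI.aParam t x y| < δ →
            ‖M t x y‖ ≤ C * t ^ (-(1 / 3) : ℝ) ∧
            ‖deriv (fun s => M t s y) x‖ ≤ C * t ^ (-(1 / 3) : ℝ)) ∧
          (KPI.aParam t x y < -δ →
            ‖M t x y‖ ≤ C * t ^ (-(1 / 2) : ℝ) ∧
            ‖deriv (fun s => M t s y) x‖ ≤ C * t ^ (-(1 / 2) : ℝ)) := by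
  -- The partial transforms of `u` and of the regular representative agree for almost every `y` and
  -- all `l`, which is all that the scattering theory sees.
  obtain ⟨u₂, R, hp⟩ := hu.exists_regPot (hinv.trans_le le_top)
  have K := R.kpot
  have hs := KPI.i2π_mul_lintegral K.mq hp
  have hsrc := KPI.i2π_mul_srcX_le K.mq hp
  rw [← hs] at hc hinv
  have ex : ∀ σ, ∃ m, KPI.IsScatteringSolution σ u m := fun σ =>
    let ⟨_, h, hC⟩ := K.exists_interactionSol hc σ
    ⟨_, h.isScatteringSolution hC hp⟩
  have sk : ∀ σ m, σ = 1 ∨ σ = -1 → KPI.IsScatteringSolution σ u m → KPI.ScatKernel (KPI.scatData σ u m) :=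
    fun σ m hσ h =>
      let ⟨_, hn, hT⟩ := h.exists_interactionSol K.mq hp
      hn.scatKernel hσ K hc hinv.le hsrc hT
  refine ⟨ex 1, ex (-1), fun mp mm h1 h2 => ?_⟩
  obtain ⟨M, hM, hd, D, hD, hb⟩ := (sk 1 mp (.inl rfl) h1).exists_solution (sk (-1) mm (.inr rfl) h2)
  -- The last factor is the sum of the constants of the three oscillatory estimates, so one constant
  -- serves in all regions. The estimate with `t^{-1/3}` holds for every `a` with constant `10`, so
  -- there the condition on `a` plays no role.
  refine ⟨M, fun t x y _ w => hM t x y w, hd, fun δ hδ => ⟨D * (4 / δ + 10 + (4 + 4 / √δ)), fun t x y ht => ?_⟩⟩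
  have bd : ∀ c s : ℝ, (∀ α β, ‖∫ v in α..β, KPI.cub t (KPI.aParam t x y) v‖ ≤ c * t ^ s) →
      c ≤ 4 / δ + 10 + (4 + 4 / √δ) →
      ‖M t x y‖ ≤ D * (4 / δ + 10 + (4 + 4 / √δ)) * t ^ s ∧
      ‖deriv (fun s => M t s y) x‖ ≤ D * (4 / δ + 10 + (4 + 4 / √δ)) * t ^ s := fun c s h hc => by
    obtain ⟨h3, h4⟩ := hb t x y _ ht fun k α β => KPI.norm_integral_osc_le ht x y k h α β
    have h5 : D * (c * t ^ s) ≤ D * (4 / δ + 10 + (4 + 4 / √δ)) * t ^ s := by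
      rw [mul_assoc]
      gcongr
    exact ⟨h3.trans h5, h4.trans h5⟩
  have p1 : 0 < 4 / δ := by positivity
  have p2 : 0 ≤ 4 / √δ := by positivity
  exact ⟨fun h => bd _ _ (KPI.norm_integral_cub_le_of_pos ht hδ h) (by linarith),
    fun _ => bd _ _ (KPI.norm_integral_cub_le_third ht _) (by linarith),
    fun h => bd _ _ (KPI.norm_integral_cub_le_of_neg ht hδ h) (by linarith)⟩
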